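/- **Setting.** Let $N\ge 2$, $K\ge 2$, and let $A_L(\xi),A_R(\xi)\in\mathbb R^{N\times N}$, $B(\xi)\in\mathbb R^N$ depend in a $C^K$ way on $\xi\in\mathbb R^2$, with $A_R=A_L+Ce_1^{\sf T}$ for some $C=C(\xi)\in\mathbb{R}^N$. Put $s=e_1^{\sf T}x$, $f^L(x)=A_Lx+B$, $f^R(x)=A_Rx+B$, and let $f=f^L$ for $s\le 0$, $f=f^R$ for $s\ge 0$. For a word $W=W_0\cdots W_{p-1}$ in $L,R$ let $f^W=f^{W_{p-1}}\circ\cdots\circ f^{W_0}$, with matrix part $M_W=A_{W_{p-1}}\cdots A_{W_0}$. A sequence of period $p$ is identified with its word of length $p$; $W^{(j)}$ is the left shift by $j$ and $W^{\overline{i}}$ is $W$ with the symbols of index $i$ modulo its period flipped. For a factor $W$ of a concatenation, $W^{\overline 0}$ is $W$ with its first symbol flipped. A $W$-cycle consists of points $x_i^W$ with $f^{W_i}(x_i^W)=x_{i+1}^W$, indices modulo $p$; it is admissible if $e_1^{\sf T}x^W_i\le 0$ when $W_i=L$ and $\ge 0$ when $W_i=R$; its stability multipliers are the eigenvalues of $M_W$,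 and it is attracting if it is admissible and these all have modulus $<1$. For $\gcd(m,n)=1$ let $\mathcal F[\ell,m,n]_i=L$ if $im \bmod n<\ell$ and $R$ otherwise. With $d=m^{-1}\bmod n$, a parameter point is an $\mathcal S$-shrinking point, $\mathcal S=\mathcal F[\ell,m,n]$, $0<m<n$, $2\le\ell\le n-2$, if $e_1^{\sf T}{\rm adj}(I-A_L)B\ne0$, $\det(I-M_{\mathcal S^{\overline 0}})\ne0$, $\det(I-M_{\mathcal S^{\overline{\ell d}}})\ne 0$, and the $\mathcal S^{\overline0}$-cycle is admissible with exactly its points of index $0$ and $\ell d$ (mod $n$) on $s=0$. Let $\xi_0$ be an $\mathcal S$-shrinking point. There let $t_i=e_1^{\sf T}x_i^{\mathcal S^{\overline0}}$ and $a=\det(I-M_{\mathcal S^{\overline 0}})$, let $\rho_1=1,\rho_2,\dots,\rho_N$ be the eigenvalues of $M_{\mathcal S}$ with multiplicity, $\rho_{\max}=\max_{j\ge2}|\rho_j|$ and $c=\prod_{j\ge2}(1-\rho_j)$. Near $\xi_0$ let $\eta,\nu$ be the first coordinates of the points of index $0$ and $\ell d$ of the $\mathcal S^{\overline0}$-cycle,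 and let $J$ be the Jacobian matrix of $\xi\mapsto(\eta,\nu)$ at $\xi_0$. Polar coordinates $(r,\theta)$, $r>0$, $0\le\theta<2\pi$, are given by $\eta=|ct_d/a|\,r\cos\theta$, $\nu=|ct_{(\ell-1)d}/a|\,r\sin\theta$. For $j=0,(\ell-1)d,\ell d,-d$ let $u_j^{\sf T},v_j$ be left and right eigenvectors of $M_{\mathcal S^{(j)}}(\xi_0)$ for the eigenvalue $1$ with $u_j^{\sf T}v_j=e_1^{\sf T}v_j=1$, and let (matrices at $\xi_0$) $\kappa^+_\chi=u_0^{\sf T}M_{\mathcal S^{\overline{\ell d}}}^{\chi}v_{-d}$ for $\chi\ge0$, and $\kappa^+_{\chi}=u_{\ell d}^{\sf T}M_{(\mathcal S^{\overline 0})^{(\ell d)}}^{-\chi-1}v_{(\ell-1)d}$ for $\chi\le-1$. Let $m^+/n^+$ be the right Farey root of $m/n$ (that is, $m^+n-mn^+=1$, $0<n^+<n$), $\ell^+=\lceil \ell n^+/n\rceil$, $(\ell_k,m_k,n_k)=(k\ell+\ell^+,km+m^+,kn+n^+)$ and $\mathcal G^+[k,\chi]=\mathcal F[\ell_k+\chi,m_k,n_k]$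 for $|\chi|<k$. **Sectors.** Fix an integer $\Delta\ell\ge0$. Let $U$ be a neighbourhood of $\xi_0$ and suppose $\kappa^+_{\Delta\ell},\kappa^+_{\Delta\ell-1}\neq0$. The mode-locking region of index $k$ is the set of $\xi\in U$ at which there is an attracting $\mathcal G^+[k,\Delta\ell]$- or $\mathcal G^+[k,\Delta\ell-1]$-cycle. Its inner boundary $\gamma_k\subset U$ is a curve $r=r_k(\theta)$ between endpoints $p_k$ and $q_k$, continuous up to its endpoints, where for each $\theta$ strictly between the angles of the endpoints $r_k(\theta)$ is the infimum of the radii of points of the region on the ray of angle $\theta$. Here $p_k$ is a $\mathcal G^+[k,\Delta\ell]$-shrinking point if $\kappa^+_{\Delta\ell}>0$, while if $\kappa^+_{\Delta\ell}<0$ there is at $p_k$ an admissible $\mathcal G^+[k,\Delta\ell]$-cycle with a stability multiplier $-1$; the same holds for $q_k$ with $\Delta\ell-1$ in place of $\Delta\ell$. If $\gamma_k,\gamma_{k+1}$ exist, the sector $\Sigma^+_{k,\Delta\ell}$ is well-defined: it is the closed region bounded by $\gamma_k$, $\gamma_{k+1}$ and the line segments $p_kp_{k+1}$ and $q_kq_{k+1}$.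 **Recurrent set and return map.** Write $\phi=f^{\mathcal S^{(-d)}}$. For $\xi$ near $\xi_0$ let $\lambda$ be the eigenvalue of $M_{\mathcal S^{(-d)}}$ nearest $1$, let $\zeta$, $\omega^{\sf T}$ be right and left eigenvectors for it with $e_1^{\sf T}\zeta=\omega^{\sf T}\zeta=1$, and let $x^{\rm int}$ be the point with $e_1^{\sf T}x^{\rm int}=0$ and $\phi(x^{\rm int})-x^{\rm int}\in\mathbb R\zeta$. Let $\mathcal X=\mathcal S_0\cdots\mathcal S_{(\ell d-1)\bmod n}$, $\mathcal Y=\mathcal S_{\ell d\bmod n}\cdots\mathcal S_{n-1}$, and $\sigma(x)=e_1^{\sf T}f^{W}(x)$ with $W=\mathcal X^{\overline0}(\mathcal Y^{\overline0}\mathcal X)^{\Delta\ell}$. For a number $\varrho\in[\rho_{\max},1)$ and $Q>0$ let $$H_{k,\Delta\ell,Q}=\Big\{x\in{\rm range}(\phi)\ \Big|\ \sigma(x)=0,\ \big\|(I-\zeta\omega^{\sf T})(x-x^{\rm int})\big\|\le Q\varrho^k\Big\},$$ $$\Phi=\Phi_{k,\Delta\ell,Q}=\{\alpha x_1+(1-\alpha)x_2\mid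 x_1\in H_{k,\Delta\ell,Q},\ x_2\in\phi(H_{k,\Delta\ell,Q}),\ 0\le\alpha<1\}.$$ For $y\in{\rm range}(\phi)$, let $\phi^{j}(y)$ with $j<0$ be the point $z\in{\rm range}(\phi)$ with $\phi^{-j}(z)=y$, and let $\beta(y)$ be the least integer $j$ with $k+j>\Delta\ell$ and $\sigma(\phi^j(y))>0$. Let $T(y)=\phi^{\beta(y)}(y)$, and let $F(x)=T(f^{\mathcal G^+[k,\Delta\ell]}(x))$ if $s\le0$ and $F(x)=T(f^{\mathcal G^+[k,\Delta\ell]^{\overline0}}(x))$ if $s\ge0$. **Lemma.** Suppose $\det J\ne0$, $\rho_{\max}<1$, $\Delta\ell\ge0$ and $(\kappa^+_{\Delta\ell}-\kappa^+_{\Delta\ell-1})\,a>0$. Suppose also that the rank of $M_{\mathcal S^{(-d)}}(\xi)$ equals the rank of $M_{\mathcal S^{(-d)}}(\xi_0)^2$ for all $\xi$ near $\xi_0$ (this is automatic if $M_{\mathcal S^{(-d)}}(\xi_0)$ is invertible). Let $\rho_{\max}\le\varrho<1$, where $\varrho=\rho_{\max}$ is allowed if the eigenvalues of $M_{\mathcal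 S^{(-d)}}(\xi_0)$ of modulus $\rho_{\max}$ are semisimple. Then there are a neighbourhood $V$ of $\xi_0$ and numbers $Q_0$, $C$ such that for every $Q\ge Q_0$ the following holds for all sufficiently large $k$. For each neighbourhood $U\subset V$ of $\xi_0$ in which $\Sigma^+_{k,\Delta\ell}$ is well-defined, and every $\xi\in\Sigma^+_{k,\Delta\ell}$: 1. for all $x\in\Phi$, $\beta(f^{\mathcal G^+[k,\Delta\ell]}(x))$ is well-defined (the points $\phi^j(y)$, $y=f^{\mathcal G^+[k,\Delta\ell]}(x)$, $k+j>\Delta\ell$, exist and are unique, and the least $j$ exists) and is at least $-C$; and for all integers $\Delta k$ with $k+\Delta k>\Delta\ell$, $f^{\mathcal G^+[k+\Delta k,\Delta\ell]}(x)\in\Phi$ if and only if $\Delta k=\beta(f^{\mathcal G^+[k,\Delta\ell]}(x))$; 2. the same holds with $\mathcal G^+[k,\Delta\ell]^{\overline0}$ and $\mathcal G^+[k+\Delta k,\Delta\ell]^{\overline0}$ in place of $\mathcal G^+[k,\Delta\ell]$ and $\mathcal G^+[k+\Delta k,\Delta\ell]$; 3. $F$ maps $\Phi$ into $\Phi$.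 -/

import Mathlib

open Set Filter Topology Matrix

namespace PWL

/-- The two sides of the switching manifold (the two symbols). -/
inductive Side
  | L
  | R
  deriving DecidableEq

/-- The other symbol. -/
def Side.flip : Side → Side
  | .L => .R
  | .R => .L

/-! ### Symbol sequences and words -/

/-- The rotational symbol sequence `F[ℓ,m,n]`. -/
def rot (l : ℤ) (m n : ℕ) (i : ℤ) : Side :=
  if (i * (m : ℤ)) % (n : ℤ) < l then Side.L else Side.R

/-- The left shift `S^{(j)}`. -/
def shift (s : ℤ → Side) (j : ℤ) (i : ℤ) : Side := s (j + i)

/-- For a sequence of period `n`, flip the symbols with indices `i + j n`, `j ∈ ℤ`. -/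
def flipAt (n : ℕ) (s : ℤ → Side) (i : ℤ) (j : ℤ) : Side :=
  if (n : ℤ) ∣ j - i then (s j).flip else s j

/-- The word `s_0 s_1 ⋯ s_{n-1}`. -/
def word (s : ℤ → Side) (n : ℕ) : List Side :=
  (List.range n).map fun i => s (i : ℤ)

/-- Flip the first symbol of a word. -/
def flipHead : List Side → List Side
  | [] => []
  | σ :: W => σ.flip :: W

/-- The multiplicative inverse of `m` modulo `n`, in `{0,…,n-1}`. -/
def modInv (m n : ℕ) : ℕ := ((m : ZMod n)⁻¹).val

/-- The numbers `ℓ, m, n` of a rotational symbol sequence, together with the right Farey root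
`m⁺/n⁺` (`mp`, `np`) of `m/n`, i.e. the right neighbour of `m/n` in the Farey sequence of
order `n`. -/
structure RotData where
  l : ℕ
  m : ℕ
  n : ℕ
  mp : ℕ
  np : ℕ
  l_pos : 0 < l
  l_lt : l < n
  m_pos : 0 < m
  m_lt : m < n
  coprime : Nat.Coprime m n
  np_pos : 0 < np
  np_lt : np < n
  farey : mp * n = m * np + 1

namespace RotData

variable (D : RotData)

/-- The inverse `d` of `m` modulo `n`. -/
def d : ℕ := modInv D.m D.n

/-- The sequence `S = F[ℓ,m,n]`. -/
def S : ℤ → Side := rot D.l D.m D.n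

/-- `S` with the symbols of index `0` (modulo `n`) flipped. -/
def S0 : ℤ → Side := flipAt D.n D.S 0

/-- `S` with the symbols of index `ℓd` (modulo `n`) flipped. -/
def Sld : ℤ → Side := flipAt D.n D.S (D.l * D.d)

/-- The word of `S^{(-d)}`. -/
def Smd : List Side := word (shift D.S (-(D.d : ℤ))) D.n

/-- The word `X = S_0 ⋯ S_{(ℓd-1) mod n}`. -/
def X : List Side := word D.S (D.l * D.d % D.n)

/-- The word `Y = S_{ℓd mod n} ⋯ S_{n-1}`. -/
def Y : List Side :=
  word (shift D.S ((D.l * D.d % D.n : ℕ) : ℤ)) (D.n - D.l * D.d % D.n)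

/-- The word obtained from `X (Y' X)^Δℓ`, where `Y'` is `Y` with flipped first symbol, by
flipping the first symbol. -/
def switchWord (Δ : ℕ) : List Side :=
  flipHead D.X ++ (List.replicate Δ (flipHead D.Y ++ D.X)).flatten

/-- `ℓ⁺ = ⌈ℓ n⁺ / n⌉`. -/
def lp : ℤ := ⌈((D.l : ℚ) * D.np) / D.n⌉

/-- `ℓ_k⁺ = k ℓ + ℓ⁺`. -/
def lk (k : ℕ) : ℤ := k * D.l + D.lp

/-- `m_k⁺ = k m + m⁺`. -/
def mk' (k : ℕ) : ℕ := k * D.m + D.mp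

/-- `n_k⁺ = k n + n⁺`. -/
def nk (k : ℕ) : ℕ := k * D.n + D.np

/-- The sequence `G⁺[k,χ] = F[ℓ_k⁺ + χ, m_k⁺, n_k⁺]`. -/
def Gseq (k : ℕ) (χ : ℤ) : ℤ → Side := rot (D.lk k + χ) (D.mk' k) (D.nk k)

/-- The word of `G⁺[k,χ]`. -/
def G (k : ℕ) (χ : ℤ) : List Side := word (D.Gseq k χ) (D.nk k)

end RotData

/-! ### The piecewise-linear continuous map -/

/-- A two-parameter family of continuous two-piece piecewise-linear maps of `ℝ^N`, with
a `C^K` dependence, `K ≥ 2`, on the parameter. The first coordinate `s` has index `0`. -/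
structure Family (N : ℕ) [NeZero N] where
  AL : ℝ × ℝ → Matrix (Fin N) (Fin N) ℝ
  AR : ℝ × ℝ → Matrix (Fin N) (Fin N) ℝ
  B : ℝ × ℝ → Fin N → ℝ
  K : ℕ
  two_le_K : 2 ≤ K
  smooth_AL : ∀ i j, ContDiff ℝ K fun ξ => AL ξ i j
  smooth_AR : ∀ i j, ContDiff ℝ K fun ξ => AR ξ i j
  smooth_B : ∀ i, ContDiff ℝ K fun ξ => B ξ i
  continuous_switch : ∀ ξ, ∃ C : Fin N → ℝ, AR ξ = AL ξ + vecMulVec C (Pi.single 0 1)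

noncomputable section

variable {N : ℕ} [NeZero N] (F : Family N) (D : RotData)

/-- `A_L` or `A_R`. -/
def Family.A (ξ : ℝ × ℝ) : Side → Matrix (Fin N) (Fin N) ℝ
  | .L => F.AL ξ
  | .R => F.AR ξ

/-- The affine maps `f^L` and `f^R`. -/
def Family.step (ξ : ℝ × ℝ) (σ : Side) (x : Fin N → ℝ) : Fin N → ℝ := F.A ξ σ *ᵥ x + F.B ξ

/-- `f^W = f^{W_{n-1}} ∘ ⋯ ∘ f^{W_0}`. -/
def Family.fWord (ξ : ℝ × ℝ) (W : List Side) (x : Fin N → ℝ) : Fin N → ℝ :=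
  W.foldl (fun y σ => F.step ξ σ y) x

/-- `M_W = A_{W_{n-1}} ⋯ A_{W_0}`, the matrix part of `f^W`. -/
def Family.MWord (ξ : ℝ × ℝ) (W : List Side) : Matrix (Fin N) (Fin N) ℝ :=
  W.foldl (fun P σ => F.A ξ σ * P) 1

/-- On the switching manifold the first symbol of the word is immaterial. -/
theorem Family.fWord_flipHead (ξ : ℝ × ℝ) (W : List Side) (x : Fin N → ℝ) (hx : x 0 = 0) :
    F.fWord ξ (flipHead W) x = F.fWord ξ W x := by
  have key : F.AR ξ *ᵥ x = F.AL ξ *ᵥ x := by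
    obtain ⟨C, hC⟩ := F.continuous_switch ξ
    rw [hC, Matrix.add_mulVec]
    ext i
    simp [Matrix.mulVec, dotProduct, vecMulVec_apply, Pi.single_apply, hx]
  cases W with
  | nil => rfl
  | cons σ W =>
    cases σ <;> simp [flipHead, Side.flip, Family.fWord, Family.step, Family.A, key]

/-- An `s`-cycle, for a symbol sequence `s` of period `n`. -/
def IsCycle (ξ : ℝ × ℝ) (s : ℤ → Side) (n : ℕ) (x : ℤ → Fin N → ℝ) : Prop :=
  ∀ i, x (i + 1) = F.step ξ (s i) (x i) ∧ x (i + n) = x i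

/-- Every point of the cycle lies on the side of the switching manifold given by its symbol. -/
def IsAdmissible (s : ℤ → Side) (x : ℤ → Fin N → ℝ) : Prop :=
  ∀ i, (s i = Side.L → x i 0 ≤ 0) ∧ (s i = Side.R → 0 ≤ x i 0)

/-- `x_i^s = (I - M_{s^{(i)}})⁻¹ P_{s^{(i)}} B`, the `i`-th point of the `s`-cycle
(when `det (I - M_s) ≠ 0`); note that `P_W B = f^W(0)`. -/
def cyclePt (ξ : ℝ × ℝ) (s : ℤ → Side) (n : ℕ) (i : ℤ) : Fin N → ℝ :=
  (1 - F.MWord ξ (word (shift s i) n))⁻¹ *ᵥ F.fWord ξ (word (shift s i) n) 0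

/-- `ξ` is an `F[l,m,n]`-shrinking point. -/
structure IsShrinkingPoint (ξ : ℝ × ℝ) (l : ℤ) (m n : ℕ) : Prop where
  two_le : 2 ≤ l
  le_sub : l ≤ n - 2
  m_pos : 0 < m
  m_lt : m < n
  coprime : Nat.Coprime m n
  generic_B : ((1 - F.AL ξ).adjugate *ᵥ F.B ξ) 0 ≠ 0
  generic_a : (1 - F.MWord ξ (word (flipAt n (rot l m n) 0) n)).det ≠ 0
  generic_b : (1 - F.MWord ξ (word (flipAt n (rot l m n) (l * modInv m n)) n)).det ≠ 0
  admissible : IsAdmissible (flipAt n (rot l m n) 0) (cyclePt F ξ (flipAt n (rot l m n) 0) n)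
  zero_iff : ∀ i : ℤ, 0 ≤ i → i < n →
    (cyclePt F ξ (flipAt n (rot l m n) 0) n i 0 = 0 ↔ i = 0 ∨ i = (l * modInv m n) % n)

/-! ### Quantities associated with an `S`-shrinking point -/

/-- The complexification of a real matrix. -/
def toC (M : Matrix (Fin N) (Fin N) ℝ) : Matrix (Fin N) (Fin N) ℂ := M.map (fun r => (r : ℂ))

/-- The eigenvalues `ρ_2,…,ρ_N` of `M_S`, with multiplicity (one copy of `1` is removed). -/
def otherEigs (ξ : ℝ × ℝ) : Multiset ℂ :=
  (toC (F.MWord ξ (word D.S D.n))).charpoly.roots.erase 1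

/-- `ρ_max = max_{j ≥ 2} |ρ_j|`. -/
def rhoMax (ξ : ℝ × ℝ) : ℝ := (((otherEigs F D ξ).map (fun z => ‖z‖₊)).sup : NNReal)

/-- `c = ∏_{j ≥ 2} (1 - ρ_j)` (a real number). -/
def cc (ξ : ℝ × ℝ) : ℝ := ((otherEigs F D ξ).map (fun z => 1 - z)).prod.re

/-- `a = det (I - M)` with `M` the matrix of the word of `S` with index `0` flipped. -/
def aa (ξ : ℝ × ℝ) : ℝ := (1 - F.MWord ξ (word D.S0 D.n)).det

/-- `t_i`, the first coordinate of the `i`-th point of the cycle for `S` with index `0`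
flipped. -/
def tt (ξ : ℝ × ℝ) (i : ℤ) : ℝ := cyclePt F ξ D.S0 D.n i 0

/-- `η`. -/
def eta (ξ : ℝ × ℝ) : ℝ := tt F D ξ 0

/-- `ν`. -/
def nu (ξ : ℝ × ℝ) : ℝ := tt F D ξ (D.l * D.d)

/-- Right eigenvector for the eigenvalue `μ`, with first coordinate `1`. -/
def rightVec (M : Matrix (Fin N) (Fin N) ℝ) (μ : ℝ) : Fin N → ℝ :=
  Classical.epsilon fun v => M *ᵥ v = μ • v ∧ v 0 = 1

/-- Left eigenvector for the eigenvalue `μ`, normalised against `rightVec M μ`. -/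
def leftVec (M : Matrix (Fin N) (Fin N) ℝ) (μ : ℝ) : Fin N → ℝ :=
  Classical.epsilon fun u => u ᵥ* M = μ • u ∧ u ⬝ᵥ rightVec M μ = 1

/-- `v_j`, for the eigenvalue `1` of the matrix of `S^{(j)}`. -/
def vv (ξ : ℝ × ℝ) (j : ℤ) : Fin N → ℝ := rightVec (F.MWord ξ (word (shift D.S j) D.n)) 1

/-- `u_j`, for the eigenvalue `1` of the matrix of `S^{(j)}`. -/
def uu (ξ : ℝ × ℝ) (j : ℤ) : Fin N → ℝ := leftVec (F.MWord ξ (word (shift D.S j) D.n)) 1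

/-- `κ⁺_χ`. -/
def kappa (ξ : ℝ × ℝ) (χ : ℤ) : ℝ :=
  if χ ≤ -1 then
    uu F D ξ (D.l * D.d) ⬝ᵥ
      ((F.MWord ξ (word (shift D.S0 (D.l * D.d)) D.n)) ^ (-χ - 1).toNat
        *ᵥ vv F D ξ (((D.l : ℤ) - 1) * D.d))
  else
    uu F D ξ 0 ⬝ᵥ
      ((F.MWord ξ (word D.Sld D.n)) ^ χ.toNat *ᵥ vv F D ξ (-(D.d : ℤ)))

/-- `(r, θ)` are the polar coordinates of `ξ` relative to the shrinking point `ξ₀`. -/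
def HasPolar (ξ₀ ξ : ℝ × ℝ) (r θ : ℝ) : Prop :=
  0 < r ∧ 0 ≤ θ ∧ θ < 2 * Real.pi ∧
  eta F D ξ = |cc F D ξ₀ * tt F D ξ₀ D.d / aa F D ξ₀| * r * Real.cos θ ∧
  nu F D ξ = |cc F D ξ₀ * tt F D ξ₀ (((D.l : ℤ) - 1) * D.d) / aa F D ξ₀| * r * Real.sin θ

/-! ### Mode-locking regions and sectors -/

/-- At `ξ` there is an attracting periodic solution with symbol sequence `G⁺[k,χ]`. -/
def HasAttractingCycle (k : ℕ) (χ : ℤ) (ξ : ℝ × ℝ) : Prop :=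
  (∃ x, IsCycle F ξ (D.Gseq k χ) (D.nk k) x ∧ IsAdmissible (D.Gseq k χ) x) ∧
  ∀ μ : ℂ, (toC (F.MWord ξ (D.G k χ))).charpoly.IsRoot μ → ‖μ‖ < 1

/-- The part of the `G_k⁺`-mode-locking region that is formed by attracting
`G⁺[k,χ]`- and `G⁺[k,χ-1]`-cycles. -/
def modeLocked (k : ℕ) (χ : ℤ) : Set (ℝ × ℝ) :=
  {ξ | HasAttractingCycle F D k χ ξ ∨ HasAttractingCycle F D k (χ - 1) ξ}

/-- The condition on an endpoint of the inner boundary: it is a `G⁺[k,χ]`-shrinking point if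
`κ⁺_χ > 0`, and there is a `G⁺[k,χ]`-cycle with stability multiplier `-1` if `κ⁺_χ < 0`. -/
def IsEndpoint (ξ₀ : ℝ × ℝ) (k : ℕ) (χ : ℤ) (p : ℝ × ℝ) : Prop :=
  (0 < kappa F D ξ₀ χ → IsShrinkingPoint F p (D.lk k + χ) (D.mk' k) (D.nk k)) ∧
  (kappa F D ξ₀ χ < 0 →
    (∃ x, IsCycle F p (D.Gseq k χ) (D.nk k) x ∧ IsAdmissible (D.Gseq k χ) x) ∧
    (F.MWord p (D.G k χ)).charpoly.IsRoot (-1))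

/-- Inside the neighbourhood `U` of `ξ₀`, the inner boundary of the `G_k⁺`-mode-locking region
between its endpoints `p` (belonging to `χ`) and `q` (belonging to `χ - 1`) is the curve `γ`:
it is a curve `r = r_k(θ)` in polar coordinates, where for every angle strictly between those
of `p` and `q` the number `r_k(θ)` is the infimum of the radii at which the ray of angle `θ`
meets the mode-locking region. -/
def IsInnerBoundary (ξ₀ : ℝ × ℝ) (U : Set (ℝ × ℝ)) (k : ℕ) (χ : ℤ) (p q : ℝ × ℝ)
    (γ : Set (ℝ × ℝ)) : Prop :=
  IsEndpoint F D ξ₀ k χ p ∧ IsEndpoint F D ξ₀ k (χ - 1) q ∧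
  ∃ (θp θq : ℝ) (rk : ℝ → ℝ) (curve : ℝ → ℝ × ℝ),
    ContinuousOn curve (uIcc θp θq) ∧ curve θp = p ∧ curve θq = q ∧
    γ = curve '' uIcc θp θq ∧
    (∀ θ ∈ uIcc θp θq, curve θ ∈ U ∧ HasPolar F D ξ₀ (curve θ) (rk θ) θ) ∧
    ∀ θ ∈ uIoo θp θq,
      IsGLB {r | ∃ ξ ∈ U, HasPolar F D ξ₀ ξ r θ ∧ ξ ∈ modeLocked F D k χ} (rk θ)

/-- The region bounded by a closed curve `Γ` of the plane: `Γ` and the bounded components of its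
complement (for `ξ ∈ Γ` the component below is empty). -/
def regionBoundedBy (Γ : Set (ℝ × ℝ)) : Set (ℝ × ℝ) :=
  {ξ | Bornology.IsBounded (connectedComponentIn Γᶜ ξ)}

/-- `Sg` is the sector `Σ⁺_{k,χ}`, inside the neighbourhood `U` of the shrinking point. -/
def IsSector (ξ₀ : ℝ × ℝ) (U : Set (ℝ × ℝ)) (k : ℕ) (χ : ℤ) (Sg : Set (ℝ × ℝ)) : Prop :=
  |χ| < k ∧ |χ - 1| < k ∧ kappa F D ξ₀ χ ≠ 0 ∧ kappa F D ξ₀ (χ - 1) ≠ 0 ∧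
  ∃ p q p' q' γ γ',
    IsInnerBoundary F D ξ₀ U k χ p q γ ∧ IsInnerBoundary F D ξ₀ U (k + 1) χ p' q' γ' ∧
    Sg = regionBoundedBy (γ ∪ γ' ∪ segment ℝ p p' ∪ segment ℝ q q')

/-! ### The centre manifold of `f^{S^{(-d)}}` -/

/-- The matrix of `S^{(-d)}`. -/
def Mmd (ξ : ℝ × ℝ) : Matrix (Fin N) (Fin N) ℝ := F.MWord ξ D.Smd

/-- The map `f^{S^{(-d)}}`. -/
def phi (ξ : ℝ × ℝ) (x : Fin N → ℝ) : Fin N → ℝ := F.fWord ξ D.Smd x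

/-- `λ`: the eigenvalue near `1` (the one closest to `1`) of the matrix of `S^{(-d)}`. -/
def lam (ξ : ℝ × ℝ) : ℝ :=
  Classical.epsilon fun μ : ℝ =>
    (toC (Mmd F D ξ)).charpoly.IsRoot (μ : ℂ) ∧
    ∀ z : ℂ, (toC (Mmd F D ξ)).charpoly.IsRoot z → ‖(μ : ℂ) - 1‖ ≤ ‖z - 1‖

/-- The right eigenvector `ζ_{-d}`. -/
def zeta (ξ : ℝ × ℝ) : Fin N → ℝ := rightVec (Mmd F D ξ) (lam F D ξ)

/-- The left eigenvector `ω_{-d}`. -/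
def omega (ξ : ℝ × ℝ) : Fin N → ℝ := leftVec (Mmd F D ξ) (lam F D ξ)

/-- `x` is a point of the switching manifold on an `f^{S^{(-d)}}`-invariant line of
direction `ζ`. -/
def IsXInt (ξ : ℝ × ℝ) (ζ x : Fin N → ℝ) : Prop :=
  x 0 = 0 ∧ ∃ s : ℝ, phi F D ξ x = x + s • ζ

/-- `x^int_{-d}`: the intersection of the centre manifold (the invariant line of
`f^{S^{(-d)}}` of direction `ζ_{-d}`) with the switching manifold. This form makes sense
also when `λ = 1`; see `isXInt_of_fixed`. -/
def xInt (ξ : ℝ × ℝ) : Fin N → ℝ := Classical.epsilon (IsXInt F D ξ (zeta F D ξ))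

/-- `f^W` is affine with matrix part `M_W`. -/
theorem Family.fWord_sub (ξ : ℝ × ℝ) (W : List Side) (x y : Fin N → ℝ) :
    F.fWord ξ W x - F.fWord ξ W y = F.MWord ξ W *ᵥ (x - y) := by
  have gen : ∀ (W : List Side) (P : Matrix (Fin N) (Fin N) ℝ) (x y z : Fin N → ℝ),
      x - y = P *ᵥ z → W.foldl (fun y σ => F.step ξ σ y) x -
        W.foldl (fun y σ => F.step ξ σ y) y = (W.foldl (fun P σ => F.A ξ σ * P) P) *ᵥ z := by
    intro W
    induction W with
    | nil => intro P x y z h; simpa using h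
    | cons σ W ih =>
      intro P x y z h
      simp only [List.foldl_cons]
      apply ih
      rw [← Matrix.mulVec_mulVec, ← h, Matrix.mulVec_sub]
      simp [Family.step]
  exact gen W 1 x y (x - y) (by simp)

/-- If `x` is a fixed point of `f^{S^{(-d)}}`, then `(I - ζ e_1ᵀ) x` has the property
defining `xInt`. -/
theorem isXInt_of_fixed (ξ : ℝ × ℝ) (μ : ℝ) (ζ x : Fin N → ℝ) (hx : phi F D ξ x = x)
    (hζ : Mmd F D ξ *ᵥ ζ = μ • ζ) (h0 : ζ 0 = 1) : IsXInt F D ξ ζ (x - x 0 • ζ) := by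
  refine ⟨by simp [h0], (1 - μ) * x 0, ?_⟩
  have h := F.fWord_sub ξ D.Smd (x - x 0 • ζ) x
  change phi F D ξ (x - x 0 • ζ) - phi F D ξ x = Mmd F D ξ *ᵥ _ at h
  rw [hx] at h
  have e : x - x 0 • ζ - x = -(x 0 • ζ) := by abel
  rw [e, Matrix.mulVec_neg, Matrix.mulVec_smul, hζ, sub_eq_iff_eq_add] at h
  rw [h]
  ext i
  simp
  ring

/-- The component `q = (I - ζ ωᵀ)(x - x^int)` of `x`. -/
def qPart (ξ : ℝ × ℝ) (x : Fin N → ℝ) : Fin N → ℝ :=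
  (x - xInt F D ξ) - (omega F D ξ ⬝ᵥ (x - xInt F D ξ)) • zeta F D ξ

/-- The left-hand side of the equation of the right face: the first coordinate of the image
of `x` under `f^W`, `W = switchWord Δ`. -/
def switchFn (ξ : ℝ × ℝ) (Δ : ℕ) (x : Fin N → ℝ) : ℝ := F.fWord ξ (D.switchWord Δ) x 0

/-- The right face `H_{k,Δℓ,Q}`, with decay rate `ρ`. -/
def face (ξ : ℝ × ℝ) (ρ : ℝ) (k Δ : ℕ) (Q : ℝ) : Set (Fin N → ℝ) :=
  {x | x ∈ range (phi F D ξ) ∧ switchFn F D ξ Δ x = 0 ∧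
    ‖WithLp.toLp 2 (qPart F D ξ x)‖ ≤ Q * ρ ^ k}

/-- The recurrent set `Φ_{k,Δℓ,Q}`. -/
def recSet (ξ : ℝ × ℝ) (ρ : ℝ) (k Δ : ℕ) (Q : ℝ) : Set (Fin N → ℝ) :=
  {x | ∃ x₁ ∈ face F D ξ ρ k Δ Q, ∃ x₂ ∈ phi F D ξ '' face F D ξ ρ k Δ Q, ∃ α : ℝ,
    0 ≤ α ∧ α < 1 ∧ x = α • x₁ + (1 - α) • x₂}

/-! ### The return map -/

/-- `z` is a preimage of `y` under the `i`-th iterate of `f^{S^{(-d)}}` that belongs to the range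
of `f^{S^{(-d)}}`. -/
def IsRangePreimage (ξ : ℝ × ℝ) (i : ℕ) (y z : Fin N → ℝ) : Prop :=
  z ∈ range (phi F D ξ) ∧ (phi F D ξ)^[i] z = y

/-- The power `(f^{S^{(-d)}})^j`, `j ∈ ℤ`, the inverse being the one that belongs to the range. -/
def phiPow (ξ : ℝ × ℝ) (j : ℤ) (y : Fin N → ℝ) : Fin N → ℝ :=
  if 0 ≤ j then (phi F D ξ)^[j.toNat] y
  else Classical.epsilon (IsRangePreimage F D ξ (-j).toNat y)

/-- The admissible values `Δk` (those with `k + Δk > Δℓ`) satisfying the inequality that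
defines `β(y)`. -/
def betaSet (ξ : ℝ × ℝ) (k Δ : ℕ) (y : Fin N → ℝ) : Set ℤ :=
  {j | (Δ : ℤ) < k + j ∧ 0 < switchFn F D ξ Δ (phiPow F D ξ j y)}

/-- The return index `β(y)`: the least element of `betaSet`. -/
def beta (ξ : ℝ × ℝ) (k Δ : ℕ) (y : Fin N → ℝ) : ℤ :=
  Classical.epsilon (IsLeast (betaSet F D ξ k Δ y))

/-- `β(y)` is well-defined: the powers of `f^{S^{(-d)}}` in its definition exist and are unique,
`betaSet` has a least element, and that is at least `-C`. -/
def BetaWellDefined (C : ℕ) (ξ : ℝ × ℝ) (k Δ : ℕ) (y : Fin N → ℝ) : Prop :=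
  (∀ i : ℕ, 0 < i → Δ + i < k → ∃! z, IsRangePreimage F D ξ i y z) ∧
  ∃ b, IsLeast (betaSet F D ξ k Δ y) b ∧ -(C : ℤ) ≤ b

/-- `T(y) = (f^{S^{(-d)}})^{β(y)}(y)`. -/
def returnT (ξ : ℝ × ℝ) (k Δ : ℕ) (y : Fin N → ℝ) : Fin N → ℝ :=
  phiPow F D ξ (beta F D ξ k Δ y) y

/-- The return map (on `s = 0` the two formulas agree by `Family.fWord_flipHead`). -/
def returnMap (ξ : ℝ × ℝ) (k Δ : ℕ) (x : Fin N → ℝ) : Fin N → ℝ :=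
  if x 0 ≤ 0 then returnT F D ξ k Δ (F.fWord ξ (D.G k Δ) x)
  else returnT F D ξ k Δ (F.fWord ξ (flipHead (D.G k Δ)) x)

/-! ### Non-degeneracy of the matrix of `S^{(-d)}` at the shrinking point -/

/-- All eigenvalues of `M` of modulus `ρ` are semisimple. -/
def SemisimpleOnCircle (M : Matrix (Fin N) (Fin N) ℝ) (ρ : ℝ) : Prop :=
  ∀ μ : ℂ, ‖μ‖ = ρ → ∀ x : Fin N → ℂ,
    (toC M - μ • (1 : Matrix (Fin N) (Fin N) ℂ)) *ᵥ
      ((toC M - μ • (1 : Matrix (Fin N) (Fin N) ℂ)) *ᵥ x) = 0 →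
    (toC M - μ • (1 : Matrix (Fin N) (Fin N) ℂ)) *ᵥ x = 0

end

end PWL

namespace PWL

/-! ### Words and rotational symbol sequences -/

/-! The lemma is a statement about single orbits of `φ = f^{S^{(-d)}}`. The word of `G⁺[k,Δ]` is `(X
Y')^Δ R⁺` followed by `k - Δ` copies of `X' Y'`, the word of `S^{(-d)}`; a prime flips the first
symbol and `R⁺` consists of the first `n⁺` symbols of `S` (`RotData.G_of_nonneg`). If `w` is the
image of `x` under the part that does not involve `k`, then `f^{G⁺[k',Δ]}(x) = φ^{k'-Δ}(w)` for all
`k' > Δ`, and the powers of `φ` in the definition of `β`, also the negative ones, only move along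
the orbit of `w`. The question is which iterates of `w` lie in `Φ`.

`Φ` is a fundamental domain for `φ` at the hyperplane `σ = 0`: as long as transverse components are
small, `φ(y) ∈ Φ` means `σ(y) ≤ 0 < σ(φ(y))` (`switchFn_pos_of_mem`, `switchFn_nonpos_of_phi_mem`,
`phi_mem_recSet`). So it suffices that `σ` is nonpositive on the early part of the orbit of `w`,
increases afterwards, and changes sign within a bounded number of steps of time `k - Δ`
(`exists_crossing_bounds`, `return_spec`).

Write `x = x^int + h ζ + q` with `ωᵀ q = 0`. Then `φ` acts by `h ↦ λ h + g`, with `λ` near `1` and a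
small drift `g`, and by a linear map on `q` whose powers decay (`normalForm`). The function `σ` is
affine, and its slope along `ζ` is negative: for `Δ ≥ 1` it is `κ⁺_Δ - κ⁺_{Δ-1}` divided by a number
of sign opposite to `a`, and for `Δ = 0` its sign is that of a point of the cycle
(`switch_slope_neg`). The orbit starts at `h = t + O(1/k)`, where `t > 0` is the first coordinate of
the point of index `-d`. Hence all follows from `R_k = λ^k t + g ∑_{i<k} λ^i = O(1/k)`, `λ - 1 =
O(1/k)`, and an upper bound `-c/k` of the steps `g` at `h = 0` and `g + (λ-1) t` at `h = t`; the
last bound is itself a consequence of the first two (`exists_drift_le`).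

These estimates come from the definition of the sector (`exists_sector_estimates`). An admissible
cycle forces `|R_k| ≤ C ‖ξ - ξ₀‖ (1 + λ^k)`, because two consecutive points of it lie on different
sides of a switching (`cycle_bound`). A multiplier `±1`, present at the endpoints of the inner
boundaries, pins `λ^k` near a positive constant (`eigenvalue_bound`). To first order `g` is a
multiple of `ν` and `g + (λ-1) t` a multiple of `η`, so `det J ≠ 0` makes `(λ, g)` local
coordinates, and at the endpoints `ξ - ξ₀` and `R_k` are `O(1/k)`. A point of an inner boundary has
its angle between those of the endpoints, so it lies in a cone in which both steps are negative and
comparable with `-‖ξ - ξ₀‖`, which again gives `O(1/k)`. On the line segments and inside the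
enclosed region `R_k` is sandwiched between boundary values in a direction in which `λ` hardly
changes, since `R_k` is monotone in `g`.

Finally the transverse part is `O(ρ^k)` after `k + O(1)` steps even though `M` is perturbed, because
`(ρ + O(1/k))^k = O(ρ^k)` for `ρ > 0`. The rank condition handles `ρ = 0` and makes `φ` bijective on
its range, with bounded inverse. -/

@[simp] theorem Side.flip_flip (σ : Side) : σ.flip.flip = σ := by cases σ <;> rfl

theorem length_word (s : ℤ → Side) (n : ℕ) : (word s n).length = n := by
  simp [word]

theorem word_eq (s : ℤ → Side) (n : ℕ) :
    word s n = (List.range n).map fun i : ℕ => s (i : ℤ) := by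
  -- In the body of `word` the index is an integer, so `List.range n` occurs there coerced to a list
  -- of integers through the list monad; this undoes the coercion.
  have : ((do let a ← List.range n; pure (a : ℤ)) : List ℤ) =
      (List.range n).map fun i : ℕ => (i : ℤ) := by
    simp only [List.bind_eq_flatMap, List.pure_def]
    exact List.flatMap_pure_eq_map _ _
  unfold word
  rw [this, List.map_map]
  rfl

theorem word_congr {s s' : ℤ → Side} {n : ℕ} (h : ∀ i : ℕ, i < n → s i = s' i) :
    word s n = word s' n := by
  rw [word_eq, word_eq]
  apply List.map_congr_left
  intro i hi
  exact h i (List.mem_range.1 hi)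

theorem word_add (s : ℤ → Side) (a b : ℕ) :
    word s (a + b) = word s a ++ word (shift s a) b := by
  simp [word_eq, List.range_add, shift, Function.comp_def]

theorem shift_shift (s : ℤ → Side) (a b : ℤ) : shift (shift s a) b = shift s (a + b) := by
  funext i; simp [shift, add_assoc]

theorem flipHead_word (s : ℤ → Side) (n : ℕ) :
    flipHead (word s n) = word (fun j => if j = 0 then (s j).flip else s j) n := by
  cases n with
  | zero => rfl
  | succ n =>
    simp only [word_eq, List.range_succ_eq_map, List.map_cons, flipHead, List.map_map]
    congr 1

theorem word_mul (s : ℤ → Side) (n : ℕ) (hs : ∀ i, s (n + i) = s i) (a : ℕ) :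
    word s (a * n) = (List.replicate a (word s n)).flatten := by
  induction a with
  | zero => simp [word]
  | succ a ih =>
    rw [Nat.succ_mul, add_comm, word_add, List.replicate_succ, List.flatten_cons, ← ih]
    congr 2
    funext i
    exact hs i

theorem flipHead_append {W : List Side} (hW : W ≠ []) (W' : List Side) :
    flipHead (W ++ W') = flipHead W ++ W' := by
  cases W with
  | nil => exact absurd rfl hW
  | cons σ W => rfl

namespace RotData

variable (D : RotData)

theorem n_pos : 0 < D.n := lt_trans D.m_pos D.m_lt

theorem d_lt : D.d < D.n := by
  have : NeZero D.n := ⟨D.n_pos.ne'⟩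
  exact ZMod.val_lt _

theorem d_mul_m : (D.n : ℤ) ∣ (D.d : ℤ) * D.m - 1 := by
  have : NeZero D.n := ⟨D.n_pos.ne'⟩
  rw [← ZMod.intCast_zmod_eq_zero_iff_dvd]
  push_cast
  have : ((D.d : ℕ) : ZMod D.n) = (D.m : ZMod D.n)⁻¹ := by
    simp [d, modInv]
  rw [this, mul_comm, ZMod.coe_mul_inv_eq_one _ D.coprime, sub_self]

/-- `ℓd mod n`, the length of the word `X`. -/
def e : ℕ := D.l * D.d % D.n

theorem dvd_mul_m {i : ℤ} : (D.n : ℤ) ∣ i * D.m ↔ (D.n : ℤ) ∣ i := by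
  constructor
  · intro h
    have : IsCoprime (D.n : ℤ) (D.m : ℤ) := (Nat.isCoprime_iff_coprime.2 D.coprime).symm
    exact this.dvd_of_dvd_mul_right h
  · exact fun h => Dvd.dvd.mul_right h _

theorem dvd_e : (D.n : ℤ) ∣ (D.l : ℤ) * D.d - D.e := by
  have := Int.emod_add_mul_ediv ((D.l : ℤ) * D.d) D.n
  refine ⟨(D.l : ℤ) * D.d / D.n, ?_⟩
  simp only [e]
  push_cast
  linarith

theorem e_lt : D.e < D.n := Nat.mod_lt _ D.n_pos

theorem e_mul_m : (D.n : ℤ) ∣ (D.e : ℤ) * D.m - D.l := by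
  have h1 := D.dvd_e.mul_right (D.m : ℤ)
  have h2 := D.d_mul_m.mul_left (D.l : ℤ)
  have e1 : (D.e : ℤ) * D.m - D.l =
      (D.l * (D.d * D.m - 1)) - (D.l * D.d - D.e) * D.m := by ring
  rw [e1]
  exact h2.sub h1

theorem e_pos : 0 < D.e := by
  rcases Nat.eq_zero_or_pos D.e with h | h
  · have := D.e_mul_m
    rw [h] at this
    simp only [Nat.cast_zero, zero_mul, zero_sub, dvd_neg] at this
    have := Int.le_of_dvd (by exact_mod_cast D.l_pos) this
    have h3 := D.l_lt
    omega
  · exact h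

/-- The Farey relation says that `-n⁺` is an inverse of `m` modulo `n`, and both `n⁺` and `d` lie
strictly below `n`. -/
theorem np_add_d : D.np + D.d = D.n := by
  have h1 : (D.n : ℤ) ∣ ((D.np + D.d : ℕ) : ℤ) := by
    rw [← D.dvd_mul_m]
    have h2 := D.d_mul_m
    have h3 : ((D.mp : ℤ) * D.n) = D.m * D.np + 1 := by exact_mod_cast D.farey
    have : ((D.np + D.d : ℕ) : ℤ) * D.m = ((D.d : ℤ) * D.m - 1) + D.n * D.mp := by
      push_cast; linarith
    rw [this]
    exact h2.add (Dvd.intro _ rfl)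
  obtain ⟨c, hc⟩ := Int.natCast_dvd_natCast.1 h1
  have := D.d_lt
  have := D.np_lt
  have := D.np_pos
  have h4 : c = 1 := by
    have h5 : 0 < c := by
      rcases Nat.eq_zero_or_pos c with h | h
      · rw [h] at hc; omega
      · exact h
    have h6 : c < 2 := by
      by_contra h
      have : D.n * 2 ≤ D.n * c := Nat.mul_le_mul_left _ (by omega)
      omega
    omega
  rw [hc, h4, mul_one]

theorem S_periodic (i : ℤ) : D.S (D.n + i) = D.S i := by
  simp only [S, rot]
  rw [add_mul, Int.add_emod, Int.mul_emod_right, zero_add, Int.emod_emod_of_dvd _ (dvd_refl _)]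

theorem S_congr {i j : ℤ} (h : (D.n : ℤ) ∣ i - j) : D.S i = D.S j := by
  simp only [S, rot]
  have : (i * D.m) % D.n = (j * D.m) % D.n := by
    rw [Int.emod_eq_emod_iff_emod_sub_eq_zero, ← Int.dvd_iff_emod_eq_zero, ← sub_mul]
    exact h.mul_right _
  rw [this]

/-- Residues of `im` modulo `n`. -/
theorem exists_residue (i : ℤ) : ∃ r q : ℤ, i * D.m = r + D.n * q ∧ 0 ≤ r ∧ r < D.n ∧
    D.S i = (if r < D.l then Side.L else Side.R) ∧ ((D.n : ℤ) ∣ i ↔ r = 0) ∧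
    ((D.n : ℤ) ∣ i - D.e ↔ r = D.l) := by
  have hn : (0 : ℤ) < D.n := by exact_mod_cast D.n_pos
  have h := (Int.emod_add_mul_ediv (i * D.m) D.n).symm
  have h0 := Int.emod_nonneg (i * (D.m : ℤ)) hn.ne'
  have h1 := Int.emod_lt_of_pos (i * (D.m : ℤ)) hn
  refine ⟨(i * D.m) % D.n, (i * D.m) / D.n, h, h0, h1, rfl, ?_, ?_⟩
  · rw [← D.dvd_mul_m]
    exact Int.dvd_iff_emod_eq_zero
  · rw [← D.dvd_mul_m]
    have hl : (D.l : ℤ) % D.n = D.l :=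
      Int.emod_eq_of_lt (by positivity) (by exact_mod_cast D.l_lt)
    have : (D.n : ℤ) ∣ (i - D.e) * D.m ↔ (D.n : ℤ) ∣ i * D.m - D.l := by
      have e1 : (i - D.e) * (D.m : ℤ) = (i * D.m - D.l) - (D.e * D.m - D.l) := by ring
      rw [e1]
      exact (dvd_sub_left D.e_mul_m)
    rw [this, Int.dvd_iff_emod_eq_zero, ← Int.emod_eq_emod_iff_emod_sub_eq_zero, hl]

/-- Passing from `i` to `i - d` lowers the residue of `i m` by one. The symbol depends only on
whether that residue is below `ℓ`, so it changes exactly at the residues `0` and `ℓ`, that is at the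
indices `0` and `ℓd`. -/
theorem S_shift (i : ℤ) : D.S (-(D.d : ℤ) + i) =
    if (D.n : ℤ) ∣ i ∨ (D.n : ℤ) ∣ i - D.e then (D.S i).flip else D.S i := by
  obtain ⟨r, q, hrq, h0, h1, hS, hi, he⟩ := D.exists_residue i
  obtain ⟨r', q', hrq', h0', h1', hS', -, -⟩ := D.exists_residue (-(D.d : ℤ) + i)
  obtain ⟨c, hc⟩ := D.d_mul_m
  have hl : (D.l : ℤ) < D.n := by exact_mod_cast D.l_lt
  have hl0 : (0 : ℤ) < D.l := by exact_mod_cast D.l_pos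
  have hn : (0 : ℤ) < D.n := by exact_mod_cast D.n_pos
  have key : r' - (r - 1) = D.n * (q - q' - c) := by linarith
  simp only [hS, hS', hi, he]
  have hr : r' = if r = 0 then (D.n : ℤ) - 1 else r - 1 := by
    have hb : -(D.n : ℤ) < r' - (r - 1) := by linarith
    have hb2 : r' - (r - 1) < 2 * D.n := by
      by_cases h : r = 0
      · linarith
      · have : 1 ≤ r := by omega
        linarith
    have h3 : -1 < q - q' - c := by nlinarith
    have h4 : q - q' - c < 2 := by nlinarith
    have : q - q' - c = 0 ∨ q - q' - c = 1 := by omega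
    split_ifs with h
    · rcases this with h' | h' <;> rw [h'] at key <;> omega
    · rcases this with h' | h' <;> rw [h'] at key <;> omega
  split_ifs at hr with hr0
  · have a1 : ¬ r' < D.l := by omega
    have a2 : r < D.l := by omega
    simp [a1, hr0, Side.flip, D.l_pos]
  · by_cases hrl : r = D.l
    · have a1 : r' < D.l := by omega
      have a2 : ¬ r < D.l := by omega
      simp [a1, hrl, Side.flip]
    · have : (r' < D.l) ↔ r < D.l := by omega
      simp [this, hr0, hrl]

theorem S_zero : D.S 0 = Side.L := by
  have hl0 : (0 : ℤ) < D.l := by exact_mod_cast D.l_pos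
  simp [S, rot, D.l_pos]

theorem X_eq : D.X = word D.S D.e := rfl

theorem Y_eq : D.Y = word (shift D.S D.e) (D.n - D.e) := rfl

theorem flipHead_X : flipHead D.X = word (fun j => if j = 0 then (D.S j).flip else D.S j) D.e := by
  rw [X_eq, flipHead_word]

theorem flipHead_Y : flipHead D.Y = word (shift (fun j => if j = D.e then (D.S j).flip else D.S j)
    D.e) (D.n - D.e) := by
  rw [Y_eq, flipHead_word]
  apply word_congr
  intro i _
  simp [shift]

/-- A word of length `n` is determined by its two parts of lengths `e` and `n - e`. -/
theorem word_n (s : ℤ → Side) : word s D.n = word s D.e ++ word (shift s D.e) (D.n - D.e) := by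
  conv_lhs => rw [← Nat.add_sub_cancel' D.e_lt.le]
  exact word_add _ _ _

theorem word_S : word D.S D.n = D.X ++ D.Y := D.word_n _

theorem dvd_iff_eq_zero {i : ℕ} (h : i < D.n) : (D.n : ℤ) ∣ (i : ℤ) ↔ i = 0 := by
  rw [Int.natCast_dvd_natCast]
  exact ⟨fun h' => Nat.eq_zero_of_dvd_of_lt h' h, fun h' => by simp [h']⟩

theorem dvd_sub_e_iff {i : ℕ} (h : i < D.n) : (D.n : ℤ) ∣ (i : ℤ) - D.e ↔ i = D.e := by
  constructor
  · intro h'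
    have h2 := Int.eq_zero_of_abs_lt_dvd h' (by
      have := D.e_lt
      rw [abs_lt]; constructor <;> omega)
    omega
  · rintro rfl; simp

theorem dvd_sub_ld_iff (i : ℤ) :
    (D.n : ℤ) ∣ i - (D.l : ℤ) * D.d ↔ (D.n : ℤ) ∣ i - D.e := by
  have e1 : i - (D.l : ℤ) * D.d = (i - D.e) - ((D.l : ℤ) * D.d - D.e) := by ring
  rw [e1]
  exact dvd_sub_left D.dvd_e

theorem word_S0 : word D.S0 D.n = flipHead D.X ++ D.Y := by
  rw [word_n, flipHead_X, Y_eq]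
  congr 1
  · apply word_congr
    intro i hi
    have h1 := D.e_lt
    simp only [S0, flipAt, sub_zero, D.dvd_iff_eq_zero (hi.trans h1)]
    norm_cast
  · apply word_congr
    intro i hi
    have h1 := D.e_pos
    have h2 : D.e + i < D.n := by omega
    have := D.dvd_iff_eq_zero h2
    push_cast at this
    simp only [S0, flipAt, shift, sub_zero, this]
    rw [if_neg (by omega)]

theorem word_Sld : word D.Sld D.n = D.X ++ flipHead D.Y := by
  rw [word_n, flipHead_Y, X_eq]
  congr 1
  · apply word_congr
    intro i hi
    have h1 := D.e_lt
    simp only [Sld, flipAt, dvd_sub_ld_iff, D.dvd_sub_e_iff (hi.trans h1)]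
    rw [if_neg (by omega)]
  · apply word_congr
    intro i hi
    have h2 : D.e + i < D.n := by omega
    have := D.dvd_sub_e_iff h2
    push_cast at this
    simp only [Sld, flipAt, shift, dvd_sub_ld_iff, this]
    congr 1
    simp

/-- The two symbols at which `S^{(-d)}` differs from `S = X Y` are the first symbols of `X` and of
`Y`. -/
theorem Smd_eq : D.Smd = flipHead D.X ++ flipHead D.Y := by
  rw [Smd, word_n, flipHead_Y, flipHead_X]
  congr 1
  · apply word_congr
    intro i hi
    have h1 := D.e_lt
    simp only [shift, S_shift, D.dvd_iff_eq_zero (hi.trans h1), D.dvd_sub_e_iff (hi.trans h1)]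
    have : i ≠ D.e := by omega
    simp [this]
  · apply word_congr
    intro i hi
    have h1 := D.e_pos
    have h2 : D.e + i < D.n := by omega
    have a1 := D.dvd_iff_eq_zero h2
    have a2 := D.dvd_sub_e_iff h2
    push_cast at a1 a2
    simp only [shift, S_shift, a1, a2]
    have : ¬ (D.e = 0 ∧ i = 0) := by omega
    simp [h1.ne']

/-- The first `n⁺` symbols of `S`. -/
def Rp : List Side := word D.S D.np

theorem length_Rp : D.Rp.length = D.np := length_word _ _

theorem Rp_ne_nil : D.Rp ≠ [] := by
  rw [← List.length_pos_iff, length_Rp]; exact D.np_pos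

theorem shift_S_np : shift D.S D.np = shift D.S (-(D.d : ℤ)) := by
  funext i
  apply D.S_congr
  have := D.np_add_d
  refine ⟨1, ?_⟩
  rw [← this]; push_cast; ring

/-- Since `n⁺ = n - d`, the sequence `S` continues as `S^{(-d)}` after its first `n⁺` symbols. -/
theorem word_S_long (a : ℕ) :
    word D.S (D.np + a * D.n) = D.Rp ++ (List.replicate a D.Smd).flatten := by
  rw [word_add, shift_S_np, word_mul]
  · rfl
  · intro i
    simp only [shift]
    apply D.S_congr
    refine ⟨1, by ring⟩

/-- As `n⁺ ≡ -d`, the amount by which the ceiling rounds `ℓ n⁺` up to a multiple of `n` is the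
residue `e` of `ℓd`. -/
theorem n_mul_lp : (D.n : ℤ) * D.lp = D.l * D.np + D.e := by
  have hn : (0 : ℚ) < D.n := by exact_mod_cast D.n_pos
  obtain ⟨c, hc⟩ := D.dvd_e
  have h1 : (D.l : ℤ) * D.np + D.e = D.n * (D.l - c) := by
    have := D.np_add_d
    have h2 : (D.np : ℤ) = D.n - D.d := by omega
    rw [h2]; linarith
  have h3 : D.lp = D.l - c := by
    rw [lp, Int.ceil_eq_iff]
    have he : (D.e : ℚ) < D.n := by exact_mod_cast D.e_lt
    have he0 : (0 : ℚ) ≤ D.e := by positivity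
    have h4 : (D.l : ℚ) * D.np + D.e = D.n * (((D.l : ℤ) - c : ℤ) : ℚ) := by exact_mod_cast h1
    constructor
    · rw [lt_div_iff₀ hn]; linarith
    · rw [div_le_iff₀ hn]; linarith
  rw [h3, h1]

/-- The Farey relation of `m⁺/n⁺` with `m/n` is inherited by all mediants `m_k/n_k`. It allows
residues modulo `n_k` to be read off from residues modulo `n`. -/
theorem mk_mul_n (k : ℕ) : ((D.mk' k : ℕ) : ℤ) * D.n = D.m * D.nk k + 1 := by
  have := D.farey
  have h : (D.mp : ℤ) * D.n = D.m * D.np + 1 := by exact_mod_cast this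
  simp only [mk', nk]; push_cast; linarith

theorem nk_pos (k : ℕ) : 0 < D.nk k := by
  have := D.np_pos
  simp only [nk]; positivity

/-- Comparison of `G⁺[k,χ]` with residues modulo `n`. -/
theorem Gseq_eq (k : ℕ) (χ : ℤ) (i : ℕ) (hi : i < D.nk k) (r q : ℤ)
    (hrq : (i : ℤ) * D.m = r + D.n * q) (h0 : 0 ≤ r) (h1 : r < D.n) :
    D.Gseq k χ i = if (r - D.l) * D.nk k + i < D.e + D.n * χ then Side.L else Side.R := by
  have hn : (0 : ℤ) < D.n := by exact_mod_cast D.n_pos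
  have hk : (0 : ℤ) < D.nk k := by exact_mod_cast D.nk_pos k
  have hm := D.mk_mul_n k
  have hik : (i : ℤ) < D.nk k := by exact_mod_cast hi
  -- `v` is the residue of `i m_k` modulo `n_k`; the relation `n v = r n_k + i` expresses it through
  -- the residue `r` of `i m` modulo `n`.
  set v : ℤ := (i : ℤ) * D.mk' k - D.nk k * q with hv
  have h2 : D.n * v = r * D.nk k + i := by
    rw [hv]
    linear_combination (i : ℤ) * hm + (D.nk k : ℤ) * hrq
  have h3 : 0 ≤ v := by
    by_contra h
    have : v ≤ -1 := by omega
    nlinarith [mul_nonneg h0 hk.le, (Int.natCast_nonneg i)]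
  have h4 : v < D.nk k := by
    by_contra h
    have : (D.nk k : ℤ) ≤ v := by omega
    have h5 : r * D.nk k ≤ (D.n - 1) * D.nk k :=
      mul_le_mul_of_nonneg_right (by omega) hk.le
    nlinarith
  have h5 : ((i : ℤ) * D.mk' k) % D.nk k = v := by
    have : (i : ℤ) * D.mk' k = v + D.nk k * q := by rw [hv]; ring
    rw [this, Int.add_mul_emod_self_left, Int.emod_eq_of_lt h3 h4]
  simp only [Gseq, rot]
  rw [h5]
  have hlp := D.n_mul_lp
  have : v < D.lk k + χ ↔ (r - D.l) * D.nk k + i < D.e + D.n * χ := by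
    rw [← mul_lt_mul_iff_right₀ hn, h2]
    have : (D.n : ℤ) * (D.lk k + χ) = D.l * D.nk k + D.e + D.n * χ := by
      simp only [lk, nk]; push_cast; linear_combination hlp
    rw [this]
    constructor <;> intro h <;> linarith
  simp only [this]

/-- In the inequality of `Gseq_eq` the term `(r - ℓ) n_k` dominates unless `r = ℓ`, so the symbol is
that of `S`. For `r = ℓ` the index is congruent to `e` modulo `n`, hence `i < e + c n` amounts to `i
< c n`, and then an `R` of `S` becomes an `L`. -/
theorem Gseq_of_nonneg (k c : ℕ) (hc : c < k) (i : ℕ) (hi : i < D.nk k) :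
    D.Gseq k c i = if (D.n : ℤ) ∣ (i : ℤ) - D.e ∧ i < c * D.n then (D.S i).flip else D.S i := by
  obtain ⟨r, q, hrq, h0, h1, hS, -, he⟩ := D.exists_residue i
  simp only [D.Gseq_eq k c i hi r q hrq h0 h1, hS, he]
  have hnk : (c * D.n : ℤ) + D.n ≤ D.nk k - D.np := by
    simp only [nk]
    have : (c + 1) * D.n ≤ k * D.n := Nat.mul_le_mul_right _ hc
    push_cast
    have h2 : ((c + 1 : ℕ) : ℤ) * D.n ≤ k * D.n := by exact_mod_cast this
    push_cast at h2
    linarith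
  have hnp : (0 : ℤ) < D.np := by exact_mod_cast D.np_pos
  have hk : (0 : ℤ) < D.nk k := by exact_mod_cast D.nk_pos k
  have hik : (i : ℤ) < D.nk k := by exact_mod_cast hi
  have hel : (D.e : ℤ) < D.n := by exact_mod_cast D.e_lt
  have he0 : (0 : ℤ) ≤ D.e := by positivity
  have hcn : (0 : ℤ) ≤ c * D.n := by positivity
  rcases lt_trichotomy r D.l with h | h | h
  · have : (r - D.l) * D.nk k ≤ (-1) * D.nk k := mul_le_mul_of_nonneg_right (by omega) hk.le
    have h2 : (r - D.l) * D.nk k + i < D.e + D.n * (c : ℤ) := by linarith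
    simp [h, h.ne, h2]
  · subst h
    have hdiv := he.2 rfl
    have : ((D.l : ℤ) - D.l) * D.nk k + i < D.e + D.n * (c : ℤ) ↔ i < c * D.n := by
      rw [sub_self, zero_mul, zero_add]
      constructor
      · intro h3
        obtain ⟨b, hb⟩ := hdiv
        have hn : (0 : ℤ) < D.n := by exact_mod_cast D.n_pos
        have h4 : b < c := by
          have : (D.n : ℤ) * b < D.n * c := by linarith
          exact lt_of_mul_lt_mul_left this hn.le
        have h5 : (D.n : ℤ) * (b + 1) ≤ D.n * c := mul_le_mul_of_nonneg_left (by omega) hn.le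
        have : (i : ℤ) < c * D.n := by linarith
        exact_mod_cast this
      · intro h3
        have : (i : ℤ) < c * D.n := by exact_mod_cast h3
        linarith
    simp only [this, lt_irrefl, if_false, true_and, Side.flip]
  · have : 1 * (D.nk k : ℤ) ≤ (r - D.l) * D.nk k := mul_le_mul_of_nonneg_right (by omega) hk.le
    have h2 : ¬ (r - D.l) * D.nk k + i < D.e + D.n * (c : ℤ) := by
      push Not
      have : (0 : ℤ) ≤ i := by positivity
      linarith
    rw [if_neg h2, if_neg (by intro h'; exact h.ne' h'.1), if_neg (by omega)]

/-- `(X Y')^c R⁺`: the part of `G⁺[k,c]` before the powers of `S^{(-d)}`. -/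
def Gpre (c : ℕ) : List Side := (List.replicate c (D.X ++ flipHead D.Y)).flatten ++ D.Rp

theorem Gpre_ne_nil (c : ℕ) : D.Gpre c ≠ [] := by
  simp [Gpre, D.Rp_ne_nil]

/-- During its first `c` periods the sequence agrees with `S` flipped at `ℓd`, which gives `(X
Y')^c`; afterwards it agrees with `S`, and `word_S_long` applies. Only the number of copies of
`S^{(-d)}` depends on `k`. -/
theorem G_of_nonneg (k c : ℕ) (hc : c < k) :
    D.G k c = D.Gpre c ++ (List.replicate (k - c) D.Smd).flatten := by
  have hlen : D.nk k = c * D.n + (D.np + (k - c) * D.n) := by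
    simp only [nk]
    have : k * D.n = c * D.n + (k - c) * D.n := by rw [← add_mul, Nat.add_sub_cancel' hc.le]
    omega
  rw [G, Gpre, List.append_assoc, ← word_S_long, ← word_Sld, ← word_mul, hlen, word_add]
  · congr 1
    · apply word_congr
      intro i hi
      rw [D.Gseq_of_nonneg k c hc i (by omega)]
      simp only [Sld, flipAt, dvd_sub_ld_iff, hi, and_true]
    · apply word_congr
      intro i hi
      simp only [shift]
      have := D.Gseq_of_nonneg k c hc (c * D.n + i) (by omega)
      rw [if_neg (by omega)] at this
      push_cast at this ⊢
      rw [this]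
      apply D.S_congr
      exact ⟨c, by ring⟩
  · intro i
    simp only [Sld, flipAt]
    have : (D.n : ℤ) ∣ D.n + i - D.l * D.d ↔ (D.n : ℤ) ∣ i - D.l * D.d := by
      rw [add_sub_assoc]; exact dvd_add_right (dvd_refl _)
    simp only [this, S_periodic]

theorem dvd_e_sub_d {i : ℤ} :
    (D.n : ℤ) ∣ i - (D.e - D.d) ↔ (D.n : ℤ) ∣ i * D.m - (D.l - 1) := by
  rw [← D.dvd_mul_m]
  have e1 : (i - (D.e - D.d)) * (D.m : ℤ) =
    (i * D.m - (D.l - 1)) - ((D.e * D.m - D.l) - (D.d * D.m - 1)) := by ring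
  rw [e1]
  exact dvd_sub_left (D.e_mul_m.sub D.d_mul_m)

/-- For `χ = -1` only the residue `r = ℓ - 1` can be affected. The indices with that residue are
congruent to `n⁺ + (k-1) n + e`, which is the largest of them below `n_k` and the only one that
reaches the lowered threshold. -/
theorem Gseq_neg_one (k : ℕ) (hk2 : 2 ≤ k) (i : ℕ) (hi : i < D.nk k) :
    D.Gseq k (-1) i = if i = D.np + ((k - 1) * D.n + D.e) then (D.S i).flip else D.S i := by
  obtain ⟨r, q, hrq, h0, h1, hS, -, he⟩ := D.exists_residue i
  rw [D.Gseq_eq k (-1) i hi r q hrq h0 h1, hS]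
  have hnk : (D.nk k : ℤ) = (k - 1) * D.n + D.n + D.np := by
    simp only [nk]; push_cast; ring
  have hkz : (2 : ℤ) ≤ k := by exact_mod_cast hk2
  have hn : (0 : ℤ) < D.n := by exact_mod_cast D.n_pos
  have hk1 : (D.n : ℤ) ≤ (k - 1) * D.n := by nlinarith
  have hnp : (0 : ℤ) < D.np := by exact_mod_cast D.np_pos
  have hk : (0 : ℤ) < D.nk k := by exact_mod_cast D.nk_pos k
  have hik : (i : ℤ) < D.nk k := by exact_mod_cast hi
  have hi0 : (0 : ℤ) ≤ i := by positivity
  have hel : (D.e : ℤ) < D.n := by exact_mod_cast D.e_lt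
  have he0 : (0 : ℤ) < D.e := by exact_mod_cast D.e_pos
  have hmod : (D.n : ℤ) ∣ i - (D.np + ((k - 1) * D.n + D.e)) ↔ r = D.l - 1 := by
    have hd : (D.np : ℤ) = D.n - D.d := by have := D.np_add_d; omega
    have e1 : (i : ℤ) - (D.np + ((k - 1) * D.n + D.e)) = (i - (D.e - D.d)) - D.n * k := by
      rw [hd]; ring
    rw [e1, dvd_sub_left (Dvd.intro _ rfl), D.dvd_e_sub_d, hrq]
    have e2 : r + D.n * q - (D.l - 1) = (r - (D.l - 1)) + D.n * q := by ring
    rw [e2, dvd_add_left (Dvd.intro _ rfl)]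
    constructor
    · intro h
      have := Int.eq_zero_of_abs_lt_dvd h (by
        have h3 : (D.l : ℤ) < D.n := by exact_mod_cast D.l_lt
        have h4 : (0 : ℤ) < D.l := by exact_mod_cast D.l_pos
        rw [abs_lt]; constructor <;> linarith)
      omega
    · rintro rfl; simp
  have hcast : i = D.np + ((k - 1) * D.n + D.e) ↔
      (i : ℤ) = D.np + ((k - 1) * D.n + D.e) := by
    rw [← Int.natCast_inj]
    push_cast
    rw [Nat.cast_sub (by omega)]
    simp
  simp only [hcast]
  rcases lt_trichotomy r (D.l - 1) with h | h | h
  · have h4 : (r - D.l) * D.nk k ≤ (-2) * D.nk k := mul_le_mul_of_nonneg_right (by omega) hk.le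
    have h2 : (r - D.l) * D.nk k + i < D.e + D.n * (-1 : ℤ) := by linarith
    have h3 : ¬ (i : ℤ) = D.np + ((k - 1) * D.n + D.e) := by
      intro h'
      rw [h', sub_self] at hmod
      exact h.ne (hmod.1 (dvd_zero _))
    have h5 : r < D.l := by omega
    simp only [h2, h3, h5, if_true, if_false]
  · obtain ⟨b, hb⟩ := hmod.2 h
    have e2 : (r - D.l) * D.nk k = - D.nk k := by rw [h]; ring
    rw [e2]
    have h5 : r < D.l := by omega
    simp only [h5, if_true]
    by_cases h' : (i : ℤ) = D.np + ((k - 1) * D.n + D.e)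
    · rw [if_neg (by linarith), if_pos h']; rfl
    · have hb0 : b < 0 := by
        have : b < 1 := by
          by_contra hcon
          have : D.n * 1 ≤ D.n * b := mul_le_mul_of_nonneg_left (by omega) hn.le
          linarith
        have : b ≠ 0 := by
          rintro rfl
          exact h' (by linarith)
        omega
      have h6 : (D.n : ℤ) * b ≤ D.n * (-1) := mul_le_mul_of_nonneg_left (by omega) hn.le
      rw [if_pos (by linarith), if_neg h']
  · have h4 : 0 * (D.nk k : ℤ) ≤ (r - D.l) * D.nk k := mul_le_mul_of_nonneg_right (by omega) hk.le
    have h2 : ¬ (r - D.l) * D.nk k + i < D.e + D.n * (-1 : ℤ) := by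
      push Not; linarith
    have h3 : ¬ (i : ℤ) = D.np + ((k - 1) * D.n + D.e) := by
      intro h'
      rw [h', sub_self] at hmod
      exact h.ne' (hmod.1 (dvd_zero _))
    have h5 : ¬ r < D.l := by omega
    simp only [h2, h3, h5, if_false]

/-- The single flipped index is the first symbol of `Y'` in the last copy of `X' Y'`; the flip turns
this `Y'` back into `Y`. -/
theorem G_neg_one (k : ℕ) (hk : 2 ≤ k) :
    D.G k (-1) = D.Rp ++ ((List.replicate (k - 1) D.Smd).flatten ++ (flipHead D.X ++ D.Y)) := by
  have hlen : D.nk k = D.np + ((k - 1) * D.n + D.e) + (D.n - D.e) := by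
    simp only [nk]
    have : k * D.n = (k - 1) * D.n + D.n := by rw [← Nat.succ_mul]; congr 1; omega
    have := D.e_lt
    omega
  have h1 : word (D.Gseq k (-1)) (D.np + ((k - 1) * D.n + D.e)) =
      D.Rp ++ ((List.replicate (k - 1) D.Smd).flatten ++ flipHead D.X) := by
    have : word (D.Gseq k (-1)) (D.np + ((k - 1) * D.n + D.e)) =
        word D.S (D.np + ((k - 1) * D.n + D.e)) := by
      apply word_congr
      intro i hi
      rw [D.Gseq_neg_one k hk i (by omega), if_neg (by omega)]
    have h2 := D.word_S_long k
    have h3 : D.np + k * D.n = D.np + ((k - 1) * D.n + D.e) + (D.n - D.e) := by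
      simp only [nk] at hlen; omega
    rw [h3, word_add] at h2
    have h4 : (List.replicate k D.Smd).flatten =
        (List.replicate (k - 1) D.Smd).flatten ++ flipHead D.X ++ flipHead D.Y := by
      conv_lhs => rw [show k = (k - 1) + 1 by omega]
      rw [List.replicate_succ', List.flatten_append, List.flatten_singleton, Smd_eq,
        List.append_assoc]
    rw [h4, ← List.append_assoc] at h2
    rw [this]
    have h5 := List.append_inj_left' h2 (by rw [length_word, flipHead_Y, length_word])
    exact h5
  have h2 : word (shift (D.Gseq k (-1)) ((D.np + ((k - 1) * D.n + D.e) : ℕ) : ℤ)) (D.n - D.e) =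
      D.Y := by
    rw [Y_eq]
    apply word_congr
    intro i hi
    simp only [shift]
    have h3 := D.Gseq_neg_one k hk (D.np + ((k - 1) * D.n + D.e) + i) (by omega)
    have h4 : D.S ((D.np + ((k - 1) * D.n + D.e) + i : ℕ) : ℤ) =
        D.S (-(D.d : ℤ) + ((D.e + i : ℕ) : ℤ)) := by
      apply D.S_congr
      have hd : (D.np : ℤ) = D.n - D.d := by have := D.np_add_d; omega
      refine ⟨k, ?_⟩
      push_cast
      rw [Nat.cast_sub (by omega), hd]
      push_cast
      ring
    have h5 : D.e + i < D.n := by omega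
    have he := D.e_pos
    rw [h4, D.S_shift] at h3
    simp only [D.dvd_iff_eq_zero h5, D.dvd_sub_e_iff h5] at h3
    rw [← Nat.cast_add, h3, ← Nat.cast_add]
    by_cases hi0 : i = 0
    · subst hi0; simp
    · simp [hi0]
  rw [G, hlen, word_add, h1, h2]
  simp only [List.append_assoc]

end RotData

end PWL


namespace PWL

namespace RotData

variable (D : RotData)

theorem flipHead_X_flipHead_Y : flipHead D.X = word (shift D.S (-(D.d : ℤ))) D.e ∧
    flipHead D.Y = word (shift D.S (-(D.d : ℤ) + D.e)) (D.n - D.e) := by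
  have h := D.Smd_eq
  rw [Smd, word_n, shift_shift] at h
  have h' := List.append_inj h (by rw [flipHead_X, length_word, length_word])
  exact ⟨h'.1.symm, h'.2.symm⟩

end RotData

variable {N : ℕ} [NeZero N] (F : Family N)

/-! ### Compositions of affine maps -/

theorem Family.fWord_append (ξ : ℝ × ℝ) (W W' : List Side) (x : Fin N → ℝ) :
    F.fWord ξ (W ++ W') x = F.fWord ξ W' (F.fWord ξ W x) := by
  simp [Family.fWord, List.foldl_append]

theorem Family.MWord_append (ξ : ℝ × ℝ) (W W' : List Side) :
    F.MWord ξ (W ++ W') = F.MWord ξ W' * F.MWord ξ W := by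
  have gen : ∀ (W : List Side) (P : Matrix (Fin N) (Fin N) ℝ),
      W.foldl (fun P σ => F.A ξ σ * P) P = F.MWord ξ W * P := by
    intro W
    induction W with
    | nil => intro P; simp [Family.MWord]
    | cons σ W ih =>
      intro P
      simp only [Family.MWord, List.foldl_cons, mul_one]
      rw [ih, ih (F.A ξ σ), mul_assoc]
  rw [Family.MWord, List.foldl_append, gen]
  rfl

theorem Family.MWord_nil (ξ : ℝ × ℝ) : F.MWord ξ [] = 1 := rfl

theorem Family.fWord_nil (ξ : ℝ × ℝ) (x : Fin N → ℝ) : F.fWord ξ [] x = x := rfl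

theorem Family.fWord_eq (ξ : ℝ × ℝ) (W : List Side) (x : Fin N → ℝ) :
    F.fWord ξ W x = F.MWord ξ W *ᵥ x + F.fWord ξ W 0 := by
  have := F.fWord_sub ξ W x 0
  rw [sub_zero] at this
  rw [← this]; abel

theorem Family.MWord_replicate (ξ : ℝ × ℝ) (W : List Side) (a : ℕ) :
    F.MWord ξ (List.replicate a W).flatten = F.MWord ξ W ^ a := by
  induction a with
  | zero => simp [Family.MWord_nil]
  | succ a ih => rw [List.replicate_succ, List.flatten_cons, Family.MWord_append, ih, pow_succ]

theorem Family.fWord_replicate (ξ : ℝ × ℝ) (W : List Side) (a : ℕ) (x : Fin N → ℝ) :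
    F.fWord ξ (List.replicate a W).flatten x = (F.fWord ξ W)^[a] x := by
  induction a generalizing x with
  | zero => simp [Family.fWord_nil]
  | succ a ih =>
    rw [List.replicate_succ, List.flatten_cons, Family.fWord_append, ih, Function.iterate_succ_apply]

/-- The effect of flipping the first symbol of a word, per unit of the first coordinate. -/
noncomputable def Family.flipVec (ξ : ℝ × ℝ) (W : List Side) : Fin N → ℝ :=
  (F.MWord ξ (flipHead W) - F.MWord ξ W) *ᵥ Pi.single 0 1

/-- The two affine maps agree on `s = 0`, so their difference depends on `x` only through its first
coordinate, and linearly. Every flip therefore costs a rank-one term with right factor `e₁ᵀ`. -/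
theorem Family.fWord_flipHead_eq (ξ : ℝ × ℝ) (W : List Side) (x : Fin N → ℝ) :
    F.fWord ξ (flipHead W) x = F.fWord ξ W x + x 0 • F.flipVec ξ W := by
  have h0 : (x - x 0 • (Pi.single 0 1 : Fin N → ℝ)) 0 = 0 := by simp
  have h1 := F.fWord_flipHead ξ W _ h0
  have h2 := F.fWord_sub ξ W x (x - x 0 • (Pi.single 0 1 : Fin N → ℝ))
  have h3 := F.fWord_sub ξ (flipHead W) x (x - x 0 • (Pi.single 0 1 : Fin N → ℝ))
  rw [sub_sub_cancel, sub_eq_iff_eq_add, mulVec_smul] at h2 h3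
  rw [h2, h3, h1, Family.flipVec, sub_mulVec, smul_sub]
  abel

theorem Family.MWord_flipHead_mulVec (ξ : ℝ × ℝ) (W : List Side) (x : Fin N → ℝ) :
    F.MWord ξ (flipHead W) *ᵥ x = F.MWord ξ W *ᵥ x + x 0 • F.flipVec ξ W := by
  have h1 := F.fWord_flipHead_eq ξ W x
  have h0 := F.fWord_flipHead_eq ξ W 0
  rw [F.fWord_eq ξ (flipHead W) x, F.fWord_eq ξ W x, h0] at h1
  simp only [Pi.zero_apply, zero_smul, add_zero] at h1
  rw [add_right_comm] at h1
  exact add_right_cancel h1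

theorem Family.MWord_flipHead (ξ : ℝ × ℝ) (W : List Side) :
    F.MWord ξ (flipHead W) = F.MWord ξ W + vecMulVec (F.flipVec ξ W) (Pi.single 0 1) := by
  apply Matrix.ext_of_mulVec_single
  intro i
  rw [F.MWord_flipHead_mulVec, add_mulVec, vecMulVec_mulVec]
  congr 1
  simp [Pi.single_apply, eq_comm]

theorem Family.step_eq_of_zero (ξ : ℝ × ℝ) (σ τ : Side) (x : Fin N → ℝ) (hx : x 0 = 0) :
    F.step ξ σ x = F.step ξ τ x := by
  have h := F.fWord_flipHead ξ [σ] x hx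
  cases σ <;> cases τ <;> first | rfl | exact h | exact h.symm

theorem word_succ (s : ℤ → Side) (n : ℕ) : word s (n + 1) = word s n ++ [s n] := by
  rw [word_add]; simp [word_eq, shift]

theorem word_succ' (s : ℤ → Side) (n : ℕ) : word s (n + 1) = s 0 :: word (shift s 1) n := by
  rw [add_comm, word_add]; simp [word_eq]

variable {F}

theorem IsCycle.fWord {ξ : ℝ × ℝ} {s : ℤ → Side} {n : ℕ} {x : ℤ → Fin N → ℝ}
    (h : IsCycle F ξ s n x) (i : ℤ) (k : ℕ) :
    F.fWord ξ (word (shift s i) k) (x i) = x (i + k) := by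
  induction k with
  | zero => simp [word_eq, Family.fWord_nil]
  | succ k ih =>
    rw [word_succ, Family.fWord_append, ih]
    have := (h (i + k)).1
    push_cast
    rw [← add_assoc, this]
    rfl

theorem IsCycle.fWord_zero {ξ : ℝ × ℝ} {s : ℤ → Side} {n : ℕ} {x : ℤ → Fin N → ℝ}
    (h : IsCycle F ξ s n x) (k : ℕ) : F.fWord ξ (word s k) (x 0) = x k := by
  have := h.fWord 0 k
  have e : shift s 0 = s := by funext i; simp [shift]
  rwa [e, zero_add] at this

theorem IsCycle.shift {ξ : ℝ × ℝ} {s : ℤ → Side} {n : ℕ} {x : ℤ → Fin N → ℝ}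
    (h : IsCycle F ξ s n x) (j : ℤ) : IsCycle F ξ (shift s j) n (fun i => x (j + i)) := by
  intro i
  have := h (j + i)
  rw [add_assoc, add_assoc] at this
  exact this

theorem IsCycle.congr_dvd {ξ : ℝ × ℝ} {s : ℤ → Side} {n : ℕ} {x : ℤ → Fin N → ℝ}
    (h : IsCycle F ξ s n x) {i j : ℤ} (hij : (n : ℤ) ∣ i - j) : x i = x j := by
  have key : ∀ (a : ℕ) (j : ℤ), x (j + n * a) = x j := by
    intro a
    induction a with
    | zero => intro j; simp
    | succ a ih =>
      intro j
      push_cast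
      rw [mul_add, mul_one, ← add_assoc, (h _).2, ih]
  obtain ⟨c, hc⟩ := hij
  rcases le_total 0 c with h0 | h0
  · obtain ⟨a, rfl⟩ := Int.eq_ofNat_of_zero_le h0
    rw [show i = j + n * a by linarith, key]
  · obtain ⟨a, ha⟩ := Int.eq_ofNat_of_zero_le (neg_nonneg.2 h0)
    rw [show j = i + n * a by rw [← ha]; linarith, key]

/-- Two cycles with the same symbols differ by an eigenvector for the eigenvalue `1`. -/
theorem IsCycle.sub_mulVec {ξ : ℝ × ℝ} {s : ℤ → Side} {n : ℕ} {x y : ℤ → Fin N → ℝ}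
    (hx : IsCycle F ξ s n x) (hy : IsCycle F ξ s n y) (i : ℤ) (k : ℕ) :
    F.MWord ξ (word (PWL.shift s i) k) *ᵥ (x i - y i) = x (i + k) - y (i + k) := by
  rw [← F.fWord_sub, hx.fWord, hy.fWord]

/-- A shift by one moves a matrix factor from one end of the product to the other, and `det (1 - PQ)
= det (1 - QP)`. -/
theorem det_one_sub_shift (ξ : ℝ × ℝ) (s : ℤ → Side) (n : ℕ) (hs : ∀ i, s (n + i) = s i) (i : ℤ) :
    (1 - F.MWord ξ (word (shift s i) n)).det = (1 - F.MWord ξ (word s n)).det := by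
  have step : ∀ i, (1 - F.MWord ξ (word (shift s (i + 1)) n)).det =
      (1 - F.MWord ξ (word (shift s i) n)).det := by
    intro i
    cases n with
    | zero => simp [word_eq]
    | succ n =>
      have h1 : word (shift s (i + 1)) (n + 1) = word (shift s (i + 1)) n ++ [s i] := by
        rw [word_succ]
        congr 2
        simp only [shift]
        rw [← hs i]
        congr 1
        push_cast; ring
      have h2 : word (shift s i) (n + 1) = [s i] ++ word (shift s (i + 1)) n := by
        rw [word_succ', shift_shift]; simp [shift]
      rw [h1, h2, F.MWord_append, F.MWord_append, Matrix.det_one_sub_mul_comm]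
  have h0 : shift s 0 = s := by funext i; simp [shift]
  induction i using Int.induction_on with
  | zero => rw [h0]
  | succ i ih => rw [step, ih]
  | pred i ih => rw [← ih, ← step (-(i : ℤ) - 1)]; simp

theorem cyclePt_unique {ξ : ℝ × ℝ} {s : ℤ → Side} {n : ℕ} {i : ℤ}
    (h : (1 - F.MWord ξ (word (shift s i) n)).det ≠ 0) {x : Fin N → ℝ} :
    F.fWord ξ (word (shift s i) n) x = x ↔ x = cyclePt F ξ s n i := by
  have hu : IsUnit (1 - F.MWord ξ (word (shift s i) n)).det := isUnit_iff_ne_zero.2 h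
  rw [F.fWord_eq, cyclePt]
  set M := F.MWord ξ (word (shift s i) n)
  constructor
  · intro hx
    have : (1 - M) *ᵥ x = F.fWord ξ (word (shift s i) n) 0 := by
      rw [sub_mulVec, one_mulVec]; nth_rw 1 [← hx]; abel
    rw [← this, mulVec_mulVec, Matrix.nonsing_inv_mul _ hu, one_mulVec]
  · intro hx
    have : (1 - M) *ᵥ x = F.fWord ξ (word (shift s i) n) 0 := by
      rw [hx, mulVec_mulVec, Matrix.mul_nonsing_inv _ hu, one_mulVec]
    rw [← this, sub_mulVec, one_mulVec]; abel

theorem isCycle_cyclePt {ξ : ℝ × ℝ} {s : ℤ → Side} {n : ℕ} (hn : 0 < n)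
    (hs : ∀ i, s (n + i) = s i) (h : (1 - F.MWord ξ (word s n)).det ≠ 0) :
    IsCycle F ξ s n (cyclePt F ξ s n) := by
  have hd : ∀ i, (1 - F.MWord ξ (word (shift s i) n)).det ≠ 0 := fun i => by
    rwa [det_one_sub_shift ξ s n hs]
  intro i
  constructor
  · symm
    rw [← cyclePt_unique (hd _)]
    obtain ⟨n, rfl⟩ : ∃ k, n = k + 1 := ⟨n - 1, by omega⟩
    have h1 : word (shift s (i + 1)) (n + 1) = word (shift s (i + 1)) n ++ [s i] := by
      rw [word_succ]
      congr 2
      simp only [shift]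
      rw [← hs i]
      congr 1
      push_cast; ring
    have h2 : word (shift s i) (n + 1) = [s i] ++ word (shift s (i + 1)) n := by
      rw [word_succ', shift_shift]; simp [shift]
    have h3 := (cyclePt_unique (hd i)).2 rfl
    rw [h2, F.fWord_append] at h3
    rw [h1, F.fWord_append]
    change F.step ξ (s i) _ = _
    congr 1
  · have : shift s (i + n) = shift s i := by
      funext j
      simp only [shift]
      rw [← hs (i + j)]
      congr 1; ring
    simp only [cyclePt, this]

/-! ### Shrinking points -/

theorem RotData.S0_periodic (D : RotData) (i : ℤ) : D.S0 (D.n + i) = D.S0 i := by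
  have : (D.n : ℤ) ∣ D.n + i ↔ (D.n : ℤ) ∣ i := dvd_add_right (dvd_refl _)
  simp only [S0, flipAt, sub_zero, this, D.S_periodic]

namespace IsShrinkingPoint

variable {D : RotData} {ξ : ℝ × ℝ}

theorem isCycle_S0 (hS : IsShrinkingPoint F ξ D.l D.m D.n) :
    IsCycle F ξ D.S0 D.n (cyclePt F ξ D.S0 D.n) :=
  isCycle_cyclePt D.n_pos D.S0_periodic hS.generic_a

theorem eq_zero_iff (hS : IsShrinkingPoint F ξ D.l D.m D.n) (i : ℤ) :
    cyclePt F ξ D.S0 D.n i 0 = 0 ↔ (D.n : ℤ) ∣ i ∨ (D.n : ℤ) ∣ i - D.e := by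
  have hn : (0 : ℤ) < D.n := by exact_mod_cast D.n_pos
  have h1 : (D.n : ℤ) ∣ i - i % D.n := by
    refine ⟨i / D.n, ?_⟩
    have := Int.emod_add_mul_ediv i D.n
    linarith
  have h2 := hS.isCycle_S0.congr_dvd h1
  have h3 := hS.zero_iff (i % D.n) (Int.emod_nonneg _ hn.ne') (Int.emod_lt_of_pos _ hn)
  rw [h2]
  refine Iff.trans h3 ?_
  rw [Int.dvd_iff_emod_eq_zero, Int.dvd_iff_emod_eq_zero (b := i - D.e),
    ← Int.emod_eq_emod_iff_emod_sub_eq_zero]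
  have h4 : ((D.e : ℕ) : ℤ) % D.n = ((D.l : ℤ) * modInv D.m D.n) % D.n := by
    have : ((D.e : ℕ) : ℤ) = ((D.l : ℤ) * modInv D.m D.n) % D.n := by
      simp only [RotData.e, RotData.d]; push_cast; rfl
    rw [this, Int.emod_emod_of_dvd _ (dvd_refl _)]
  rw [h4]

/-- The symbols at which the sequences differ belong to points on the switching manifold, where both
branches of the map agree. One cycle thus has three itineraries: `S` with index `0` flipped, `S`,
and `S^{(-d)}`. -/
theorem isCycle_S (hS : IsShrinkingPoint F ξ D.l D.m D.n) :
    IsCycle F ξ D.S D.n (cyclePt F ξ D.S0 D.n) := by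
  intro i
  refine ⟨?_, (hS.isCycle_S0 i).2⟩
  rw [(hS.isCycle_S0 i).1]
  by_cases h : (D.n : ℤ) ∣ i
  · exact F.step_eq_of_zero _ _ _ _ ((hS.eq_zero_iff i).2 (Or.inl h))
  · simp only [RotData.S0, flipAt, sub_zero, h, if_false]

theorem isCycle_shift (hS : IsShrinkingPoint F ξ D.l D.m D.n) :
    IsCycle F ξ (shift D.S (-(D.d : ℤ))) D.n (cyclePt F ξ D.S0 D.n) := by
  intro i
  refine ⟨?_, (hS.isCycle_S0 i).2⟩
  rw [(hS.isCycle_S i).1]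
  by_cases h : (D.n : ℤ) ∣ i ∨ (D.n : ℤ) ∣ i - D.e
  · exact F.step_eq_of_zero _ _ _ _ ((hS.eq_zero_iff i).2 h)
  · simp only [shift, D.S_shift, h, if_false]

/-- Re-indexing the itinerary `S^{(-d)}` by `d` yields a second `S`-cycle through the same points.
That a matrix has two different cycles with the same symbols is the source of the eigenvalue `1`. -/
theorem isCycle_S_add (hS : IsShrinkingPoint F ξ D.l D.m D.n) :
    IsCycle F ξ D.S D.n (fun i => cyclePt F ξ D.S0 D.n (D.d + i)) := by
  have := hS.isCycle_shift.shift D.d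
  rw [shift_shift, neg_add_cancel] at this
  have e : shift D.S 0 = D.S := by funext i; simp [shift]
  rwa [e] at this

theorem isCycle_shift_sub (hS : IsShrinkingPoint F ξ D.l D.m D.n) :
    IsCycle F ξ (shift D.S (-(D.d : ℤ))) D.n (fun i => cyclePt F ξ D.S0 D.n (-(D.d : ℤ) + i)) :=
  hS.isCycle_S.shift _

theorem isAdmissible_S (hS : IsShrinkingPoint F ξ D.l D.m D.n) :
    IsAdmissible D.S (cyclePt F ξ D.S0 D.n) := by
  intro i
  by_cases h : (D.n : ℤ) ∣ i
  · have := (hS.eq_zero_iff i).2 (Or.inl h)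
    exact ⟨fun _ => this.le, fun _ => this.ge⟩
  · have h2 := hS.admissible i
    have : flipAt D.n (rot D.l D.m D.n) 0 i = D.S i := by
      simp only [flipAt, sub_zero, h, if_false]; rfl
    rw [this] at h2
    exact h2

theorem pos_of_R (hS : IsShrinkingPoint F ξ D.l D.m D.n) {i : ℤ} (hi : D.S i = Side.R)
    (he : ¬ (D.n : ℤ) ∣ i - D.e) : 0 < cyclePt F ξ D.S0 D.n i 0 := by
  refine lt_of_le_of_ne ((hS.isAdmissible_S i).2 hi) (fun h => ?_)
  rcases (hS.eq_zero_iff i).1 h.symm with h | h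
  · have := D.S_congr (i := i) (j := 0) (by simpa using h)
    rw [this, D.S_zero] at hi
    cases hi
  · exact he h

theorem neg_of_L (hS : IsShrinkingPoint F ξ D.l D.m D.n) {i : ℤ} (hi : D.S i = Side.L)
    (h0 : ¬ (D.n : ℤ) ∣ i) : cyclePt F ξ D.S0 D.n i 0 < 0 := by
  refine lt_of_le_of_ne ((hS.isAdmissible_S i).1 hi) (fun h => ?_)
  rcases (hS.eq_zero_iff i).1 h with h | h
  · exact h0 h
  · obtain ⟨r, q, -, -, -, hS', -, he⟩ := D.exists_residue i
    rw [hS', he.1 h] at hi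
    simp at hi

theorem S_of_residue {i r q : ℤ} (h : i * D.m = r + D.n * q) (h0 : 0 ≤ r) (h1 : r < D.n) :
    D.S i = (if r < D.l then Side.L else Side.R) ∧ ((D.n : ℤ) ∣ i ↔ r = 0) ∧
    ((D.n : ℤ) ∣ i - D.e ↔ r = D.l) := by
  obtain ⟨r', q', h', h0', h1', h2⟩ := D.exists_residue i
  have : r' = r := by
    have h3 : (D.n : ℤ) ∣ r' - r := ⟨q - q', by linarith⟩
    have := Int.eq_zero_of_abs_lt_dvd h3 (by rw [abs_lt]; constructor <;> linarith)
    omega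
  rwa [this] at h2

theorem two_le_l (hS : IsShrinkingPoint F ξ D.l D.m D.n) : (2 : ℤ) ≤ D.l := hS.two_le

theorem l_le (hS : IsShrinkingPoint F ξ D.l D.m D.n) : (D.l : ℤ) + 2 ≤ D.n := by
  have := hS.le_sub
  have h2 := hS.two_le
  omega

/-- Multiplication by `m` sends the indices `-d`, `d`, `e - d`, `e + d` to the residues `n - 1`,
`1`, `ℓ - 1`, `ℓ + 1`. As `2 ≤ ℓ ≤ n - 2`, none of these is `0` or `ℓ`, so the four points are off
the switching manifold and their signs are given by their symbols. -/
theorem pt_neg_d (hS : IsShrinkingPoint F ξ D.l D.m D.n) :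
    0 < cyclePt F ξ D.S0 D.n (-(D.d : ℤ)) 0 := by
  obtain ⟨c, hc⟩ := D.d_mul_m
  have h1 := hS.two_le_l
  have h2 := hS.l_le
  have := S_of_residue (D := D) (i := -(D.d : ℤ)) (r := D.n - 1) (q := -c - 1) (by linarith)
    (by linarith) (by linarith)
  apply hS.pos_of_R
  · rw [this.1, if_neg (by linarith)]
  · rw [this.2.2]; intro h; linarith

theorem pt_d (hS : IsShrinkingPoint F ξ D.l D.m D.n) :
    cyclePt F ξ D.S0 D.n (D.d : ℤ) 0 < 0 := by
  obtain ⟨c, hc⟩ := D.d_mul_m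
  have h1 := hS.two_le_l
  have h2 := hS.l_le
  have := S_of_residue (D := D) (i := (D.d : ℤ)) (r := 1) (q := c) (by linarith)
    (by linarith) (by linarith)
  apply hS.neg_of_L
  · rw [this.1, if_pos (by linarith)]
  · rw [this.2.1]; intro h; linarith

theorem pt_e_sub (hS : IsShrinkingPoint F ξ D.l D.m D.n) :
    cyclePt F ξ D.S0 D.n (-(D.d : ℤ) + D.e) 0 < 0 := by
  obtain ⟨c, hc⟩ := D.d_mul_m
  obtain ⟨b, hb⟩ := D.e_mul_m
  have h1 := hS.two_le_l
  have h2 := hS.l_le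
  have := S_of_residue (D := D) (i := -(D.d : ℤ) + D.e) (r := D.l - 1) (q := b - c) (by linarith)
    (by linarith) (by linarith)
  apply hS.neg_of_L
  · rw [this.1, if_pos (by linarith)]
  · rw [this.2.1]; intro h; linarith

theorem pt_e_add (hS : IsShrinkingPoint F ξ D.l D.m D.n) :
    0 < cyclePt F ξ D.S0 D.n ((D.d : ℤ) + D.e) 0 := by
  obtain ⟨c, hc⟩ := D.d_mul_m
  obtain ⟨b, hb⟩ := D.e_mul_m
  have h1 := hS.two_le_l
  have h2 := hS.l_le
  have := S_of_residue (D := D) (i := (D.d : ℤ) + D.e) (r := D.l + 1) (q := b + c) (by linarith)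
    (by linarith) (by linarith)
  apply hS.pos_of_R
  · rw [this.1, if_neg (by linarith)]
  · rw [this.2.2]; intro h; linarith

theorem pt_zero (hS : IsShrinkingPoint F ξ D.l D.m D.n) :
    cyclePt F ξ D.S0 D.n 0 0 = 0 := (hS.eq_zero_iff 0).2 (Or.inl (dvd_zero _))

theorem pt_e (hS : IsShrinkingPoint F ξ D.l D.m D.n) :
    cyclePt F ξ D.S0 D.n D.e 0 = 0 := (hS.eq_zero_iff _).2 (Or.inr (by simp))

/-- The values of the maps of the partial words at the points of the cycle. -/
theorem fWord_X (hS : IsShrinkingPoint F ξ D.l D.m D.n) :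
    F.fWord ξ D.X (cyclePt F ξ D.S0 D.n 0) = cyclePt F ξ D.S0 D.n D.e :=
  hS.isCycle_S.fWord_zero _

theorem fWord_X_add (hS : IsShrinkingPoint F ξ D.l D.m D.n) :
    F.fWord ξ D.X (cyclePt F ξ D.S0 D.n D.d) = cyclePt F ξ D.S0 D.n (D.d + D.e) := by
  have := hS.isCycle_S_add.fWord_zero D.e
  rw [← D.X_eq] at this
  simpa using this

theorem fWord_X' (hS : IsShrinkingPoint F ξ D.l D.m D.n) :
    F.fWord ξ (flipHead D.X) (cyclePt F ξ D.S0 D.n 0) = cyclePt F ξ D.S0 D.n D.e := by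
  rw [F.fWord_flipHead _ _ _ hS.pt_zero, hS.fWord_X]

theorem fWord_X'_sub (hS : IsShrinkingPoint F ξ D.l D.m D.n) :
    F.fWord ξ (flipHead D.X) (cyclePt F ξ D.S0 D.n (-(D.d : ℤ))) =
      cyclePt F ξ D.S0 D.n (-(D.d : ℤ) + D.e) := by
  have := hS.isCycle_shift_sub.fWord_zero D.e
  rw [← D.flipHead_X_flipHead_Y.1] at this
  simpa using this

theorem e_add (D : RotData) : (D.e : ℤ) + ((D.n - D.e : ℕ) : ℤ) = D.n := by
  rw [Nat.cast_sub D.e_lt.le]; ring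

theorem fWord_Y (hS : IsShrinkingPoint F ξ D.l D.m D.n) :
    F.fWord ξ D.Y (cyclePt F ξ D.S0 D.n D.e) = cyclePt F ξ D.S0 D.n 0 := by
  have := hS.isCycle_S.fWord D.e (D.n - D.e)
  rw [e_add] at this
  rw [D.Y_eq, this]
  exact hS.isCycle_S.congr_dvd (by simp)

theorem fWord_Y_add (hS : IsShrinkingPoint F ξ D.l D.m D.n) :
    F.fWord ξ D.Y (cyclePt F ξ D.S0 D.n (D.d + D.e)) = cyclePt F ξ D.S0 D.n D.d := by
  have := hS.isCycle_S_add.fWord D.e (D.n - D.e)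
  simp only [e_add] at this
  rw [D.Y_eq, this]
  exact hS.isCycle_S.congr_dvd (by simp)

theorem fWord_Y' (hS : IsShrinkingPoint F ξ D.l D.m D.n) :
    F.fWord ξ (flipHead D.Y) (cyclePt F ξ D.S0 D.n D.e) = cyclePt F ξ D.S0 D.n 0 := by
  rw [F.fWord_flipHead _ _ _ hS.pt_e, hS.fWord_Y]

theorem fWord_Y'_sub (hS : IsShrinkingPoint F ξ D.l D.m D.n) :
    F.fWord ξ (flipHead D.Y) (cyclePt F ξ D.S0 D.n (-(D.d : ℤ) + D.e)) =
      cyclePt F ξ D.S0 D.n (-(D.d : ℤ)) := by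
  have := hS.isCycle_shift_sub.fWord D.e (D.n - D.e)
  simp only [e_add, shift_shift] at this
  rw [D.flipHead_X_flipHead_Y.2, this]
  exact hS.isCycle_S.congr_dvd (by simp)

theorem fWord_Rp (hS : IsShrinkingPoint F ξ D.l D.m D.n) :
    F.fWord ξ D.Rp (cyclePt F ξ D.S0 D.n 0) = cyclePt F ξ D.S0 D.n (-(D.d : ℤ)) := by
  rw [RotData.Rp, hS.isCycle_S.fWord_zero]
  apply hS.isCycle_S.congr_dvd
  have := D.np_add_d
  exact ⟨1, by rw [← this]; push_cast; ring⟩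

theorem fWord_Rp_add (hS : IsShrinkingPoint F ξ D.l D.m D.n) :
    F.fWord ξ D.Rp (cyclePt F ξ D.S0 D.n D.d) = cyclePt F ξ D.S0 D.n 0 := by
  have h := hS.isCycle_S_add.fWord_zero D.np
  simp only [add_zero] at h
  rw [RotData.Rp, h]
  apply hS.isCycle_S.congr_dvd
  have := D.np_add_d
  exact ⟨1, by rw [← this]; push_cast; ring⟩

/-- Together with `phi_pt_neg_d`: at the shrinking point `φ` fixes two points of the cycle, hence
the whole line through them. Near `ξ₀` this line persists as the slow invariant line. -/
theorem phi_pt_zero (hS : IsShrinkingPoint F ξ D.l D.m D.n) :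
    phi F D ξ (cyclePt F ξ D.S0 D.n 0) = cyclePt F ξ D.S0 D.n 0 := by
  rw [phi, D.Smd_eq, F.fWord_append, hS.fWord_X', hS.fWord_Y']

theorem phi_pt_neg_d (hS : IsShrinkingPoint F ξ D.l D.m D.n) :
    phi F D ξ (cyclePt F ξ D.S0 D.n (-(D.d : ℤ))) = cyclePt F ξ D.S0 D.n (-(D.d : ℤ)) := by
  rw [phi, D.Smd_eq, F.fWord_append, hS.fWord_X'_sub, hS.fWord_Y'_sub]

theorem fWord_S_pt_d (hS : IsShrinkingPoint F ξ D.l D.m D.n) :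
    F.fWord ξ (word D.S D.n) (cyclePt F ξ D.S0 D.n D.d) = cyclePt F ξ D.S0 D.n D.d := by
  rw [D.word_S, F.fWord_append, hS.fWord_X_add, hS.fWord_Y_add]

theorem fWord_S_pt_zero (hS : IsShrinkingPoint F ξ D.l D.m D.n) :
    F.fWord ξ (word D.S D.n) (cyclePt F ξ D.S0 D.n 0) = cyclePt F ξ D.S0 D.n 0 := by
  rw [D.word_S, F.fWord_append, hS.fWord_X, hS.fWord_Y]

/-- The eigenvector is the difference of the two `S`-cycles at index `0`; it is nonzero because its
first coordinate is that of the point of index `d`. -/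
theorem charpoly_isRoot_one (hS : IsShrinkingPoint F ξ D.l D.m D.n) :
    (F.MWord ξ (word D.S D.n)).charpoly.IsRoot 1 := by
  have h1 := F.fWord_sub ξ (word D.S D.n) (cyclePt F ξ D.S0 D.n D.d) (cyclePt F ξ D.S0 D.n 0)
  rw [hS.fWord_S_pt_d, hS.fWord_S_pt_zero] at h1
  set v := cyclePt F ξ D.S0 D.n D.d - cyclePt F ξ D.S0 D.n 0 with hv
  have hv0 : v ≠ 0 := by
    intro h
    have h2 : v 0 = 0 := by rw [h]; rfl
    rw [hv, Pi.sub_apply, hS.pt_zero, sub_zero] at h2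
    exact hS.pt_d.ne h2
  rw [Polynomial.IsRoot, Matrix.eval_charpoly]
  apply Matrix.exists_mulVec_eq_zero_iff.1
  refine ⟨v, hv0, ?_⟩
  rw [sub_mulVec, ← h1]
  simp

end IsShrinkingPoint

namespace RotData

/-- The rotational data of `G⁺[k,χ]`. -/
def next (D : RotData) (k l : ℕ) (hk : 0 < k) (h0 : 0 < l) (h1 : l < D.nk k) : RotData where
  l := l
  m := D.mk' k
  n := D.nk k
  -- Consecutive fractions `m_{k-1}/n_{k-1}` and `m_k/n_k` are Farey neighbours, so the preceding
  -- one is the right Farey root.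
  mp := D.mk' (k - 1)
  np := D.nk (k - 1)
  l_pos := h0
  l_lt := h1
  m_pos := by
    have := Nat.mul_pos hk D.m_pos
    simp only [mk']; omega
  m_lt := by
    have h2 := Nat.mul_lt_mul_of_pos_left D.m_lt hk
    have h3 := D.farey
    have h4 : D.mp ≤ D.np := by
      by_contra h
      have : (D.np + 1) * D.n ≤ D.mp * D.n := Nat.mul_le_mul_right _ (by omega)
      have h5 : D.m * D.np ≤ D.n * D.np := Nat.mul_le_mul_right _ D.m_lt.le
      have := D.n_pos
      have h6 := D.m_pos
      have h7 := D.m_lt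
      nlinarith
    simp only [mk', nk]; omega
  coprime := by
    have := D.mk_mul_n k
    rw [← Nat.isCoprime_iff_coprime]
    exact ⟨D.n, -D.m, by linarith⟩
  np_pos := D.nk_pos _
  np_lt := by
    have : (k - 1) * D.n < k * D.n := Nat.mul_lt_mul_of_pos_right (by omega) D.n_pos
    simp only [nk]; omega
  farey := by
    obtain ⟨k, rfl⟩ : ∃ j, k = j + 1 := ⟨k - 1, by omega⟩
    have h1 := D.farey
    simp only [nk, mk', Nat.add_sub_cancel]
    zify at h1 ⊢
    linear_combination h1

end RotData

/-- At a `G⁺[k,χ]`-shrinking point there is an admissible cycle, with a multiplier `1`. -/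
theorem IsShrinkingPoint.exists_cycle {D : RotData} {ξ : ℝ × ℝ} {k : ℕ} {χ : ℤ} (hk : 0 < k)
    (hS : IsShrinkingPoint F ξ (D.lk k + χ) (D.mk' k) (D.nk k)) :
    (∃ x, IsCycle F ξ (D.Gseq k χ) (D.nk k) x ∧ IsAdmissible (D.Gseq k χ) x) ∧
    (F.MWord ξ (D.G k χ)).charpoly.IsRoot 1 := by
  obtain ⟨l, hl⟩ := Int.eq_ofNat_of_zero_le (le_trans (by norm_num) hS.two_le)
  have h2 := hS.two_le
  have h3 := hS.le_sub
  let D' := D.next k l hk (by omega) (by omega)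
  have hG : D.Gseq k χ = D'.S := by
    simp only [RotData.Gseq, hl]; rfl
  rw [hl] at hS
  have hS' : IsShrinkingPoint F ξ D'.l D'.m D'.n := hS
  refine ⟨⟨cyclePt F ξ D'.S0 D'.n, ?_, ?_⟩, ?_⟩
  · rw [hG]; exact hS'.isCycle_S
  · rw [hG]; exact hS'.isAdmissible_S
  · rw [RotData.G, hG]; exact hS'.charpoly_isRoot_one

end PWL


namespace PWL

set_option linter.unusedSectionVars false

attribute [local instance] Matrix.linftyOpNormedAddCommGroup Matrix.linftyOpNormedSpace
  Matrix.linftyOpNormedRing Matrix.linftyOpNormedAlgebra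

/-! ### Simple eigenvalues -/

section Simple

variable {N : ℕ} [NeZero N]

/-- The bordered matrix `μ I - M + w e₁ᵀ`. -/
noncomputable def bord (M : Matrix (Fin N) (Fin N) ℝ) (w : Fin N → ℝ) (μ : ℝ) :
    Matrix (Fin N) (Fin N) ℝ := μ • 1 - M + vecMulVec w (Pi.single 0 1)

theorem bord_mulVec (M : Matrix (Fin N) (Fin N) ℝ) (w : Fin N → ℝ) (μ : ℝ) (x : Fin N → ℝ) :
    bord M w μ *ᵥ x = μ • x - M *ᵥ x + x 0 • w := by
  rw [bord, add_mulVec, sub_mulVec, smul_mulVec, one_mulVec, vecMulVec_mulVec]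
  simp

theorem vecMul_bord (M : Matrix (Fin N) (Fin N) ℝ) (w : Fin N → ℝ) (μ : ℝ) (u : Fin N → ℝ) :
    u ᵥ* bord M w μ = μ • u - u ᵥ* M + (u ⬝ᵥ w) • Pi.single 0 1 := by
  rw [bord, vecMul_add, vecMul_sub, vecMul_smul, vecMul_one, vecMul_vecMulVec]

theorem eq_zero_of_det_ne_zero {E : Matrix (Fin N) (Fin N) ℝ} (h : E.det ≠ 0) {x : Fin N → ℝ}
    (hx : E *ᵥ x = 0) : x = 0 := Matrix.eq_zero_of_mulVec_eq_zero h hx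

/-- A null vector `x` satisfies `M x - x = x₀ v`, so it lies in the generalized eigenspace of `1`,
which is the line of `v` by simplicity. Hence `M x = x`, which forces `x₀ = 0` and then `x = 0`. -/
theorem det_bord_ne_zero {M : Matrix (Fin N) (Fin N) ℝ} {v : Fin N → ℝ} (hv : M *ᵥ v = v)
    (hv0 : v 0 = 1) (hm : M.charpoly.rootMultiplicity 1 = 1) : (bord M v 1).det ≠ 0 := by
  intro h
  obtain ⟨x, hx, hx2⟩ := Matrix.exists_mulVec_eq_zero_iff.2 h
  rw [bord_mulVec, one_smul] at hx2
  set f : Module.End ℝ (Fin N → ℝ) := Matrix.toLin' M with hf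
  have hfr : Module.finrank ℝ (f.maxGenEigenspace 1) = 1 := by
    rw [LinearMap.finrank_maxGenEigenspace_eq, hf, Matrix.charpoly_toLin', hm]
  have happ : ∀ y, (f - (1 : ℝ) • (1 : Module.End ℝ (Fin N → ℝ))) y = M *ᵥ y - y := by
    intro y
    simp [hf]
  have hvm : v ∈ f.maxGenEigenspace 1 := by
    rw [Module.End.mem_maxGenEigenspace]
    exact ⟨1, by rw [pow_one, happ, hv, sub_self]⟩
  have hMx : M *ᵥ x - x = x 0 • v := by
    rw [sub_add_eq_add_sub, sub_eq_zero] at hx2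
    rw [← hx2]; abel
  have hxm : x ∈ f.maxGenEigenspace 1 := by
    rw [Module.End.mem_maxGenEigenspace]
    refine ⟨2, ?_⟩
    rw [pow_two, Module.End.mul_apply, happ, happ, hMx, mulVec_smul, hv, sub_self]
  have hv' : (⟨v, hvm⟩ : f.maxGenEigenspace 1) ≠ 0 := by
    intro h'
    have : v = 0 := congrArg Subtype.val h'
    rw [this] at hv0
    simp at hv0
  obtain ⟨c, hc⟩ := (finrank_eq_one_iff_of_nonzero' _ hv').1 hfr ⟨x, hxm⟩
  have hc' : c • v = x := congrArg Subtype.val hc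
  rw [← hc', mulVec_smul, hv, sub_self] at hMx
  simp only [Pi.smul_apply, hv0, smul_eq_mul, mul_one] at hMx
  rw [hc'] at hMx
  exact hx hMx.symm

theorem right_unique {M : Matrix (Fin N) (Fin N) ℝ} {w v v' : Fin N → ℝ} {μ : ℝ}
    (h : (bord M w μ).det ≠ 0) (hv : M *ᵥ v = μ • v) (hv' : M *ᵥ v' = μ • v') (h0 : v 0 = v' 0) :
    v = v' := by
  rw [← sub_eq_zero]
  apply eq_zero_of_det_ne_zero h
  rw [mulVec_sub, bord_mulVec, bord_mulVec, hv, hv', h0]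
  simp

/-- A left eigenvector orthogonal to the border `w` is annihilated by the bordered matrix, so it
vanishes; the left eigenspace is therefore one-dimensional. -/
theorem left_unique {M : Matrix (Fin N) (Fin N) ℝ} {w v u z : Fin N → ℝ} {μ : ℝ}
    (h : (bord M w μ).det ≠ 0) (hu : u ᵥ* M = μ • u) (huv : u ⬝ᵥ v = 1) (hz : z ᵥ* M = μ • z) :
    z = (z ⬝ᵥ v) • u := by
  have key : ∀ y : Fin N → ℝ, y ᵥ* M = μ • y → y ⬝ᵥ w = 0 → y = 0 := by
    intro y hy hyw
    apply Matrix.eq_zero_of_vecMul_eq_zero h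
    rw [vecMul_bord, hy, hyw]
    simp
  have hw : u ⬝ᵥ w ≠ 0 := by
    intro h'
    rw [key u hu h'] at huv
    simp at huv
  have h1 := key (z - ((z ⬝ᵥ w) / (u ⬝ᵥ w)) • u) (by
    rw [sub_vecMul, smul_vecMul, hz, hu, smul_sub, smul_comm]) (by
    rw [sub_dotProduct, smul_dotProduct, smul_eq_mul, div_mul_cancel₀ _ hw, sub_self])
  rw [sub_eq_zero] at h1
  have h2 : z ⬝ᵥ v = (z ⬝ᵥ w) / (u ⬝ᵥ w) := by
    rw [h1, smul_dotProduct, huv, smul_eq_mul, mul_one, ← h1]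
  rw [h2, ← h1]

/-- The eigenvectors of the setting are arbitrary choices among the normalised ones; invertibility
of some bordered matrix makes the choice unique. The same holds for `leftVec_eq`. -/
theorem rightVec_eq {M : Matrix (Fin N) (Fin N) ℝ} {w v : Fin N → ℝ} {μ : ℝ}
    (h : (bord M w μ).det ≠ 0) (hv : M *ᵥ v = μ • v) (hv0 : v 0 = 1) : rightVec M μ = v := by
  have := Classical.epsilon_spec (p := fun v => M *ᵥ v = μ • v ∧ v 0 = 1) ⟨v, hv, hv0⟩
  exact right_unique h this.1 hv (by rw [hv0]; exact this.2)

theorem leftVec_eq {M : Matrix (Fin N) (Fin N) ℝ} {w v u : Fin N → ℝ} {μ : ℝ}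
    (h : (bord M w μ).det ≠ 0) (hv : M *ᵥ v = μ • v) (hv0 : v 0 = 1)
    (hu : u ᵥ* M = μ • u) (huv : u ⬝ᵥ v = 1) : leftVec M μ = u := by
  have hr := rightVec_eq h hv hv0
  have := Classical.epsilon_spec (p := fun u => u ᵥ* M = μ • u ∧ u ⬝ᵥ rightVec M μ = 1)
    ⟨u, hu, by rw [hr, huv]⟩
  have h2 := left_unique h hu huv this.1
  have h3 : leftVec M μ ⬝ᵥ v = 1 := by rw [← hr]; exact this.2
  change leftVec M μ = _ at h2
  rw [h2]
  change (leftVec M μ ⬝ᵥ v) • u = u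
  rw [h3, one_smul]

/-- The left vector `e₁ᵀ E⁻¹` of a bordered matrix `E`. -/
theorem left_of_bord {M : Matrix (Fin N) (Fin N) ℝ} {w : Fin N → ℝ} {μ : ℝ}
    (h : (bord M w μ).det ≠ 0) (hw : ((bord M w μ)⁻¹ *ᵥ w) 0 = 1) :
    (Pi.single 0 1 ᵥ* (bord M w μ)⁻¹) ᵥ* M = μ • (Pi.single 0 1 ᵥ* (bord M w μ)⁻¹) := by
  have hu : IsUnit (bord M w μ).det := isUnit_iff_ne_zero.2 h
  have h1 := vecMul_bord M w μ (Pi.single 0 1 ᵥ* (bord M w μ)⁻¹)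
  have h2 : (Pi.single 0 1 ᵥ* (bord M w μ)⁻¹) ⬝ᵥ w = 1 := by
    rw [← dotProduct_mulVec, single_one_dotProduct, hw]
  rw [vecMul_vecMul, Matrix.nonsing_inv_mul _ hu, vecMul_one, h2, one_smul] at h1
  have h3 := right_eq_add.1 h1
  rw [sub_eq_zero] at h3
  exact h3.symm

/-- If `y = E⁻¹ w` has first coordinate `1`, the border term in `E y = w` cancels the right-hand
side and leaves `μ y = M y`. So `(E⁻¹ w)₀ = 1` is a smooth scalar equation for the eigenvalue `μ`.
-/
theorem right_of_bord {M : Matrix (Fin N) (Fin N) ℝ} {w : Fin N → ℝ} {μ : ℝ}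
    (h : (bord M w μ).det ≠ 0) (hw : ((bord M w μ)⁻¹ *ᵥ w) 0 = 1) :
    M *ᵥ ((bord M w μ)⁻¹ *ᵥ w) = μ • ((bord M w μ)⁻¹ *ᵥ w) := by
  have hu : IsUnit (bord M w μ).det := isUnit_iff_ne_zero.2 h
  have h1 := bord_mulVec M w μ ((bord M w μ)⁻¹ *ᵥ w)
  rw [mulVec_mulVec, Matrix.mul_nonsing_inv _ hu, one_mulVec, hw, one_smul] at h1
  have h3 := right_eq_add.1 h1
  rw [sub_eq_zero] at h3
  exact h3.symm

theorem bord_inv_mulVec {M : Matrix (Fin N) (Fin N) ℝ} {v : Fin N → ℝ} {μ : ℝ}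
    (h : (bord M v μ).det ≠ 0) (hv : M *ᵥ v = μ • v) (hv0 : v 0 = 1) :
    (bord M v μ)⁻¹ *ᵥ v = v := by
  have hu : IsUnit (bord M v μ).det := isUnit_iff_ne_zero.2 h
  have h1 : bord M v μ *ᵥ v = v := by rw [bord_mulVec, hv, hv0]; simp
  nth_rw 2 [← h1]
  rw [mulVec_mulVec, Matrix.nonsing_inv_mul _ hu, one_mulVec]

/-- A simple eigenvalue `1` with eigenvector `v` has a left eigenvector `u` with `u v = 1`. -/
theorem simple_spec {M : Matrix (Fin N) (Fin N) ℝ} {v : Fin N → ℝ} (hv : M *ᵥ v = v)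
    (hv0 : v 0 = 1) (hm : M.charpoly.rootMultiplicity 1 = 1) :
    rightVec M 1 = v ∧ leftVec M 1 ᵥ* M = leftVec M 1 ∧ leftVec M 1 ⬝ᵥ v = 1 ∧
    ∀ z : Fin N → ℝ, z ᵥ* M = z → z = (z ⬝ᵥ v) • leftVec M 1 := by
  have hd := det_bord_ne_zero hv hv0 hm
  have hv' : M *ᵥ v = (1 : ℝ) • v := by rw [one_smul, hv]
  have h1 := bord_inv_mulVec hd hv' hv0
  have hu := left_of_bord hd (by rw [h1, hv0])
  have huv : (Pi.single 0 1 ᵥ* (bord M v 1)⁻¹) ⬝ᵥ v = 1 := by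
    rw [← dotProduct_mulVec, single_one_dotProduct, h1, hv0]
  have h2 := leftVec_eq hd hv' hv0 hu huv
  rw [h2]
  refine ⟨rightVec_eq hd hv' hv0, by rw [hu, one_smul], huv, fun z hz => ?_⟩
  exact left_unique hd hu huv (by rw [hz, one_smul])

end Simple

/-! ### Bounds for powers -/

section Powers

variable {N : ℕ} [NeZero N]

theorem norm_le_sum_col (A : Matrix (Fin N) (Fin N) ℂ) :
    ‖A‖ ≤ ∑ j, ‖A *ᵥ Pi.single j 1‖ := by
  have h : ‖A‖₊ ≤ ∑ j, ‖A *ᵥ Pi.single j 1‖₊ := by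
    rw [Matrix.linfty_opNNNorm_def]
    apply Finset.sup_le
    intro i _
    apply Finset.sum_le_sum
    intro j _
    have := nnnorm_le_pi_nnnorm (A *ᵥ Pi.single j 1) i
    simpa using this
  have h2 := NNReal.coe_le_coe.2 h
  rw [NNReal.coe_sum] at h2
  exact h2

/-- Induction on the order of the generalized eigenvector: `A^{j+1} x` is `μ A^j x` plus `A^j`
applied to a generalized eigenvector of lower order, and the gap `ρ - |μ|` absorbs the latter. -/
theorem pow_mulVec_bound {A : Matrix (Fin N) (Fin N) ℂ} {ρ : ℝ} {μ : ℂ} (hμ : ‖μ‖ < ρ) (k : ℕ) :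
    ∀ x : Fin N → ℂ, ((Matrix.toLin' A - μ • (1 : Module.End ℂ (Fin N → ℂ))) ^ k) x = 0 →
      ∃ C, ∀ j : ℕ, ‖A ^ j *ᵥ x‖ ≤ C * ρ ^ j := by
  have hρ : 0 < ρ := lt_of_le_of_lt (norm_nonneg _) hμ
  induction k with
  | zero =>
    intro x hx
    have : x = 0 := by simpa using hx
    exact ⟨0, fun j => by simp [this]⟩
  | succ k ih =>
    intro x hx
    have hx' : ((Matrix.toLin' A - μ • (1 : Module.End ℂ (Fin N → ℂ))) ^ k) (A *ᵥ x - μ • x) = 0 := by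
      rw [pow_succ, Module.End.mul_apply] at hx
      simpa using hx
    obtain ⟨C, hC⟩ := ih _ hx'
    have hd : 0 < ρ - ‖μ‖ := by linarith
    -- The constant `C'` must exceed `‖x‖` for `j = 0` and satisfy `|μ| C' + C ≤ ρ C'` for the
    -- inductive step.
    refine ⟨max ‖x‖ (C / (ρ - ‖μ‖)), fun j => ?_⟩
    induction j with
    | zero => simp
    | succ j ihj =>
      have e1 : A ^ (j + 1) *ᵥ x = μ • (A ^ j *ᵥ x) + A ^ j *ᵥ (A *ᵥ x - μ • x) := by
        rw [mulVec_sub, mulVec_mulVec, mulVec_smul, pow_succ]; abel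
      rw [e1]
      have h2 := norm_add_le (μ • (A ^ j *ᵥ x)) (A ^ j *ᵥ (A *ᵥ x - μ • x))
      rw [norm_smul] at h2
      have h3 : C ≤ max ‖x‖ (C / (ρ - ‖μ‖)) * (ρ - ‖μ‖) := by
        rw [← div_le_iff₀ hd]; exact le_max_right _ _
      have h4 := hC j
      have h5 : 0 < ρ ^ j := by positivity
      have h6 := mul_le_mul_of_nonneg_left ihj (norm_nonneg μ)
      have h7 := mul_le_mul_of_nonneg_right h3 h5.le
      rw [pow_succ]
      nlinarith

/-- Power bounds for a matrix whose eigenvalues have modulus at most `ρ`, those of modulus `ρ`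
being semisimple. -/
theorem pow_bound {A : Matrix (Fin N) (Fin N) ℂ} {ρ : ℝ}
    (h : ∀ (μ : ℂ) (x : Fin N → ℂ), x ≠ 0 → A *ᵥ x = μ • x → ‖μ‖ < ρ ∨ (‖μ‖ = ρ ∧
      ∀ y : Fin N → ℂ, (A - μ • 1) *ᵥ ((A - μ • 1) *ᵥ y) = 0 → (A - μ • 1) *ᵥ y = 0)) :
    ∃ C, ∀ j : ℕ, ‖A ^ j‖ ≤ C * ρ ^ j := by
  -- The vectors with the required decay form a subspace; it contains every generalized eigenspace,
  -- hence everything.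
  let W : Submodule ℂ (Fin N → ℂ) :=
    { carrier := {x | ∃ C, ∀ j : ℕ, ‖A ^ j *ᵥ x‖ ≤ C * ρ ^ j}
      add_mem' := by
        rintro x y ⟨C, hC⟩ ⟨C', hC'⟩
        refine ⟨C + C', fun j => ?_⟩
        rw [mulVec_add, add_mul]
        exact (norm_add_le _ _).trans (add_le_add (hC j) (hC' j))
      zero_mem' := ⟨0, fun j => by simp⟩
      smul_mem' := by
        rintro c x ⟨C, hC⟩
        refine ⟨‖c‖ * C, fun j => ?_⟩
        rw [mulVec_smul, norm_smul, mul_assoc]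
        exact mul_le_mul_of_nonneg_left (hC j) (norm_nonneg _) }
  have hW : W = ⊤ := by
    rw [eq_top_iff, ← Module.End.iSup_maxGenEigenspace_eq_top (Matrix.toLin' A)]
    apply iSup_le
    intro μ x hx
    rw [Module.End.mem_maxGenEigenspace] at hx
    obtain ⟨k, hk⟩ := hx
    have happ : ∀ y, (Matrix.toLin' A - μ • (1 : Module.End ℂ (Fin N → ℂ))) y =
        (A - μ • 1) *ᵥ y := by
      intro y
      simp [sub_mulVec, smul_mulVec]
    by_cases hex : ∃ y : Fin N → ℂ, y ≠ 0 ∧ A *ᵥ y = μ • y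
    · obtain ⟨y, hy, hAy⟩ := hex
      rcases h μ y hy hAy with h1 | ⟨h1, h2⟩
      · exact pow_mulVec_bound h1 k x hk
      · have h3 : ∀ (k : ℕ) (x : Fin N → ℂ),
            ((Matrix.toLin' A - μ • (1 : Module.End ℂ (Fin N → ℂ))) ^ k) x = 0 →
            (A - μ • 1) *ᵥ x = 0 := by
          intro k
          induction k with
          | zero =>
            intro x hx
            have : x = 0 := by simpa using hx
            simp [this]
          | succ k ih =>
            intro x hx
            rw [pow_succ, Module.End.mul_apply, happ] at hx
            exact h2 x (ih _ hx)
        have h4 := h3 k x hk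
        rw [sub_mulVec, smul_mulVec, one_mulVec, sub_eq_zero] at h4
        have h5 : ∀ j : ℕ, A ^ j *ᵥ x = μ ^ j • x := by
          intro j
          induction j with
          | zero => simp
          | succ j ih => rw [pow_succ, ← mulVec_mulVec, h4, mulVec_smul, ih, smul_smul, pow_succ,
              mul_comm]
        refine ⟨‖x‖, fun j => ?_⟩
        rw [h5, norm_smul, norm_pow, h1, mul_comm]
    · have h3 : ∀ (k : ℕ) (x : Fin N → ℂ),
          ((Matrix.toLin' A - μ • (1 : Module.End ℂ (Fin N → ℂ))) ^ k) x = 0 → x = 0 := by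
        intro k
        induction k with
        | zero => intro x hx; simpa using hx
        | succ k ih =>
          intro x hx
          rw [pow_succ, Module.End.mul_apply, happ] at hx
          have := ih _ hx
          rw [sub_mulVec, smul_mulVec, one_mulVec, sub_eq_zero] at this
          by_contra h0
          exact hex ⟨x, h0, this⟩
      rw [h3 k x hk]
      exact W.zero_mem
  have hmem : ∀ i, ∃ C, ∀ j : ℕ, ‖A ^ j *ᵥ Pi.single i 1‖ ≤ C * ρ ^ j := by
    intro i
    have : (Pi.single i 1 : Fin N → ℂ) ∈ W := by rw [hW]; trivial
    exact this
  choose C hC using hmem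
  refine ⟨∑ i, C i, fun j => (norm_le_sum_col _).trans ?_⟩
  rw [Finset.sum_mul]
  exact Finset.sum_le_sum fun i _ => hC i j

theorem norm_toC (A : Matrix (Fin N) (Fin N) ℝ) : ‖toC A‖ = ‖A‖ := by
  have : ‖toC A‖₊ = ‖A‖₊ := by
    rw [Matrix.linfty_opNNNorm_def, Matrix.linfty_opNNNorm_def]
    simp [toC]
  exact congrArg NNReal.toReal this

theorem toC_eq (A : Matrix (Fin N) (Fin N) ℝ) : toC A = Complex.ofRealHom.mapMatrix A := rfl

theorem toC_pow (A : Matrix (Fin N) (Fin N) ℝ) (j : ℕ) : toC (A ^ j) = toC A ^ j := by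
  simp only [toC_eq, map_pow]

theorem toC_mulVec (A : Matrix (Fin N) (Fin N) ℝ) (x : Fin N → ℝ) :
    toC A *ᵥ (fun i => (x i : ℂ)) = fun i => ((A *ᵥ x) i : ℂ) := by
  ext i
  simp [toC, mulVec, dotProduct]

theorem toC_vecMul (A : Matrix (Fin N) (Fin N) ℝ) (x : Fin N → ℝ) :
    (fun i => (x i : ℂ)) ᵥ* toC A = fun i => ((x ᵥ* A) i : ℂ) := by
  ext i
  simp [toC, vecMul, dotProduct]

theorem charpoly_toC (A : Matrix (Fin N) (Fin N) ℝ) :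
    (toC A).charpoly = A.charpoly.map Complex.ofRealHom := by
  rw [← Matrix.charpoly_map]; rfl

/-- Multiplicity of a real root of the complexified characteristic polynomial. -/
theorem isRoot_toC {A : Matrix (Fin N) (Fin N) ℝ} {μ : ℝ} :
    (toC A).charpoly.IsRoot (μ : ℂ) ↔ A.charpoly.IsRoot μ := by
  rw [charpoly_toC]
  exact Polynomial.isRoot_map_iff (f := Complex.ofRealHom) (x := μ) Complex.ofReal_injective

theorem isRoot_iff_exists {A : Matrix (Fin N) (Fin N) ℂ} {μ : ℂ} :
    A.charpoly.IsRoot μ ↔ ∃ x : Fin N → ℂ, x ≠ 0 ∧ A *ᵥ x = μ • x := by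
  rw [Polynomial.IsRoot, Matrix.eval_charpoly, ← Matrix.exists_mulVec_eq_zero_iff]
  constructor
  · rintro ⟨x, hx, h⟩
    refine ⟨x, hx, ?_⟩
    rw [sub_mulVec, sub_eq_zero] at h
    rw [← h]; ext i; simp [Matrix.scalar_apply, Matrix.mulVec_diagonal]
  · rintro ⟨x, hx, h⟩
    refine ⟨x, hx, ?_⟩
    rw [sub_mulVec, sub_eq_zero, h]; ext i; simp [Matrix.scalar_apply, Matrix.mulVec_diagonal]

theorem isRoot_iff_exists_real {A : Matrix (Fin N) (Fin N) ℝ} {μ : ℝ} :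
    A.charpoly.IsRoot μ ↔ ∃ x : Fin N → ℝ, x ≠ 0 ∧ A *ᵥ x = μ • x := by
  rw [Polynomial.IsRoot, Matrix.eval_charpoly, ← Matrix.exists_mulVec_eq_zero_iff]
  constructor
  · rintro ⟨x, hx, h⟩
    refine ⟨x, hx, ?_⟩
    rw [sub_mulVec, sub_eq_zero] at h
    rw [← h]; ext i; simp [Matrix.scalar_apply, Matrix.mulVec_diagonal]
  · rintro ⟨x, hx, h⟩
    refine ⟨x, hx, ?_⟩
    rw [sub_mulVec, sub_eq_zero, h]; ext i; simp [Matrix.scalar_apply, Matrix.mulVec_diagonal]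

/-- Power bounds for the part of `M` complementary to a simple eigenvalue `1`. -/
theorem pow_bound_compl {M : Matrix (Fin N) (Fin N) ℝ} {v u : Fin N → ℝ} {ρ r : ℝ}
    (hv : M *ᵥ v = v) (hv0 : v 0 = 1) (hu : u ᵥ* M = u) (huv : u ⬝ᵥ v = 1)
    (hd : (bord M v 1).det ≠ 0) (hr0 : 0 ≤ r)
    (hr : ∀ z : ℂ, z ≠ 1 → (toC M).charpoly.IsRoot z → ‖z‖ ≤ r)
    (hρ : r < ρ ∨ (ρ = r ∧ SemisimpleOnCircle M ρ)) :
    ∃ C, ∀ j : ℕ, ‖(M - vecMulVec v u) ^ j‖ ≤ C * ρ ^ j := by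
  set A : Matrix (Fin N) (Fin N) ℂ := toC (M - vecMulVec v u) with hA
  set vc : Fin N → ℂ := fun i => (v i : ℂ) with hvc
  set uc : Fin N → ℂ := fun i => (u i : ℂ) with huc
  have hAM : A = toC M - vecMulVec vc uc := by
    ext i j; simp [hA, toC, hvc, huc, vecMulVec_apply]
  have hucv : uc ⬝ᵥ vc = 1 := by
    have : ((u ⬝ᵥ v : ℝ) : ℂ) = 1 := by rw [huv]; simp
    rw [← this]; simp [dotProduct, huc, hvc]
  have hucM : uc ᵥ* toC M = uc := by
    rw [huc, toC_vecMul, hu]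
  have hvcM : toC M *ᵥ vc = vc := by
    rw [hvc, toC_mulVec, hv]
  have huA : uc ᵥ* A = 0 := by
    rw [hAM, vecMul_sub, hucM, vecMul_vecMulVec, hucv, one_smul, sub_self]
  have hvA : A *ᵥ vc = 0 := by
    rw [hAM, sub_mulVec, hvcM, vecMulVec_mulVec, hucv]; simp
  have hAx : ∀ x, A *ᵥ x = toC M *ᵥ x - (uc ⬝ᵥ x) • vc := by
    intro x; rw [hAM, sub_mulVec, vecMulVec_mulVec]; simp
  -- the eigenvalue `1` of the complexification is simple
  have hone : ∀ x : Fin N → ℂ, toC M *ᵥ x = x → uc ⬝ᵥ x = 0 → x = 0 := by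
    intro x hx hux
    have hdc : (toC (bord M v 1)).det ≠ 0 := by
      rw [toC_eq, ← RingHom.map_det]
      simpa using hd
    have hb : toC (bord M v 1) = 1 - toC M + vecMulVec vc (Pi.single 0 1) := by
      ext i j
      simp [toC, bord, vecMulVec_apply, hvc, Matrix.one_apply, Pi.single_apply]
      split_ifs <;> simp
    have h1 : toC (bord M v 1) *ᵥ (x - x 0 • vc) = 0 := by
      rw [hb, add_mulVec, sub_mulVec, one_mulVec, mulVec_sub, mulVec_smul, hx, hvcM,
        vecMulVec_mulVec]
      simp [hvc, hv0]
    have h2 := Matrix.eq_zero_of_mulVec_eq_zero hdc h1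
    rw [sub_eq_zero] at h2
    rw [h2, dotProduct_smul, hucv, smul_eq_mul, mul_one] at hux
    rw [h2, hux, zero_smul]
  have hcore : ∃ C, ∀ j : ℕ, ‖A ^ j‖ ≤ C * ρ ^ j := by
    apply pow_bound
    intro μ x hx hAμ
    have hμr : ‖μ‖ ≤ r := by
      by_cases hμ : μ = 0
      · rw [hμ, norm_zero]; exact hr0
      · have hux : uc ⬝ᵥ x = 0 := by
          have h1 : uc ⬝ᵥ (A *ᵥ x) = 0 := by rw [dotProduct_mulVec, huA, zero_dotProduct]
          rw [hAμ, dotProduct_smul, smul_eq_mul] at h1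
          exact (mul_eq_zero.1 h1).resolve_left hμ
        have hMx : toC M *ᵥ x = μ • x := by
          have := hAx x
          rw [hux, zero_smul, sub_zero] at this
          rw [← this, hAμ]
        apply hr μ
        · rintro rfl
          rw [one_smul] at hMx
          exact hx (hone x hMx hux)
        · exact isRoot_iff_exists.2 ⟨x, hx, hMx⟩
    rcases hρ with h | ⟨h, hss⟩
    · exact Or.inl (lt_of_le_of_lt hμr h)
    · rcases hμr.lt_or_eq with h' | h'
      · left; rw [h]; exact h'
      · right
        refine ⟨h'.trans h.symm, fun y hy => ?_⟩
        have hss' := hss μ (h'.trans h.symm)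
        have e1 : ∀ y, (A - μ • 1) *ᵥ y = A *ᵥ y - μ • y := by
          intro y; rw [sub_mulVec, smul_mulVec, one_mulVec]
        have e2 : ∀ y, (toC M - μ • (1 : Matrix (Fin N) (Fin N) ℂ)) *ᵥ y = toC M *ᵥ y - μ • y := by
          intro y; rw [sub_mulVec, smul_mulVec, one_mulVec]
        set y' := y - (uc ⬝ᵥ y) • vc with hy'
        have huy' : uc ⬝ᵥ y' = 0 := by
          rw [hy', dotProduct_sub, dotProduct_smul, hucv, smul_eq_mul, mul_one, sub_self]
        have hAy' : A *ᵥ y' = A *ᵥ y := by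
          rw [hy', mulVec_sub, mulVec_smul, hvA, smul_zero, sub_zero]
        have hMy' : toC M *ᵥ y' = A *ᵥ y' := by
          rw [hAx, huy', zero_smul, sub_zero]
        -- `A` annihilates `v`, so `0` is an eigenvalue of `A` irrespective of `M`, and the
        -- component along `v` has to be removed by hand. For `μ ≠ 0` the condition `(A - μ)² y = 0`
        -- itself gives `u y = 0`.
        by_cases hμ : μ = 0
        · subst hμ
          simp only [zero_smul, sub_zero] at hy hss' ⊢
          have := hss' y' (by
            rw [hMy', hAy']
            have h3 := hAx (A *ᵥ y)
            rw [hy] at h3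
            have h4 : uc ⬝ᵥ (A *ᵥ y) = 0 := by rw [dotProduct_mulVec, huA, zero_dotProduct]
            rw [h4, zero_smul, sub_zero] at h3
            exact h3.symm)
          rw [← hAy', ← hMy', this]
        · have huz : ∀ z, uc ⬝ᵥ ((A - μ • 1) *ᵥ z) = -μ * (uc ⬝ᵥ z) := by
            intro z
            rw [e1, dotProduct_sub, dotProduct_mulVec, huA, zero_dotProduct, dotProduct_smul,
              smul_eq_mul]; ring
          have h5 : uc ⬝ᵥ y = 0 := by
            have h6 := huz ((A - μ • 1) *ᵥ y)
            rw [hy, huz, dotProduct_zero] at h6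
            have h7 : μ * μ * (uc ⬝ᵥ y) = 0 := by linear_combination -h6
            exact (mul_eq_zero.1 h7).resolve_left (mul_ne_zero hμ hμ)
          have h8 : (A - μ • 1) *ᵥ y = (toC M - μ • (1 : Matrix (Fin N) (Fin N) ℂ)) *ᵥ y := by
            rw [e1, e2, hAx, h5, zero_smul, sub_zero]
          have h9 : uc ⬝ᵥ ((A - μ • 1) *ᵥ y) = 0 := by rw [huz, h5, mul_zero]
          rw [h8]
          apply hss'
          rw [← h8, e2, ← hy, e1 ((A - μ • 1) *ᵥ y), hAx ((A - μ • 1) *ᵥ y), h9, zero_smul, sub_zero]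
  obtain ⟨C, hC⟩ := hcore
  refine ⟨C, fun j => ?_⟩
  rw [← norm_toC, toC_pow]
  exact hC j

/-- Power bounds are stable under perturbations. -/
theorem pow_bound_perturb {A B : Matrix (Fin N) (Fin N) ℝ} {C ρ ε : ℝ} (hC : 1 ≤ C) (hρ : 0 ≤ ρ)
    (hA : ∀ j : ℕ, ‖A ^ j‖ ≤ C * ρ ^ j) (hB : ‖B - A‖ ≤ ε) (j : ℕ) :
    ‖B ^ j‖ ≤ C * (ρ + C * ε) ^ j := by
  have hε : 0 ≤ ε := (norm_nonneg _).trans hB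
  -- `‖A^i B^j‖ ≤ C ρ^i (ρ + Cε)^j`
  have key : ∀ j i : ℕ, ‖A ^ i * B ^ j‖ ≤ C * ρ ^ i * (ρ + C * ε) ^ j := by
    intro j
    induction j with
    | zero => intro i; simpa using hA i
    | succ j ih =>
      intro i
      have e1 : A ^ i * B ^ (j + 1) = A ^ (i + 1) * B ^ j + A ^ i * ((B - A) * B ^ j) := by
        rw [pow_succ' B, pow_succ A]; noncomm_ring
      have h1 := ih (i + 1)
      have h2 := ih 0
      rw [pow_zero, one_mul, pow_zero, mul_one] at h2
      have h3 : ‖A ^ i * ((B - A) * B ^ j)‖ ≤ (C * ρ ^ i) * (ε * (C * (ρ + C * ε) ^ j)) := by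
        refine (norm_mul_le _ _).trans ?_
        refine mul_le_mul (hA i) ((norm_mul_le _ _).trans ?_) (norm_nonneg _) (by positivity)
        exact mul_le_mul hB h2 (norm_nonneg _) hε
      rw [e1]
      refine (norm_add_le _ _).trans ((add_le_add h1 h3).trans (le_of_eq ?_))
      rw [pow_succ, pow_succ]; ring
  have := key j 0
  simpa using this

end Powers

end PWL


namespace PWL

set_option linter.unusedSectionVars false

attribute [local instance] Matrix.linftyOpNormedAddCommGroup Matrix.linftyOpNormedSpace
  Matrix.linftyOpNormedRing Matrix.linftyOpNormedAlgebra

variable {N : ℕ} [NeZero N]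

/-! ### Differentiability of matrix operations -/

section Smooth

variable {E : Type*} [NormedAddCommGroup E] [NormedSpace ℝ E] {n : WithTop ℕ∞} {x : E}

theorem contDiffAt_matrix {A : E → Matrix (Fin N) (Fin N) ℝ} :
    ContDiffAt ℝ n A x ↔ ∀ i j, ContDiffAt ℝ n (fun y => A y i j) x := by
  constructor
  · intro h i j
    let f : Matrix (Fin N) (Fin N) ℝ →ₗ[ℝ] ℝ := Matrix.entryLinearMap ℝ ℝ i j
    exact f.toContinuousLinearMap.contDiff.contDiffAt.comp x h
  · intro h
    have : A = fun y => ∑ i, ∑ j, A y i j • Matrix.single i j (1 : ℝ) := by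
      funext y
      conv_lhs => rw [Matrix.matrix_eq_sum_single (A y)]
      simp [Matrix.smul_single]
    rw [this]
    exact ContDiffAt.sum fun i _ => ContDiffAt.sum fun j _ => (h i j).smul contDiffAt_const

theorem contDiffAt_mulVec {A : E → Matrix (Fin N) (Fin N) ℝ} {v : E → Fin N → ℝ}
    (hA : ContDiffAt ℝ n A x) (hv : ContDiffAt ℝ n v x) :
    ContDiffAt ℝ n (fun y => A y *ᵥ v y) x := by
  rw [contDiffAt_pi]
  intro i
  simp only [mulVec, dotProduct]
  exact ContDiffAt.sum fun j _ => (contDiffAt_matrix.1 hA i j).mul (contDiffAt_pi.1 hv j)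

theorem contDiffAt_vecMul {A : E → Matrix (Fin N) (Fin N) ℝ} {v : E → Fin N → ℝ}
    (hv : ContDiffAt ℝ n v x) (hA : ContDiffAt ℝ n A x) :
    ContDiffAt ℝ n (fun y => v y ᵥ* A y) x := by
  rw [contDiffAt_pi]
  intro i
  simp only [vecMul, dotProduct]
  exact ContDiffAt.sum fun j _ => (contDiffAt_pi.1 hv j).mul (contDiffAt_matrix.1 hA j i)

theorem contDiffAt_dotProduct {u v : E → Fin N → ℝ}
    (hu : ContDiffAt ℝ n u x) (hv : ContDiffAt ℝ n v x) :
    ContDiffAt ℝ n (fun y => u y ⬝ᵥ v y) x := by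
  simp only [dotProduct]
  exact ContDiffAt.sum fun j _ => (contDiffAt_pi.1 hu j).mul (contDiffAt_pi.1 hv j)

theorem contDiffAt_vecMulVec {u v : E → Fin N → ℝ}
    (hu : ContDiffAt ℝ n u x) (hv : ContDiffAt ℝ n v x) :
    ContDiffAt ℝ n (fun y => vecMulVec (u y) (v y)) x := by
  rw [contDiffAt_matrix]
  intro i j
  simp only [vecMulVec_apply]
  exact (contDiffAt_pi.1 hu i).mul (contDiffAt_pi.1 hv j)

theorem contDiffAt_matInv {A : E → Matrix (Fin N) (Fin N) ℝ}
    (hA : ContDiffAt ℝ n A x) (h : (A x).det ≠ 0) :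
    ContDiffAt ℝ n (fun y => (A y)⁻¹) x := by
  have : CompleteSpace (Matrix (Fin N) (Fin N) ℝ) := FiniteDimensional.complete ℝ _
  obtain ⟨U, hU⟩ := (Matrix.isUnit_iff_isUnit_det _).2 (isUnit_iff_ne_zero.2 h)
  have h1 := contDiffAt_ringInverse ℝ (n := n) U
  rw [hU] at h1
  have h2 := h1.comp x hA
  have h3 : (fun y => (A y)⁻¹) = Ring.inverse ∘ A := by
    funext y; exact Matrix.nonsing_inv_eq_ringInverse _
  rw [h3]; exact h2

theorem contDiffAt_matDet {A : E → Matrix (Fin N) (Fin N) ℝ}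
    (hA : ContDiffAt ℝ n A x) : ContDiffAt ℝ n (fun y => (A y).det) x := by
  simp only [Matrix.det_apply]
  refine ContDiffAt.sum fun σ _ => ?_
  exact (contDiffAt_prod fun i _ => contDiffAt_matrix.1 hA _ _).const_smul _

end Smooth

variable (F : Family N) (D : RotData)

theorem Family.contDiff_A (σ : Side) (ξ : ℝ × ℝ) : ContDiffAt ℝ 2 (fun ξ => F.A ξ σ) ξ := by
  have hK : (2 : WithTop ℕ∞) ≤ (F.K : WithTop ℕ∞) := by exact_mod_cast F.two_le_K
  rw [contDiffAt_matrix]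
  intro i j
  cases σ
  · exact ((F.smooth_AL i j).of_le hK).contDiffAt
  · exact ((F.smooth_AR i j).of_le hK).contDiffAt

theorem Family.contDiff_B (ξ : ℝ × ℝ) : ContDiffAt ℝ 2 F.B ξ := by
  have hK : (2 : WithTop ℕ∞) ≤ (F.K : WithTop ℕ∞) := by exact_mod_cast F.two_le_K
  rw [contDiffAt_pi]
  intro i
  exact ((F.smooth_B i).of_le hK).contDiffAt

theorem Family.contDiff_MWord (W : List Side) (ξ : ℝ × ℝ) :
    ContDiffAt ℝ 2 (fun ξ => F.MWord ξ W) ξ := by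
  induction W using List.reverseRecOn with
  | nil => exact contDiffAt_const
  | append_singleton W σ ih =>
    simp only [F.MWord_append]
    have : (fun ξ => F.MWord ξ [σ]) = fun ξ => F.A ξ σ := by
      funext ξ; simp [Family.MWord]
    refine ContDiffAt.mul ?_ ih
    rw [this]
    exact F.contDiff_A σ ξ

theorem Family.contDiff_fWord (W : List Side) {x : ℝ × ℝ → Fin N → ℝ} {ξ : ℝ × ℝ}
    (hx : ContDiffAt ℝ 2 x ξ) : ContDiffAt ℝ 2 (fun ξ => F.fWord ξ W (x ξ)) ξ := by
  induction W using List.reverseRecOn with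
  | nil => exact hx
  | append_singleton W σ ih =>
    simp only [F.fWord_append]
    exact (contDiffAt_mulVec (F.contDiff_A σ ξ) ih).add (F.contDiff_B ξ)

theorem Family.contDiff_flipVec (W : List Side) (ξ : ℝ × ℝ) :
    ContDiffAt ℝ 2 (fun ξ => F.flipVec ξ W) ξ :=
  contDiffAt_mulVec ((F.contDiff_MWord _ ξ).sub (F.contDiff_MWord _ ξ)) contDiffAt_const

variable {F D}

theorem contDiffAt_cyclePt {ξ : ℝ × ℝ} {s : ℤ → Side} {n : ℕ} (hs : ∀ i, s (n + i) = s i)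
    (h : (1 - F.MWord ξ (word s n)).det ≠ 0) (i : ℤ) :
    ContDiffAt ℝ 2 (fun ξ => cyclePt F ξ s n i) ξ := by
  unfold cyclePt
  apply contDiffAt_mulVec
  · apply contDiffAt_matInv
    · exact contDiffAt_const.sub (F.contDiff_MWord _ ξ)
    · rwa [det_one_sub_shift ξ s n hs]
  · exact F.contDiff_fWord _ contDiffAt_const

/-! ### Spectral gap -/

/-- An eigenvector for `z ≠ μ` is annihilated by `uᵀ`, so it is also an eigenvector of the deflated
matrix. The power bound gives `|z|^j ≤ C r^j` for all `j`, which excludes `|z| > r`. -/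
theorem spectral_gap {M : Matrix (Fin N) (Fin N) ℝ} {v u : Fin N → ℝ} {μ C r : ℝ}
    (hu : u ᵥ* M = μ • u) (hr : 0 < r)
    (hpow : ∀ j : ℕ, ‖(M - μ • vecMulVec v u) ^ j‖ ≤ C * r ^ j) {z : ℂ}
    (hz : (toC M).charpoly.IsRoot z) (hzμ : z ≠ μ) : ‖z‖ ≤ r := by
  obtain ⟨x, hx, hMx⟩ := isRoot_iff_exists.1 hz
  set A : Matrix (Fin N) (Fin N) ℂ := toC (M - μ • vecMulVec v u) with hA
  set uc : Fin N → ℂ := fun i => (u i : ℂ) with huc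
  have hucM : uc ᵥ* toC M = (μ : ℂ) • uc := by
    rw [huc, toC_vecMul, hu]; ext i; simp
  have hux : uc ⬝ᵥ x = 0 := by
    have h1 : uc ⬝ᵥ (toC M *ᵥ x) = μ * (uc ⬝ᵥ x) := by
      rw [dotProduct_mulVec, hucM, smul_dotProduct, smul_eq_mul]
    rw [hMx, dotProduct_smul, smul_eq_mul] at h1
    have h2 : (z - μ) * (uc ⬝ᵥ x) = 0 := by linear_combination h1
    exact (mul_eq_zero.1 h2).resolve_left (sub_ne_zero.2 hzμ)
  have hAx : A *ᵥ x = z • x := by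
    have hAM : A = toC M - (μ : ℂ) • vecMulVec (fun i => (v i : ℂ)) uc := by
      ext i j; simp [hA, toC, huc, vecMulVec_apply]
    rw [hAM, sub_mulVec, smul_mulVec, vecMulVec_mulVec, hux, hMx]; simp
  have hpow' : ∀ j : ℕ, A ^ j *ᵥ x = z ^ j • x := by
    intro j
    induction j with
    | zero => simp
    | succ j ih =>
      rw [pow_succ, ← mulVec_mulVec, hAx, mulVec_smul, ih, smul_smul, pow_succ, mul_comm]
  have hxn : 0 < ‖x‖ := norm_pos_iff.2 hx
  have hb : ∀ j : ℕ, ‖z‖ ^ j ≤ C * r ^ j := by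
    intro j
    have h1 := Matrix.linfty_opNorm_mulVec (A ^ j) x
    rw [hpow', norm_smul, norm_pow] at h1
    have h2 := le_of_mul_le_mul_right h1 hxn
    rw [hA, ← toC_pow, norm_toC] at h2
    exact h2.trans (hpow j)
  by_contra hlt
  push Not at hlt
  have h1 : 1 < ‖z‖ / r := (one_lt_div hr).2 hlt
  obtain ⟨j, hj⟩ := pow_unbounded_of_one_lt C h1
  rw [div_pow, lt_div_iff₀ (by positivity)] at hj
  exact absurd (hb j) (not_le.2 hj)

theorem charpoly_shift (ξ : ℝ × ℝ) (s : ℤ → Side) (n : ℕ) (hs : ∀ i, s (n + i) = s i) (i : ℤ) :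
    (F.MWord ξ (word (shift s i) n)).charpoly = (F.MWord ξ (word s n)).charpoly := by
  have step : ∀ i, (F.MWord ξ (word (shift s (i + 1)) n)).charpoly =
      (F.MWord ξ (word (shift s i) n)).charpoly := by
    intro i
    cases n with
    | zero => simp [word_eq]
    | succ n =>
      have h1 : word (shift s (i + 1)) (n + 1) = word (shift s (i + 1)) n ++ [s i] := by
        rw [word_succ]
        congr 2
        simp only [shift]
        rw [← hs i]
        congr 1
        push_cast; ring
      have h2 : word (shift s i) (n + 1) = [s i] ++ word (shift s (i + 1)) n := by
        rw [word_succ', shift_shift]; simp [shift]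
      rw [h1, h2, F.MWord_append, F.MWord_append, Matrix.charpoly_mul_comm]
  have h0 : shift s 0 = s := by funext i; simp [shift]
  induction i using Int.induction_on with
  | zero => rw [h0]
  | succ i ih => rw [step, ih]
  | pred i ih => rw [← ih, ← step (-(i : ℤ) - 1)]; simp

variable {ξ₀ : ℝ × ℝ}

theorem norm_le_rhoMax {z : ℂ} (hz : z ≠ 1)
    (h : (toC (F.MWord ξ₀ (word D.S D.n))).charpoly.IsRoot z) : ‖z‖ ≤ rhoMax F D ξ₀ := by
  have h0 : (toC (F.MWord ξ₀ (word D.S D.n))).charpoly ≠ 0 := (Matrix.charpoly_monic _).ne_zero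
  have h1 : z ∈ otherEigs F D ξ₀ := by
    rw [otherEigs, Multiset.mem_erase_of_ne hz, Polynomial.mem_roots h0]
    exact h
  have h2 : ‖z‖₊ ≤ ((otherEigs F D ξ₀).map (fun z => ‖z‖₊)).sup :=
    Multiset.le_sup (Multiset.mem_map_of_mem _ h1)
  exact_mod_cast h2

/-- Only one copy of `1` is removed from the eigenvalues in `otherEigs`; a second copy would make
`ρ_max` at least `1`. -/
theorem rootMultiplicity_one (hS : IsShrinkingPoint F ξ₀ D.l D.m D.n) (h : rhoMax F D ξ₀ < 1) :
    (F.MWord ξ₀ (word D.S D.n)).charpoly.rootMultiplicity 1 = 1 := by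
  set M := F.MWord ξ₀ (word D.S D.n)
  have hr := hS.charpoly_isRoot_one
  have h0 : M.charpoly ≠ 0 := (Matrix.charpoly_monic _).ne_zero
  have h1 : 0 < M.charpoly.rootMultiplicity 1 := (Polynomial.rootMultiplicity_pos h0).2 hr
  by_contra hne
  have h2 : 2 ≤ M.charpoly.rootMultiplicity 1 := by omega
  rw [Polynomial.eq_rootMultiplicity_map (f := Complex.ofRealHom) Complex.ofReal_injective,
    ← charpoly_toC, map_one, ← Polynomial.count_roots] at h2
  have h3 : (1 : ℂ) ∈ otherEigs F D ξ₀ := by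
    rw [otherEigs, ← Multiset.one_le_count_iff_mem, Multiset.count_erase_self]
    change 2 ≤ Multiset.count 1 (toC (F.MWord ξ₀ (word D.S D.n))).charpoly.roots at h2
    omega
  have h4 : ‖(1 : ℂ)‖₊ ≤ ((otherEigs F D ξ₀).map (fun z => ‖z‖₊)).sup :=
    Multiset.le_sup (Multiset.mem_map_of_mem _ h3)
  have h5 : (1 : ℝ) ≤ rhoMax F D ξ₀ := by
    rw [rhoMax]
    have : (1 : NNReal) ≤ ((otherEigs F D ξ₀).map (fun z => ‖z‖₊)).sup := by simpa using h4
    exact_mod_cast this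
  linarith

end PWL


namespace PWL

set_option linter.unusedSectionVars false

attribute [local instance] Matrix.linftyOpNormedAddCommGroup Matrix.linftyOpNormedSpace
  Matrix.linftyOpNormedRing Matrix.linftyOpNormedAlgebra

variable {N : ℕ} [NeZero N] (F : Family N) (D : RotData)

/-! ### The normal form of `f^{S^{(-d)}}` near a shrinking point -/

/-- The direction of the line through the points of index `0` and `-d` of the cycle. -/
noncomputable def dirVec (ξ : ℝ × ℝ) : Fin N → ℝ :=
  (cyclePt F ξ D.S0 D.n (-(D.d : ℤ)) 0)⁻¹ •
    (cyclePt F ξ D.S0 D.n (-(D.d : ℤ)) - cyclePt F ξ D.S0 D.n 0)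

/-- The drift of `f^{S^{(-d)}}` along its invariant line, at the switching manifold. -/
noncomputable def drift (ξ : ℝ × ℝ) : ℝ :=
  omega F D ξ ⬝ᵥ (phi F D ξ (xInt F D ξ) - xInt F D ξ)

/-- The part of the matrix of `S^{(-d)}` that is transverse to the invariant line. -/
noncomputable def transv (ξ : ℝ × ℝ) : Matrix (Fin N) (Fin N) ℝ :=
  Mmd F D ξ - lam F D ξ • vecMulVec (zeta F D ξ) (omega F D ξ)

/-- The defining equations of `λ`, `ζ`, `ω` and `x^int` hold at `ξ`. -/
structure IsNormal (ξ : ℝ × ℝ) : Prop where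
  right : Mmd F D ξ *ᵥ zeta F D ξ = lam F D ξ • zeta F D ξ
  left : omega F D ξ ᵥ* Mmd F D ξ = lam F D ξ • omega F D ξ
  zeta_zero : zeta F D ξ 0 = 1
  omega_zeta : omega F D ξ ⬝ᵥ zeta F D ξ = 1
  xInt_zero : xInt F D ξ 0 = 0
  phi_xInt : phi F D ξ (xInt F D ξ) = xInt F D ξ + drift F D ξ • zeta F D ξ

/-- Existence and smoothness of the normal form near `ξ₀`. -/
structure NormalForm (ξ₀ : ℝ × ℝ) (ρ : ℝ) : Prop where
  lam_smooth : ContDiffAt ℝ 2 (lam F D) ξ₀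
  zeta_smooth : ContDiffAt ℝ 2 (zeta F D) ξ₀
  omega_smooth : ContDiffAt ℝ 2 (omega F D) ξ₀
  xInt_smooth : ContDiffAt ℝ 2 (xInt F D) ξ₀
  lam_eq : lam F D ξ₀ = 1
  zeta_eq : zeta F D ξ₀ = dirVec F D ξ₀
  xInt_eq : xInt F D ξ₀ = cyclePt F ξ₀ D.S0 D.n 0
  normal : ∀ᶠ ξ in 𝓝 ξ₀, IsNormal F D ξ
  pow_le : ∃ C, 1 ≤ C ∧ ∀ᶠ ξ in 𝓝 ξ₀, ∀ j : ℕ, ‖transv F D ξ ^ j‖ ≤ C * (ρ + C * ‖ξ - ξ₀‖) ^ j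

variable {F D} {ξ₀ : ℝ × ℝ}

theorem phi_sub (ξ : ℝ × ℝ) (x y : Fin N → ℝ) :
    phi F D ξ x - phi F D ξ y = Mmd F D ξ *ᵥ (x - y) := F.fWord_sub ξ D.Smd x y

namespace IsShrinkingPoint

theorem dirVec_zero (hS : IsShrinkingPoint F ξ₀ D.l D.m D.n) : dirVec F D ξ₀ 0 = 1 := by
  simp only [dirVec, Pi.smul_apply, Pi.sub_apply, hS.pt_zero, sub_zero, smul_eq_mul]
  exact inv_mul_cancel₀ hS.pt_neg_d.ne'

theorem Mmd_dirVec (hS : IsShrinkingPoint F ξ₀ D.l D.m D.n) :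
    Mmd F D ξ₀ *ᵥ dirVec F D ξ₀ = dirVec F D ξ₀ := by
  rw [dirVec, mulVec_smul, ← phi_sub, hS.phi_pt_neg_d, hS.phi_pt_zero]

end IsShrinkingPoint

theorem charpoly_Mmd (ξ : ℝ × ℝ) :
    (Mmd F D ξ).charpoly = (F.MWord ξ (word D.S D.n)).charpoly :=
  charpoly_shift ξ D.S D.n D.S_periodic _

/-- The difference of two solutions satisfies `M (x - y) = (x - y) + (s - s') v`. The bordered
matrix multiplies `v` by `2 - μ`, so adding `(s - s') / (2 - μ)` times `v` produces a null vector of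
it. Unlike an argument through fixed points of `φ`, this works for `μ = 1`. -/
theorem isXInt_unique {ξ : ℝ × ℝ} {v x y : Fin N → ℝ} {μ : ℝ} (hd : (bord (Mmd F D ξ) v 1).det ≠ 0)
    (hv : Mmd F D ξ *ᵥ v = μ • v) (hv0 : v 0 = 1) (hμ : μ ≠ 2)
    (hx : IsXInt F D ξ v x) (hy : IsXInt F D ξ v y) : x = y := by
  obtain ⟨hx0, s, hs⟩ := hx
  obtain ⟨hy0, s', hs'⟩ := hy
  have h1 := phi_sub (F := F) (D := D) ξ x y
  rw [hs, hs'] at h1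
  have h2 : Mmd F D ξ *ᵥ (x - y) = (x - y) + (s - s') • v := by
    rw [← h1, sub_smul]; abel
  have h3 : bord (Mmd F D ξ) v 1 *ᵥ ((x - y) + ((s - s') / (2 - μ)) • v) = 0 := by
    rw [bord_mulVec, mulVec_add, mulVec_smul, hv, h2]
    have : (2 - μ) ≠ 0 := sub_ne_zero.2 hμ.symm
    ext i
    simp [hx0, hy0, hv0]
    field_simp
    ring
  have h4 := eq_zero_of_det_ne_zero hd h3
  have h5 : (s - s') / (2 - μ) = 0 := by
    have := congrFun h4 0
    simpa [hx0, hy0, hv0] using this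
  rw [h5, zero_smul, add_zero, sub_eq_zero] at h4
  exact h4

theorem exists_norm_sub_le {V : Type*} [NormedAddCommGroup V] [NormedSpace ℝ V] {f : ℝ × ℝ → V}
    (hf : ContDiffAt ℝ 2 f ξ₀) :
    ∃ C, 0 < C ∧ ∀ᶠ ξ in 𝓝 ξ₀, ‖f ξ - f ξ₀‖ ≤ C * ‖ξ - ξ₀‖ :=
  (hf.differentiableAt (by norm_num)).isBigO_sub.exists_pos.imp fun _ h => ⟨h.1, h.2.bound⟩

theorem isInvertible_of_ne_zero {f : ℝ →L[ℝ] ℝ} (h : f 1 ≠ 0) : f.IsInvertible := by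
  refine ⟨ContinuousLinearEquiv.unitsEquivAut ℝ (Units.mk0 (f 1) h), ?_⟩
  ext
  simp

-- The eigenvalue solves `((μ I - M(ξ) + v₀ e₁ᵀ)⁻¹ v₀)₀ = 1`, to which the implicit function theorem
-- applies at `(ξ₀, 1)`; eigenvectors are then rational in `M` and `μ`, hence `C²`. Power bounds for
-- the deflated matrix hold at `ξ₀` by the spectral assumption and nearby by perturbation. Since
-- `λ`, `ζ`, `ω` and `x^int` are defined by choice, each has to be identified with the smooth
-- solution through uniqueness.
set_option maxHeartbeats 1000000 in
theorem normalForm (hS : IsShrinkingPoint F ξ₀ D.l D.m D.n) {ρ : ℝ} (hρ1 : ρ < 1)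
    (hρ : rhoMax F D ξ₀ < ρ ∨ (ρ = rhoMax F D ξ₀ ∧ SemisimpleOnCircle (Mmd F D ξ₀) ρ)) :
    NormalForm F D ξ₀ ρ := by
  have hr0 : 0 ≤ rhoMax F D ξ₀ := NNReal.coe_nonneg _
  have hr1 : rhoMax F D ξ₀ < 1 := by rcases hρ with h | ⟨h, -⟩ <;> linarith
  have hρ0 : 0 ≤ ρ := by rcases hρ with h | ⟨h, -⟩ <;> linarith
  set v₀ := dirVec F D ξ₀ with hv₀
  set M : ℝ × ℝ → Matrix (Fin N) (Fin N) ℝ := Mmd F D with hM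
  have hMs : ContDiffAt ℝ 2 M ξ₀ := F.contDiff_MWord _ ξ₀
  have hMv : M ξ₀ *ᵥ v₀ = v₀ := hS.Mmd_dirVec
  have hv00 : v₀ 0 = 1 := hS.dirVec_zero
  have hmult : (M ξ₀).charpoly.rootMultiplicity 1 = 1 := by
    rw [hM, charpoly_Mmd]; exact rootMultiplicity_one hS hr1
  have hdet : (bord (M ξ₀) v₀ 1).det ≠ 0 := det_bord_ne_zero hMv hv00 hmult
  -- the eigenvalue, by the implicit function theorem
  let B : (ℝ × ℝ) × ℝ → Matrix (Fin N) (Fin N) ℝ := fun p => bord (M p.1) v₀ p.2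
  have hB : ContDiffAt ℝ 2 B (ξ₀, 1) := by
    refine ((contDiffAt_snd.smul contDiffAt_const).sub ?_).add contDiffAt_const
    exact ContDiffAt.comp (ξ₀, (1 : ℝ)) (f := Prod.fst) hMs contDiffAt_fst
  have hBi : ContDiffAt ℝ 2 (fun p => (B p)⁻¹) (ξ₀, 1) := contDiffAt_matInv hB hdet
  let ψ : (ℝ × ℝ) × ℝ → ℝ := fun p => ((B p)⁻¹ *ᵥ v₀) 0
  have hψ : ContDiffAt ℝ 2 ψ (ξ₀, 1) :=
    contDiffAt_pi.1 (contDiffAt_mulVec hBi contDiffAt_const) 0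
  have hB0v : (B (ξ₀, 1))⁻¹ *ᵥ v₀ = v₀ :=
    bord_inv_mulVec hdet (by rw [one_smul, hMv]) hv00
  have hψ1 : ψ (ξ₀, 1) = 1 := by
    change ((B (ξ₀, 1))⁻¹ *ᵥ v₀) 0 = 1
    rw [hB0v, hv00]
  have hdetB : ∀ᶠ p in 𝓝 ((ξ₀, 1) : (ℝ × ℝ) × ℝ), (B p).det ≠ 0 :=
    (contDiffAt_matDet hB).continuousAt.eventually_ne hdet
  have hinv : (fderiv ℝ ψ (ξ₀, 1) ∘L .inr ℝ (ℝ × ℝ) ℝ).IsInvertible := by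
    apply isInvertible_of_ne_zero
    have h1 : HasFDerivAt ψ (fderiv ℝ ψ (ξ₀, 1)) (ξ₀, 1) :=
      (hψ.differentiableAt (by norm_num)).hasFDerivAt
    have h2 : HasDerivAt (fun s : ℝ => ((ξ₀, s) : (ℝ × ℝ) × ℝ)) ((0 : ℝ × ℝ), (1 : ℝ)) 1 :=
      (hasDerivAt_const _ _).prodMk (hasDerivAt_id _)
    have h3 := h1.comp_hasDerivAt (1 : ℝ) h2
    -- At `ξ₀` the bordered matrix with parameter `s` multiplies `v₀` by `s`, so `ψ(ξ₀, s) = 1/s`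
    -- and the partial derivative at `s = 1` is `-1`.
    have h4 : (ψ ∘ fun s : ℝ => ((ξ₀, s) : (ℝ × ℝ) × ℝ)) =ᶠ[𝓝 1] fun s => s⁻¹ := by
      have hc : ContinuousAt (fun s : ℝ => ((ξ₀, s) : (ℝ × ℝ) × ℝ)) 1 := by fun_prop
      filter_upwards [hc.eventually hdetB, eventually_ne_nhds (one_ne_zero)] with s hs hs0
      change ((B (ξ₀, s))⁻¹ *ᵥ v₀) 0 = s⁻¹
      have hu : IsUnit (B (ξ₀, s)).det := isUnit_iff_ne_zero.2 hs
      have h5 : B (ξ₀, s) *ᵥ (s⁻¹ • v₀) = v₀ := by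
        change bord (M ξ₀) v₀ s *ᵥ _ = _
        rw [bord_mulVec, mulVec_smul, hMv, smul_smul, mul_inv_cancel₀ hs0]
        simp [hv00]
      have h6 : (B (ξ₀, s))⁻¹ *ᵥ v₀ = s⁻¹ • v₀ := by
        nth_rw 1 [← h5]
        rw [mulVec_mulVec, Matrix.nonsing_inv_mul _ hu, one_mulVec]
      rw [h6, Pi.smul_apply, hv00, smul_eq_mul, mul_one]
    have h7 := (h3.congr_of_eventuallyEq h4.symm).unique (hasDerivAt_inv (one_ne_zero))
    change fderiv ℝ ψ (ξ₀, 1) (0, 1) ≠ 0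
    rw [h7]; norm_num
  set μ : ℝ × ℝ → ℝ := hψ.implicitFunction (by norm_num) hinv with hμdef
  have hμs : ContDiffAt ℝ 2 μ ξ₀ := hψ.contDiffAt_implicitFunction (by norm_num) hinv
  have hμ1 : μ ξ₀ = 1 := hψ.implicitFunction_apply_self (by norm_num) hinv
  have hμψ : ∀ᶠ ξ in 𝓝 ξ₀, ψ (ξ, μ ξ) = 1 := by
    have := hψ.eventually_apply_implicitFunction (by norm_num) hinv
    rwa [hψ1] at this
  clear_value μ
  have hpair : ContDiffAt ℝ 2 (fun ξ => (ξ, μ ξ)) ξ₀ := contDiffAt_id.prodMk hμs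
  -- eigenvectors
  let Bi : ℝ × ℝ → Matrix (Fin N) (Fin N) ℝ := fun ξ => (bord (M ξ) v₀ (μ ξ))⁻¹
  have hBis : ContDiffAt ℝ 2 Bi ξ₀ := by
    have key : ∀ G : (ℝ × ℝ) × ℝ → Matrix (Fin N) (Fin N) ℝ, ContDiffAt ℝ 2 G (ξ₀, 1) →
        ContDiffAt ℝ 2 (fun ξ => G (ξ, μ ξ)) ξ₀ := fun G hG =>
      ContDiffAt.comp ξ₀ (g := G) (f := fun ξ => (ξ, μ ξ)) (by rwa [hμ1]) hpair
    exact key _ hBi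
  let v : ℝ × ℝ → Fin N → ℝ := fun ξ => Bi ξ *ᵥ v₀
  have hvs : ContDiffAt ℝ 2 v ξ₀ := contDiffAt_mulVec hBis contDiffAt_const
  have hv0 : v ξ₀ = v₀ := by
    change (bord (M ξ₀) v₀ (μ ξ₀))⁻¹ *ᵥ v₀ = v₀
    rw [hμ1]; exact hB0v
  let w : ℝ × ℝ → Fin N → ℝ := fun ξ => Pi.single 0 1 ᵥ* Bi ξ
  have hws : ContDiffAt ℝ 2 w ξ₀ := contDiffAt_vecMul contDiffAt_const hBis
  have hwv0 : w ξ₀ ⬝ᵥ v ξ₀ = 1 := by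
    rw [hv0]
    change (Pi.single 0 1 ᵥ* Bi ξ₀) ⬝ᵥ v₀ = 1
    rw [← dotProduct_mulVec, single_one_dotProduct]
    change v ξ₀ 0 = 1
    rw [hv0, hv00]
  have hwvs : ContDiffAt ℝ 2 (fun ξ => w ξ ⬝ᵥ v ξ) ξ₀ := contDiffAt_dotProduct hws hvs
  have hwv : ∀ᶠ ξ in 𝓝 ξ₀, w ξ ⬝ᵥ v ξ ≠ 0 :=
    hwvs.continuousAt.eventually_ne (by rw [hwv0]; exact one_ne_zero)
  let u : ℝ × ℝ → Fin N → ℝ := fun ξ => (w ξ ⬝ᵥ v ξ)⁻¹ • w ξ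
  have hus : ContDiffAt ℝ 2 u ξ₀ := (hwvs.inv (by rw [hwv0]; exact one_ne_zero)).smul hws
  have hdetμ : ∀ᶠ ξ in 𝓝 ξ₀, (bord (M ξ) v₀ (μ ξ)).det ≠ 0 := by
    have hc : ContinuousAt (fun ξ => (ξ, μ ξ)) ξ₀ := hpair.continuousAt
    have h2 : ∀ᶠ p in 𝓝 ((ξ₀, μ ξ₀) : (ℝ × ℝ) × ℝ), (B p).det ≠ 0 := by rw [hμ1]; exact hdetB
    exact hc.eventually h2
  have hspec : ∀ᶠ ξ in 𝓝 ξ₀, M ξ *ᵥ v ξ = μ ξ • v ξ ∧ v ξ 0 = 1 ∧ u ξ ᵥ* M ξ = μ ξ • u ξ ∧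
      u ξ ⬝ᵥ v ξ = 1 := by
    filter_upwards [hμψ, hwv, hdetμ] with ξ h1 h2 h3
    have h4 : v ξ 0 = 1 := h1
    refine ⟨right_of_bord h3 h4, h4, ?_, ?_⟩
    · have := left_of_bord h3 h4
      change ((w ξ ⬝ᵥ v ξ)⁻¹ • w ξ) ᵥ* M ξ = μ ξ • ((w ξ ⬝ᵥ v ξ)⁻¹ • w ξ)
      rw [smul_vecMul, smul_comm (μ ξ)]
      congr 1
    · change ((w ξ ⬝ᵥ v ξ)⁻¹ • w ξ) ⬝ᵥ v ξ = 1
      rw [smul_dotProduct, smul_eq_mul, inv_mul_cancel₀ h2]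
  -- powers
  let T : ℝ × ℝ → Matrix (Fin N) (Fin N) ℝ := fun ξ => M ξ - μ ξ • vecMulVec (v ξ) (u ξ)
  have hTs : ContDiffAt ℝ 2 T ξ₀ := hMs.sub (hμs.smul (contDiffAt_vecMulVec hvs hus))
  obtain ⟨s1, s2, s3, s4⟩ := hspec.self_of_nhds
  obtain ⟨C₀, hC₀⟩ : ∃ C, ∀ j : ℕ, ‖T ξ₀ ^ j‖ ≤ C * ρ ^ j := by
    have h1 : T ξ₀ = M ξ₀ - vecMulVec v₀ (u ξ₀) := by
      change M ξ₀ - μ ξ₀ • vecMulVec (v ξ₀) (u ξ₀) = _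
      rw [hμ1, hv0, one_smul]
    rw [h1]
    rw [hμ1, one_smul] at s3
    rw [hv0] at s4
    refine pow_bound_compl hMv hv00 s3 s4 hdet hr0 (fun z hz hzr => norm_le_rhoMax hz ?_) hρ
    rw [charpoly_toC, ← charpoly_Mmd, ← charpoly_toC]
    exact hzr
  obtain ⟨C₁, hC₁0, hC₁⟩ := exists_norm_sub_le hTs
  set C := max 1 C₀ * max 1 C₁ with hC
  have hm0 : (1 : ℝ) ≤ max 1 C₀ := le_max_left _ _
  have hm1 : (1 : ℝ) ≤ max 1 C₁ := le_max_left _ _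
  have hC1 : 1 ≤ C := by nlinarith
  have hpow : ∀ᶠ ξ in 𝓝 ξ₀, ∀ j : ℕ, ‖T ξ ^ j‖ ≤ C * (ρ + C * ‖ξ - ξ₀‖) ^ j := by
    filter_upwards [hC₁] with ξ hξ j
    have h1 : ‖T ξ - T ξ₀‖ ≤ max 1 C₁ * ‖ξ - ξ₀‖ :=
      hξ.trans (mul_le_mul_of_nonneg_right (le_max_right _ _) (norm_nonneg _))
    have h2 := pow_bound_perturb hm0 hρ0 (fun j => (hC₀ j).trans
      (mul_le_mul_of_nonneg_right (le_max_right 1 C₀) (pow_nonneg hρ0 _))) h1 j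
    rw [← mul_assoc, ← hC] at h2
    refine h2.trans (mul_le_mul_of_nonneg_right ?_ ?_)
    · nlinarith
    · positivity
  -- identification of `λ`
  have hsmall : ∀ᶠ ξ in 𝓝 ξ₀, ρ + C * ‖ξ - ξ₀‖ < (1 + ρ) / 2 ∧ |μ ξ - 1| < 1 - (1 + ρ) / 2 := by
    have h1 : ContinuousAt (fun ξ : ℝ × ℝ => ρ + C * ‖ξ - ξ₀‖) ξ₀ := by fun_prop
    have h2 : ContinuousAt (fun ξ : ℝ × ℝ => |μ ξ - 1|) ξ₀ :=
      (hμs.continuousAt.sub continuousAt_const).abs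
    refine (h1.eventually_lt continuousAt_const ?_).and (h2.eventually_lt continuousAt_const ?_)
    · simp; linarith
    · simp [hμ1]; linarith
  have hlam : ∀ᶠ ξ in 𝓝 ξ₀, lam F D ξ = μ ξ := by
    filter_upwards [hspec, hpow, hsmall] with ξ ⟨h1, h2, h3, h4⟩ h5 ⟨h6, h7⟩
    -- All other eigenvalues lie in the disc of radius `(1 + ρ)/2`, so their distance to `1` exceeds
    -- that of `μ`; hence the eigenvalue nearest to `1` is `μ` and no other.
    have hgap : ∀ z : ℂ, (toC (M ξ)).charpoly.IsRoot z → z ≠ μ ξ → ‖z‖ ≤ (1 + ρ) / 2 := by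
      intro z hz hzμ
      refine spectral_gap (v := v ξ) (C := C) h3 (by linarith) (fun j => (h5 j).trans ?_) hz hzμ
      have : 0 ≤ ρ + C * ‖ξ - ξ₀‖ := by positivity
      gcongr
    have hfar : ∀ z : ℂ, ‖z‖ ≤ (1 + ρ) / 2 → 1 - (1 + ρ) / 2 ≤ ‖z - 1‖ := by
      intro z hz
      have := norm_sub_norm_le (1 : ℂ) z
      rw [norm_one, norm_sub_rev] at this
      linarith
    have hcast : ∀ m : ℝ, ‖(m : ℂ) - 1‖ = |m - 1| := by
      intro m
      rw [← Complex.ofReal_one, ← Complex.ofReal_sub, Complex.norm_real, Real.norm_eq_abs]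
    have hroot : (toC (M ξ)).charpoly.IsRoot (μ ξ : ℂ) := by
      rw [isRoot_toC, isRoot_iff_exists_real]
      refine ⟨v ξ, fun h => ?_, h1⟩
      rw [h] at h2; simp at h2
    have hex : (toC (Mmd F D ξ)).charpoly.IsRoot (μ ξ : ℂ) ∧
        ∀ z : ℂ, (toC (Mmd F D ξ)).charpoly.IsRoot z → ‖(μ ξ : ℂ) - 1‖ ≤ ‖z - 1‖ := by
      refine ⟨hroot, fun z hz => ?_⟩
      by_cases hzμ : z = μ ξ
      · rw [hzμ]
      · have := hfar z (hgap z hz hzμ)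
        rw [hcast]; linarith
    have hsp := Classical.epsilon_spec (p := fun m : ℝ => (toC (Mmd F D ξ)).charpoly.IsRoot (m : ℂ) ∧
        ∀ z : ℂ, (toC (Mmd F D ξ)).charpoly.IsRoot z → ‖(m : ℂ) - 1‖ ≤ ‖z - 1‖) ⟨μ ξ, hex⟩
    change (toC (Mmd F D ξ)).charpoly.IsRoot (lam F D ξ : ℂ) ∧
      ∀ z : ℂ, (toC (Mmd F D ξ)).charpoly.IsRoot z → ‖(lam F D ξ : ℂ) - 1‖ ≤ ‖z - 1‖ at hsp
    by_contra hne
    have h8 := hfar _ (hgap _ hsp.1 (by exact_mod_cast hne))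
    have h9 := hsp.2 _ hroot
    rw [hcast (μ ξ)] at h9
    linarith
  have hzeta : ∀ᶠ ξ in 𝓝 ξ₀, zeta F D ξ = v ξ := by
    filter_upwards [hspec, hlam, hdetμ] with ξ ⟨h1, h2, h3, h4⟩ h5 h6
    rw [zeta, h5]
    exact rightVec_eq h6 h1 h2
  have homega : ∀ᶠ ξ in 𝓝 ξ₀, omega F D ξ = u ξ := by
    filter_upwards [hspec, hlam, hdetμ] with ξ ⟨h1, h2, h3, h4⟩ h5 h6
    rw [omega, h5]
    exact leftVec_eq h6 h1 h2 h3 h4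
  -- `x^int`
  have hE's : ContDiffAt ℝ 2 (fun ξ => bord (M ξ) (v ξ) 1) ξ₀ :=
    (contDiffAt_const.sub hMs).add (contDiffAt_vecMulVec hvs contDiffAt_const)
  have hE'0 : (bord (M ξ₀) (v ξ₀) 1).det ≠ 0 := by rw [hv0]; exact hdet
  have hE'd : ∀ᶠ ξ in 𝓝 ξ₀, (bord (M ξ) (v ξ) 1).det ≠ 0 :=
    (contDiffAt_matDet hE's).continuousAt.eventually_ne hE'0
  -- The bordered system `y - M y + y₀ v = φ(0)` says `φ(y) = y + y₀ v`. Subtracting `y₀ v` moves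
  -- `y` to the switching manifold, and the displacement there is `(2 - μ) y₀ v`.
  let y : ℝ × ℝ → Fin N → ℝ := fun ξ => (bord (M ξ) (v ξ) 1)⁻¹ *ᵥ phi F D ξ 0
  have hys : ContDiffAt ℝ 2 y ξ₀ :=
    contDiffAt_mulVec (contDiffAt_matInv hE's hE'0) (F.contDiff_fWord _ contDiffAt_const)
  let X : ℝ × ℝ → Fin N → ℝ := fun ξ => y ξ - y ξ 0 • v ξ
  have hXs : ContDiffAt ℝ 2 X ξ₀ := hys.sub ((contDiffAt_pi.1 hys 0).smul hvs)
  have hX : ∀ᶠ ξ in 𝓝 ξ₀, X ξ 0 = 0 ∧ phi F D ξ (X ξ) = X ξ + ((2 - μ ξ) * y ξ 0) • v ξ := by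
    filter_upwards [hspec, hE'd] with ξ ⟨h1, h2, h3, h4⟩ h6
    have hu : IsUnit (bord (M ξ) (v ξ) 1).det := isUnit_iff_ne_zero.2 h6
    have h7 : bord (M ξ) (v ξ) 1 *ᵥ y ξ = phi F D ξ 0 := by
      change bord (M ξ) (v ξ) 1 *ᵥ ((bord (M ξ) (v ξ) 1)⁻¹ *ᵥ phi F D ξ 0) = _
      rw [mulVec_mulVec, Matrix.mul_nonsing_inv _ hu, one_mulVec]
    rw [bord_mulVec] at h7
    refine ⟨by change y ξ 0 - y ξ 0 * v ξ 0 = 0; rw [h2]; ring, ?_⟩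
    have h8 := phi_sub (F := F) (D := D) ξ (X ξ) 0
    rw [sub_zero, sub_eq_iff_eq_add] at h8
    rw [h8, ← h7]
    change M ξ *ᵥ (y ξ - y ξ 0 • v ξ) + _ = y ξ - y ξ 0 • v ξ + _
    rw [mulVec_sub, mulVec_smul, h1]
    ext i
    simp
    ring
  have hμ2 : ∀ᶠ ξ in 𝓝 ξ₀, μ ξ ≠ 2 :=
    hμs.continuousAt.eventually_ne (by rw [hμ1]; norm_num)
  have hxint : ∀ᶠ ξ in 𝓝 ξ₀, xInt F D ξ = X ξ ∧ IsXInt F D ξ (v ξ) (X ξ) := by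
    filter_upwards [hspec, hE'd, hX, hμ2, hzeta] with ξ ⟨h1, h2, h3, h4⟩ h6 ⟨h7, h8⟩ h9 h10
    have hXi : IsXInt F D ξ (v ξ) (X ξ) := ⟨h7, _, h8⟩
    refine ⟨?_, hXi⟩
    rw [xInt, h10]
    exact isXInt_unique h6 h1 h2 h9 (Classical.epsilon_spec (p := IsXInt F D ξ (v ξ)) ⟨_, hXi⟩) hXi
  have hxint0 : xInt F D ξ₀ = cyclePt F ξ₀ D.S0 D.n 0 := by
    obtain ⟨h1, h2⟩ := hxint.self_of_nhds
    rw [h1]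
    refine isXInt_unique hE'0 s1 s2 hμ2.self_of_nhds h2 ⟨hS.pt_zero, 0, ?_⟩
    rw [hS.phi_pt_zero]; simp
  refine ⟨hμs.congr_of_eventuallyEq hlam, hvs.congr_of_eventuallyEq hzeta,
    hus.congr_of_eventuallyEq homega,
    hXs.congr_of_eventuallyEq (hxint.mono fun _ h => h.1), ?_, ?_, hxint0, ?_, ?_⟩
  · rw [hlam.self_of_nhds, hμ1]
  · rw [hzeta.self_of_nhds, hv0]
  · filter_upwards [hspec, hlam, hzeta, homega, hxint, hX] with ξ ⟨h1, h2, h3, h4⟩ h5 h6 h7 ⟨h8, h9⟩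
      ⟨h10, h11⟩
    refine ⟨by rw [h5, h6]; exact h1, by rw [h5, h7]; exact h3, by rw [h6, h2], by rw [h6, h7, h4],
      by rw [h8, h10], ?_⟩
    have : drift F D ξ = (2 - μ ξ) * y ξ 0 := by
      rw [drift, h8, h11, add_sub_cancel_left, h7, dotProduct_smul, h4, smul_eq_mul, mul_one]
    rw [this, h8, h6, h11]
  · refine ⟨C, hC1, ?_⟩
    filter_upwards [hpow, hlam, hzeta, homega] with ξ h1 h2 h3 h4
    have : transv F D ξ = T ξ := by rw [transv, h2, h3, h4]
    rw [this]
    exact h1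

end PWL


namespace PWL

set_option linter.unusedSectionVars false

attribute [local instance] Matrix.linftyOpNormedAddCommGroup Matrix.linftyOpNormedSpace
  Matrix.linftyOpNormedRing Matrix.linftyOpNormedAlgebra

variable {N : ℕ} [NeZero N] {F : Family N} {D : RotData} {ξ₀ : ℝ × ℝ}

/-! ### Algebraic relations at a shrinking point -/

/-- The update affects only the first column, in which the determinant is linear. -/
theorem det_add_vecMulVec_single (A : Matrix (Fin N) (Fin N) ℝ) (w : Fin N → ℝ) :
    (A + vecMulVec w (Pi.single 0 1)).det = A.det + (A.adjugate *ᵥ w) 0 := by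
  have h1 : A + vecMulVec w (Pi.single 0 1) = A.updateCol 0 ((fun i => A i 0) + w) := by
    ext i j
    by_cases hj : j = 0
    · subst hj; simp [vecMulVec_apply]
    · simp [vecMulVec_apply, hj]
  have h2 : A.updateCol 0 (fun i => A i 0) = A := Matrix.updateCol_eq_self A 0
  rw [h1, Matrix.det_updateCol_add, h2, ← Matrix.cramer_eq_adjugate_mulVec, Matrix.cramer_apply]

/-- The determinant of the bordered matrix with parameter `μ` is the characteristic polynomial of `M
- v e₁ᵀ` at `μ`. For `μ > 1` a root of it would give an eigenvector `x + x₀/(μ-1) v` of `M`, so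
there is no root on `[1, ∞)`, and a monic polynomial is positive there. -/
theorem det_bord_pos {M : Matrix (Fin N) (Fin N) ℝ} {v : Fin N → ℝ} (hv : M *ᵥ v = v)
    (hv0 : v 0 = 1) (hd : (bord M v 1).det ≠ 0)
    (hM : ∀ μ : ℝ, 1 < μ → ¬ M.charpoly.IsRoot μ) : 0 < (bord M v 1).det := by
  set A := M - vecMulVec v (Pi.single 0 1) with hA
  have heval : ∀ μ : ℝ, A.charpoly.eval μ = (bord M v μ).det := by
    intro μ
    rw [Matrix.eval_charpoly, bord, hA]
    congr 1
    rw [Matrix.scalar_apply, ← Matrix.smul_one_eq_diagonal]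
    abel
  have hne : ∀ μ : ℝ, 1 ≤ μ → A.charpoly.eval μ ≠ 0 := by
    intro μ hμ h0
    rcases hμ.eq_or_lt with h | h
    · rw [heval, ← h] at h0; exact hd h0
    · obtain ⟨x, hx, hAx⟩ := isRoot_iff_exists_real.1 h0
      rw [hA, sub_mulVec, vecMulVec_mulVec, sub_eq_iff_eq_add] at hAx
      simp only [single_one_dotProduct] at hAx
      have h1 : μ - 1 ≠ 0 := by linarith
      have h2 : M *ᵥ (x + (x 0 / (μ - 1)) • v) = μ • (x + (x 0 / (μ - 1)) • v) := by
        rw [mulVec_add, mulVec_smul, hAx, hv]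
        ext i
        simp
        field_simp
        ring
      apply hM μ h
      refine isRoot_iff_exists_real.2 ⟨_, fun h3 => hx ?_, h2⟩
      have h4 := congrFun h3 0
      simp only [Pi.add_apply, Pi.smul_apply, hv0, smul_eq_mul, mul_one, Pi.zero_apply] at h4
      have h5 : x 0 = 0 := by
        field_simp at h4
        have : x 0 * μ = 0 := by linarith
        rcases mul_eq_zero.1 this with h | h
        · exact h
        · linarith
      rw [h5] at h3
      simpa using h3
  rw [← heval]
  by_contra hle
  have hdeg : 0 < A.charpoly.degree := by
    rw [Matrix.charpoly_degree_eq_dim, Fintype.card_fin]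
    exact_mod_cast Nat.pos_of_ne_zero (NeZero.ne N)
  have htop := Polynomial.tendsto_atTop_of_leadingCoeff_nonneg A.charpoly hdeg
    (by rw [(Matrix.charpoly_monic A).leadingCoeff]; exact zero_le_one)
  obtain ⟨μ, hμ1, hμ2⟩ := ((htop.eventually_ge_atTop 0).and (eventually_ge_atTop 1)).exists
  have := intermediate_value_Icc hμ2 A.charpoly.continuous.continuousOn
  obtain ⟨y, hy, hy0⟩ := this ⟨not_lt.1 hle, hμ1⟩
  exact hne y hy.1 hy0

namespace IsShrinkingPoint


/-- The eigenvectors that occur are differences of points of the cycle, whose first coordinate is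
not `1`. Here `u_j` and `v_j` are expressed through such an unnormalised vector. -/
theorem fixed_spec (hS : IsShrinkingPoint F ξ₀ D.l D.m D.n) (hr : rhoMax F D ξ₀ < 1) (j : ℤ) {y : Fin N → ℝ}
    (hy : F.MWord ξ₀ (word (shift D.S j) D.n) *ᵥ y = y) (hy0 : y 0 ≠ 0) :
    y 0 • vv F D ξ₀ j = y ∧
    uu F D ξ₀ j ᵥ* F.MWord ξ₀ (word (shift D.S j) D.n) = uu F D ξ₀ j ∧
    uu F D ξ₀ j ⬝ᵥ y = y 0 ∧
    ∀ z : Fin N → ℝ, z ᵥ* F.MWord ξ₀ (word (shift D.S j) D.n) = z →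
      z = ((z ⬝ᵥ y) / y 0) • uu F D ξ₀ j := by
  have hm : (F.MWord ξ₀ (word (shift D.S j) D.n)).charpoly.rootMultiplicity 1 = 1 := by
    rw [charpoly_shift ξ₀ D.S D.n D.S_periodic]; exact rootMultiplicity_one hS hr
  obtain ⟨h1, h2, h3, h4⟩ := simple_spec (v := (y 0)⁻¹ • y) (by rw [mulVec_smul, hy])
    (by simp [hy0]) hm
  refine ⟨?_, h2, ?_, fun z hz => ?_⟩
  · rw [vv, h1, smul_smul, mul_inv_cancel₀ hy0, one_smul]
  · rw [dotProduct_smul, smul_eq_mul] at h3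
    field_simp at h3
    exact h3
  · rw [div_eq_inv_mul, ← smul_eq_mul (y 0)⁻¹, ← dotProduct_smul]
    exact h4 z hz

theorem smul_dirVec (hS : IsShrinkingPoint F ξ₀ D.l D.m D.n) : cyclePt F ξ₀ D.S0 D.n (-(D.d : ℤ)) 0 • dirVec F D ξ₀ =
    cyclePt F ξ₀ D.S0 D.n (-(D.d : ℤ)) - cyclePt F ξ₀ D.S0 D.n 0 := by
  rw [dirVec, smul_smul, mul_inv_cancel₀ hS.pt_neg_d.ne', one_smul]

theorem mulVec_X'_dirVec (hS : IsShrinkingPoint F ξ₀ D.l D.m D.n) : cyclePt F ξ₀ D.S0 D.n (-(D.d : ℤ)) 0 •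
    F.MWord ξ₀ (flipHead D.X) *ᵥ dirVec F D ξ₀ =
    cyclePt F ξ₀ D.S0 D.n (-(D.d : ℤ) + D.e) - cyclePt F ξ₀ D.S0 D.n D.e := by
  rw [← mulVec_smul, hS.smul_dirVec, ← F.fWord_sub, hS.fWord_X'_sub, hS.fWord_X']

theorem shift_zero_word (D : RotData) : word (shift D.S 0) D.n = word D.S D.n := by
  apply word_congr; intro i _; simp [shift]

/-- Properties of `u_0` and `v_0`. -/
theorem uu_zero (hS : IsShrinkingPoint F ξ₀ D.l D.m D.n) (hr : rhoMax F D ξ₀ < 1) :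
    uu F D ξ₀ 0 ᵥ* F.MWord ξ₀ (word D.S D.n) = uu F D ξ₀ 0 ∧
    uu F D ξ₀ 0 ⬝ᵥ (cyclePt F ξ₀ D.S0 D.n D.d - cyclePt F ξ₀ D.S0 D.n 0) =
      cyclePt F ξ₀ D.S0 D.n D.d 0 ∧
    ∀ z : Fin N → ℝ, z ᵥ* F.MWord ξ₀ (word D.S D.n) = z →
      z = ((z ⬝ᵥ (cyclePt F ξ₀ D.S0 D.n D.d - cyclePt F ξ₀ D.S0 D.n 0)) /
        cyclePt F ξ₀ D.S0 D.n D.d 0) • uu F D ξ₀ 0 := by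
  have h0 : (cyclePt F ξ₀ D.S0 D.n D.d - cyclePt F ξ₀ D.S0 D.n 0) 0 =
      cyclePt F ξ₀ D.S0 D.n D.d 0 := by rw [Pi.sub_apply, hS.pt_zero, sub_zero]
  have h := hS.fixed_spec hr 0 (y := cyclePt F ξ₀ D.S0 D.n D.d - cyclePt F ξ₀ D.S0 D.n 0)
    (by rw [shift_zero_word, ← F.fWord_sub, hS.fWord_S_pt_d, hS.fWord_S_pt_zero])
    (by rw [h0]; exact hS.pt_d.ne)
  rw [shift_zero_word, h0] at h
  exact ⟨h.2.1, h.2.2.1, h.2.2.2⟩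

theorem vv_neg_d (hS : IsShrinkingPoint F ξ₀ D.l D.m D.n) (hr : rhoMax F D ξ₀ < 1) : vv F D ξ₀ (-(D.d : ℤ)) = dirVec F D ξ₀ := by
  have h := hS.fixed_spec hr (-(D.d : ℤ)) (y := dirVec F D ξ₀) hS.Mmd_dirVec
    (by rw [hS.dirVec_zero]; exact one_ne_zero)
  simpa [hS.dirVec_zero] using h.1

/-- The first `n + n⁺` symbols of `S` can be read as `S` followed by `R⁺`, or as `R⁺` followed by
`S^{(-d)}`. So `M_{R⁺}` intertwines the matrices of `S` and `S^{(-d)}`. -/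
theorem MWord_Rp_mul (F : Family N) (D : RotData) (ξ₀ : ℝ × ℝ) :
    F.MWord ξ₀ D.Rp * F.MWord ξ₀ (word D.S D.n) =
    Mmd F D ξ₀ * F.MWord ξ₀ D.Rp := by
  have h1 := D.word_S_long 1
  rw [one_mul, add_comm, word_add] at h1
  have h2 : word (shift D.S D.n) D.np = D.Rp := word_congr fun i _ => D.S_periodic i
  rw [h2] at h1
  simp only [List.replicate_one, List.flatten_singleton] at h1
  rw [Mmd, ← F.MWord_append, ← F.MWord_append, h1]

/-- By the intertwining relation `uᵀ M_{R⁺}` is a left eigenvector of `M_S`, hence a multiple of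
`u_0`. The factor is found by evaluating on `x_d - x_0`, which `M_{R⁺}` maps to `x_0 - x_{-d}`. -/
theorem vecMul_Rp (hS : IsShrinkingPoint F ξ₀ D.l D.m D.n) (hr : rhoMax F D ξ₀ < 1) {u : Fin N → ℝ} (hu : u ᵥ* Mmd F D ξ₀ = u)
    (huv : u ⬝ᵥ dirVec F D ξ₀ = 1) : u ᵥ* F.MWord ξ₀ D.Rp =
    (-cyclePt F ξ₀ D.S0 D.n (-(D.d : ℤ)) 0 / cyclePt F ξ₀ D.S0 D.n D.d 0) • uu F D ξ₀ 0 := by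
  have h := (hS.uu_zero hr).2.2 (u ᵥ* F.MWord ξ₀ D.Rp)
    (by rw [vecMul_vecMul, MWord_Rp_mul, ← vecMul_vecMul, hu])
  rw [h, ← dotProduct_mulVec, ← F.fWord_sub, hS.fWord_Rp_add, hS.fWord_Rp, ← neg_sub,
    ← hS.smul_dirVec, dotProduct_neg, dotProduct_smul, huv, smul_eq_mul, mul_one]

/-- The product `ω₀ᵀ M_V ζ₀`, where `V` is the part of the word `G⁺[k,χ]` that remains when
the powers of `S^{(-d)}` are removed, for `χ ≥ 0`. -/
theorem kappa_nonneg (hS : IsShrinkingPoint F ξ₀ D.l D.m D.n) (hr : rhoMax F D ξ₀ < 1) {u : Fin N → ℝ} (hu : u ᵥ* Mmd F D ξ₀ = u)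
    (huv : u ⬝ᵥ dirVec F D ξ₀ = 1) (c : ℕ) :
    u ⬝ᵥ F.MWord ξ₀ (D.Gpre c) *ᵥ dirVec F D ξ₀ =
    (-cyclePt F ξ₀ D.S0 D.n (-(D.d : ℤ)) 0 / cyclePt F ξ₀ D.S0 D.n D.d 0) * kappa F D ξ₀ c := by
  have h1 : ¬ ((c : ℤ) ≤ -1) := by omega
  rw [kappa, if_neg h1, hS.vv_neg_d hr, RotData.Gpre, F.MWord_append, F.MWord_replicate,
    dotProduct_mulVec, ← vecMul_vecMul, hS.vecMul_Rp hr hu huv, D.word_Sld, Int.toNat_natCast,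
    smul_vecMul, smul_dotProduct, smul_eq_mul, ← dotProduct_mulVec]

/-- `M_Y` intertwines the matrices of `Y X`, the word of `S^{(ℓd)}`, and `X Y`. The factor comes
from the images of the points of index `d + e` and `e`. -/
theorem vecMul_Y (hS : IsShrinkingPoint F ξ₀ D.l D.m D.n) (hr : rhoMax F D ξ₀ < 1) : uu F D ξ₀ 0 ᵥ* F.MWord ξ₀ D.Y =
    (cyclePt F ξ₀ D.S0 D.n D.d 0 / cyclePt F ξ₀ D.S0 D.n (D.d + D.e) 0) •
      uu F D ξ₀ (D.l * D.d) := by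
  have hw : word (shift D.S (D.l * D.d)) D.n = D.Y ++ D.X := by
    have h1 : word (shift D.S (D.l * D.d)) D.n = word (shift D.S D.e) ((D.n - D.e) + D.e) := by
      rw [Nat.sub_add_cancel D.e_lt.le]
      apply word_congr
      intro i _
      apply D.S_congr
      have := D.dvd_e
      rw [show (D.l * D.d : ℤ) + i - (D.e + i) = D.l * D.d - D.e by ring]
      exact_mod_cast this
    rw [h1, word_add, shift_shift, e_add]
    congr 1
    exact word_congr fun i _ => D.S_periodic i
  obtain ⟨h1, h2, h3⟩ := hS.uu_zero hr
  rw [D.word_S, F.MWord_append] at h1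
  have hy : F.MWord ξ₀ (D.Y ++ D.X) *ᵥ
      (cyclePt F ξ₀ D.S0 D.n (D.d + D.e) - cyclePt F ξ₀ D.S0 D.n D.e) =
      cyclePt F ξ₀ D.S0 D.n (D.d + D.e) - cyclePt F ξ₀ D.S0 D.n D.e := by
    rw [← F.fWord_sub, F.fWord_append, F.fWord_append, hS.fWord_Y_add, hS.fWord_Y, hS.fWord_X_add,
      hS.fWord_X]
  have hy0 : (cyclePt F ξ₀ D.S0 D.n (D.d + D.e) - cyclePt F ξ₀ D.S0 D.n D.e) 0 =
      cyclePt F ξ₀ D.S0 D.n (D.d + D.e) 0 := by rw [Pi.sub_apply, hS.pt_e, sub_zero]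
  have h := hS.fixed_spec hr (D.l * D.d) (by rw [hw]; exact hy)
    (by rw [hy0]; exact hS.pt_e_add.ne')
  rw [hw] at h
  rw [h.2.2.2 (uu F D ξ₀ 0 ᵥ* F.MWord ξ₀ D.Y)
    (by rw [vecMul_vecMul, F.MWord_append, ← Matrix.mul_assoc, ← vecMul_vecMul, h1]), hy0,
    ← dotProduct_mulVec, ← F.fWord_sub, hS.fWord_Y_add, hS.fWord_Y, h2]

/-- The image is proportional to `x_{e-d} - x_e`, the difference at index `(ℓ-1) d` of the two
`S`-cycles, which is fixed by the matrix of `S^{((ℓ-1)d)}`. -/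
theorem mulVec_X'_eq (hS : IsShrinkingPoint F ξ₀ D.l D.m D.n) (hr : rhoMax F D ξ₀ < 1) : F.MWord ξ₀ (flipHead D.X) *ᵥ dirVec F D ξ₀ =
    (cyclePt F ξ₀ D.S0 D.n (-(D.d : ℤ) + D.e) 0 / cyclePt F ξ₀ D.S0 D.n (-(D.d : ℤ)) 0) •
      vv F D ξ₀ (((D.l : ℤ) - 1) * D.d) := by
  have hdvd : (D.n : ℤ) ∣ ((D.l : ℤ) - 1) * D.d - (-(D.d : ℤ) + D.e) := by
    have := D.dvd_e
    rw [show ((D.l : ℤ) - 1) * D.d - (-(D.d : ℤ) + D.e) = D.l * D.d - D.e by ring]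
    exact_mod_cast this
  set j := ((D.l : ℤ) - 1) * D.d with hj
  have e1 : cyclePt F ξ₀ D.S0 D.n (-(D.d : ℤ) + D.e) = cyclePt F ξ₀ D.S0 D.n j :=
    (hS.isCycle_S.congr_dvd hdvd).symm
  have e2 : cyclePt F ξ₀ D.S0 D.n D.e = cyclePt F ξ₀ D.S0 D.n (D.d + j) := by
    refine (hS.isCycle_S.congr_dvd ?_).symm
    rw [show D.d + j - D.e = j - (-(D.d : ℤ) + D.e) by ring]
    exact hdvd
  have hy := hS.isCycle_S.sub_mulVec hS.isCycle_S_add j D.n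
  simp only [(hS.isCycle_S j).2, (hS.isCycle_S_add j).2, ← e2, ← e1] at hy
  have hy0 : (cyclePt F ξ₀ D.S0 D.n (-(D.d : ℤ) + D.e) - cyclePt F ξ₀ D.S0 D.n D.e) 0 =
      cyclePt F ξ₀ D.S0 D.n (-(D.d : ℤ) + D.e) 0 := by rw [Pi.sub_apply, hS.pt_e, sub_zero]
  have h := (hS.fixed_spec hr j hy (by rw [hy0]; exact hS.pt_e_sub.ne)).1
  rw [hy0, ← hS.mulVec_X'_dirVec] at h
  rw [div_eq_inv_mul, mul_smul, h, smul_smul, inv_mul_cancel₀ hS.pt_neg_d.ne', one_smul]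

/-- The counterpart of `kappa_nonneg` for `χ = -1`. -/
theorem kappa_neg_one (hS : IsShrinkingPoint F ξ₀ D.l D.m D.n) (hr : rhoMax F D ξ₀ < 1) {u : Fin N → ℝ} (hu : u ᵥ* Mmd F D ξ₀ = u)
    (huv : u ⬝ᵥ dirVec F D ξ₀ = 1) :
    ∃ c : ℝ, c ≠ 0 ∧ u ⬝ᵥ F.MWord ξ₀ ((flipHead D.X ++ D.Y) ++ D.Rp) *ᵥ dirVec F D ξ₀ =
      c * kappa F D ξ₀ (-1) := by
  refine ⟨(-cyclePt F ξ₀ D.S0 D.n (-(D.d : ℤ)) 0 / cyclePt F ξ₀ D.S0 D.n D.d 0) *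
    (cyclePt F ξ₀ D.S0 D.n D.d 0 / cyclePt F ξ₀ D.S0 D.n (D.d + D.e) 0) *
    (cyclePt F ξ₀ D.S0 D.n (-(D.d : ℤ) + D.e) 0 / cyclePt F ξ₀ D.S0 D.n (-(D.d : ℤ)) 0), ?_, ?_⟩
  · have h1 := hS.pt_neg_d.ne'
    have h2 := hS.pt_d.ne
    have h3 := hS.pt_e_add.ne'
    have h4 := hS.pt_e_sub.ne
    exact mul_ne_zero (mul_ne_zero (div_ne_zero (neg_ne_zero.2 h1) h2) (div_ne_zero h2 h3))
      (div_ne_zero h4 h1)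
  · have hk : kappa F D ξ₀ (-1) = uu F D ξ₀ (D.l * D.d) ⬝ᵥ vv F D ξ₀ (((D.l : ℤ) - 1) * D.d) := by
      rw [kappa, if_pos le_rfl]; simp
    rw [hk, F.MWord_append, F.MWord_append, dotProduct_mulVec, ← vecMul_vecMul,
      hS.vecMul_Rp hr hu huv, smul_vecMul, smul_dotProduct, ← vecMul_vecMul, ← dotProduct_mulVec,
      hS.mulVec_X'_eq hr, hS.vecMul_Y hr, smul_dotProduct, dotProduct_smul]
    simp only [smul_eq_mul]
    ring

/-! ### The slope of the switching function -/

theorem uu_fWord (hS : IsShrinkingPoint F ξ₀ D.l D.m D.n) (hr : rhoMax F D ξ₀ < 1) (x : Fin N → ℝ) :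
    uu F D ξ₀ 0 ⬝ᵥ F.fWord ξ₀ (word D.S D.n) x = uu F D ξ₀ 0 ⬝ᵥ x := by
  have h := F.fWord_sub ξ₀ (word D.S D.n) x (cyclePt F ξ₀ D.S0 D.n 0)
  rw [hS.fWord_S_pt_zero] at h
  have h2 := congrArg (uu F D ξ₀ 0 ⬝ᵥ ·) h
  simp only [dotProduct_mulVec, (hS.uu_zero hr).1, dotProduct_sub] at h2
  linarith

/-- The point `x_{-d}` is fixed by `f^{X'Y'}`. Replacing this map by `f^{XY}` costs one rank-one
term for each flip, and `u_0` is invariant under `f^{XY}`, so its pairing with the two terms must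
cancel. -/
theorem flipVec_relation (hS : IsShrinkingPoint F ξ₀ D.l D.m D.n) (hr : rhoMax F D ξ₀ < 1) :
    cyclePt F ξ₀ D.S0 D.n (-(D.d : ℤ)) 0 *
      (uu F D ξ₀ 0 ⬝ᵥ F.MWord ξ₀ D.Y *ᵥ F.flipVec ξ₀ D.X) +
    cyclePt F ξ₀ D.S0 D.n (-(D.d : ℤ) + D.e) 0 * (uu F D ξ₀ 0 ⬝ᵥ F.flipVec ξ₀ D.Y) = 0 := by
  set x := cyclePt F ξ₀ D.S0 D.n (-(D.d : ℤ)) with hx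
  have h1 := hS.fWord_Y'_sub
  rw [F.fWord_flipHead_eq, ← hS.fWord_X'_sub] at h1
  have h2 := F.fWord_sub ξ₀ D.Y (F.fWord ξ₀ (flipHead D.X) x) (F.fWord ξ₀ D.X x)
  have h3 : F.fWord ξ₀ (flipHead D.X) x - F.fWord ξ₀ D.X x = x 0 • F.flipVec ξ₀ D.X := by
    rw [F.fWord_flipHead_eq]; abel
  rw [h3, ← F.fWord_append ξ₀ D.X D.Y, ← D.word_S, sub_eq_iff_eq_add] at h2
  rw [h2] at h1
  have h4 := congrArg (uu F D ξ₀ 0 ⬝ᵥ ·) h1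
  simp only [dotProduct_add, hS.uu_fWord hr, mulVec_smul, dotProduct_smul, smul_eq_mul] at h4
  rw [hS.fWord_X'_sub] at h4
  linarith

/-- `I - M` for `X' Y` differs from the singular matrix `I - M_S` by a rank-one term, so `a` is read
off from the first row of the adjugate of `I - M_S`. That row is `u_0` times the bordered
determinant, which is positive because `M_S` has no real eigenvalue above `1`. -/
theorem aa_sign (hS : IsShrinkingPoint F ξ₀ D.l D.m D.n) (hr : rhoMax F D ξ₀ < 1) :
    aa F D ξ₀ * (uu F D ξ₀ 0 ⬝ᵥ F.MWord ξ₀ D.Y *ᵥ F.flipVec ξ₀ D.X) < 0 := by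
  set M := F.MWord ξ₀ (word D.S D.n) with hM
  set y := cyclePt F ξ₀ D.S0 D.n D.d - cyclePt F ξ₀ D.S0 D.n 0 with hy
  have hy0 : y 0 = cyclePt F ξ₀ D.S0 D.n D.d 0 := by rw [hy, Pi.sub_apply, hS.pt_zero, sub_zero]
  have ht : y 0 ≠ 0 := by rw [hy0]; exact hS.pt_d.ne
  have hMy : M *ᵥ y = y := by rw [hM, hy, ← F.fWord_sub, hS.fWord_S_pt_d, hS.fWord_S_pt_zero]
  obtain ⟨hu, huy, huniq⟩ := hS.uu_zero hr
  set u := uu F D ξ₀ 0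
  set v := (y 0)⁻¹ • y with hv
  have hMv : M *ᵥ v = v := by rw [hv, mulVec_smul, hMy]
  have hv0 : v 0 = 1 := by simp [hv, ht]
  have huv : u ⬝ᵥ v = 1 := by rw [hv, dotProduct_smul, huy, ← hy0]; simp [ht]
  have hd := det_bord_ne_zero hMv hv0 (rootMultiplicity_one hS hr)
  have hpos : 0 < (bord M v 1).det := by
    refine det_bord_pos hMv hv0 hd fun μ hμ h => ?_
    have h1 := norm_le_rhoMax (F := F) (D := D) (ξ₀ := ξ₀) (z := (μ : ℂ))
      (by exact_mod_cast hμ.ne') (isRoot_toC.2 h)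
    rw [Complex.norm_real, Real.norm_eq_abs, abs_of_pos (by linarith)] at h1
    linarith
  have hdet0 : (1 - M).det = 0 := by
    by_contra h
    have h1 := eq_zero_of_det_ne_zero h (x := y) (by rw [sub_mulVec, one_mulVec, hMy, sub_self])
    apply ht; rw [h1]; rfl
  set z : Fin N → ℝ := Pi.single 0 1 ᵥ* (1 - M).adjugate with hz
  have hzM : z ᵥ* M = z := by
    have h1 : z ᵥ* (1 - M) = 0 := by
      rw [hz, vecMul_vecMul, Matrix.adjugate_mul, hdet0, zero_smul, vecMul_zero]
    rw [vecMul_sub, vecMul_one, sub_eq_zero] at h1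
    exact h1.symm
  have hzu := huniq z hzM
  have hzw : ∀ w : Fin N → ℝ, ((1 - M).adjugate *ᵥ w) 0 = z ⬝ᵥ w := by
    intro w; rw [hz, ← dotProduct_mulVec, single_one_dotProduct]
  have h1 : (bord M v 1).det = z ⬝ᵥ v := by
    rw [bord, one_smul, det_add_vecMulVec_single, hdet0, zero_add, hzw]
  have h2 : z ⬝ᵥ v = (z ⬝ᵥ y) / cyclePt F ξ₀ D.S0 D.n D.d 0 := by
    rw [hv, dotProduct_smul, smul_eq_mul, hy0, inv_mul_eq_div]
  rw [← h2, ← h1] at hzu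
  set b := F.MWord ξ₀ D.Y *ᵥ F.flipVec ξ₀ D.X with hb
  have h3 : 1 - F.MWord ξ₀ (word D.S0 D.n) = (1 - M) + vecMulVec (-b) (Pi.single 0 1) := by
    rw [hM, D.word_S0, D.word_S, F.MWord_append, F.MWord_append, F.MWord_flipHead, Matrix.mul_add,
      Matrix.mul_vecMulVec, ← hb, neg_vecMulVec]
    abel
  have h4 : aa F D ξ₀ = -((bord M v 1).det * (u ⬝ᵥ b)) := by
    rw [aa, h3, det_add_vecMulVec_single, hdet0, zero_add, hzw, dotProduct_neg]
    conv_lhs => rw [hzu]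
    rw [smul_dotProduct, smul_eq_mul]
  have hane : aa F D ξ₀ ≠ 0 := hS.generic_a
  have hub : u ⬝ᵥ b ≠ 0 := by
    intro h; apply hane; rw [h4, h]; ring
  rw [h4]
  have := mul_pos hpos (mul_self_pos.2 hub)
  linarith

/-- Let `P` be the matrix of `X Y'` and `b_Y` the flip vector of `Y`. From `u_0 P = u_0 + (u_0 b_Y)
e₁ᵀ M_X` one gets `κ⁺_Δ - κ⁺_{Δ-1} = (u_0 b_Y) · slope` for `Δ ≥ 1`, and `flipVec_relation` with
`aa_sign` gives `a (u_0 b_Y) < 0`. For `Δ = 0` the slope has the sign of the point of index `e - d`.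
-/
theorem switch_slope_neg (hS : IsShrinkingPoint F ξ₀ D.l D.m D.n) (hr : rhoMax F D ξ₀ < 1) (Δ : ℕ)
    (hκ : 0 < (kappa F D ξ₀ Δ - kappa F D ξ₀ ((Δ : ℤ) - 1)) * aa F D ξ₀) :
    (F.MWord ξ₀ (D.switchWord Δ) *ᵥ dirVec F D ξ₀) 0 < 0 := by
  have hX' : (F.MWord ξ₀ (flipHead D.X) *ᵥ dirVec F D ξ₀) 0 < 0 := by
    have h := congrFun hS.mulVec_X'_dirVec 0
    rw [Pi.smul_apply, Pi.sub_apply, hS.pt_e, sub_zero, smul_eq_mul] at h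
    have h1 := hS.pt_e_sub
    rw [← h] at h1
    exact (pos_iff_neg_of_mul_neg h1).1 hS.pt_neg_d
  rcases Nat.eq_zero_or_pos Δ with h0 | h0
  · subst h0
    simpa [RotData.switchWord] using hX'
  obtain ⟨c, rfl⟩ : ∃ c, Δ = c + 1 := ⟨Δ - 1, by omega⟩
  have hword : ∀ c : ℕ, (List.replicate (c + 1) (flipHead D.Y ++ D.X)).flatten =
      flipHead D.Y ++ ((List.replicate c (D.X ++ flipHead D.Y)).flatten ++ D.X) := by
    intro c
    induction c with
    | zero => simp
    | succ c ih =>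
      rw [List.replicate_succ, List.flatten_cons, ih, List.replicate_succ, List.flatten_cons]
      simp only [List.append_assoc]
  set P := F.MWord ξ₀ (D.X ++ flipHead D.Y) with hP
  set v := dirVec F D ξ₀ with hv
  set u := uu F D ξ₀ 0 with hu
  -- `X' (Y' X)^{c+1}` is the same word as `X' Y' (X Y')^c X`, and the matrix of `X' Y'` fixes `v`.
  have hm : F.MWord ξ₀ (D.switchWord (c + 1)) *ᵥ v = F.MWord ξ₀ D.X *ᵥ (P ^ c *ᵥ v) := by
    have h1 : F.MWord ξ₀ (flipHead D.Y) *ᵥ (F.MWord ξ₀ (flipHead D.X) *ᵥ v) = v := by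
      rw [mulVec_mulVec, ← F.MWord_append, ← D.Smd_eq]; exact hS.Mmd_dirVec
    rw [RotData.switchWord, hword, F.MWord_append, F.MWord_append, F.MWord_append,
      F.MWord_replicate, ← hP]
    simp only [← mulVec_mulVec]
    rw [h1]
  have hk1 : kappa F D ξ₀ ((c + 1 : ℕ) : ℤ) = u ⬝ᵥ P *ᵥ (P ^ c *ᵥ v) := by
    have h1 : ¬ (((c + 1 : ℕ) : ℤ) ≤ -1) := by omega
    rw [kappa, if_neg h1, hS.vv_neg_d hr, D.word_Sld, Int.toNat_natCast, pow_succ', mulVec_mulVec]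
  have hk2 : kappa F D ξ₀ (((c + 1 : ℕ) : ℤ) - 1) = u ⬝ᵥ (P ^ c *ᵥ v) := by
    have h2 : (((c + 1 : ℕ) : ℤ) - 1) = (c : ℤ) := by push_cast; ring
    have h1 : ¬ ((c : ℤ) ≤ -1) := by omega
    rw [h2, kappa, if_neg h1, hS.vv_neg_d hr, D.word_Sld, Int.toNat_natCast]
  have huP : u ᵥ* P = u + (u ⬝ᵥ F.flipVec ξ₀ D.Y) • (Pi.single 0 1 ᵥ* F.MWord ξ₀ D.X) := by
    have h1 := (hS.uu_zero hr).1
    rw [D.word_S, F.MWord_append] at h1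
    rw [hP, F.MWord_append, F.MWord_flipHead, Matrix.add_mul, vecMul_add, h1, ← vecMul_vecMul,
      vecMul_vecMulVec, smul_vecMul]
  rw [hm]
  set s := (F.MWord ξ₀ D.X *ᵥ (P ^ c *ᵥ v)) 0 with hs
  have hdiff : kappa F D ξ₀ ((c + 1 : ℕ) : ℤ) - kappa F D ξ₀ (((c + 1 : ℕ) : ℤ) - 1) =
      (u ⬝ᵥ F.flipVec ξ₀ D.Y) * s := by
    rw [hk1, hk2, dotProduct_mulVec, huP, add_dotProduct, smul_dotProduct, ← dotProduct_mulVec,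
      single_one_dotProduct, smul_eq_mul]
    ring
  rw [hdiff] at hκ
  have h1 := hS.flipVec_relation hr
  have h2 := hS.aa_sign hr
  have h3 := hS.pt_neg_d
  have h4 := hS.pt_e_sub
  set a := aa F D ξ₀
  set α := u ⬝ᵥ F.MWord ξ₀ D.Y *ᵥ F.flipVec ξ₀ D.X
  set β := u ⬝ᵥ F.flipVec ξ₀ D.Y
  set t := cyclePt F ξ₀ D.S0 D.n (-(D.d : ℤ)) 0
  set t' := cyclePt F ξ₀ D.S0 D.n (-(D.d : ℤ) + D.e) 0
  have h5 : a * β < 0 := by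
    have : t' * (a * β) = -(t * (a * α)) := by linear_combination a * h1
    have h6 : 0 < t' * (a * β) := by
      rw [this]; have := mul_neg_of_pos_of_neg h3 h2; linarith
    by_contra hcon
    have := mul_nonpos_of_nonpos_of_nonneg h4.le (not_lt.1 hcon)
    linarith
  by_contra hcon
  have h6 : (β * s) * a = (a * β) * s := by ring
  rw [h6] at hκ
  have := mul_nonpos_of_nonpos_of_nonneg h5.le (not_lt.1 hcon)
  linarith

end IsShrinkingPoint

end PWL


namespace PWL

set_option linter.unusedSectionVars false

attribute [local instance] Matrix.linftyOpNormedAddCommGroup Matrix.linftyOpNormedSpace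
  Matrix.linftyOpNormedRing Matrix.linftyOpNormedAlgebra

variable {N : ℕ} [NeZero N] {F : Family N} {D : RotData} {ξ₀ : ℝ × ℝ}

/-! ### First order expansions at a shrinking point -/

/-- Mean value inequality on the ball of radius `‖ξ - ξ₀‖`, on which the derivative differs from
that at `ξ₀` by `O(‖ξ - ξ₀‖)`. -/
theorem exists_taylor_bound {V : Type*} [NormedAddCommGroup V] [NormedSpace ℝ V]
    {f : ℝ × ℝ → V} (hf : ContDiffAt ℝ 2 f ξ₀) :
    ∃ C, 0 < C ∧ ∀ᶠ ξ in 𝓝 ξ₀, ‖f ξ - f ξ₀ - fderiv ℝ f ξ₀ (ξ - ξ₀)‖ ≤ C * ‖ξ - ξ₀‖ ^ 2 := by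
  have h1 : ContDiffAt ℝ 1 (fderiv ℝ f) ξ₀ := hf.fderiv_right (by norm_num)
  obtain ⟨C, hC, hb⟩ := (h1.differentiableAt (by norm_num)).isBigO_sub.exists_pos
  have hd : ∀ᶠ ξ in 𝓝 ξ₀, DifferentiableAt ℝ f ξ := by
    have := hf.eventually (by simp)
    exact this.mono fun ξ h => h.differentiableAt (by norm_num)
  refine ⟨C, hC, ?_⟩
  obtain ⟨r, hr, hball⟩ := Metric.eventually_nhds_iff_ball.1 (hb.bound.and hd)
  filter_upwards [Metric.ball_mem_nhds ξ₀ hr] with ξ hξ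
  have hsub : Metric.closedBall ξ₀ ‖ξ - ξ₀‖ ⊆ Metric.ball ξ₀ r := by
    apply Metric.closedBall_subset_ball
    rwa [Metric.mem_ball, dist_eq_norm] at hξ
  have h2 : ∀ x ∈ Metric.closedBall ξ₀ ‖ξ - ξ₀‖,
      HasFDerivWithinAt f (fderiv ℝ f x) (Metric.closedBall ξ₀ ‖ξ - ξ₀‖) x := fun x hx =>
    (hball x (hsub hx)).2.hasFDerivAt.hasFDerivWithinAt
  have h3 : ∀ x ∈ Metric.closedBall ξ₀ ‖ξ - ξ₀‖, ‖fderiv ℝ f x - fderiv ℝ f ξ₀‖ ≤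
      C * ‖ξ - ξ₀‖ := by
    intro x hx
    refine (hball x (hsub hx)).1.trans ?_
    rw [Metric.mem_closedBall, dist_eq_norm] at hx
    gcongr
  have := (convex_closedBall ξ₀ ‖ξ - ξ₀‖).norm_image_sub_le_of_norm_hasFDerivWithin_le' h2 h3
    (Metric.mem_closedBall_self (norm_nonneg _)) (y := ξ) (by simp [dist_eq_norm])
  rw [pow_two, ← mul_assoc]
  exact this

theorem eta_smooth (hS : IsShrinkingPoint F ξ₀ D.l D.m D.n) : ContDiffAt ℝ 2 (eta F D) ξ₀ :=
  contDiffAt_pi.1 (contDiffAt_cyclePt D.S0_periodic hS.generic_a _) 0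

theorem nu_smooth (hS : IsShrinkingPoint F ξ₀ D.l D.m D.n) : ContDiffAt ℝ 2 (nu F D) ξ₀ :=
  contDiffAt_pi.1 (contDiffAt_cyclePt D.S0_periodic hS.generic_a _) 0

theorem eventually_isCycle_S0 (hS : IsShrinkingPoint F ξ₀ D.l D.m D.n) :
    ∀ᶠ ξ in 𝓝 ξ₀, IsCycle F ξ D.S0 D.n (cyclePt F ξ D.S0 D.n) := by
  have h : ContDiffAt ℝ 2 (fun ξ => (1 - F.MWord ξ (word D.S0 D.n)).det) ξ₀ :=
    contDiffAt_matDet (contDiffAt_const.sub (F.contDiff_MWord _ ξ₀))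
  filter_upwards [h.continuousAt.eventually_ne hS.generic_a] with ξ hξ
  exact isCycle_cyclePt D.n_pos D.S0_periodic hξ

theorem nu_eq {ξ : ℝ × ℝ} (h : IsCycle F ξ D.S0 D.n (cyclePt F ξ D.S0 D.n)) :
    nu F D ξ = cyclePt F ξ D.S0 D.n D.e 0 := by
  rw [nu, tt, h.congr_dvd (j := D.e) (by exact_mod_cast D.dvd_e)]

/-- The first return of the point of index `0` of the cycle. -/
theorem phi_cyclePt_zero {ξ : ℝ × ℝ} (h : IsCycle F ξ D.S0 D.n (cyclePt F ξ D.S0 D.n)) :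
    phi F D ξ (cyclePt F ξ D.S0 D.n 0) =
      cyclePt F ξ D.S0 D.n 0 + nu F D ξ • F.flipVec ξ D.Y := by
  have h1 := h.fWord_zero D.n
  have h2 : cyclePt F ξ D.S0 D.n D.n = cyclePt F ξ D.S0 D.n 0 := h.congr_dvd (by simp)
  have h3 := h.fWord_zero D.e
  have h4 : flipHead D.X = word D.S0 D.e := by
    have h5 := D.word_S0
    rw [D.word_n] at h5
    exact (List.append_inj h5 (by
      rw [length_word, D.flipHead_X, length_word])).1.symm
  rw [← h4] at h3
  rw [D.word_S0, F.fWord_append, h3, h2] at h1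
  rw [phi, D.Smd_eq, F.fWord_append, h3, F.fWord_flipHead_eq, h1, nu_eq h]

/-- Along one period from index `-d`, the word of `S^{(-d)}` differs from the itinerary of the cycle
only when index `0` is passed, where the first coordinate is `η`; the rest of the period is `R⁺`. -/
theorem phi_cyclePt_neg_d {ξ : ℝ × ℝ} (h : IsCycle F ξ D.S0 D.n (cyclePt F ξ D.S0 D.n)) :
    phi F D ξ (cyclePt F ξ D.S0 D.n (-(D.d : ℤ))) =
      cyclePt F ξ D.S0 D.n (-(D.d : ℤ)) - eta F D ξ • F.flipVec ξ D.Rp := by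
  have hdn : D.n = D.d + D.np := by rw [← D.np_add_d]; ring
  have h1 : D.Smd = word (shift D.S0 (-(D.d : ℤ))) D.d ++ D.Rp := by
    rw [RotData.Smd]
    conv_lhs => rw [hdn]
    rw [word_add, shift_shift, neg_add_cancel]
    congr 1
    · apply word_congr
      intro i hi
      have h2 : ¬ (D.n : ℤ) ∣ -(D.d : ℤ) + i := by
        intro h3
        have h4 := Int.eq_zero_of_abs_lt_dvd h3 (by
          have := D.d_lt
          rw [abs_lt]; constructor <;> omega)
        omega
      simp [shift, RotData.S0, flipAt, h2]
    · exact word_congr fun i _ => by simp [shift]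
  have h2 : flipHead D.Rp = word D.S0 D.np := by
    rw [RotData.Rp, flipHead_word]
    apply word_congr
    intro i hi
    have h3 : (D.n : ℤ) ∣ (i : ℤ) - 0 ↔ (i : ℤ) = 0 := by
      rw [sub_zero, D.dvd_iff_eq_zero (hi.trans D.np_lt)]; norm_cast
    simp only [RotData.S0, flipAt, h3]
  have h3 := h.fWord (-(D.d : ℤ)) D.d
  rw [neg_add_cancel] at h3
  have h4 := h.fWord_zero D.np
  have h5 : cyclePt F ξ D.S0 D.n D.np = cyclePt F ξ D.S0 D.n (-(D.d : ℤ)) := by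
    apply h.congr_dvd
    exact ⟨1, by rw [hdn]; push_cast; ring⟩
  rw [← h2, F.fWord_flipHead_eq, h5] at h4
  rw [phi, h1, F.fWord_append, h3]
  exact eq_sub_of_add_eq h4

theorem IsNormal.omega_phi {ξ : ℝ × ℝ} (h : IsNormal F D ξ) (x : Fin N → ℝ) :
    omega F D ξ ⬝ᵥ (phi F D ξ x - x) =
      (lam F D ξ - 1) * (omega F D ξ ⬝ᵥ (x - xInt F D ξ)) + drift F D ξ := by
  have h1 := phi_sub (F := F) (D := D) ξ x (xInt F D ξ)
  rw [sub_eq_iff_eq_add] at h1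
  rw [h1, h.phi_xInt]
  have : Mmd F D ξ *ᵥ (x - xInt F D ξ) + (xInt F D ξ + drift F D ξ • zeta F D ξ) - x =
    Mmd F D ξ *ᵥ (x - xInt F D ξ) - (x - xInt F D ξ) + drift F D ξ • zeta F D ξ := by abel
  rw [this, dotProduct_add, dotProduct_sub, dotProduct_mulVec, h.left, smul_dotProduct,
    dotProduct_smul, h.omega_zeta]
  simp only [smul_eq_mul]
  ring

theorem IsShrinkingPoint.vecMul_Mmd (nf : ∃ ρ, NormalForm F D ξ₀ ρ) :
    omega F D ξ₀ ᵥ* Mmd F D ξ₀ = omega F D ξ₀ ∧ omega F D ξ₀ ⬝ᵥ dirVec F D ξ₀ = 1 := by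
  obtain ⟨ρ, nf⟩ := nf
  have h := nf.normal.self_of_nhds
  refine ⟨?_, by rw [← nf.zeta_eq, h.omega_zeta]⟩
  have := h.left
  rwa [nf.lam_eq, one_smul] at this

variable {ρ : ℝ}

theorem drift_smooth (nf : NormalForm F D ξ₀ ρ) : ContDiffAt ℝ 2 (drift F D) ξ₀ :=
  contDiffAt_dotProduct nf.omega_smooth ((F.contDiff_fWord _ nf.xInt_smooth).sub nf.xInt_smooth)

theorem drift_zero (hS : IsShrinkingPoint F ξ₀ D.l D.m D.n) (nf : NormalForm F D ξ₀ ρ) :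
    drift F D ξ₀ = 0 := by
  rw [drift, nf.xInt_eq, hS.phi_pt_zero, sub_self, dotProduct_zero]

theorem eta_zero (hS : IsShrinkingPoint F ξ₀ D.l D.m D.n) : eta F D ξ₀ = 0 := hS.pt_zero

theorem nu_zero (hS : IsShrinkingPoint F ξ₀ D.l D.m D.n) : nu F D ξ₀ = 0 := by
  rw [nu_eq hS.isCycle_S0, hS.pt_e]

/-- Otherwise `u` would be a left eigenvector of `B` for the eigenvalue `1`. -/
theorem ne_zero_of_left {A B : Matrix (Fin N) (Fin N) ℝ} {u w : Fin N → ℝ} (hu : u ≠ 0)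
    (hA : u ᵥ* A = u) (hd : (1 - B).det ≠ 0) (h : u ⬝ᵥ w = 0 → u ᵥ* B = u ᵥ* A) :
    u ⬝ᵥ w ≠ 0 := by
  intro h0
  apply hu
  apply Matrix.eq_zero_of_vecMul_eq_zero hd
  rw [vecMul_sub, vecMul_one, h h0, hA, sub_self]

/-- Projecting the displacement of the point of index `0` under `φ` to `ω` gives `ν (ω b_Y) = (λ -
1) h + g`, where `h` is the coordinate of that point along `ζ`. Both `λ - 1` and `h` vanish at `ξ₀`,
so their product is of second order. -/
theorem drift_eq_nu (hS : IsShrinkingPoint F ξ₀ D.l D.m D.n) (nf : NormalForm F D ξ₀ ρ) :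
    ∃ α, α ≠ 0 ∧ ∃ C, 0 < C ∧ ∀ᶠ ξ in 𝓝 ξ₀, |drift F D ξ - α * nu F D ξ| ≤ C * ‖ξ - ξ₀‖ ^ 2 := by
  obtain ⟨hω, hωv⟩ := IsShrinkingPoint.vecMul_Mmd ⟨ρ, nf⟩
  refine ⟨omega F D ξ₀ ⬝ᵥ F.flipVec ξ₀ D.Y, ?_, ?_⟩
  · refine ne_zero_of_left (fun h => ?_) hω hS.generic_a fun h0 => ?_
    · rw [h, zero_dotProduct] at hωv; exact zero_ne_one hωv
    · change omega F D ξ₀ ᵥ* F.MWord ξ₀ (word D.S0 D.n) = _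
      rw [Mmd, D.Smd_eq, D.word_S0, F.MWord_append, F.MWord_append, F.MWord_flipHead ξ₀ D.Y,
        Matrix.add_mul, vecMul_add, Matrix.vecMulVec_mul, vecMul_vecMulVec, h0, zero_smul, add_zero]
  · set h : ℝ × ℝ → ℝ := fun ξ => omega F D ξ ⬝ᵥ (cyclePt F ξ D.S0 D.n 0 - xInt F D ξ) with hh
    set a : ℝ × ℝ → ℝ := fun ξ => omega F D ξ ⬝ᵥ F.flipVec ξ D.Y with ha
    have h1 : ContDiffAt ℝ 2 h ξ₀ := contDiffAt_dotProduct nf.omega_smooth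
      ((contDiffAt_cyclePt D.S0_periodic hS.generic_a _).sub nf.xInt_smooth)
    have h2 : ContDiffAt ℝ 2 a ξ₀ := contDiffAt_dotProduct nf.omega_smooth (F.contDiff_flipVec _ _)
    have h0 : h ξ₀ = 0 := by rw [hh]; simp [nf.xInt_eq]
    obtain ⟨C1, hC1, b1⟩ := exists_norm_sub_le h1
    obtain ⟨C2, hC2, b2⟩ := exists_norm_sub_le h2
    obtain ⟨C3, hC3, b3⟩ := exists_norm_sub_le (nu_smooth hS)
    obtain ⟨C4, hC4, b4⟩ := exists_norm_sub_le nf.lam_smooth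
    refine ⟨C3 * C2 + C4 * C1, by positivity, ?_⟩
    filter_upwards [b1, b2, b3, b4, nf.normal, eventually_isCycle_S0 hS] with ξ b1 b2 b3 b4 hn hc
    have h3 := hn.omega_phi (cyclePt F ξ D.S0 D.n 0)
    rw [phi_cyclePt_zero hc, add_sub_cancel_left, dotProduct_smul, smul_eq_mul] at h3
    change nu F D ξ * a ξ = (lam F D ξ - 1) * h ξ + drift F D ξ at h3
    rw [h0, sub_zero] at b1
    rw [nu_zero hS, sub_zero] at b3
    rw [nf.lam_eq] at b4
    rw [Real.norm_eq_abs] at b1 b2 b3 b4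
    have h4 : drift F D ξ - a ξ₀ * nu F D ξ =
        nu F D ξ * (a ξ - a ξ₀) - (lam F D ξ - 1) * h ξ := by linarith
    change |drift F D ξ - a ξ₀ * nu F D ξ| ≤ _
    rw [h4]
    calc _ ≤ |nu F D ξ * (a ξ - a ξ₀)| + |(lam F D ξ - 1) * h ξ| := abs_sub _ _
      _ ≤ (C3 * ‖ξ - ξ₀‖) * (C2 * ‖ξ - ξ₀‖) + (C4 * ‖ξ - ξ₀‖) * (C1 * ‖ξ - ξ₀‖) := by
        rw [abs_mul, abs_mul]; gcongr
      _ = _ := by ring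

/-- The same projection at the point of index `-d`, where `h` tends to `t` instead of `0`: this
measures the drift at the other fixed point of `φ` at `ξ₀`. -/
theorem drift_eq_eta (hS : IsShrinkingPoint F ξ₀ D.l D.m D.n) (nf : NormalForm F D ξ₀ ρ) :
    ∃ α, α ≠ 0 ∧ ∃ C, 0 < C ∧ ∀ᶠ ξ in 𝓝 ξ₀,
      |drift F D ξ + (lam F D ξ - 1) * cyclePt F ξ₀ D.S0 D.n (-(D.d : ℤ)) 0 - α * eta F D ξ| ≤
        C * ‖ξ - ξ₀‖ ^ 2 := by
  obtain ⟨hω, hωv⟩ := IsShrinkingPoint.vecMul_Mmd ⟨ρ, nf⟩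
  refine ⟨-(omega F D ξ₀ ⬝ᵥ F.flipVec ξ₀ D.Rp), neg_ne_zero.2 ?_, ?_⟩
  · refine ne_zero_of_left (B := F.MWord ξ₀ (word (shift D.S0 (-(D.d : ℤ))) D.n)) (fun h => ?_) hω
      (by rw [det_one_sub_shift ξ₀ D.S0 D.n D.S0_periodic]; exact hS.generic_a) fun h0 => ?_
    · rw [h, zero_dotProduct] at hωv; exact zero_ne_one hωv
    · have hdn : D.n = D.d + D.np := by rw [← D.np_add_d]; ring
      obtain ⟨W, hW1, hW2⟩ : ∃ W, D.Smd = W ++ D.Rp ∧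
          word (shift D.S0 (-(D.d : ℤ))) D.n = W ++ flipHead D.Rp := by
        refine ⟨word (shift D.S (-(D.d : ℤ))) D.d, ?_, ?_⟩
        · rw [RotData.Smd]
          conv_lhs => rw [hdn]
          rw [word_add, shift_shift, neg_add_cancel]
          congr 1
          exact word_congr fun i _ => by simp [shift]
        · conv_lhs => rw [hdn]
          rw [word_add, shift_shift, neg_add_cancel]
          congr 1
          · apply word_congr
            intro i hi
            have h2 : ¬ (D.n : ℤ) ∣ -(D.d : ℤ) + i := by
              intro h3
              have h4 := Int.eq_zero_of_abs_lt_dvd h3 (by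
                have := D.d_lt
                rw [abs_lt]; constructor <;> omega)
              omega
            simp [shift, RotData.S0, flipAt, h2]
          · rw [RotData.Rp, flipHead_word]
            apply word_congr
            intro i hi
            have h3 : (D.n : ℤ) ∣ (i : ℤ) - 0 ↔ (i : ℤ) = 0 := by
              rw [sub_zero, D.dvd_iff_eq_zero (hi.trans D.np_lt)]; norm_cast
            simp only [shift, zero_add, RotData.S0, flipAt, h3]
      rw [hW2, Mmd, hW1, F.MWord_append, F.MWord_append, F.MWord_flipHead,
        Matrix.add_mul, vecMul_add, Matrix.vecMulVec_mul, vecMul_vecMulVec, h0, zero_smul, add_zero]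
  · set t := cyclePt F ξ₀ D.S0 D.n (-(D.d : ℤ)) 0 with ht
    set h : ℝ × ℝ → ℝ := fun ξ => omega F D ξ ⬝ᵥ (cyclePt F ξ D.S0 D.n (-(D.d : ℤ)) - xInt F D ξ)
      with hh
    set a : ℝ × ℝ → ℝ := fun ξ => omega F D ξ ⬝ᵥ F.flipVec ξ D.Rp with ha
    have h1 : ContDiffAt ℝ 2 h ξ₀ := contDiffAt_dotProduct nf.omega_smooth
      ((contDiffAt_cyclePt D.S0_periodic hS.generic_a _).sub nf.xInt_smooth)
    have h2 : ContDiffAt ℝ 2 a ξ₀ := contDiffAt_dotProduct nf.omega_smooth (F.contDiff_flipVec _ _)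
    have h0 : h ξ₀ = t := by
      simp only [hh, nf.xInt_eq]
      rw [← hS.smul_dirVec, dotProduct_smul, hωv, smul_eq_mul, mul_one]
    obtain ⟨C1, hC1, b1⟩ := exists_norm_sub_le h1
    obtain ⟨C2, hC2, b2⟩ := exists_norm_sub_le h2
    obtain ⟨C3, hC3, b3⟩ := exists_norm_sub_le (eta_smooth hS)
    obtain ⟨C4, hC4, b4⟩ := exists_norm_sub_le nf.lam_smooth
    refine ⟨C3 * C2 + C4 * C1, by positivity, ?_⟩
    filter_upwards [b1, b2, b3, b4, nf.normal, eventually_isCycle_S0 hS] with ξ b1 b2 b3 b4 hn hc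
    have h3 := hn.omega_phi (cyclePt F ξ D.S0 D.n (-(D.d : ℤ)))
    rw [phi_cyclePt_neg_d hc, sub_sub_cancel_left, dotProduct_neg, dotProduct_smul,
      smul_eq_mul] at h3
    change -(eta F D ξ * a ξ) = (lam F D ξ - 1) * h ξ + drift F D ξ at h3
    rw [h0] at b1
    rw [eta_zero hS, sub_zero] at b3
    rw [nf.lam_eq] at b4
    rw [Real.norm_eq_abs] at b1 b2 b3 b4
    have h4 : drift F D ξ + (lam F D ξ - 1) * t - -a ξ₀ * eta F D ξ =
        -(eta F D ξ * (a ξ - a ξ₀)) - (lam F D ξ - 1) * (h ξ - t) := by linarith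
    change |drift F D ξ + (lam F D ξ - 1) * t - -a ξ₀ * eta F D ξ| ≤ _
    rw [h4]
    calc _ ≤ |-(eta F D ξ * (a ξ - a ξ₀))| + |(lam F D ξ - 1) * (h ξ - t)| := abs_sub _ _
      _ ≤ (C3 * ‖ξ - ξ₀‖) * (C2 * ‖ξ - ξ₀‖) + (C4 * ‖ξ - ξ₀‖) * (C1 * ‖ξ - ξ₀‖) := by
        rw [abs_neg, abs_mul, abs_mul]; gcongr
      _ = _ := by ring

end PWL


namespace PWL

set_option linter.unusedSectionVars false

attribute [local instance] Matrix.linftyOpNormedAddCommGroup Matrix.linftyOpNormedSpace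
  Matrix.linftyOpNormedRing Matrix.linftyOpNormedAlgebra

variable {N : ℕ} [NeZero N] {F : Family N} {D : RotData} {ξ₀ : ℝ × ℝ} {ρ : ℝ}

/-! ### Coordinates along and transverse to the invariant line -/

/-- The component of `x - x^int` along `ζ`. -/
noncomputable def hCoord (F : Family N) (D : RotData) (ξ : ℝ × ℝ) (x : Fin N → ℝ) : ℝ :=
  omega F D ξ ⬝ᵥ (x - xInt F D ξ)

/-- The result of `k` steps of `h ↦ λ h + g`, from `h = t`. -/
noncomputable def affIter (l g t : ℝ) (k : ℕ) : ℝ := l ^ k * t + g * ∑ i ∈ Finset.range k, l ^ i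

theorem affIter_zero (l g t : ℝ) : affIter l g t 0 = t := by simp [affIter]

theorem affIter_succ (l g t : ℝ) (k : ℕ) : affIter l g t (k + 1) = l * affIter l g t k + g := by
  simp only [affIter]
  rw [geom_sum_succ]
  ring

theorem affIter_add (l g t : ℝ) (j k : ℕ) :
    affIter l g t (k + j) = affIter l g (affIter l g t k) j := by
  induction j with
  | zero => rw [affIter_zero, add_zero]
  | succ j ih => rw [← add_assoc, affIter_succ, affIter_succ, ih]

theorem affIter_sub (l g t t' : ℝ) (k : ℕ) :
    affIter l g t k - affIter l g t' k = l ^ k * (t - t') := by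
  simp only [affIter]; ring

theorem decomp (ξ : ℝ × ℝ) (x : Fin N → ℝ) :
    x = xInt F D ξ + hCoord F D ξ x • zeta F D ξ + qPart F D ξ x := by
  rw [qPart, hCoord]; abel

namespace IsNormal

variable {ξ : ℝ × ℝ}

theorem hCoord_phi (h : IsNormal F D ξ) (x : Fin N → ℝ) :
    hCoord F D ξ (phi F D ξ x) = lam F D ξ * hCoord F D ξ x + drift F D ξ := by
  have h1 := h.omega_phi x
  have h2 : phi F D ξ x - xInt F D ξ = (phi F D ξ x - x) + (x - xInt F D ξ) := by abel
  rw [hCoord, h2, dotProduct_add, h1, hCoord]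
  ring

theorem omega_qPart (h : IsNormal F D ξ) (x : Fin N → ℝ) :
    omega F D ξ ⬝ᵥ qPart F D ξ x = 0 := by
  rw [qPart, dotProduct_sub, dotProduct_smul, h.omega_zeta, smul_eq_mul, mul_one, sub_self]

theorem transv_mulVec (x : Fin N → ℝ) (hx : omega F D ξ ⬝ᵥ x = 0) :
    transv F D ξ *ᵥ x = Mmd F D ξ *ᵥ x := by
  rw [transv, sub_mulVec, smul_mulVec, vecMulVec_mulVec, hx]
  simp

theorem qPart_phi (h : IsNormal F D ξ) (x : Fin N → ℝ) :
    qPart F D ξ (phi F D ξ x) = Mmd F D ξ *ᵥ qPart F D ξ x := by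
  have h0 := h.hCoord_phi x
  simp only [hCoord] at h0
  have h1 := phi_sub (F := F) (D := D) ξ x (xInt F D ξ)
  rw [sub_eq_iff_eq_add, h.phi_xInt] at h1
  rw [qPart, h0, qPart, mulVec_sub, mulVec_smul, h.right, h1]
  ext i
  simp
  ring

theorem hCoord_iterate (h : IsNormal F D ξ) (x : Fin N → ℝ) (i : ℕ) :
    hCoord F D ξ ((phi F D ξ)^[i] x) =
      affIter (lam F D ξ) (drift F D ξ) (hCoord F D ξ x) i := by
  induction i with
  | zero => rw [affIter_zero]; rfl
  | succ i ih => rw [Function.iterate_succ_apply', h.hCoord_phi, ih, affIter_succ]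

theorem qPart_iterate (h : IsNormal F D ξ) (x : Fin N → ℝ) (i : ℕ) :
    qPart F D ξ ((phi F D ξ)^[i] x) = transv F D ξ ^ i *ᵥ qPart F D ξ x := by
  induction i with
  | zero => simp
  | succ i ih =>
    rw [Function.iterate_succ_apply', h.qPart_phi, ← transv_mulVec _ (h.omega_qPart _), ih,
      mulVec_mulVec, pow_succ']

theorem fWord_zero_coord (W : List Side) (ξ : ℝ × ℝ) (x : Fin N → ℝ) :
    F.fWord ξ W x 0 = F.fWord ξ W (xInt F D ξ) 0 +
      hCoord F D ξ x * (F.MWord ξ W *ᵥ zeta F D ξ) 0 + (F.MWord ξ W *ᵥ qPart F D ξ x) 0 := by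
  have h1 := F.fWord_sub ξ W x (xInt F D ξ)
  rw [sub_eq_iff_eq_add] at h1
  have h2 : x - xInt F D ξ = hCoord F D ξ x • zeta F D ξ + qPart F D ξ x := by
    rw [qPart, hCoord]; abel
  rw [h1, h2, mulVec_add, mulVec_smul]
  simp only [Pi.add_apply, Pi.smul_apply, smul_eq_mul]
  ring

end IsNormal

theorem eventually_norm_le {V : Type*} [NormedAddCommGroup V] [NormedSpace ℝ V]
    {f : ℝ × ℝ → V} (hf : ContDiffAt ℝ 2 f ξ₀) : ∀ᶠ ξ in 𝓝 ξ₀, ‖f ξ‖ ≤ ‖f ξ₀‖ + 1 :=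
  (hf.continuousAt.norm.eventually_lt continuousAt_const (by linarith [norm_nonneg (f ξ₀)])).mono
    fun _ h => le_of_lt h

theorem abs_dotProduct_le (u x : Fin N → ℝ) : |u ⬝ᵥ x| ≤ N * ‖u‖ * ‖x‖ := by
  rw [dotProduct]
  refine (Finset.abs_sum_le_sum_abs _ _).trans ?_
  have : ∀ i ∈ Finset.univ, |u i * x i| ≤ ‖u‖ * ‖x‖ := fun i _ => by
    rw [abs_mul]
    exact mul_le_mul (norm_le_pi_norm u i) (norm_le_pi_norm x i) (abs_nonneg _) (norm_nonneg _)
  refine (Finset.sum_le_sum this).trans ?_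
  simp [mul_assoc]

/-- Bounds for the normal form that are uniform near the shrinking point. -/
structure NormalBounds (F : Family N) (D : RotData) (ξ₀ : ℝ × ℝ) (r C : ℝ) (ξ : ℝ × ℝ) :
    Prop where
  normal : IsNormal F D ξ
  lam_le : |lam F D ξ - 1| ≤ C * ‖ξ - ξ₀‖
  lam_half : |lam F D ξ - 1| ≤ 1 / 2
  drift_le : |drift F D ξ| ≤ C * ‖ξ - ξ₀‖
  zeta_le : ‖zeta F D ξ‖ ≤ C
  omega_le : ∀ x : Fin N → ℝ, |omega F D ξ ⬝ᵥ x| ≤ C * ‖x‖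
  qPart_le : ∀ x : Fin N → ℝ, ‖qPart F D ξ x‖ ≤ C * ‖x - xInt F D ξ‖
  pow_le : ∀ (j : ℕ) (x : Fin N → ℝ), ‖transv F D ξ ^ j *ᵥ x‖ ≤ C * r ^ j * ‖x‖

theorem exists_normalBounds (hS : IsShrinkingPoint F ξ₀ D.l D.m D.n) (nf : NormalForm F D ξ₀ ρ)
    (hρ0 : 0 ≤ ρ) {r : ℝ} (hr : ρ < r) :
    ∃ C, 1 ≤ C ∧ ∀ᶠ ξ in 𝓝 ξ₀, NormalBounds F D ξ₀ r C ξ := by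
  obtain ⟨C1, hC1, b1⟩ := exists_norm_sub_le nf.lam_smooth
  obtain ⟨C2, hC2, b2⟩ := exists_norm_sub_le (drift_smooth nf)
  obtain ⟨C3, hC3, b3⟩ := nf.pow_le
  set Z := ‖zeta F D ξ₀‖ + 1
  set O := ‖omega F D ξ₀‖ + 1
  have hZ : 0 ≤ Z := by positivity
  have hO : 0 ≤ O := by positivity
  have hsmall : ∀ᶠ ξ in 𝓝 ξ₀, ρ + C3 * ‖ξ - ξ₀‖ < r := by
    have h1 : ContinuousAt (fun ξ : ℝ × ℝ => ρ + C3 * ‖ξ - ξ₀‖) ξ₀ := by fun_prop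
    exact h1.eventually_lt continuousAt_const (by simpa using hr)
  have hhalf : ∀ᶠ ξ in 𝓝 ξ₀, |lam F D ξ - 1| < 1 / 2 :=
    (nf.lam_smooth.continuousAt.sub continuousAt_const).abs.eventually_lt continuousAt_const
      (by simp [nf.lam_eq])
  have hN : (0 : ℝ) ≤ N * O := by positivity
  refine ⟨C1 + C2 + C3 + Z + N * O + (1 + N * O * Z), by
    have : 0 ≤ N * O * Z := by positivity
    linarith, ?_⟩
  have hNOZ : 0 ≤ N * O * Z := by positivity
  filter_upwards [b1, b2, b3, hsmall, hhalf, nf.normal, eventually_norm_le nf.zeta_smooth,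
    eventually_norm_le nf.omega_smooth] with ξ b1 b2 b3 hsm hh hn hz ho
  have hδ := norm_nonneg (ξ - ξ₀)
  have hom : ∀ x : Fin N → ℝ, |omega F D ξ ⬝ᵥ x| ≤ N * O * ‖x‖ := fun x =>
    (abs_dotProduct_le _ _).trans (by gcongr)
  refine ⟨hn, ?_, hh.le, ?_, by linarith, fun x => (hom x).trans ?_, fun x => ?_, fun j x => ?_⟩
  · rw [nf.lam_eq, Real.norm_eq_abs] at b1
    exact b1.trans (mul_le_mul_of_nonneg_right (by linarith) hδ)
  · rw [drift_zero hS nf, sub_zero, Real.norm_eq_abs] at b2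
    exact b2.trans (mul_le_mul_of_nonneg_right (by linarith) hδ)
  · exact mul_le_mul_of_nonneg_right (by linarith) (norm_nonneg _)
  · rw [qPart]
    refine (norm_sub_le _ _).trans ?_
    rw [norm_smul, Real.norm_eq_abs]
    have h1 : |omega F D ξ ⬝ᵥ (x - xInt F D ξ)| * ‖zeta F D ξ‖ ≤
        N * O * ‖x - xInt F D ξ‖ * Z := by
      gcongr
      exact hom _
    have h2 : ‖x - xInt F D ξ‖ + |omega F D ξ ⬝ᵥ (x - xInt F D ξ)| * ‖zeta F D ξ‖ ≤
        (1 + N * O * Z) * ‖x - xInt F D ξ‖ := by linarith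
    exact h2.trans (mul_le_mul_of_nonneg_right (by linarith) (norm_nonneg _))
  · refine (Matrix.linfty_opNorm_mulVec _ _).trans ?_
    refine mul_le_mul_of_nonneg_right ?_ (norm_nonneg _)
    have h1 : 0 ≤ ρ + C3 * ‖ξ - ξ₀‖ := by positivity
    refine (b3 j).trans ?_
    refine mul_le_mul (by linarith) (pow_le_pow_left₀ h1 hsm.le j) (pow_nonneg h1 j) ?_
    linarith

/-- A word whose map sends the point of index `0` of the cycle to the point of index `-d`. -/
theorem exists_word_bounds (hS : IsShrinkingPoint F ξ₀ D.l D.m D.n) (nf : NormalForm F D ξ₀ ρ)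
    (hρ0 : 0 ≤ ρ) (V : List Side)
    (hV : F.fWord ξ₀ V (cyclePt F ξ₀ D.S0 D.n 0) = cyclePt F ξ₀ D.S0 D.n (-(D.d : ℤ))) :
    ∃ C, 1 ≤ C ∧ ∀ᶠ ξ in 𝓝 ξ₀, (∀ x,
      |hCoord F D ξ (F.fWord ξ V x) - cyclePt F ξ₀ D.S0 D.n (-(D.d : ℤ)) 0| ≤
        C * (‖ξ - ξ₀‖ + ‖x - xInt F D ξ‖) ∧
      ‖qPart F D ξ (F.fWord ξ V x)‖ ≤ C * (‖ξ - ξ₀‖ + ‖x - xInt F D ξ‖)) ∧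
      (∀ x, ‖F.MWord ξ V *ᵥ x‖ ≤ C * ‖x‖) := by
  obtain ⟨C0, hC0, b0⟩ := exists_normalBounds hS nf hρ0 (lt_add_one ρ)
  have hxs : ContDiffAt ℝ 2 (fun ξ => F.fWord ξ V (xInt F D ξ) - xInt F D ξ) ξ₀ :=
    (F.contDiff_fWord _ nf.xInt_smooth).sub nf.xInt_smooth
  have h1 : ContDiffAt ℝ 2 (fun ξ => omega F D ξ ⬝ᵥ (F.fWord ξ V (xInt F D ξ) - xInt F D ξ)) ξ₀ :=
    contDiffAt_dotProduct nf.omega_smooth hxs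
  have h2 : ContDiffAt ℝ 2 (fun ξ => qPart F D ξ (F.fWord ξ V (xInt F D ξ))) ξ₀ :=
    hxs.sub (h1.smul nf.zeta_smooth)
  obtain ⟨C1, hC1, b1⟩ := exists_norm_sub_le h1
  obtain ⟨C2, hC2, b2⟩ := exists_norm_sub_le h2
  obtain ⟨hω, hωv⟩ := IsShrinkingPoint.vecMul_Mmd ⟨ρ, nf⟩
  set t := cyclePt F ξ₀ D.S0 D.n (-(D.d : ℤ)) 0 with ht
  have e1 : omega F D ξ₀ ⬝ᵥ (F.fWord ξ₀ V (xInt F D ξ₀) - xInt F D ξ₀) = t := by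
    rw [nf.xInt_eq, hV, ← hS.smul_dirVec, dotProduct_smul, hωv, smul_eq_mul, mul_one]
  have e2 : qPart F D ξ₀ (F.fWord ξ₀ V (xInt F D ξ₀)) = 0 := by
    rw [qPart, e1, nf.xInt_eq, hV, nf.zeta_eq, hS.smul_dirVec, sub_self]
  set m := ‖F.MWord ξ₀ V‖ + 1 with hm
  have hm0 : 1 ≤ m := by rw [hm]; linarith [norm_nonneg (F.MWord ξ₀ V)]
  have hCm : 1 ≤ C0 * m := by nlinarith
  refine ⟨C1 + C2 + C0 * m, by linarith, ?_⟩
  filter_upwards [b0, b1, b2, eventually_norm_le (F.contDiff_MWord V ξ₀)] with ξ b0 b1 b2 b3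
  have hδ := norm_nonneg (ξ - ξ₀)
  have hMx : ∀ x, ‖F.MWord ξ V *ᵥ x‖ ≤ m * ‖x‖ := fun x =>
    (Matrix.linfty_opNorm_mulVec _ _).trans (mul_le_mul_of_nonneg_right b3 (norm_nonneg _))
  rw [e1, Real.norm_eq_abs] at b1
  rw [e2, sub_zero] at b2
  refine ⟨fun x => ?_, fun x => (hMx x).trans (mul_le_mul_of_nonneg_right (by nlinarith)
    (norm_nonneg _))⟩
  set y := x - xInt F D ξ
  have hy := norm_nonneg y
  have h3 : F.fWord ξ V x = F.fWord ξ V (xInt F D ξ) + F.MWord ξ V *ᵥ y := by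
    rw [← F.fWord_sub]; abel
  have h4 : hCoord F D ξ (F.fWord ξ V x) = hCoord F D ξ (F.fWord ξ V (xInt F D ξ)) +
      omega F D ξ ⬝ᵥ F.MWord ξ V *ᵥ y := by
    rw [hCoord, hCoord, h3, ← dotProduct_add]; congr 1; abel
  have h5 : ‖F.MWord ξ V *ᵥ y‖ ≤ m * ‖y‖ := hMx y
  constructor
  · have h6 : |omega F D ξ ⬝ᵥ F.MWord ξ V *ᵥ y| ≤ C0 * (m * ‖y‖) :=
      (b0.omega_le _).trans (mul_le_mul_of_nonneg_left h5 (by linarith))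
    rw [h4, add_sub_right_comm]
    refine (abs_add_le _ _).trans ((add_le_add b1 h6).trans ?_)
    nlinarith [mul_nonneg hC2.le hδ, mul_nonneg hC1.le hy, mul_nonneg hC2.le hy,
      mul_nonneg (by linarith : 0 ≤ C0 * m) hδ]
  · have h7 : qPart F D ξ (F.fWord ξ V x) = qPart F D ξ (F.fWord ξ V (xInt F D ξ)) +
        qPart F D ξ (xInt F D ξ + F.MWord ξ V *ᵥ y) := by
      simp only [hCoord] at h4
      rw [qPart, h4, h3, qPart, qPart, add_sub_cancel_left, add_smul]
      abel
    have h8 := b0.qPart_le (xInt F D ξ + F.MWord ξ V *ᵥ y)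
    rw [add_sub_cancel_left] at h8
    rw [h7]
    refine (norm_add_le _ _).trans ((add_le_add b2 (h8.trans
      (mul_le_mul_of_nonneg_left h5 (by linarith)))).trans ?_)
    nlinarith [mul_nonneg hC1.le hδ, mul_nonneg hC1.le hy, mul_nonneg hC2.le hy,
      mul_nonneg (by linarith : 0 ≤ C0 * m) hδ]

/-- A word whose map sends the point of index `0` of the cycle to the switching manifold. -/
theorem exists_coord_bounds (nf : NormalForm F D ξ₀ ρ) (W : List Side)
    (hW : F.fWord ξ₀ W (cyclePt F ξ₀ D.S0 D.n 0) 0 = 0) :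
    ∃ C, 1 ≤ C ∧ ∀ᶠ ξ in 𝓝 ξ₀, |F.fWord ξ W (xInt F D ξ) 0| ≤ C * ‖ξ - ξ₀‖ ∧
      |(F.MWord ξ W *ᵥ zeta F D ξ) 0 - (F.MWord ξ₀ W *ᵥ dirVec F D ξ₀) 0| ≤ C * ‖ξ - ξ₀‖ ∧
      ∀ x, |(F.MWord ξ W *ᵥ x) 0| ≤ C * ‖x‖ := by
  obtain ⟨C1, hC1, b1⟩ := exists_norm_sub_le
    (contDiffAt_pi.1 (F.contDiff_fWord W nf.xInt_smooth) 0)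
  obtain ⟨C2, hC2, b2⟩ := exists_norm_sub_le
    (contDiffAt_pi.1 (contDiffAt_mulVec (F.contDiff_MWord W ξ₀) nf.zeta_smooth) 0)
  refine ⟨C1 + C2 + (‖F.MWord ξ₀ W‖ + 1), by linarith [norm_nonneg (F.MWord ξ₀ W)], ?_⟩
  filter_upwards [b1, b2, eventually_norm_le (F.contDiff_MWord W ξ₀)] with ξ b1 b2 b3
  have h0 := norm_nonneg (F.MWord ξ₀ W)
  rw [nf.xInt_eq, hW, sub_zero, Real.norm_eq_abs] at b1
  rw [nf.zeta_eq, Real.norm_eq_abs] at b2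
  refine ⟨b1.trans (mul_le_mul_of_nonneg_right (by linarith) (norm_nonneg _)),
    b2.trans (mul_le_mul_of_nonneg_right (by linarith) (norm_nonneg _)), fun x => ?_⟩
  refine (norm_le_pi_norm (F.MWord ξ W *ᵥ x) 0).trans ((Matrix.linfty_opNorm_mulVec _ _).trans ?_)
  exact mul_le_mul_of_nonneg_right (by linarith) (norm_nonneg _)

theorem lam_pos {r C : ℝ} {ξ : ℝ × ℝ} (h : NormalBounds F D ξ₀ r C ξ) :
    1 / 2 ≤ lam F D ξ ∧ lam F D ξ ≤ 3 / 2 := by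
  have := abs_le.1 h.lam_half
  constructor <;> linarith [this.1, this.2]

theorem norm_sub_xInt_le {r C : ℝ} {ξ : ℝ × ℝ} (h : NormalBounds F D ξ₀ r C ξ) (x : Fin N → ℝ) :
    ‖x - xInt F D ξ‖ ≤ C * |hCoord F D ξ x| + ‖qPart F D ξ x‖ := by
  have h2 : x - xInt F D ξ = hCoord F D ξ x • zeta F D ξ + qPart F D ξ x := by
    rw [qPart, hCoord]; abel
  calc ‖x - xInt F D ξ‖ = ‖hCoord F D ξ x • zeta F D ξ + qPart F D ξ x‖ := by rw [← h2]
    _ ≤ ‖hCoord F D ξ x • zeta F D ξ‖ + ‖qPart F D ξ x‖ := norm_add_le _ _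
    _ ≤ _ := by
      rw [norm_smul, Real.norm_eq_abs, mul_comm]
      exact add_le_add (mul_le_mul_of_nonneg_right h.zeta_le (abs_nonneg _)) le_rfl

end PWL


namespace PWL

set_option linter.unusedSectionVars false

attribute [local instance] Matrix.linftyOpNormedAddCommGroup Matrix.linftyOpNormedSpace
  Matrix.linftyOpNormedRing Matrix.linftyOpNormedAlgebra

variable {N : ℕ} [NeZero N] {F : Family N} {D : RotData} {ξ₀ : ℝ × ℝ} {ρ : ℝ}

/-! ### Consequences of the existence of a cycle near the shrinking point -/

-- Between the iterates `K - 1` and `K` of `w` the function `ε f^W(·)₀` passes from nonpositive to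
-- nonnegative. It is affine with nonzero slope in `h`, so `h(z)` is bounded by `δ = ‖ξ - ξ₀‖` plus
-- transverse parts, and these are absorbed by contraction over many steps. As `V` sends `z` back to
-- `w` near the point of index `-d`, also `h(w) - t = O(δ)`. Comparing the `K` steps from `h(w)` to
-- `h(z)` with those from `t` gives the estimate.
set_option maxHeartbeats 600000 in
theorem cycle_bound (hS : IsShrinkingPoint F ξ₀ D.l D.m D.n) (nf : NormalForm F D ξ₀ ρ)
    (hρ0 : 0 ≤ ρ) (hρ1 : ρ < 1) {V W : List Side} {ε : ℝ} (hε : |ε| = 1)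
    (hV : F.fWord ξ₀ V (cyclePt F ξ₀ D.S0 D.n 0) = cyclePt F ξ₀ D.S0 D.n (-(D.d : ℤ)))
    (hW : F.fWord ξ₀ W (cyclePt F ξ₀ D.S0 D.n 0) 0 = 0)
    (hm : ε * (F.MWord ξ₀ W *ᵥ dirVec F D ξ₀) 0 < 0) :
    ∃ (C : ℝ) (K₀ : ℕ), 1 ≤ C ∧ ∀ᶠ ξ in 𝓝 ξ₀, ∀ K : ℕ, K₀ ≤ K → ∀ z w : Fin N → ℝ,
      w = F.fWord ξ V z → (phi F D ξ)^[K] w = z → 0 ≤ ε * F.fWord ξ W z 0 →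
      ε * F.fWord ξ W ((phi F D ξ)^[K - 1] w) 0 ≤ 0 →
      |affIter (lam F D ξ) (drift F D ξ) (cyclePt F ξ₀ D.S0 D.n (-(D.d : ℤ)) 0) K| ≤
        C * ‖ξ - ξ₀‖ * (1 + lam F D ξ ^ K) := by
  set t := cyclePt F ξ₀ D.S0 D.n (-(D.d : ℤ)) 0 with ht
  set r := (1 + ρ) / 2 with hr
  obtain ⟨A, hA, bA⟩ := exists_normalBounds hS nf hρ0 (r := r) (by linarith)
  obtain ⟨B, hB, bB⟩ := exists_word_bounds hS nf hρ0 V hV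
  obtain ⟨E, hE, bE⟩ := exists_coord_bounds nf W hW
  set μ := -(ε * (F.MWord ξ₀ W *ᵥ dirVec F D ξ₀) 0) with hμ
  have hμ0 : 0 < μ := by linarith
  set G := 2 * E / μ with hG
  have hG0 : 0 < G := by positivity
  set C1 := 2 * G + A with hC1
  have hC10 : 0 < C1 := by positivity
  set C2 := B * (1 + A * C1) + B with hC2
  have hC20 : 0 < C2 := by positivity
  set C3 := B * (1 + A * (2 * C1) + 1) with hC3
  have hC30 : 0 < C3 := by positivity
  have hr0 : 0 ≤ r := by linarith
  -- The transverse part of `w` is at most `C2 (δ + qz + qy)`. With contraction by `1 / (4 C2)` each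
  -- of `qz` and `qy` is at most a quarter of `δ + qz + qy`, whence `qz + qy ≤ δ`. The hypothesis
  -- uses `K₀ + 1` since `y` is reached one step earlier.
  obtain ⟨K₀, hK₀⟩ : ∃ K₀ : ℕ, ∀ K, K₀ ≤ K → A * r ^ K ≤ 1 / (4 * C2) := by
    have h1 : Tendsto (fun K : ℕ => A * r ^ K) atTop (𝓝 (A * 0)) :=
      (tendsto_pow_atTop_nhds_zero_of_lt_one hr0 (by linarith)).const_mul A
    rw [mul_zero] at h1
    have h2 : (0 : ℝ) < 1 / (4 * C2) := by positivity
    obtain ⟨K₀, h⟩ := eventually_atTop.1 (h1.eventually_le_const h2)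
    exact ⟨K₀, h⟩
  have hsm : ∀ᶠ ξ in 𝓝 ξ₀, E * ‖ξ - ξ₀‖ < μ / 2 := by
    have h1 : ContinuousAt (fun ξ : ℝ × ℝ => E * ‖ξ - ξ₀‖) ξ₀ := by fun_prop
    exact h1.eventually_lt continuousAt_const (by simpa using hμ0)
  refine ⟨2 * C1 + C3 + 1, K₀ + 1, by linarith, ?_⟩
  filter_upwards [bA, bB, bE, hsm] with ξ bA bB bE hsm K hK z w hw hz hz0 hz1
  obtain ⟨j, rfl⟩ : ∃ j, K = j + 1 := ⟨K - 1, by omega⟩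
  rw [Nat.add_sub_cancel] at hz1
  have hδ := norm_nonneg (ξ - ξ₀)
  have hdl := bA.drift_le
  set δ := ‖ξ - ξ₀‖ with hδd
  clear_value δ C1 C2 C3 G μ r
  set y := (phi F D ξ)^[j] w with hy
  have hyz : phi F D ξ y = z := by
    rw [hy, ← Function.iterate_succ_apply' (phi F D ξ), hz]
  set l := lam F D ξ
  set g := drift F D ξ
  have hl := lam_pos bA
  have hn := bA.normal
  -- slopes
  set σ := (F.MWord ξ W *ᵥ zeta F D ξ) 0 with hσ
  have hσμ : ε * σ ≤ -(μ / 2) := by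
    have h1 : |ε * (σ - (F.MWord ξ₀ W *ᵥ dirVec F D ξ₀) 0)| ≤ E * δ := by
      rw [abs_mul, hε, one_mul]; exact bE.2.1
    have h2 := (abs_le.1 h1).2
    rw [mul_sub] at h2
    linarith
  have habs : ∀ a : ℝ, ε * a ≤ |a| := fun a => by
    have := le_abs_self (ε * a); rwa [abs_mul, hε, one_mul] at this
  have habs' : ∀ a : ℝ, -|a| ≤ ε * a := fun a => by
    have := neg_abs_le (ε * a); rwa [abs_mul, hε, one_mul] at this
  have hs : ∀ x, ε * F.fWord ξ W x 0 ≤ E * (δ + ‖qPart F D ξ x‖) + hCoord F D ξ x * (ε * σ) ∧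
      -(E * (δ + ‖qPart F D ξ x‖)) + hCoord F D ξ x * (ε * σ) ≤ ε * F.fWord ξ W x 0 := by
    intro x
    rw [IsNormal.fWord_zero_coord W ξ x, mul_add, mul_add]
    have h1 := bE.1
    have h2 := bE.2.2 (qPart F D ξ x)
    have h3 := habs (F.fWord ξ W (xInt F D ξ) 0)
    have h4 := habs ((F.MWord ξ W *ᵥ qPart F D ξ x) 0)
    have h5 := habs' (F.fWord ξ W (xInt F D ξ) 0)
    have h6 := habs' ((F.MWord ξ W *ᵥ qPart F D ξ x) 0)
    constructor <;> nlinarith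
  have hdiv : ∀ a b : ℝ, 0 ≤ b → a * (μ / 2) ≤ E * b → a ≤ G * b := by
    intro a b _ h
    rw [hG, div_mul_eq_mul_div, le_div_iff₀ hμ0]; linarith
  set qz := ‖qPart F D ξ z‖ with hqz
  set qy := ‖qPart F D ξ y‖ with hqy
  have hqz0 : 0 ≤ qz := norm_nonneg _
  have hqy0 : 0 ≤ qy := norm_nonneg _
  clear_value qz qy
  have h1 : hCoord F D ξ z ≤ G * (δ + qz) := by
    rcases le_or_gt (hCoord F D ξ z) 0 with h | h
    · exact h.trans (by positivity)
    · apply hdiv _ _ (by positivity)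
      have := (hs z).1
      nlinarith
  have h2 : -(G * (δ + qy)) ≤ hCoord F D ξ y := by
    rcases le_or_gt 0 (hCoord F D ξ y) with h | h
    · have : 0 ≤ G * (δ + qy) := by positivity
      linarith
    · have := hdiv (-hCoord F D ξ y) (δ + qy) (by positivity) (by
        have := (hs y).2
        nlinarith)
      linarith
  have h3 : hCoord F D ξ z = l * hCoord F D ξ y + g := by rw [← hyz, hn.hCoord_phi]
  have hg := abs_le.1 hdl
  have h4 : |hCoord F D ξ z| ≤ C1 * (δ + qz + qy) := by
    have e1 : 0 ≤ G * qz := by positivity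
    have e2 : 0 ≤ G * qy := by positivity
    have e3 : 0 ≤ G * δ := by positivity
    have e4 : 0 ≤ A * qz := by positivity
    have e5 : 0 ≤ A * qy := by positivity
    have e6 : 0 ≤ A * δ := by positivity
    have e7 : C1 * (δ + qz + qy) = 2 * (G * δ) + 2 * (G * qy) + 2 * (G * qz) + A * δ + A * qz +
      A * qy := by rw [hC1]; ring
    rw [mul_add] at h1 h2
    rw [abs_le, e7]
    constructor
    · have h2' : -(2 * (G * δ + G * qy)) ≤ l * hCoord F D ξ y := by
        have e8 : l * -(G * δ + G * qy) ≤ l * hCoord F D ξ y :=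
          mul_le_mul_of_nonneg_left h2 (by linarith [hl.1])
        have e9 : l * (G * δ + G * qy) ≤ 2 * (G * δ + G * qy) :=
          mul_le_mul_of_nonneg_right (by linarith [hl.2]) (by linarith)
        linarith
      rw [h3]
      linarith [hg.1]
    · linarith
  set Q := ‖qPart F D ξ w‖ with hQ
  have hQ0 : 0 ≤ Q := norm_nonneg _
  have hx := norm_sub_xInt_le bA z
  have h5 : ‖z - xInt F D ξ‖ ≤ A * (C1 * (δ + qz + qy)) + qz :=
    hx.trans (add_le_add (mul_le_mul_of_nonneg_left h4 (by linarith)) hqz.ge)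
  have h6 : Q ≤ C2 * (δ + qz + qy) := by
    have := (bB.1 z).2
    rw [← hw] at this
    have h7 : B * (δ + ‖z - xInt F D ξ‖) ≤ B * (δ + (A * (C1 * (δ + qz + qy)) + qz)) := by gcongr
    have e1 : 0 ≤ B * qz := by positivity
    have e2 : 0 ≤ B * qy := by positivity
    have e3 : 0 ≤ B * δ := by positivity
    have e4 : C2 * (δ + qz + qy) = B * (δ + (A * (C1 * (δ + qz + qy)) + qz)) + B * δ + B * qz +
      2 * (B * qy) := by rw [hC2]; ring
    rw [e4]
    linarith
  have hpow : ∀ i, K₀ ≤ i → ‖qPart F D ξ ((phi F D ξ)^[i] w)‖ ≤ 1 / (4 * C2) * Q := by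
    intro i hi
    rw [hn.qPart_iterate]
    exact (bA.pow_le i _).trans (mul_le_mul_of_nonneg_right (hK₀ i hi) hQ0)
  have h7 : qy ≤ 1 / (4 * C2) * Q := by rw [hqy, hy]; exact hpow j (by omega)
  have h8 : qz ≤ 1 / (4 * C2) * Q := by rw [hqz, ← hz]; exact hpow (j + 1) (by omega)
  have h9 : qz + qy ≤ δ := by
    have e1 : 1 / (4 * C2) * Q ≤ (δ + qz + qy) / 4 := by
      rw [div_mul_eq_mul_div, one_mul, div_le_div_iff₀ (by positivity) (by norm_num)]
      linarith
    linarith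
  have h10 : |hCoord F D ξ z| ≤ 2 * C1 * δ :=
    h4.trans (by
      rw [mul_comm 2 C1, mul_assoc]
      exact mul_le_mul_of_nonneg_left (by linarith) hC10.le)
  have h11 : |hCoord F D ξ w - t| ≤ C3 * δ := by
    have := (bB.1 z).1
    rw [← hw] at this
    refine this.trans ?_
    have h12 : ‖z - xInt F D ξ‖ ≤ A * (2 * C1 * δ) + δ :=
      hx.trans (add_le_add (mul_le_mul_of_nonneg_left h10 (by linarith)) (by rw [← hqz]; linarith))
    have h13 : B * (δ + ‖z - xInt F D ξ‖) ≤ B * (δ + (A * (2 * C1 * δ) + δ)) := by gcongr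
    rw [hC3]
    linarith
  have h12 := hn.hCoord_iterate w (j + 1)
  rw [hz] at h12
  have h13 := affIter_sub l g t (hCoord F D ξ w) (j + 1)
  rw [← h12, sub_eq_iff_eq_add] at h13
  have hlp : 0 ≤ l ^ (j + 1) := pow_nonneg (by linarith [hl.1]) _
  rw [h13]
  refine (abs_add_le _ _).trans ?_
  rw [abs_mul, abs_of_nonneg hlp, abs_sub_comm]
  have h14 : l ^ (j + 1) * |hCoord F D ξ w - t| ≤ l ^ (j + 1) * (C3 * δ) := by gcongr
  have h15 : (2 * C1 + C3 + 1) * δ * (1 + l ^ (j + 1)) = l ^ (j + 1) * (C3 * δ) + 2 * C1 * δ +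
      (C3 * δ + δ + (2 * C1 * δ + δ) * l ^ (j + 1)) := by ring
  have h16 : 0 ≤ C3 * δ + δ + (2 * C1 * δ + δ) * l ^ (j + 1) := by positivity
  rw [h15]
  linarith

-- Split `y = M_V x`, for an eigenvector `x`, into its parts along `ζ` and transverse to it. After
-- `K` steps only the part along `ζ` survives, so the eigenvalue equation becomes `ε = λ^K ωᵀ M_V ζ`
-- up to a small relative error. Thus `λ^K` is close to `1/|κ|`, where `κ` is the value of `ωᵀ M_V
-- ζ` at `ξ₀`.
set_option maxHeartbeats 600000 in
theorem eigenvalue_bound (hS : IsShrinkingPoint F ξ₀ D.l D.m D.n) (nf : NormalForm F D ξ₀ ρ)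
    (hρ0 : 0 ≤ ρ) (hρ1 : ρ < 1) {V : List Side}
    (hV : F.fWord ξ₀ V (cyclePt F ξ₀ D.S0 D.n 0) = cyclePt F ξ₀ D.S0 D.n (-(D.d : ℤ)))
    (hκ : omega F D ξ₀ ⬝ᵥ F.MWord ξ₀ V *ᵥ dirVec F D ξ₀ ≠ 0) :
    ∃ (y C : ℝ) (K₀ : ℕ), 0 < y ∧ 1 ≤ C ∧ ∀ᶠ ξ in 𝓝 ξ₀, ∀ K : ℕ, K₀ ≤ K → ∀ ε : ℝ, |ε| = 1 →
      (F.MWord ξ (V ++ (List.replicate K D.Smd).flatten)).charpoly.IsRoot ε →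
      |lam F D ξ ^ K - y| ≤ C * (‖ξ - ξ₀‖ + ((1 + ρ) / 2) ^ K) := by
  set r := (1 + ρ) / 2 with hr
  have hr0 : 0 ≤ r := by linarith
  obtain ⟨A, hA, bA⟩ := exists_normalBounds hS nf hρ0 (r := r) (by linarith)
  obtain ⟨B, hB, bB⟩ := exists_word_bounds hS nf hρ0 V hV
  set κ := omega F D ξ₀ ⬝ᵥ F.MWord ξ₀ V *ᵥ dirVec F D ξ₀ with hκd
  have hκs : ContDiffAt ℝ 2 (fun ξ => omega F D ξ ⬝ᵥ F.MWord ξ V *ᵥ zeta F D ξ) ξ₀ :=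
    contDiffAt_dotProduct nf.omega_smooth
      (contDiffAt_mulVec (F.contDiff_MWord V ξ₀) nf.zeta_smooth)
  obtain ⟨E, hE, bE⟩ := exists_norm_sub_le hκs
  have hκ0 : 0 < |κ| := abs_pos.2 hκ
  -- `P = I - ζ ωᵀ` has norm at most `1 + A²`
  set P := 1 + A * A with hP
  have hP0 : 1 ≤ P := by nlinarith
  set H := 2 * (P * B * A) with hH
  have hH0 : 0 < H := by positivity
  set J := A * B * A * H with hJ
  have hJ0 : 0 < J := by positivity
  obtain ⟨K₀, hK₀⟩ : ∃ K₀ : ℕ, ∀ K, K₀ ≤ K → (P * B * A) * r ^ K ≤ 1 / 2 ∧ J * r ^ K ≤ |κ| / 4 := by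
    have h1 : ∀ a : ℝ, Tendsto (fun K : ℕ => a * r ^ K) atTop (𝓝 0) := fun a => by
      simpa using (tendsto_pow_atTop_nhds_zero_of_lt_one hr0 (by linarith)).const_mul a
    have h2 := ((h1 (P * B * A)).eventually_le_const (by norm_num : (0 : ℝ) < 1 / 2)).and
      ((h1 J).eventually_le_const (by positivity : (0 : ℝ) < |κ| / 4))
    exact eventually_atTop.1 h2
  have hsm : ∀ᶠ ξ in 𝓝 ξ₀, E * ‖ξ - ξ₀‖ < |κ| / 4 := by
    have h1 : ContinuousAt (fun ξ : ℝ × ℝ => E * ‖ξ - ξ₀‖) ξ₀ := by fun_prop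
    exact h1.eventually_lt continuousAt_const (by simpa using hκ0)
  refine ⟨1 / |κ|, (E + J) * (2 / |κ|) * (1 / |κ|) + 1, K₀, by positivity, by
    have : 0 ≤ (E + J) * (2 / |κ|) * (1 / |κ|) := by positivity
    linarith, ?_⟩
  filter_upwards [bA, bB, bE, hsm] with ξ bA bB bE hsm K hK ε hε hroot
  obtain ⟨hK1, hK2⟩ := hK₀ K hK
  have hδ := norm_nonneg (ξ - ξ₀)
  set δ := ‖ξ - ξ₀‖ with hδd
  clear_value δ H J P κ r
  have hn := bA.normal
  set l := lam F D ξ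
  set M := Mmd F D ξ with hM
  set T := transv F D ξ with hT
  set ω := omega F D ξ
  set ζ := zeta F D ξ
  set MV := F.MWord ξ V
  have hl := lam_pos bA
  have hlK : 0 < l ^ K := pow_pos (by linarith [hl.1]) _
  have hrK : 0 ≤ r ^ K := pow_nonneg hr0 _
  rw [nf.zeta_eq] at bE
  rw [← hκd, Real.norm_eq_abs] at bE
  change |ω ⬝ᵥ MV *ᵥ ζ - κ| ≤ _ at bE
  obtain ⟨x, hx0, hx⟩ := isRoot_iff_exists_real.1 hroot
  rw [F.MWord_append, F.MWord_replicate, ← mulVec_mulVec] at hx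
  change M ^ K *ᵥ (MV *ᵥ x) = ε • x at hx
  set y := MV *ᵥ x with hy
  have hy2 : MV *ᵥ (M ^ K *ᵥ y) = ε • y := by rw [hx, mulVec_smul]
  set h := ω ⬝ᵥ y with hh
  set q := y - h • ζ with hq
  have hωq : ω ⬝ᵥ q = 0 := by
    rw [hq, dotProduct_sub, dotProduct_smul, hn.omega_zeta, smul_eq_mul, mul_one, sub_self]
  have hMζ : ∀ j : ℕ, M ^ j *ᵥ ζ = l ^ j • ζ := by
    intro j
    induction j with
    | zero => simp
    | succ j ih =>
      rw [pow_succ, ← mulVec_mulVec, hn.right, mulVec_smul, ih, smul_smul, pow_succ]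
      congr 1
      ring
  have hMq : ∀ j : ℕ, M ^ j *ᵥ q = T ^ j *ᵥ q ∧ ω ⬝ᵥ (M ^ j *ᵥ q) = 0 := by
    intro j
    induction j with
    | zero => simpa using hωq
    | succ j ih =>
      have e1 : M ^ (j + 1) *ᵥ q = M *ᵥ (M ^ j *ᵥ q) := by rw [mulVec_mulVec, pow_succ']
      have e2 : T ^ (j + 1) *ᵥ q = T *ᵥ (T ^ j *ᵥ q) := by rw [mulVec_mulVec, pow_succ']
      refine ⟨?_, ?_⟩
      · rw [e1, e2, ← ih.1, hT, IsNormal.transv_mulVec _ ih.2]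
      · rw [e1, dotProduct_mulVec, hn.left, smul_dotProduct, ih.2, smul_zero]
  have hyq : y = h • ζ + q := by rw [hq]; abel
  set b := MV *ᵥ (T ^ K *ᵥ q) with hb
  have hy3 : ε • y = (h * l ^ K) • (MV *ᵥ ζ) + b := by
    rw [← hy2, hyq, mulVec_add, mulVec_smul, hMζ, (hMq K).1, mulVec_add, mulVec_smul, mulVec_smul,
      smul_smul]
  have hbn : ‖b‖ ≤ B * A * r ^ K * ‖q‖ := by
    refine (bB.2 _).trans ?_
    have := bA.pow_le K q
    calc B * ‖T ^ K *ᵥ q‖ ≤ B * (A * r ^ K * ‖q‖) := by gcongr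
      _ = _ := by ring
  have hζn : ‖MV *ᵥ ζ‖ ≤ B * A := (bB.2 _).trans (by gcongr; exact bA.zeta_le)
  have hproj : ∀ z : Fin N → ℝ, ‖z - (ω ⬝ᵥ z) • ζ‖ ≤ P * ‖z‖ := by
    intro z
    refine (norm_sub_le _ _).trans ?_
    rw [norm_smul, Real.norm_eq_abs]
    have h1 : |ω ⬝ᵥ z| * ‖ζ‖ ≤ A * ‖z‖ * A := by
      gcongr
      · exact bA.omega_le z
      · exact bA.zeta_le
    rw [hP]; linarith
  have hqn : ‖q‖ ≤ H * |h| * l ^ K := by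
    have h1 : ε • q = (ε • y) - (ω ⬝ᵥ (ε • y)) • ζ := by
      rw [hq, dotProduct_smul, smul_sub, smul_smul, smul_eq_mul]
    have h2 : ‖q‖ = ‖ε • q‖ := by rw [norm_smul, Real.norm_eq_abs, hε, one_mul]
    have h3 : ‖ε • y‖ ≤ |h| * l ^ K * (B * A) + B * A * r ^ K * ‖q‖ := by
      rw [hy3]
      refine (norm_add_le _ _).trans (add_le_add ?_ hbn)
      rw [norm_smul, Real.norm_eq_abs, abs_mul, abs_of_pos hlK]
      gcongr
    have h4 : ‖q‖ ≤ P * (|h| * l ^ K * (B * A) + B * A * r ^ K * ‖q‖) := by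
      exact ((h2.trans (congrArg norm h1)).le.trans (hproj _)).trans
        (mul_le_mul_of_nonneg_left h3 (by linarith))
    have h5 : (P * B * A) * r ^ K * ‖q‖ ≤ 1 / 2 * ‖q‖ :=
      mul_le_mul_of_nonneg_right hK1 (norm_nonneg _)
    rw [hH]
    nlinarith
  have hh0 : h ≠ 0 := by
    intro h0
    rw [h0, abs_zero, mul_zero, zero_mul] at hqn
    have h1 : q = 0 := norm_le_zero_iff.1 hqn
    have h2 : y = 0 := by rw [hyq, h0, h1]; simp
    rw [h2, mulVec_zero] at hx
    have hε0 : ε ≠ 0 := by intro h; rw [h, abs_zero] at hε; exact zero_ne_one hε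
    exact hx0 ((smul_eq_zero.1 hx.symm).resolve_left hε0)
  have hhp : 0 < |h| := abs_pos.2 hh0
  -- the scalar equation
  have h1 : ε * h = h * l ^ K * (ω ⬝ᵥ MV *ᵥ ζ) + ω ⬝ᵥ b := by
    have := congrArg (ω ⬝ᵥ ·) hy3
    simpa only [dotProduct_add, dotProduct_smul, smul_eq_mul] using this
  have h2 : |ω ⬝ᵥ b| ≤ J * r ^ K * l ^ K * |h| := by
    refine (bA.omega_le b).trans ?_
    calc A * ‖b‖ ≤ A * (B * A * r ^ K * (H * |h| * l ^ K)) := by gcongr; exact hbn.trans (by gcongr)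
      _ = _ := by rw [hJ]; ring
  have h3 : |ε - l ^ K * (ω ⬝ᵥ MV *ᵥ ζ)| ≤ J * r ^ K * l ^ K := by
    have e : (ε - l ^ K * (ω ⬝ᵥ MV *ᵥ ζ)) * h = ω ⬝ᵥ b := by linear_combination h1
    rw [← e, abs_mul] at h2
    exact le_of_mul_le_mul_right h2 hhp
  have h4 : |ε - l ^ K * κ| ≤ (E * δ + J * r ^ K) * l ^ K := by
    have e : ε - l ^ K * κ = (ε - l ^ K * (ω ⬝ᵥ MV *ᵥ ζ)) + l ^ K * (ω ⬝ᵥ MV *ᵥ ζ - κ) := by ring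
    rw [e]
    refine (abs_add_le _ _).trans ?_
    rw [abs_mul, abs_of_pos hlK]
    have : l ^ K * |ω ⬝ᵥ MV *ᵥ ζ - κ| ≤ l ^ K * (E * δ) := by gcongr
    linarith
  -- Passing to absolute values removes the unknown sign `ε`; this is why multipliers `1` and `-1`
  -- are treated alike.
  have h5 : |1 - l ^ K * abs κ| ≤ (E * δ + J * r ^ K) * l ^ K := by
    refine le_trans ?_ h4
    have := abs_abs_sub_abs_le ε (l ^ K * κ)
    rwa [hε, abs_mul, abs_of_pos hlK] at this
  have h6 : l ^ K ≤ 2 / |κ| := by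
    rw [le_div_iff₀ hκ0]
    have h7 := (abs_le.1 h5).1
    have h8 : (E * δ + J * r ^ K) * l ^ K ≤ (|κ| / 2) * l ^ K := by
      gcongr; linarith
    linarith
  have h7 : l ^ K - 1 / |κ| = -((1 - l ^ K * |κ|) * (1 / |κ|)) := by field_simp; ring
  rw [h7, abs_neg, abs_mul, abs_of_pos (by positivity : 0 < 1 / |κ|)]
  calc |1 - l ^ K * abs κ| * (1 / |κ|) ≤ (E * δ + J * r ^ K) * (2 / |κ|) * (1 / |κ|) := by
        gcongr
        exact h5.trans (by gcongr)
    _ ≤ ((E + J) * (δ + r ^ K)) * (2 / |κ|) * (1 / |κ|) := by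
        gcongr
        nlinarith [mul_nonneg hE.le hrK, mul_nonneg hJ0.le hδ]
    _ = (E + J) * (2 / |κ|) * (1 / |κ|) * (δ + r ^ K) := by ring
    _ ≤ _ := by
        gcongr; linarith

end PWL


namespace PWL

set_option linter.unusedSectionVars false

attribute [local instance] Matrix.linftyOpNormedAddCommGroup Matrix.linftyOpNormedSpace
  Matrix.linftyOpNormedRing Matrix.linftyOpNormedAlgebra

variable {N : ℕ} [NeZero N] {F : Family N} {D : RotData} {ξ₀ : ℝ × ℝ} {ρ : ℝ}

/-! ### The words `G⁺[k,χ]` -/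

theorem word_prefix {s : ℤ → Side} {n : ℕ} {A B : List Side} (h : word s n = A ++ B) :
    A = word s A.length := by
  have hn : n = A.length + B.length := by
    rw [← List.length_append, ← h, length_word]
  rw [hn, word_add] at h
  exact (List.append_inj h (by rw [length_word])).1.symm

theorem symbol_of_append {s : ℤ → Side} {n : ℕ} {A B : List Side} {σ : Side}
    (h : word s n = A ++ σ :: B) : s A.length = σ := by
  have h1 : word s n = (A ++ [σ]) ++ B := by rw [h]; simp
  have h2 := word_prefix h1
  rw [List.length_append, List.length_singleton, word_succ] at h2
  have h3 := List.append_inj_right' h2 (by simp)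
  simpa using h3.symm

theorem IsCycle.fWord_prefix {ξ : ℝ × ℝ} {s : ℤ → Side} {n : ℕ} {x : ℤ → Fin N → ℝ}
    (hx : IsCycle F ξ s n x) {A B : List Side} (h : word s n = A ++ B) :
    F.fWord ξ A (x 0) = x A.length := by
  conv_lhs => rw [word_prefix h]
  exact hx.fWord_zero _

namespace RotData

theorem X_eq_cons (D : RotData) : ∃ W, D.X = Side.L :: W := by
  obtain ⟨e, he⟩ : ∃ e, D.e = e + 1 := ⟨D.e - 1, by have := D.e_pos; omega⟩
  exact ⟨_, by rw [X_eq, he, word_succ', D.S_zero]⟩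

theorem Y_eq_cons (D : RotData) : ∃ W, D.Y = Side.R :: W := by
  obtain ⟨e, he⟩ : ∃ e, D.n - D.e = e + 1 := ⟨D.n - D.e - 1, by have := D.e_lt; omega⟩
  obtain ⟨c, hc⟩ := D.e_mul_m
  have h := IsShrinkingPoint.S_of_residue (D := D) (i := D.e) (r := D.l) (q := c) (by linarith)
    (by positivity) (by exact_mod_cast D.l_lt)
  refine ⟨_, by rw [Y_eq, he, word_succ']; simp only [shift, add_zero]; rw [h.1, if_neg (lt_irrefl _)]⟩

theorem Smd_eq_cons (D : RotData) : ∃ W, D.Smd = Side.R :: W := by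
  obtain ⟨W, hW⟩ := D.X_eq_cons
  exact ⟨W ++ flipHead D.Y, by rw [D.Smd_eq, hW]; rfl⟩

theorem Gpre_eq_cons (D : RotData) (c : ℕ) : ∃ W, D.Gpre c = Side.L :: W := by
  cases c with
  | zero =>
    obtain ⟨e, he⟩ : ∃ e, D.np = e + 1 := ⟨D.np - 1, by have := D.np_pos; omega⟩
    exact ⟨word (shift D.S 1) e, by simp [Gpre, Rp, he, word_succ', D.S_zero]⟩
  | succ c =>
    obtain ⟨W, hW⟩ := D.X_eq_cons
    exact ⟨W ++ flipHead D.Y ++ (List.replicate c (D.X ++ flipHead D.Y)).flatten ++ D.Rp, by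
      rw [Gpre, List.replicate_succ, List.flatten_cons]; nth_rw 1 [hW]; simp⟩

end RotData

theorem replicate_flatten_succ (W : List Side) (a : ℕ) :
    (List.replicate (a + 1) W).flatten = (List.replicate a W).flatten ++ W := by
  rw [List.replicate_succ']
  simp

theorem IsShrinkingPoint.fWord_Gpre (hS : IsShrinkingPoint F ξ₀ D.l D.m D.n) (c : ℕ) :
    F.fWord ξ₀ (D.Gpre c) (cyclePt F ξ₀ D.S0 D.n 0) = cyclePt F ξ₀ D.S0 D.n (-(D.d : ℤ)) := by
  have h1 : ∀ j : ℕ, F.fWord ξ₀ (List.replicate j (D.X ++ flipHead D.Y)).flatten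
      (cyclePt F ξ₀ D.S0 D.n 0) = cyclePt F ξ₀ D.S0 D.n 0 := by
    intro j
    induction j with
    | zero => simp [F.fWord_nil]
    | succ j ih =>
      rw [List.replicate_succ, List.flatten_cons, F.fWord_append, F.fWord_append, hS.fWord_X,
        hS.fWord_Y', ih]
  rw [RotData.Gpre, F.fWord_append, h1, hS.fWord_Rp]

/-- The position of the powers of `S^{(-d)}` in the word `G⁺[k,χ]`, and its consequences for the
points of a cycle. -/
theorem exists_cyclic_decomp (hS : IsShrinkingPoint F ξ₀ D.l D.m D.n) (nf : NormalForm F D ξ₀ ρ)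
    (hr : rhoMax F D ξ₀ < 1) {χ : ℤ} (hχ : -1 ≤ χ) (hκ : kappa F D ξ₀ χ ≠ 0) :
    ∃ (V W : List Side) (ε : ℝ) (c : ℕ), |ε| = 1 ∧
      F.fWord ξ₀ V (cyclePt F ξ₀ D.S0 D.n 0) = cyclePt F ξ₀ D.S0 D.n (-(D.d : ℤ)) ∧
      F.fWord ξ₀ W (cyclePt F ξ₀ D.S0 D.n 0) 0 = 0 ∧
      ε * (F.MWord ξ₀ W *ᵥ dirVec F D ξ₀) 0 < 0 ∧
      omega F D ξ₀ ⬝ᵥ F.MWord ξ₀ V *ᵥ dirVec F D ξ₀ ≠ 0 ∧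
      ∀ (ξ : ℝ × ℝ) (K : ℕ), 2 ≤ K →
        (F.MWord ξ (D.G (K + c) χ)).charpoly =
          (F.MWord ξ (V ++ (List.replicate K D.Smd).flatten)).charpoly ∧
        ∀ x, IsCycle F ξ (D.Gseq (K + c) χ) (D.nk (K + c)) x → IsAdmissible (D.Gseq (K + c) χ) x →
          ∃ z w, w = F.fWord ξ V z ∧ (phi F D ξ)^[K] w = z ∧ 0 ≤ ε * F.fWord ξ W z 0 ∧
            ε * F.fWord ξ W ((phi F D ξ)^[K - 1] w) 0 ≤ 0 := by
  obtain ⟨hω, hωv⟩ := IsShrinkingPoint.vecMul_Mmd ⟨ρ, nf⟩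
  obtain ⟨XW, hX⟩ := D.X_eq_cons
  obtain ⟨YW, hY⟩ := D.Y_eq_cons
  obtain ⟨SW, hSm⟩ := D.Smd_eq_cons
  have hphi : ∀ (ξ : ℝ × ℝ) (j : ℕ) (x : Fin N → ℝ),
      F.fWord ξ (List.replicate j D.Smd).flatten x = (phi F D ξ)^[j] x := fun ξ j x =>
    F.fWord_replicate ξ D.Smd j x
  rcases hχ.eq_or_lt with h | h
  · subst h
    -- For `χ = -1` the word is `R⁺ (X' Y')^K X' Y` with `K = k - 1`, read cyclically from the start
    -- of the copies of `X' Y'`. The switching occurs after `X'`: the final `Y` begins with `R`,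
    -- while the `Y'` in the last copy begins with `L`.
    refine ⟨(flipHead D.X ++ D.Y) ++ D.Rp, flipHead D.X, 1, 1, abs_one, ?_, ?_, ?_, ?_,
      fun ξ K hK => ?_⟩
    · rw [F.fWord_append, F.fWord_append, hS.fWord_X', hS.fWord_Y, hS.fWord_Rp]
    · rw [hS.fWord_X', hS.pt_e]
    · have h1 := congrFun hS.mulVec_X'_dirVec 0
      rw [Pi.smul_apply, Pi.sub_apply, hS.pt_e, sub_zero, smul_eq_mul] at h1
      have h2 := hS.pt_e_sub
      rw [← h1] at h2
      rw [one_mul]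
      exact (pos_iff_neg_of_mul_neg h2).1 hS.pt_neg_d
    · obtain ⟨b, hb, hb2⟩ := hS.kappa_neg_one hr hω hωv
      rw [hb2]
      exact mul_ne_zero hb hκ
    · have hG := D.G_neg_one (K + 1) (by omega)
      rw [Nat.add_sub_cancel] at hG
      constructor
      · rw [hG, ← List.append_assoc, F.MWord_append, Matrix.charpoly_mul_comm, ← F.MWord_append]
        simp only [F.MWord_append, Matrix.mul_assoc]
      · intro x hx hadm
        obtain ⟨j, rfl⟩ : ∃ j, K = j + 1 := ⟨K - 1, by omega⟩
        have hG1 : word (D.Gseq (j + 1 + 1) (-1)) (D.nk (j + 1 + 1)) =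
          D.Rp ++ ((List.replicate (j + 1) D.Smd).flatten ++ (flipHead D.X ++ D.Y)) := hG
        have hG2 : word (D.Gseq (j + 1 + 1) (-1)) (D.nk (j + 1 + 1)) =
          (D.Rp ++ (List.replicate (j + 1) D.Smd).flatten ++ flipHead D.X) ++ Side.R :: YW := by
          rw [hG1, ← hY]; simp
        have hG3 : word (D.Gseq (j + 1 + 1) (-1)) (D.nk (j + 1 + 1)) =
          (D.Rp ++ (List.replicate j D.Smd).flatten ++ flipHead D.X) ++
            Side.L :: (YW ++ (flipHead D.X ++ D.Y)) := by
          have h1 : flipHead D.Y = Side.L :: YW := by rw [hY]; rfl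
          have h2 : Side.L :: (YW ++ (flipHead D.X ++ D.Y)) =
            flipHead D.Y ++ (flipHead D.X ++ D.Y) := by rw [h1]; rfl
          rw [hG1, replicate_flatten_succ, D.Smd_eq, h2]
          simp only [List.append_assoc]
        have e2 := hx.fWord_prefix hG2
        have e3 := hx.fWord_prefix hG3
        have s2 := (hadm _).2 (symbol_of_append hG2)
        have s3 := (hadm _).1 (symbol_of_append hG3)
        rw [← e2, F.fWord_append, F.fWord_append, hphi] at s2
        rw [← e3, F.fWord_append, F.fWord_append, hphi] at s3
        have e1 := hx.fWord_zero (D.nk (j + 1 + 1))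
        rw [hx.congr_dvd (i := (D.nk (j + 1 + 1) : ℤ)) (j := 0) (by simp), hG1, F.fWord_append,
          F.fWord_append, hphi] at e1
        refine ⟨(phi F D ξ)^[j + 1] (F.fWord ξ D.Rp (x 0)), F.fWord ξ D.Rp (x 0), ?_, rfl, ?_, ?_⟩
        · rw [F.fWord_append, e1]
        · rw [one_mul]; exact s2
        · rw [one_mul]; exact s3
  · obtain ⟨c, rfl⟩ := Int.eq_ofNat_of_zero_le (by omega : 0 ≤ χ)
    -- For `χ ≥ 0` the switching is at the point itself: the word begins with `L`, while the last
    -- copy of `X' Y'` begins with `R`. Both signs are opposite to those of the previous case, hence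
    -- `ε = -1`.
    refine ⟨D.Gpre c, [], -1, c, by simp, hS.fWord_Gpre c, hS.pt_zero, ?_, ?_, fun ξ K hK => ?_⟩
    · rw [F.MWord_nil, one_mulVec, hS.dirVec_zero]; norm_num
    · rw [hS.kappa_nonneg hr hω hωv]
      exact mul_ne_zero (div_ne_zero (neg_ne_zero.2 hS.pt_neg_d.ne') hS.pt_d.ne) hκ
    · have hG := D.G_of_nonneg (K + c) c (by omega)
      rw [Nat.add_sub_cancel] at hG
      refine ⟨by rw [hG], ?_⟩
      intro x hx hadm
      obtain ⟨j, rfl⟩ : ∃ j, K = j + 1 := ⟨K - 1, by omega⟩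
      obtain ⟨GW, hGp⟩ := D.Gpre_eq_cons c
      have hG1 : word (D.Gseq (j + 1 + c) c) (D.nk (j + 1 + c)) =
        D.Gpre c ++ (List.replicate (j + 1) D.Smd).flatten := hG
      have hG2 : word (D.Gseq (j + 1 + c) c) (D.nk (j + 1 + c)) =
          [] ++ Side.L :: (GW ++ (List.replicate (j + 1) D.Smd).flatten) := by
        rw [hG1, hGp]; rfl
      have hG3 : word (D.Gseq (j + 1 + c) c) (D.nk (j + 1 + c)) =
          (D.Gpre c ++ (List.replicate j D.Smd).flatten) ++ Side.R :: SW := by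
        rw [hG1, replicate_flatten_succ, ← hSm, List.append_assoc]
      have e3 := hx.fWord_prefix hG3
      have s2 := (hadm _).1 (symbol_of_append hG2)
      have s3 := (hadm _).2 (symbol_of_append hG3)
      rw [← e3, F.fWord_append, hphi] at s3
      have e1 := hx.fWord_zero (D.nk (j + 1 + c))
      rw [hx.congr_dvd (i := (D.nk (j + 1 + c) : ℤ)) (j := 0) (by simp), hG1, F.fWord_append,
        hphi] at e1
      simp only [List.length_nil, Nat.cast_zero] at s2
      refine ⟨x 0, F.fWord ξ (D.Gpre c) (x 0), rfl, e1, ?_, ?_⟩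
      · rw [F.fWord_nil]; linarith
      · rw [F.fWord_nil, Nat.add_sub_cancel]; linarith

theorem abs_pow_sub_one_le {l : ℝ} (h1 : 1 / 2 ≤ l) (h2 : l ≤ 3 / 2) (c : ℕ) :
    |l ^ c - 1| ≤ c * 2 ^ c * |l - 1| := by
  have h := geom_sum_mul l c
  rw [← h, abs_mul]
  refine mul_le_mul_of_nonneg_right ?_ (abs_nonneg _)
  rw [abs_of_nonneg (Finset.sum_nonneg fun i _ => pow_nonneg (by linarith) i)]
  calc ∑ i ∈ Finset.range c, l ^ i ≤ ∑ _i ∈ Finset.range c, (2 : ℝ) ^ c := by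
        refine Finset.sum_le_sum fun i hi => ?_
        calc l ^ i ≤ 2 ^ i := pow_le_pow_left₀ (by linarith) (by linarith) i
          _ ≤ 2 ^ c := pow_le_pow_right₀ (by norm_num) (Finset.mem_range.1 hi).le
    _ = _ := by simp

theorem abs_affIter_le {l g R : ℝ} (h1 : 1 / 2 ≤ l) (h2 : l ≤ 3 / 2) (c : ℕ) :
    |affIter l g R c| ≤ 2 ^ c * (|R| + c * |g|) := by
  induction c with
  | zero => simp [affIter_zero]
  | succ c ih =>
    rw [affIter_succ]
    refine (abs_add_le _ _).trans ?_
    rw [abs_mul, abs_of_nonneg (by linarith : 0 ≤ l)]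
    have h3 : l * |affIter l g R c| ≤ 2 * (2 ^ c * (|R| + c * |g|)) :=
      mul_le_mul (by linarith) ih (abs_nonneg _) (by norm_num)
    have h4 : (1 : ℝ) ≤ 2 ^ (c + 1) := one_le_pow₀ (by norm_num)
    have h5 : |g| ≤ 2 ^ (c + 1) * |g| := le_mul_of_one_le_left (abs_nonneg _) h4
    push_cast
    rw [pow_succ] at h5 ⊢
    linarith

/-- Near the shrinking point, the consequences of the existence of an admissible
`G⁺[k,χ]`-cycle, and of a stability multiplier `±1`. -/
theorem exists_cycle_bounds (hS : IsShrinkingPoint F ξ₀ D.l D.m D.n) (nf : NormalForm F D ξ₀ ρ)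
    (hρ0 : 0 ≤ ρ) (hρ1 : ρ < 1) (hr : rhoMax F D ξ₀ < 1) {χ : ℤ} (hχ : -1 ≤ χ)
    (hκ : kappa F D ξ₀ χ ≠ 0) :
    ∃ (y C : ℝ) (k₀ : ℕ), 0 < y ∧ 1 ≤ C ∧ ∀ᶠ ξ in 𝓝 ξ₀, ∀ k : ℕ, k₀ ≤ k →
      ((∃ x, IsCycle F ξ (D.Gseq k χ) (D.nk k) x ∧ IsAdmissible (D.Gseq k χ) x) →
        |affIter (lam F D ξ) (drift F D ξ) (cyclePt F ξ₀ D.S0 D.n (-(D.d : ℤ)) 0) k| ≤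
          C * ‖ξ - ξ₀‖ * (1 + lam F D ξ ^ k)) ∧
      ∀ ε : ℝ, |ε| = 1 → (F.MWord ξ (D.G k χ)).charpoly.IsRoot ε →
        |lam F D ξ ^ k - y| ≤ C * (‖ξ - ξ₀‖ + ((1 + ρ) / 2) ^ k) := by
  obtain ⟨V, W, ε, c, hε, hV, hW, hm, hκ', hG⟩ := exists_cyclic_decomp hS nf hr hχ hκ
  obtain ⟨A, hA, bA⟩ := exists_normalBounds hS nf hρ0 hρ1
  obtain ⟨C1, K1, hC1, b1⟩ := cycle_bound hS nf hρ0 hρ1 hε hV hW hm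
  obtain ⟨y, C2, K2, hy, hC2, b2⟩ := eigenvalue_bound hS nf hρ0 hρ1 hV hκ'
  set r := (1 + ρ) / 2 with hrd
  have hr0 : 1 / 2 ≤ r := by linarith
  set t := cyclePt F ξ₀ D.S0 D.n (-(D.d : ℤ)) 0
  -- With `λ` between `1/2` and `3/2`, changing an exponent by `c` costs a factor of at most `2^c`
  -- either way. This converts estimates for the number `K` of copies of `S^{(-d)}` into estimates
  -- for `k = K + c`.
  set P : ℝ := 2 ^ c with hP
  have hP1 : 1 ≤ P := one_le_pow₀ (by norm_num)
  refine ⟨y, P * (C1 * P + c * A) + (P * C2 * P + y * (c * P * A)), K1 + K2 + 2 + c, hy, ?_, ?_⟩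
  · have h1 : 1 ≤ P * (C1 * P + c * A) := by
      have h2 : 1 ≤ C1 * P := by nlinarith
      have h3 : 0 ≤ (c : ℝ) * A := by positivity
      nlinarith
    have : 0 ≤ P * C2 * P + y * (c * P * A) := by positivity
    linarith
  filter_upwards [bA, b1, b2] with ξ bA b1 b2 k hk
  obtain ⟨K, rfl⟩ : ∃ K, k = K + c := ⟨k - c, by omega⟩
  obtain ⟨hG1, hG2⟩ := hG ξ K (by omega)
  have hδ := norm_nonneg (ξ - ξ₀)
  obtain ⟨hl1, hl2⟩ := lam_pos bA
  have hlc := abs_pow_sub_one_le hl1 hl2 c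
  have hle := bA.lam_le
  have hdr := bA.drift_le
  set l := lam F D ξ
  set g := drift F D ξ
  set δ := ‖ξ - ξ₀‖
  have hlK : 0 ≤ l ^ K := pow_nonneg (by linarith) _
  have hlc0 : 0 ≤ l ^ c := pow_nonneg (by linarith) _
  have hlcP : l ^ c ≤ P := pow_le_pow_left₀ (by linarith) (by linarith) c
  have hPl : l ^ K ≤ P * l ^ (K + c) := by
    have h3 : (1 : ℝ) ≤ (2 * l) ^ c := one_le_pow₀ (by linarith)
    have h4 : P * l ^ (K + c) = (2 * l) ^ c * l ^ K := by rw [hP, mul_pow, pow_add]; ring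
    rw [h4]
    exact le_mul_of_one_le_left hlK h3
  constructor
  · rintro ⟨x, hx, hadm⟩
    obtain ⟨z, w, h1, h2, h3, h4⟩ := hG2 x hx hadm
    have h5 := b1 K (by omega) z w h1 h2 h3 h4
    rw [affIter_add]
    refine (abs_affIter_le hl1 hl2 c).trans ?_
    have h6 : |affIter l g t K| ≤ C1 * P * (δ * (1 + l ^ (K + c))) := by
      refine h5.trans ?_
      have : 1 + l ^ K ≤ P * (1 + l ^ (K + c)) := by linarith
      calc C1 * δ * (1 + l ^ K) ≤ C1 * δ * (P * (1 + l ^ (K + c))) := by gcongr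
        _ = _ := by ring
    have hlk : 0 ≤ l ^ (K + c) := pow_nonneg (by linarith) _
    have h7 : c * |g| ≤ c * A * (δ * (1 + l ^ (K + c))) := by
      have : |g| ≤ A * (δ * (1 + l ^ (K + c))) := hdr.trans (by
        gcongr; exact le_mul_of_one_le_right hδ (by linarith))
      calc c * |g| ≤ c * (A * (δ * (1 + l ^ (K + c)))) := by gcongr
        _ = _ := by ring
    have h8 : 0 ≤ δ * (1 + l ^ (K + c)) := by positivity
    calc P * (|affIter l g t K| + c * |g|)
        ≤ P * (C1 * P * (δ * (1 + l ^ (K + c))) + c * A * (δ * (1 + l ^ (K + c)))) := by gcongr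
      _ = P * (C1 * P + c * A) * (δ * (1 + l ^ (K + c))) := by ring
      _ ≤ (P * (C1 * P + c * A) + (P * C2 * P + y * (c * P * A))) * (δ * (1 + l ^ (K + c))) := by
        refine mul_le_mul_of_nonneg_right ?_ h8
        have : 0 ≤ P * C2 * P + y * (c * P * A) := by positivity
        linarith
      _ = _ := by ring
  · intro ε' hε' hroot
    rw [hG1] at hroot
    have h5 := b2 K (by omega) ε' hε' hroot
    have hrk : 0 ≤ r ^ (K + c) := by positivity
    have hrK : r ^ K ≤ P * r ^ (K + c) := by
      have h3 : (1 : ℝ) ≤ (2 * r) ^ c := one_le_pow₀ (by linarith)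
      have h4 : P * r ^ (K + c) = (2 * r) ^ c * r ^ K := by rw [hP, mul_pow, pow_add]; ring
      rw [h4]
      exact le_mul_of_one_le_left (by positivity) h3
    have h6 : l ^ (K + c) - y = l ^ c * (l ^ K - y) + y * (l ^ c - 1) := by rw [pow_add]; ring
    rw [h6]
    refine (abs_add_le _ _).trans ?_
    rw [abs_mul, abs_mul, abs_of_nonneg hlc0, abs_of_pos hy]
    have h7 : l ^ c * |l ^ K - y| ≤ P * C2 * P * (δ + r ^ (K + c)) := by
      calc l ^ c * |l ^ K - y| ≤ P * (C2 * (δ + r ^ K)) := by gcongr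
        _ ≤ P * (C2 * (P * (δ + r ^ (K + c)))) := by
          gcongr
          have : δ ≤ P * δ := le_mul_of_one_le_left hδ hP1
          linarith
        _ = _ := by ring
    have h8 : y * |l ^ c - 1| ≤ y * (c * P * A) * (δ + r ^ (K + c)) := by
      calc y * |l ^ c - 1| ≤ y * (c * P * (A * δ)) := by gcongr; exact hlc.trans (by gcongr)
        _ ≤ y * (c * P * (A * (δ + r ^ (K + c)))) := by gcongr; linarith
        _ = _ := by ring
    have h9 : 0 ≤ P * (C1 * P + c * A) * (δ + r ^ (K + c)) := by positivity
    linarith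

end PWL


namespace PWL

/-! ### Scalar estimates for `h ↦ λ h + g` with `λ` near `1` -/

theorem abs_log_le {l : ℝ} (h1 : 1 / 2 ≤ l) : |Real.log l| ≤ 2 * |l - 1| := by
  have hl : 0 < l := by linarith
  have h3 := Real.log_le_sub_one_of_pos hl
  have h4 := Real.one_sub_inv_le_log_of_pos hl
  have h5 := le_abs_self (l - 1)
  have h6 := neg_abs_le (l - 1)
  have h7 : -(2 * |l - 1|) ≤ 1 - l⁻¹ := by
    have e : 1 - l⁻¹ = (l - 1) * l⁻¹ := by field_simp
    have h8 : l⁻¹ ≤ 2 := by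
      rw [inv_le_comm₀ hl (by norm_num)]; linarith
    have h9 : 0 < l⁻¹ := inv_pos.2 hl
    rw [e]
    nlinarith [abs_nonneg (l - 1)]
  rw [abs_le]
  constructor <;> linarith [abs_nonneg (l - 1)]

theorem abs_sub_one_le_log {l : ℝ} (h1 : 1 / 2 ≤ l) (h2 : l ≤ 3 / 2) :
    |l - 1| ≤ 2 * |Real.log l| := by
  have hl : 0 < l := by linarith
  have h3 := Real.log_le_sub_one_of_pos hl
  have h4 := Real.one_sub_inv_le_log_of_pos hl
  have e : l - 1 = (1 - l⁻¹) * l := by field_simp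
  have h5 := le_abs_self (Real.log l)
  have h6 := neg_abs_le (Real.log l)
  rw [abs_le]
  constructor
  · linarith [abs_nonneg (Real.log l)]
  · rw [e]
    nlinarith [abs_nonneg (Real.log l)]

/-- Written as `exp (i log l)`, with `|log l| ≤ 2 |l - 1|`; the bounds are uniform for `i` up to a
multiple of `k`. -/
theorem pow_mem_of_abs_sub_le {l A B : ℝ} {k i : ℕ} (hk : 0 < k) (h1 : 1 / 2 ≤ l)
    (hA : |l - 1| ≤ A / k) (hi : (i : ℝ) ≤ B * k) (hA0 : 0 ≤ A) :
    Real.exp (-(2 * A * B)) ≤ l ^ i ∧ l ^ i ≤ Real.exp (2 * A * B) := by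
  have hl : 0 < l := by linarith
  have hk' : (0 : ℝ) < k := by exact_mod_cast hk
  have h2 : l ^ i = Real.exp (i * Real.log l) := by
    rw [mul_comm, Real.exp_mul, Real.exp_log hl, Real.rpow_natCast]
  have h3 : |i * Real.log l| ≤ 2 * A * B := by
    rw [abs_mul, Nat.abs_cast]
    calc (i : ℝ) * |Real.log l| ≤ (i : ℝ) * (2 * (A / k)) := by
          gcongr; exact (abs_log_le h1).trans (by linarith)
      _ ≤ (B * k) * (2 * (A / k)) := by gcongr
      _ = 2 * A * B := by field_simp
  rw [h2]
  exact ⟨Real.exp_le_exp.2 (abs_le.1 h3).1, Real.exp_le_exp.2 (abs_le.1 h3).2⟩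

/-- If `λ^k` is bounded above and below then `λ - 1 = O(1/k)`. -/
theorem exists_abs_sub_one_le {c C : ℝ} (hc : 0 < c) :
    ∃ A, 1 ≤ A ∧ ∀ (l : ℝ) (k : ℕ), 0 < k → 1 / 2 ≤ l → l ≤ 3 / 2 → c ≤ l ^ k → l ^ k ≤ C →
      |l - 1| ≤ A / k := by
  refine ⟨2 * (|Real.log c| + |Real.log C|) + 1, by
    linarith [abs_nonneg (Real.log c), abs_nonneg (Real.log C)], ?_⟩
  intro l k hk h1 h2 h3 h4
  have hl : 0 < l := by linarith
  have hk' : (0 : ℝ) < k := by exact_mod_cast hk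
  have h5 := abs_sub_one_le_log h1 h2
  have h6 := Real.log_le_log hc h3
  have h7 := Real.log_le_log (pow_pos hl k) h4
  rw [Real.log_pow] at h6 h7
  have h8 : |k * Real.log l| ≤ |Real.log c| + |Real.log C| := by
    rw [abs_le]
    constructor
    · linarith [neg_abs_le (Real.log c), abs_nonneg (Real.log C)]
    · linarith [le_abs_self (Real.log C), abs_nonneg (Real.log c)]
  rw [abs_mul, Nat.abs_cast] at h8
  rw [le_div_iff₀ hk']
  nlinarith

theorem geomSum_bounds {l E : ℝ} {k : ℕ} (h : ∀ i < k, E⁻¹ ≤ l ^ i ∧ l ^ i ≤ E) :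
    k * E⁻¹ ≤ ∑ i ∈ Finset.range k, l ^ i ∧ ∑ i ∈ Finset.range k, l ^ i ≤ k * E := by
  constructor
  · have := Finset.card_nsmul_le_sum (Finset.range k) (fun i => l ^ i) E⁻¹
      (fun i hi => (h i (Finset.mem_range.1 hi)).1)
    simpa using this
  · have := Finset.sum_le_card_nsmul (Finset.range k) (fun i => l ^ i) E
      (fun i hi => (h i (Finset.mem_range.1 hi)).2)
    simpa using this

/-- The iterates in terms of the first increment `g + (l - 1) t`, the drift at `h = t`; the defining
form exhibits `g`, the drift at `h = 0`. -/
theorem affIter_eq (l g t : ℝ) (k : ℕ) :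
    affIter l g t k = t + (g + (l - 1) * t) * ∑ i ∈ Finset.range k, l ^ i := by
  have := geom_sum_mul l k
  rw [affIter]
  linear_combination (-t) * this

/-- Uniform bounds on the powers of `λ` when `λ - 1 = O(1/k)`. -/
theorem exists_pow_bounds {A : ℝ} (hA : 0 ≤ A) : ∃ E, 1 ≤ E ∧ ∀ (l : ℝ) (k : ℕ), 0 < k →
    1 / 2 ≤ l → |l - 1| ≤ A / k → (∀ i ≤ k, E⁻¹ ≤ l ^ i ∧ l ^ i ≤ E) ∧
      k * E⁻¹ ≤ ∑ i ∈ Finset.range k, l ^ i ∧ ∑ i ∈ Finset.range k, l ^ i ≤ k * E := by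
  refine ⟨Real.exp (2 * A * 1), Real.one_le_exp (by positivity), ?_⟩
  intro l k hk hl hA'
  have h : ∀ i ≤ k, (Real.exp (2 * A * 1))⁻¹ ≤ l ^ i ∧ l ^ i ≤ Real.exp (2 * A * 1) := by
    intro i hi
    rw [← Real.exp_neg]
    exact pow_mem_of_abs_sub_le hk hl hA' (by rw [one_mul]; exact_mod_cast hi) hA
  exact ⟨h, geomSum_bounds fun i hi => h i hi.le⟩

/-- Dependence of the iterates on `λ` and `g`. -/
theorem exists_affIter_lipschitz {A t : ℝ} (hA : 0 ≤ A) :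
    ∃ C, 1 ≤ C ∧ ∀ (l g l' g' : ℝ) (k : ℕ), 0 < k → 1 / 2 ≤ l → 1 / 2 ≤ l' → |l - 1| ≤ A / k →
      |l' - 1| ≤ A / k → |g| ≤ A / k → |l - l'| ≤ A / k ^ 2 → |g - g'| ≤ A / k ^ 2 →
      |affIter l g t k - affIter l' g' t k| ≤ C / k := by
  obtain ⟨E, hE, hb⟩ := exists_pow_bounds hA
  refine ⟨A * E * |t| + A * (A * E) + A * E + 1, by
    have : 0 ≤ A * E * |t| + A * (A * E) + A * E := by positivity
    linarith, ?_⟩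
  intro l g l' g' k hk h1 h2 h3 h4 h5 h6 h7
  have hk' : (0 : ℝ) < k := by exact_mod_cast hk
  obtain ⟨p1, s1, s2⟩ := hb l k hk h1 h3
  obtain ⟨p2, s3, s4⟩ := hb l' k hk h2 h4
  have hpow : ∀ i ≤ k, |l ^ i - l' ^ i| ≤ A * E / k := by
    intro i hi
    have h8 := abs_pow_sub_pow_le l l' i
    rw [abs_of_nonneg (by linarith : 0 ≤ l), abs_of_nonneg (by linarith : 0 ≤ l')] at h8
    have h9 : max l l' ^ (i - 1) ≤ E := by
      rcases le_total l l' with h | h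
      · rw [max_eq_right h]; exact (p2 (i - 1) (by omega)).2
      · rw [max_eq_left h]; exact (p1 (i - 1) (by omega)).2
    refine h8.trans ?_
    have hi' : (i : ℝ) ≤ k := by exact_mod_cast hi
    calc |l - l'| * i * max l l' ^ (i - 1) ≤ A / k ^ 2 * k * E := by
          gcongr
      _ = A * E / k := by field_simp
  have hsum : |∑ i ∈ Finset.range k, l ^ i - ∑ i ∈ Finset.range k, l' ^ i| ≤ A * E := by
    rw [← Finset.sum_sub_distrib]
    refine (Finset.abs_sum_le_sum_abs _ _).trans ?_
    have := Finset.sum_le_card_nsmul (Finset.range k) (fun i => |l ^ i - l' ^ i|) (A * E / k)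
      (fun i hi => hpow i (Finset.mem_range.1 hi).le)
    rw [Finset.card_range, nsmul_eq_mul] at this
    refine this.trans (le_of_eq ?_)
    field_simp
  set S := ∑ i ∈ Finset.range k, l ^ i
  set S' := ∑ i ∈ Finset.range k, l' ^ i
  have hS' : 0 ≤ S' := le_trans (by positivity) s3
  have e : affIter l g t k - affIter l' g' t k = (l ^ k - l' ^ k) * t + g * (S - S') +
      (g - g') * S' := by simp only [affIter]; ring
  rw [e]
  calc _ ≤ |(l ^ k - l' ^ k) * t| + |g * (S - S')| + |(g - g') * S'| := abs_add_three _ _ _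
    _ ≤ A * E / k * |t| + A / k * (A * E) + A / k ^ 2 * (k * E) := by
      rw [abs_mul, abs_mul, abs_mul, abs_of_nonneg hS']
      gcongr
      exact hpow k le_rfl
    _ = (A * E * |t| + A * (A * E) + A * E) / k := by field_simp
    _ ≤ _ := div_le_div_of_nonneg_right (by linarith) hk'.le

/-- A converse: closeness of `λ^k` and `λ'^k` gives closeness of `λ` and `λ'`. -/
theorem exists_abs_sub_le_of_pow {A : ℝ} (hA : 0 ≤ A) :
    ∃ C, 1 ≤ C ∧ ∀ (l l' B : ℝ) (k : ℕ), 0 < k → 1 / 2 ≤ l → 1 / 2 ≤ l' → |l - 1| ≤ A / k →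
      |l' - 1| ≤ A / k → |l ^ k - l' ^ k| ≤ B / k → |l - l'| ≤ C * B / k ^ 2 := by
  obtain ⟨E, hE, hb⟩ := exists_pow_bounds hA
  refine ⟨E * E, by nlinarith, ?_⟩
  intro l l' B k hk h1 h2 h3 h4 h5
  have hk' : (0 : ℝ) < k := by exact_mod_cast hk
  have p1 := (hb l k hk h1 h3).1
  have p2 := (hb l' k hk h2 h4).1
  have hE0 : 0 < E := by linarith
  -- `l^k - l'^k` is `l - l'` times a sum of `k` terms, each at least `E⁻²`. This gains the extra
  -- factor `1/k`.
  have hs : k * (E⁻¹ * E⁻¹) ≤ ∑ i ∈ Finset.range k, l ^ i * l' ^ (k - 1 - i) := by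
    have := Finset.card_nsmul_le_sum (Finset.range k) (fun i => l ^ i * l' ^ (k - 1 - i))
      (E⁻¹ * E⁻¹) (fun i hi => by
        have := Finset.mem_range.1 hi
        exact mul_le_mul (p1 i this.le).1 (p2 (k - 1 - i) (by omega)).1 (by positivity)
          (pow_nonneg (by linarith) _))
    simpa using this
  have hs0 : 0 ≤ ∑ i ∈ Finset.range k, l ^ i * l' ^ (k - 1 - i) := le_trans (by positivity) hs
  have h6 := (Commute.all l l').geom_sum₂_mul k
  rw [← h6, abs_mul, abs_of_nonneg hs0] at h5
  have h7 : k * (E⁻¹ * E⁻¹) * |l - l'| ≤ B / k :=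
    (mul_le_mul_of_nonneg_right hs (abs_nonneg _)).trans h5
  rw [le_div_iff₀ hk'] at h7
  rw [le_div_iff₀ (by positivity)]
  have h8 : k * (E⁻¹ * E⁻¹) * |l - l'| * k * (E * E) ≤ B * (E * E) :=
    mul_le_mul_of_nonneg_right h7 (by positivity)
  have h9 : k * (E⁻¹ * E⁻¹) * |l - l'| * k * (E * E) = |l - l'| * k ^ 2 := by field_simp
  linarith

/-- If `R_k = O(1/k)` and `λ - 1 = O(1/k)` then the drift is comparable with `-1/k`. -/
theorem exists_drift_le {A t : ℝ} (hA : 0 ≤ A) (ht : 0 < t) :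
    ∃ (c : ℝ) (k₀ : ℕ), 0 < c ∧ ∀ (l g : ℝ) (k : ℕ), k₀ ≤ k → 1 / 2 ≤ l → |l - 1| ≤ A / k →
      |affIter l g t k| ≤ A / k → g ≤ -(c / k) ∧ g + (l - 1) * t ≤ -(c / k) := by
  obtain ⟨E, hE, hb⟩ := exists_pow_bounds hA
  have hE0 : 0 < E := by linarith
  obtain ⟨k₀, hk₀⟩ := exists_nat_gt (2 * A * E / t)
  refine ⟨t / (2 * E ^ 2), k₀ + 1, by positivity, ?_⟩
  intro l g k hk h1 h2 h3
  have hk' : (0 : ℝ) < k := by exact_mod_cast (by omega : 0 < k)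
  obtain ⟨p, s1, s2⟩ := hb l k (by omega) h1 h2
  -- The result is `l^k t + g S` and also `t + (g + (l - 1) t) S`. Both leading terms are at least
  -- `t/E`, while the result is at most `t/(2E)` for large `k`. So both products with `S` are at
  -- most `-t/(2E)`, and `S ≤ k E`.
  have e1 : affIter l g t k = l ^ k * t + g * ∑ i ∈ Finset.range k, l ^ i := rfl
  have e2 := affIter_eq l g t k
  set S := ∑ i ∈ Finset.range k, l ^ i
  have hS : 0 < S := lt_of_lt_of_le (by positivity) s1
  have h4 : A / k ≤ t / (2 * E) := by
    rw [div_le_div_iff₀ hk' (by positivity)]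
    have h5 : (k₀ : ℝ) ≤ k := by exact_mod_cast (by omega : k₀ ≤ k)
    have h6 : 2 * A * E / t ≤ k := hk₀.le.trans h5
    rw [div_le_iff₀ ht] at h6
    linarith
  have hEt : t / E ≤ t := div_le_self ht.le hE
  have h2E : t / (2 * E) = (t / E) / 2 := by field_simp
  have h7 : E⁻¹ * t ≤ l ^ k * t := mul_le_mul_of_nonneg_right (p k le_rfl).1 ht.le
  have h8 : E⁻¹ * t = t / E := by field_simp
  have key : ∀ a : ℝ, a * S ≤ -(t / (2 * E)) → a ≤ -(t / (2 * E ^ 2) / k) := by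
    intro a ha
    have h9 : a * S ≤ -(t / (2 * E ^ 2) / k) * S := by
      have h10 : t / (2 * E ^ 2) / k * S ≤ t / (2 * E ^ 2) / k * (k * E) := by gcongr
      have h11 : t / (2 * E ^ 2) / k * (k * E) = t / (2 * E) := by field_simp
      linarith
    exact le_of_mul_le_mul_right h9 hS
  have h12 := (abs_le.1 h3).2
  have h13 := (abs_le.1 h3).1
  refine ⟨key _ ?_, key _ ?_⟩
  · linarith
  · linarith

end PWL


namespace PWL

/-! ### Localisation in the parameter plane -/

/-- First order model of the parameter dependence near `ξ₀`: `λ` and the drift `g`, and the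
coordinates `η` and `ν`. -/
structure PlanarModel (ξ₀ : ℝ × ℝ) (l g η ν : ℝ × ℝ → ℝ) (L₁ L₂ : ℝ × ℝ →L[ℝ] ℝ)
    (t α β C r : ℝ) : Prop where
  t_pos : 0 < t
  alpha_ne : α ≠ 0
  beta_ne : β ≠ 0
  one_le : 1 ≤ C
  r_pos : 0 < r
  r_le : r ≤ 1
  cont_l : ∀ ξ, ‖ξ - ξ₀‖ < r → ContinuousAt l ξ
  cont_g : ∀ ξ, ‖ξ - ξ₀‖ < r → ContinuousAt g ξ
  half : ∀ ξ, ‖ξ - ξ₀‖ < r → |l ξ - 1| ≤ 1 / 2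
  taylor_l : ∀ ξ, ‖ξ - ξ₀‖ < r → |l ξ - 1 - L₁ (ξ - ξ₀)| ≤ C * ‖ξ - ξ₀‖ ^ 2
  taylor_g : ∀ ξ, ‖ξ - ξ₀‖ < r → |g ξ - L₂ (ξ - ξ₀)| ≤ C * ‖ξ - ξ₀‖ ^ 2
  drift_nu : ∀ ξ, ‖ξ - ξ₀‖ < r → |g ξ - α * ν ξ| ≤ C * ‖ξ - ξ₀‖ ^ 2
  drift_eta : ∀ ξ, ‖ξ - ξ₀‖ < r → |g ξ + (l ξ - 1) * t - β * η ξ| ≤ C * ‖ξ - ξ₀‖ ^ 2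
  dist_le : ∀ ξ ξ', ‖ξ - ξ₀‖ < r → ‖ξ' - ξ₀‖ < r →
    ‖ξ - ξ'‖ ≤ C * (|η ξ - η ξ'| + |ν ξ - ν ξ'|)
  eta_zero : η ξ₀ = 0
  nu_zero : ν ξ₀ = 0
  lower : ∀ v, ‖v‖ ≤ C * (|L₁ v| + |L₂ v|)
  upper₁ : ∀ v, |L₁ v| ≤ C * ‖v‖
  upper₂ : ∀ v, |L₂ v| ≤ C * ‖v‖
  dir : ∃ w, L₁ w = 0 ∧ L₂ w = 1

namespace PlanarModel

variable {ξ₀ : ℝ × ℝ} {l g η ν : ℝ × ℝ → ℝ} {L₁ L₂ : ℝ × ℝ →L[ℝ] ℝ} {t α β C r : ℝ}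

theorem half_le (P : PlanarModel ξ₀ l g η ν L₁ L₂ t α β C r) {ξ : ℝ × ℝ} (h : ‖ξ - ξ₀‖ < r) :
    1 / 2 ≤ l ξ ∧ l ξ ≤ 3 / 2 := by
  have := abs_le.1 (P.half ξ h)
  constructor <;> linarith [this.1, this.2]

theorem bounds (P : PlanarModel ξ₀ l g η ν L₁ L₂ t α β C r) {ξ : ℝ × ℝ} (h : ‖ξ - ξ₀‖ < r) :
    |l ξ - 1| ≤ 2 * C * ‖ξ - ξ₀‖ ∧ |g ξ| ≤ 2 * C * ‖ξ - ξ₀‖ := by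
  have h0 := norm_nonneg (ξ - ξ₀)
  have h1 : ‖ξ - ξ₀‖ ^ 2 ≤ ‖ξ - ξ₀‖ := by
    rw [pow_two]; exact mul_le_of_le_one_left h0 (h.le.trans P.r_le)
  have h2 : C * ‖ξ - ξ₀‖ ^ 2 ≤ C * ‖ξ - ξ₀‖ := mul_le_mul_of_nonneg_left h1 (by linarith [P.one_le])
  have h3 := abs_le.1 (P.taylor_l ξ h)
  have h4 := abs_le.1 (P.taylor_g ξ h)
  have h5 := abs_le.1 (P.upper₁ (ξ - ξ₀))
  have h6 := abs_le.1 (P.upper₂ (ξ - ξ₀))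
  refine ⟨?_, ?_⟩ <;> rw [abs_le] <;> constructor <;> linarith [h3.1, h3.2, h4.1, h4.2, h5.1, h5.2,
    h6.1, h6.2]

/-- A bound of `λ - 1` and `g` bounds the distance to `ξ₀`. -/
theorem norm_le (P : PlanarModel ξ₀ l g η ν L₁ L₂ t α β C r) {ξ : ℝ × ℝ} (h : ‖ξ - ξ₀‖ < r)
    (h' : 4 * C ^ 2 * ‖ξ - ξ₀‖ ≤ 1) : ‖ξ - ξ₀‖ ≤ 2 * C * (|l ξ - 1| + |g ξ|) := by
  have hC := P.one_le
  have h0 := norm_nonneg (ξ - ξ₀)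
  have h1 := P.lower (ξ - ξ₀)
  have h2 : |L₁ (ξ - ξ₀)| ≤ |l ξ - 1| + C * ‖ξ - ξ₀‖ ^ 2 := by
    have := abs_sub_abs_le_abs_sub (L₁ (ξ - ξ₀)) (l ξ - 1)
    linarith [P.taylor_l ξ h, abs_sub_comm (L₁ (ξ - ξ₀)) (l ξ - 1)]
  have h3 : |L₂ (ξ - ξ₀)| ≤ |g ξ| + C * ‖ξ - ξ₀‖ ^ 2 := by
    have := abs_sub_abs_le_abs_sub (L₂ (ξ - ξ₀)) (g ξ)
    linarith [P.taylor_g ξ h, abs_sub_comm (L₂ (ξ - ξ₀)) (g ξ)]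
  have h4 : C * (C * ‖ξ - ξ₀‖ ^ 2 + C * ‖ξ - ξ₀‖ ^ 2) ≤ ‖ξ - ξ₀‖ / 2 := by
    have : 4 * C ^ 2 * ‖ξ - ξ₀‖ * ‖ξ - ξ₀‖ ≤ 1 * ‖ξ - ξ₀‖ := mul_le_mul_of_nonneg_right h' h0
    nlinarith
  have h5 : C * (|L₁ (ξ - ξ₀)| + |L₂ (ξ - ξ₀)|) ≤
      C * (|l ξ - 1| + |g ξ|) + C * (C * ‖ξ - ξ₀‖ ^ 2 + C * ‖ξ - ξ₀‖ ^ 2) := by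
    rw [← mul_add]
    exact mul_le_mul_of_nonneg_left (by linarith) (by linarith)
  linarith

/-- Points where `λ^k` is close to a given positive number and `R_k` is small. -/
theorem exists_endpoint_bounds (P : PlanarModel ξ₀ l g η ν L₁ L₂ t α β C r) {B y σ : ℝ}
    (hB : 1 ≤ B) (hy : 0 < y) (hσ0 : 0 ≤ σ) (hσ1 : σ < 1) :
    ∃ (A r₁ : ℝ) (k₀ : ℕ), 1 ≤ A ∧ 0 < r₁ ∧ ∀ ξ, ‖ξ - ξ₀‖ < r₁ → ∀ k : ℕ, k₀ ≤ k →
      |affIter (l ξ) (g ξ) t k| ≤ B * ‖ξ - ξ₀‖ * (1 + l ξ ^ k) →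
      |l ξ ^ k - y| ≤ B * (‖ξ - ξ₀‖ + σ ^ k) →
      ‖ξ - ξ₀‖ ≤ A / k ∧ |affIter (l ξ) (g ξ) t k| ≤ A / k ∧ |l ξ ^ k - y| ≤ A / k := by
  have hC := P.one_le
  have hr := P.r_pos
  have ht := P.t_pos
  -- For small radius and large `k` the hypothesis on `λ^k` gives `|λ^k - y| ≤ y/2`. Then `λ - 1 =
  -- O(1/k)`, the geometric sum is of order `k`, and `R_k` bounded forces `g = O(1/k)`; finally
  -- `norm_le` bounds the distance.
  obtain ⟨A₁, hA₁, b₁⟩ := exists_abs_sub_one_le (c := y / 2) (C := 3 * y / 2) (by positivity)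
  obtain ⟨E, hE, b₂⟩ := exists_pow_bounds (A := A₁) (by linarith)
  obtain ⟨k₁, hk₁⟩ : ∃ k₁ : ℕ, ∀ k, k₁ ≤ k → B * σ ^ k ≤ y / 4 ∧ k * σ ^ k ≤ 1 := by
    have h1 : Tendsto (fun k : ℕ => B * σ ^ k) atTop (𝓝 0) := by
      simpa using (tendsto_pow_atTop_nhds_zero_of_lt_one hσ0 hσ1).const_mul B
    have h2 : Tendsto (fun k : ℕ => (k : ℝ) * σ ^ k) atTop (𝓝 0) :=
      tendsto_self_mul_const_pow_of_lt_one hσ0 hσ1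
    exact eventually_atTop.1 ((h1.eventually_le_const (by positivity)).and
      (h2.eventually_le_const one_pos))
  set A₂ := E * (E * t + B * (1 + E)) with hA₂
  set A₃ := 2 * C * (A₁ + A₂) with hA₃
  have hA₂0 : 0 < A₂ := by positivity
  have hA₃0 : 0 < A₃ := by positivity
  set r₁ := min r (min (1 / (4 * C ^ 2)) (y / (4 * B))) with hr₁
  refine ⟨A₃ * (B * (1 + E)) + A₃ + B * (A₃ + 1) + 1, r₁, k₁ + 1, by
    have : 0 ≤ A₃ * (B * (1 + E)) + A₃ + B * (A₃ + 1) := by positivity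
    linarith, by positivity, ?_⟩
  intro ξ hξ k hk hR hl
  have hk' : (0 : ℝ) < k := by exact_mod_cast (by omega : 0 < k)
  have hξr : ‖ξ - ξ₀‖ < r := hξ.trans_le (min_le_left _ _)
  have hξ2 : 4 * C ^ 2 * ‖ξ - ξ₀‖ ≤ 1 := by
    have := hξ.le.trans ((min_le_right _ _).trans (min_le_left _ _))
    rw [le_div_iff₀ (by positivity)] at this
    linarith
  have hξ3 : B * ‖ξ - ξ₀‖ ≤ y / 4 := by
    have := hξ.le.trans ((min_le_right _ _).trans (min_le_right _ _))
    rw [le_div_iff₀ (by positivity)] at this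
    linarith
  have h0 := norm_nonneg (ξ - ξ₀)
  obtain ⟨hl1, hl2⟩ := P.half_le hξr
  obtain ⟨hs1, hs2⟩ := hk₁ k (by omega)
  have hy2 := abs_le.1 hl
  have hla := b₁ (l ξ) k (by omega) hl1 hl2 (by linarith [hy2.1]) (by linarith [hy2.2])
  obtain ⟨p, s1, s2⟩ := b₂ (l ξ) k (by omega) hl1 hla
  have hE0 : 0 < E := by linarith
  have hpk := (p k le_rfl).2
  have hR1 : |affIter (l ξ) (g ξ) t k| ≤ B * ‖ξ - ξ₀‖ * (1 + E) :=
    hR.trans (by gcongr)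
  have hR2 : |affIter (l ξ) (g ξ) t k| ≤ B * (1 + E) := by
    refine hR1.trans ?_
    have : ‖ξ - ξ₀‖ ≤ 1 := hξr.le.trans P.r_le
    have h3 : B * ‖ξ - ξ₀‖ ≤ B * 1 := by gcongr
    calc B * ‖ξ - ξ₀‖ * (1 + E) ≤ B * 1 * (1 + E) := by gcongr
      _ = _ := by ring
  have hg : |g ξ| ≤ A₂ / k := by
    have e : g ξ * ∑ i ∈ Finset.range k, l ξ ^ i = affIter (l ξ) (g ξ) t k - l ξ ^ k * t := by
      rw [affIter]; ring
    have hS : 0 ≤ ∑ i ∈ Finset.range k, l ξ ^ i := le_trans (by positivity) s1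
    have h1 : |g ξ| * ∑ i ∈ Finset.range k, l ξ ^ i ≤ B * (1 + E) + E * t := by
      rw [← abs_of_nonneg hS, ← abs_mul, e]
      refine (abs_sub _ _).trans (add_le_add hR2 ?_)
      rw [abs_mul, abs_of_pos ht, abs_of_nonneg (pow_nonneg (by linarith) _)]
      gcongr
    have h2 : |g ξ| * (k * E⁻¹) ≤ B * (1 + E) + E * t :=
      (mul_le_mul_of_nonneg_left s1 (abs_nonneg _)).trans h1
    rw [le_div_iff₀ hk']
    have h3 : |g ξ| * k = |g ξ| * (k * E⁻¹) * E := by field_simp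
    rw [h3, hA₂]
    nlinarith
  have hδ : ‖ξ - ξ₀‖ ≤ A₃ / k := by
    refine (P.norm_le hξr hξ2).trans ?_
    calc 2 * C * (|l ξ - 1| + |g ξ|) ≤ 2 * C * (A₁ / k + A₂ / k) := by gcongr
      _ = A₃ / k := by rw [hA₃]; ring
  have hσk : σ ^ k ≤ 1 / k := by rw [le_div_iff₀ hk']; linarith
  have q1 : 0 ≤ A₃ * (B * (1 + E)) := by positivity
  have q2 : 0 ≤ B * (A₃ + 1) := by positivity
  refine ⟨hδ.trans (div_le_div_of_nonneg_right (by linarith) hk'.le), ?_, ?_⟩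
  · refine hR1.trans ?_
    calc B * ‖ξ - ξ₀‖ * (1 + E) ≤ B * (A₃ / k) * (1 + E) := by gcongr
      _ = A₃ * (B * (1 + E)) / k := by ring
      _ ≤ _ := div_le_div_of_nonneg_right (by linarith) hk'.le
  · refine hl.trans ?_
    calc B * (‖ξ - ξ₀‖ + σ ^ k) ≤ B * (A₃ / k + 1 / k) := by gcongr
      _ = B * (A₃ + 1) / k := by ring
      _ ≤ _ := div_le_div_of_nonneg_right (by linarith) hk'.le

/-- Points in the cone where both drifts are negative and comparable with the distance to `ξ₀`,
and `R_k` is small. -/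
theorem exists_cone_bounds (P : PlanarModel ξ₀ l g η ν L₁ L₂ t α β C r) {B c : ℝ}
    (hB : 1 ≤ B) (hc : 0 < c) :
    ∃ (A r₁ : ℝ), 1 ≤ A ∧ 0 < r₁ ∧ ∀ ξ, ‖ξ - ξ₀‖ < r₁ → ∀ k : ℕ, 0 < k →
      |affIter (l ξ) (g ξ) t k| ≤ B * ‖ξ - ξ₀‖ * (1 + l ξ ^ k) →
      g ξ ≤ -(c * ‖ξ - ξ₀‖) → g ξ + (l ξ - 1) * t ≤ -(c * ‖ξ - ξ₀‖) →
      ‖ξ - ξ₀‖ ≤ A / k ∧ |affIter (l ξ) (g ξ) t k| ≤ A / k := by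
  have hC := P.one_le
  have hr := P.r_pos
  have ht := P.t_pos
  set G := 2 * C with hG
  set G' := 2 * C * (1 + t) with hG'
  have hG0 : 0 < G := by positivity
  have hG'0 : 0 < G' := by positivity
  -- With `S = ∑_{i<k} λ^i`, the constants `X`, `x₀` bound `x = ‖ξ - ξ₀‖ S` above and below, and
  -- `Y`, `y₀` bound `λ^k`. They come from `R = λ^k t + g S = t + (g + (λ-1) t) S` with `R` small,
  -- since both products with `S` lie between `-const · x` and `-c x`. Bounds on `λ^k` make `S` of
  -- order `k`, so `‖ξ - ξ₀‖ = x / S = O(1/k)`.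
  set X := 4 * t / c with hX
  have hX0 : 0 < X := by positivity
  set Y := 1 + 2 * G * X / t with hY
  have hY1 : 1 ≤ Y := by
    have : 0 ≤ 2 * G * X / t := by positivity
    linarith
  set x₀ := t / (2 * G') with hx₀
  have hx₀0 : 0 < x₀ := by positivity
  set y₀ := c * x₀ / (2 * t) with hy₀
  have hy₀0 : 0 < y₀ := by positivity
  obtain ⟨A₁, hA₁, b₁⟩ := exists_abs_sub_one_le (c := y₀) (C := Y) hy₀0
  obtain ⟨E, hE, b₂⟩ := exists_pow_bounds (A := A₁) (by linarith)
  have hE0 : 0 < E := by linarith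
  set m := min (min (t / 2) (c * t / (4 * G))) (min (t / (2 * (1 + Y))) (c * x₀ / (2 * (1 + Y))))
    with hm
  have hm0 : 0 < m := by positivity
  have hXE : 0 ≤ X * E := by positivity
  refine ⟨X * E * (B * (1 + Y)) + X * E + 1, min r (m / B), by
    have : 0 ≤ X * E * (B * (1 + Y)) := by positivity
    linarith, by positivity, ?_⟩
  intro ξ hξ k hk hR hg1 hg2
  have hk' : (0 : ℝ) < k := by exact_mod_cast hk
  have hξr : ‖ξ - ξ₀‖ < r := hξ.trans_le (min_le_left _ _)
  have hξm : B * ‖ξ - ξ₀‖ ≤ m := by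
    have := hξ.le.trans (min_le_right _ _)
    rw [le_div_iff₀ (by positivity)] at this
    linarith
  have m1 : B * ‖ξ - ξ₀‖ ≤ t / 2 := hξm.trans ((min_le_left _ _).trans (min_le_left _ _))
  have m2 : B * ‖ξ - ξ₀‖ ≤ c * t / (4 * G) := hξm.trans ((min_le_left _ _).trans (min_le_right _ _))
  have m3 : B * ‖ξ - ξ₀‖ ≤ t / (2 * (1 + Y)) :=
    hξm.trans ((min_le_right _ _).trans (min_le_left _ _))
  have m4 : B * ‖ξ - ξ₀‖ ≤ c * x₀ / (2 * (1 + Y)) :=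
    hξm.trans ((min_le_right _ _).trans (min_le_right _ _))
  obtain ⟨hl1, hl2⟩ := P.half_le hξr
  obtain ⟨hb1, hb2⟩ := P.bounds hξr
  have e1 : affIter (l ξ) (g ξ) t k = l ξ ^ k * t + g ξ * ∑ i ∈ Finset.range k, l ξ ^ i := rfl
  have e2 := affIter_eq (l ξ) (g ξ) t k
  have hS0 : 0 ≤ ∑ i ∈ Finset.range k, l ξ ^ i :=
    Finset.sum_nonneg fun i _ => pow_nonneg (by linarith) _
  have hδ0 := norm_nonneg (ξ - ξ₀)
  have hyp : 0 < l ξ ^ k := pow_pos (by linarith) _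
  have hgl : |g ξ + (l ξ - 1) * t| ≤ G' * ‖ξ - ξ₀‖ := by
    refine (abs_add_le _ _).trans ?_
    rw [abs_mul, abs_of_pos ht, hG']
    nlinarith
  set R := affIter (l ξ) (g ξ) t k
  set S := ∑ i ∈ Finset.range k, l ξ ^ i with hS
  set δ := ‖ξ - ξ₀‖ with hδ
  set y := l ξ ^ k with hy
  set g' := g ξ + (l ξ - 1) * t
  set x := δ * S with hx
  have hx0 : 0 ≤ x := mul_nonneg hδ0 hS0
  have hR' := abs_le.1 hR
  have hgS : -(G * x) ≤ g ξ * S := by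
    have := (abs_le.1 hb2).1
    have h3 : -(2 * C * δ) * S ≤ g ξ * S := mul_le_mul_of_nonneg_right this hS0
    rw [hG, hx]; linarith
  have hg'S : -(G' * x) ≤ g' * S := by
    have := (abs_le.1 hgl).1
    have h3 : -(G' * δ) * S ≤ g' * S := mul_le_mul_of_nonneg_right this hS0
    rw [hx]; linarith
  have hcg : g ξ * S ≤ -(c * x) := by
    have := mul_le_mul_of_nonneg_right hg1 hS0
    rw [hx]; linarith
  have hcg' : g' * S ≤ -(c * x) := by
    have := mul_le_mul_of_nonneg_right hg2 hS0
    rw [hx]; linarith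
  have hBy : B * δ * y ≤ t / 2 * y := mul_le_mul_of_nonneg_right m1 hyp.le
  have hBG : B * δ * (4 * G) ≤ c * t := by rwa [le_div_iff₀ (by positivity)] at m2
  have i1 : y * t ≤ t + 2 * (G * x) := by linarith
  -- an upper bound of `x`
  have i2 : c * x ≤ t + B * δ + B * δ * y := by linarith
  have i3 : B * δ * (y * t) ≤ B * δ * (t + 2 * (G * x)) := by gcongr
  have hxX : x ≤ X := by
    rw [hX, le_div_iff₀ hc]
    have i4 : c * x * t ≤ (t + B * δ) * t + B * δ * (t + 2 * (G * x)) := by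
      have := mul_le_mul_of_nonneg_right i2 ht.le
      linarith
    have i5 : B * δ * (4 * G) * x ≤ c * t * x := mul_le_mul_of_nonneg_right hBG hx0
    have i6 : B * δ * t ≤ t / 2 * t := mul_le_mul_of_nonneg_right m1 ht.le
    have i7 : c * x * t ≤ 4 * t * t := by linarith
    have := le_of_mul_le_mul_right i7 ht
    linarith
  have hyY : y ≤ Y := by
    have h3 : y * t ≤ Y * t := by
      have : Y * t = t + 2 * (G * X) := by rw [hY]; field_simp
      rw [this]
      have : G * x ≤ G * X := by gcongr
      linarith
    exact le_of_mul_le_mul_right h3 ht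
  have hBY : B * δ * (1 + y) ≤ B * δ * (1 + Y) := by gcongr
  have h1Y : 0 < 2 * (1 + Y) := by linarith
  have m3' : B * δ * (1 + Y) ≤ t / 2 := by
    rw [le_div_iff₀ h1Y] at m3; linarith
  have m4' : B * δ * (1 + Y) ≤ c * x₀ / 2 := by
    rw [le_div_iff₀ h1Y] at m4; linarith
  have hxx : x₀ ≤ x := by
    rw [hx₀, div_le_iff₀ (by positivity)]
    linarith
  have hyy : y₀ ≤ y := by
    rw [hy₀, div_le_iff₀ (by positivity)]
    have : c * x₀ ≤ c * x := by gcongr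
    linarith
  have hla := b₁ (l ξ) k hk hl1 hl2 hyy hyY
  obtain ⟨p, s1, s2⟩ := b₂ (l ξ) k hk hl1 hla
  have hδk : δ ≤ X * E / k := by
    rw [le_div_iff₀ hk']
    have h3 : δ * (k * E⁻¹) ≤ X := (mul_le_mul_of_nonneg_left s1 hδ0).trans hxX
    have h4 : δ * k = δ * (k * E⁻¹) * E := by field_simp
    rw [h4]
    gcongr
  refine ⟨hδk.trans (div_le_div_of_nonneg_right ?_ hk'.le), (hR.trans hBY).trans ?_⟩
  · have : 0 ≤ X * E * (B * (1 + Y)) := by positivity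
    linarith
  · calc B * δ * (1 + Y) ≤ B * (X * E / k) * (1 + Y) := by gcongr
      _ = X * E * (B * (1 + Y)) / k := by ring
      _ ≤ _ := div_le_div_of_nonneg_right (by linarith) hk'.le

end PlanarModel

end PWL


/-! ### Cones in polar coordinates, bounded regions, and interpolation of estimates in the plane. -/

namespace PWL

/-- In polar coordinates with elliptic scaling, a point whose angle is between those of two points
on the same side of the horizontal axis is in the cone that these span. -/
theorem exists_polar_cone {E₁ E₂ r r₁ r₂ θ θ₁ θ₂ : ℝ} (hr : 0 < r) (hr₁ : 0 < r₁) (hr₂ : 0 < r₂)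
    (h₁ : 0 ≤ θ₁) (h₁' : θ₁ < 2 * Real.pi) (h₂ : 0 ≤ θ₂) (h₂' : θ₂ < 2 * Real.pi)
    (hs : 0 < Real.sin θ₁ * Real.sin θ₂) (hθ : θ ∈ uIoo θ₁ θ₂) :
    ∃ A B : ℝ, 0 ≤ A ∧ 0 ≤ B ∧
      E₁ * r * Real.cos θ = A * (E₁ * r₁ * Real.cos θ₁) + B * (E₁ * r₂ * Real.cos θ₂) ∧
      E₂ * r * Real.sin θ = A * (E₂ * r₁ * Real.sin θ₁) + B * (E₂ * r₂ * Real.sin θ₂) := by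
  wlog hle : θ₁ ≤ θ₂ generalizing r₁ r₂ θ₁ θ₂
  · obtain ⟨A, B, hA, hB, e1, e2⟩ := this hr₂ hr₁ h₂ h₂' h₁ h₁' (by rwa [mul_comm])
      (by rwa [uIoo_comm]) (not_le.1 hle).le
    exact ⟨B, A, hB, hA, by linarith, by linarith⟩
  rw [uIoo_of_le hle] at hθ
  obtain ⟨hl, hh⟩ := hθ
  have hpi := Real.pi_pos
  -- Sines of equal sign put both angles in the same open half turn.
  have hdiff : θ₂ - θ₁ < Real.pi := by
    rcases lt_or_ge θ₁ Real.pi with h | h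
    · by_contra hc
      have h3 : Real.sin θ₂ ≤ 0 := by
        have := Real.sin_nonneg_of_nonneg_of_le_pi (x := θ₂ - Real.pi) (by linarith) (by linarith)
        rw [Real.sin_sub_pi] at this
        linarith
      have h4 : 0 ≤ Real.sin θ₁ := Real.sin_nonneg_of_nonneg_of_le_pi h₁ h.le
      nlinarith
    · linarith
  have d0 : 0 < Real.sin (θ₂ - θ₁) := Real.sin_pos_of_pos_of_lt_pi (by linarith) hdiff
  have d1 : 0 < Real.sin (θ₂ - θ) := Real.sin_pos_of_pos_of_lt_pi (by linarith) (by linarith)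
  have d2 : 0 < Real.sin (θ - θ₁) := Real.sin_pos_of_pos_of_lt_pi (by linarith) (by linarith)
  have p1 := Real.sin_sq_add_cos_sq θ
  -- With `e(θ)` the unit vector of angle `θ`, the coefficients come from `sin (θ₂ - θ₁) e(θ) = sin
  -- (θ₂ - θ) e(θ₁) + sin (θ - θ₁) e(θ₂)`.
  refine ⟨r * Real.sin (θ₂ - θ) / (Real.sin (θ₂ - θ₁) * r₁),
    r * Real.sin (θ - θ₁) / (Real.sin (θ₂ - θ₁) * r₂), by positivity, by positivity, ?_, ?_⟩
  · have e : Real.sin (θ₂ - θ₁) * Real.cos θ =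
        Real.sin (θ₂ - θ) * Real.cos θ₁ + Real.sin (θ - θ₁) * Real.cos θ₂ := by
      simp only [Real.sin_sub]; ring
    field_simp
    linear_combination E₁ * e
  · have e : Real.sin (θ₂ - θ₁) * Real.sin θ =
        Real.sin (θ₂ - θ) * Real.sin θ₁ + Real.sin (θ - θ₁) * Real.sin θ₂ := by
      simp only [Real.sin_sub]; ring
    field_simp
    linear_combination E₂ * e

/-- From a point of a region bounded by `Γ`, every ray meets `Γ`. -/
theorem exists_mem_of_regionBoundedBy {Γ : Set (ℝ × ℝ)} {ξ w : ℝ × ℝ} (h : ξ ∈ regionBoundedBy Γ)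
    (hw : w ≠ 0) : ∃ s : ℝ, 0 ≤ s ∧ ξ + s • w ∈ Γ := by
  by_contra! hc
  -- A ray missing `Γ` is a connected unbounded set in the component of the complement that contains
  -- its origin.
  have h1 : (fun s : ℝ => ξ + s • w) '' Ici 0 ⊆ connectedComponentIn Γᶜ ξ := by
    refine IsPreconnected.subset_connectedComponentIn ?_ ⟨0, by simp, by simp⟩ ?_
    · exact (convex_Ici (0 : ℝ)).isPreconnected.image _ (by fun_prop)
    · rintro _ ⟨s, hs, rfl⟩
      exact hc s hs
  obtain ⟨R, hR⟩ := (Bornology.IsBounded.subset (show Bornology.IsBounded (connectedComponentIn Γᶜ ξ) from h) h1).exists_norm_le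
  have hw' : 0 < ‖w‖ := norm_pos_iff.2 hw
  have hR0 : 0 ≤ R := (norm_nonneg _).trans (hR _ ⟨0, by simp, rfl⟩)
  have h2 := hR (ξ + ((R + ‖ξ‖ + 1) / ‖w‖) • w) ⟨_, by simp only [mem_Ici]; positivity, rfl⟩
  have h3 : ‖((R + ‖ξ‖ + 1) / ‖w‖) • w‖ = R + ‖ξ‖ + 1 := by
    rw [norm_smul, Real.norm_of_nonneg (by positivity)]
    field_simp
  have h4 := norm_sub_le (ξ + ((R + ‖ξ‖ + 1) / ‖w‖) • w) ξ
  rw [add_sub_cancel_left, h3] at h4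
  linarith

theorem affIter_mono {l g g' t : ℝ} (hl : 0 ≤ l) (hg : g ≤ g') (k : ℕ) :
    affIter l g t k ≤ affIter l g' t k := by
  simp only [affIter]
  have : 0 ≤ ∑ i ∈ Finset.range k, l ^ i := Finset.sum_nonneg fun i _ => pow_nonneg hl _
  linarith [mul_le_mul_of_nonneg_right hg this]

namespace PlanarModel

variable {ξ₀ : ℝ × ℝ} {l g η ν : ℝ × ℝ → ℝ} {L₁ L₂ : ℝ × ℝ →L[ℝ] ℝ} {t α β C r : ℝ}

/-- Negativity of both drifts passes from two points to the points with angle between theirs. -/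
theorem exists_cone_le (P : PlanarModel ξ₀ l g η ν L₁ L₂ t α β C r) {c : ℝ} (hc : 0 < c) :
    ∃ c' r₁ : ℝ, 0 < c' ∧ 0 < r₁ ∧ ∀ p q ξ, ‖p - ξ₀‖ < r₁ → ‖q - ξ₀‖ < r₁ → ‖ξ - ξ₀‖ < r₁ →
      0 < ‖p - ξ₀‖ → 0 < ‖q - ξ₀‖ →
      g p ≤ -(c * ‖p - ξ₀‖) → g p + (l p - 1) * t ≤ -(c * ‖p - ξ₀‖) →
      g q ≤ -(c * ‖q - ξ₀‖) → g q + (l q - 1) * t ≤ -(c * ‖q - ξ₀‖) →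
      ∀ E₁ E₂ s s₁ s₂ θ θ₁ θ₂ : ℝ, 0 ≤ E₂ → 0 < s → 0 < s₁ → 0 < s₂ →
      0 ≤ θ₁ → θ₁ < 2 * Real.pi → 0 ≤ θ₂ → θ₂ < 2 * Real.pi → θ ∈ uIoo θ₁ θ₂ →
      η p = E₁ * s₁ * Real.cos θ₁ → ν p = E₂ * s₁ * Real.sin θ₁ →
      η q = E₁ * s₂ * Real.cos θ₂ → ν q = E₂ * s₂ * Real.sin θ₂ →
      η ξ = E₁ * s * Real.cos θ → ν ξ = E₂ * s * Real.sin θ →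
      g ξ ≤ -(c' * ‖ξ - ξ₀‖) ∧ g ξ + (l ξ - 1) * t ≤ -(c' * ‖ξ - ξ₀‖) := by
  have hC := P.one_le
  have hr := P.r_pos
  have ht := P.t_pos
  have hα := abs_pos.2 P.alpha_ne
  have hβ := abs_pos.2 P.beta_ne
  obtain ⟨D, hD⟩ : ∃ D, D = 6 * C + 2 * C * t := ⟨_, rfl⟩
  have hD0 : 0 < D := by rw [hD]; positivity
  obtain ⟨c₁, hc₁⟩ : ∃ c₁, c₁ = c / (2 * D) := ⟨_, rfl⟩
  have hc₁0 : 0 < c₁ := by rw [hc₁]; positivity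
  obtain ⟨m, hm⟩ : ∃ m, m = C * (1 / |α| + 1 / |β|) := ⟨_, rfl⟩
  have hm0 : 0 < m := by rw [hm]; positivity
  obtain ⟨c₂, hc₂⟩ : ∃ c₂, c₂ = c₁ / m := ⟨_, rfl⟩
  have hc₂0 : 0 < c₂ := by rw [hc₂]; positivity
  refine ⟨c₂ / 2, min r (min (c / (2 * C)) (c₂ / (2 * C))), by positivity, by positivity, ?_⟩
  have small : ∀ p, ‖p - ξ₀‖ < min r (min (c / (2 * C)) (c₂ / (2 * C))) →
      ‖p - ξ₀‖ < r ∧ C * ‖p - ξ₀‖ ^ 2 ≤ c / 2 * ‖p - ξ₀‖ ∧ C * ‖p - ξ₀‖ ^ 2 ≤ c₂ / 2 * ‖p - ξ₀‖ ∧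
      C * ‖p - ξ₀‖ ^ 2 ≤ C * ‖p - ξ₀‖ := by
    intro p hp
    have h0 := norm_nonneg (p - ξ₀)
    have h1 := hp.le.trans ((min_le_right _ _).trans (min_le_left _ _))
    have h2 := hp.le.trans ((min_le_right _ _).trans (min_le_right _ _))
    have h3 := hp.trans_le (min_le_left _ _)
    rw [le_div_iff₀ (by positivity)] at h1 h2
    have h4 : ‖p - ξ₀‖ ≤ 1 := h3.le.trans P.r_le
    refine ⟨h3, ?_, ?_, ?_⟩
    · nlinarith
    · nlinarith
    · rw [pow_two]
      exact mul_le_mul_of_nonneg_left (mul_le_of_le_one_left h0 h4) (by linarith)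
  -- Up to quadratic errors `-α ν` and `-β η` are the negatives of the two drifts. Requiring each to
  -- be at least a fixed fraction of their sum defines a convex cone in the `(η, ν)`-plane, which
  -- passes from `p` and `q` to their nonnegative combinations.
  have cone : ∀ p, ‖p - ξ₀‖ < min r (min (c / (2 * C)) (c₂ / (2 * C))) → 0 < ‖p - ξ₀‖ →
      g p ≤ -(c * ‖p - ξ₀‖) → g p + (l p - 1) * t ≤ -(c * ‖p - ξ₀‖) →
      0 < -(α * ν p) ∧ 0 < -(β * η p) ∧ c₁ * (-(α * ν p) + -(β * η p)) ≤ -(α * ν p) ∧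
        c₁ * (-(α * ν p) + -(β * η p)) ≤ -(β * η p) := by
    intro p hp hp0 h1 h2
    obtain ⟨s1, s2, s3, s4⟩ := small p hp
    have hn := abs_le.1 (P.drift_nu p s1)
    have he := abs_le.1 (P.drift_eta p s1)
    obtain ⟨b1, b2⟩ := P.bounds s1
    have b1' := abs_le.1 b1
    have b2' := abs_le.1 b2
    have b3 : -(2 * C * ‖p - ξ₀‖ * t) ≤ (l p - 1) * t := by
      have := mul_le_mul_of_nonneg_right b1'.1 ht.le
      linarith
    have a1 : c / 2 * ‖p - ξ₀‖ ≤ -(α * ν p) := by linarith [hn.1, hn.2]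
    have a2 : c / 2 * ‖p - ξ₀‖ ≤ -(β * η p) := by linarith [he.1, he.2]
    have a3 : -(α * ν p) + -(β * η p) ≤ D * ‖p - ξ₀‖ := by
      rw [hD]; linarith [hn.1, hn.2, he.1, he.2, b2'.1]
    have a4 : c₁ * (-(α * ν p) + -(β * η p)) ≤ c / 2 * ‖p - ξ₀‖ := by
      calc c₁ * (-(α * ν p) + -(β * η p)) ≤ c₁ * (D * ‖p - ξ₀‖) := by gcongr
        _ = c / 2 * ‖p - ξ₀‖ := by rw [hc₁]; field_simp
    have a5 : 0 < c / 2 * ‖p - ξ₀‖ := by positivity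
    exact ⟨by linarith, by linarith, by linarith, by linarith⟩
  intro p q ξ hp hq hξ hp0 hq0 gp gp' gq gq' E₁ E₂ s s₁ s₂ θ θ₁ θ₂ hE hs hs₁ hs₂ h₁ h₁' h₂ h₂' hθ
    ep np eq nq ex nx
  obtain ⟨p1, p2, p3, p4⟩ := cone p hp hp0 gp gp'
  obtain ⟨q1, q2, q3, q4⟩ := cone q hq hq0 gq gq'
  have hsin : 0 < Real.sin θ₁ * Real.sin θ₂ := by
    have h := mul_pos p1 q1
    rw [np, nq] at h
    have h' : 0 < (α ^ 2 * E₂ ^ 2 * (s₁ * s₂)) * (Real.sin θ₁ * Real.sin θ₂) := by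
      linarith
    exact pos_of_mul_pos_right h' (by positivity)
  obtain ⟨A, B, hA, hB, e1, e2⟩ := exists_polar_cone (E₁ := E₁) (E₂ := E₂) hs hs₁ hs₂ h₁ h₁' h₂ h₂'
    hsin hθ
  rw [← ex, ← ep, ← eq] at e1
  rw [← nx, ← np, ← nq] at e2
  have ea : -(α * ν ξ) = A * -(α * ν p) + B * -(α * ν q) := by rw [e2]; ring
  have eb : -(β * η ξ) = A * -(β * η p) + B * -(β * η q) := by rw [e1]; ring
  have a0 : 0 ≤ -(α * ν ξ) := by rw [ea]; positivity
  have b0 : 0 ≤ -(β * η ξ) := by rw [eb]; positivity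
  have c1 : c₁ * (-(α * ν ξ) + -(β * η ξ)) ≤ -(α * ν ξ) := by
    rw [ea, eb]
    linarith [mul_le_mul_of_nonneg_left p3 hA, mul_le_mul_of_nonneg_left q3 hB]
  have c2 : c₁ * (-(α * ν ξ) + -(β * η ξ)) ≤ -(β * η ξ) := by
    rw [ea, eb]
    linarith [mul_le_mul_of_nonneg_left p4 hA, mul_le_mul_of_nonneg_left q4 hB]
  obtain ⟨s1, s2, s3, s4⟩ := small ξ hξ
  have hd : ‖ξ - ξ₀‖ ≤ m * (-(α * ν ξ) + -(β * η ξ)) := by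
    have h := P.dist_le ξ ξ₀ s1 (by simpa using hr)
    rw [P.eta_zero, P.nu_zero, sub_zero, sub_zero] at h
    have f1 : |ν ξ| = -(α * ν ξ) / |α| := by
      rw [← abs_of_nonneg a0, abs_neg, abs_mul]; field_simp
    have f2 : |η ξ| = -(β * η ξ) / |β| := by
      rw [← abs_of_nonneg b0, abs_neg, abs_mul]; field_simp
    refine h.trans ?_
    rw [f1, f2, hm, mul_assoc]
    refine mul_le_mul_of_nonneg_left ?_ (by linarith)
    have g1 : 0 ≤ 1 / |α| * -(β * η ξ) := by positivity
    have g2 : 0 ≤ 1 / |β| * -(α * ν ξ) := by positivity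
    have : (1 / |α| + 1 / |β|) * (-(α * ν ξ) + -(β * η ξ)) = -(β * η ξ) / |β| + -(α * ν ξ) / |α| +
      (1 / |α| * -(β * η ξ) + 1 / |β| * -(α * ν ξ)) := by ring
    linarith
  have hd' : c₂ * ‖ξ - ξ₀‖ ≤ c₁ * (-(α * ν ξ) + -(β * η ξ)) := by
    calc c₂ * ‖ξ - ξ₀‖ ≤ c₂ * (m * (-(α * ν ξ) + -(β * η ξ))) := by gcongr
      _ = _ := by rw [hc₂]; field_simp
  have hn := abs_le.1 (P.drift_nu ξ s1)
  have he := abs_le.1 (P.drift_eta ξ s1)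
  constructor
  · linarith [hn.2]
  · linarith [he.2]

/-- If `ξ` lies between two points at which `R_k = O(1/k)`, in a direction in which `λ` varies by
`O(1/k²)`, then also at `ξ`. -/
theorem exists_between_bound (P : PlanarModel ξ₀ l g η ν L₁ L₂ t α β C r) {A : ℝ} (hA : 0 ≤ A) :
    ∃ B : ℝ, 1 ≤ B ∧ ∀ k : ℕ, 0 < k → ∀ ξ ξ₁ ξ₂, ‖ξ - ξ₀‖ < r → ‖ξ₁ - ξ₀‖ < r → ‖ξ₂ - ξ₀‖ < r →
      ‖ξ - ξ₀‖ ≤ A / k → ‖ξ₁ - ξ₀‖ ≤ A / k → ‖ξ₂ - ξ₀‖ ≤ A / k →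
      |L₁ (ξ - ξ₀) - L₁ (ξ₁ - ξ₀)| ≤ A / k ^ 2 → |L₁ (ξ - ξ₀) - L₁ (ξ₂ - ξ₀)| ≤ A / k ^ 2 →
      L₂ (ξ₁ - ξ₀) ≤ L₂ (ξ - ξ₀) → L₂ (ξ - ξ₀) ≤ L₂ (ξ₂ - ξ₀) →
      |affIter (l ξ₁) (g ξ₁) t k| ≤ A / k → |affIter (l ξ₂) (g ξ₂) t k| ≤ A / k →
      |affIter (l ξ) (g ξ) t k| ≤ B / k := by
  have hC := P.one_le
  obtain ⟨A', hA'⟩ : ∃ A', A' = 2 * C * A + A + 2 * C * A ^ 2 := ⟨_, rfl⟩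
  have hA'0 : 0 ≤ A' := by rw [hA']; positivity
  obtain ⟨E, hE, b⟩ := exists_affIter_lipschitz (A := A') (t := t) hA'0
  refine ⟨2 * E + A, by linarith, ?_⟩
  intro k hk ξ ξ₁ ξ₂ h0 h1 h2 d0 d1 d2 e1 e2 o1 o2 R1 R2
  have hk' : (0 : ℝ) < k := by exact_mod_cast hk
  have sq : ∀ ζ : ℝ × ℝ, ‖ζ - ξ₀‖ ≤ A / k → C * ‖ζ - ξ₀‖ ^ 2 ≤ C * A ^ 2 / k ^ 2 := by
    intro ζ hζ
    calc C * ‖ζ - ξ₀‖ ^ 2 ≤ C * (A / k) ^ 2 := by gcongr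
      _ = _ := by ring
  have lb : ∀ ζ : ℝ × ℝ, ‖ζ - ξ₀‖ < r → ‖ζ - ξ₀‖ ≤ A / k → |l ζ - 1| ≤ A' / k ∧ |g ζ| ≤ A' / k := by
    intro ζ h d
    obtain ⟨b1, b2⟩ := P.bounds h
    have : 2 * C * ‖ζ - ξ₀‖ ≤ A' / k := by
      calc 2 * C * ‖ζ - ξ₀‖ ≤ 2 * C * (A / k) := by gcongr
        _ = 2 * C * A / k := by ring
        _ ≤ _ := div_le_div_of_nonneg_right (by
          rw [hA']; have : 0 ≤ A + 2 * C * A ^ 2 := by positivity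
          linarith) hk'.le
    exact ⟨b1.trans this, b2.trans this⟩
  -- Replacing `λ(ζ)`, `g(ζ)` by `λ(ξ)` and the linear part `L₂ (ζ - ξ₀)` changes each by `O(1/k²)`,
  -- hence `R_k` by `O(1/k)`. After that only the drift differs between the three points, and `R_k`
  -- is monotone in it.
  have comp : ∀ ζ : ℝ × ℝ, ‖ζ - ξ₀‖ < r → ‖ζ - ξ₀‖ ≤ A / k →
      |L₁ (ξ - ξ₀) - L₁ (ζ - ξ₀)| ≤ A / k ^ 2 →
      |affIter (l ζ) (g ζ) t k - affIter (l ξ) (L₂ (ζ - ξ₀)) t k| ≤ E / k := by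
    intro ζ h d e
    obtain ⟨c1, c2⟩ := lb ζ h d
    obtain ⟨c3, c4⟩ := lb ξ h0 d0
    refine b _ _ _ _ k hk (P.half_le h).1 (P.half_le h0).1 c1 c3 c2 ?_ ?_
    · have t1 := abs_le.1 (P.taylor_l ζ h)
      have t2 := abs_le.1 (P.taylor_l ξ h0)
      have e' := abs_le.1 e
      have s1 := sq ζ d
      have s2 := sq ξ d0
      have : A / (k : ℝ) ^ 2 + 2 * (C * A ^ 2 / k ^ 2) ≤ A' / k ^ 2 := by
        rw [← mul_div_assoc, ← add_div]
        refine div_le_div_of_nonneg_right ?_ (by positivity)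
        rw [hA']
        have : 0 ≤ 2 * C * A := by positivity
        linarith
      rw [abs_le]
      constructor <;> linarith [t1.1, t1.2, t2.1, t2.2, e'.1, e'.2]
    · refine (P.taylor_g ζ h).trans ((sq ζ d).trans (div_le_div_of_nonneg_right ?_ (by positivity)))
      rw [hA']
      have : 0 ≤ 2 * C * A + A + C * A ^ 2 := by positivity
      linarith
  have u0 := abs_le.1 (comp ξ h0 d0 (by rw [sub_self, abs_zero]; positivity))
  have u1 := abs_le.1 (comp ξ₁ h1 d1 e1)
  have u2 := abs_le.1 (comp ξ₂ h2 d2 e2)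
  have hl : 0 ≤ l ξ := by linarith [(P.half_le h0).1]
  have m1 := affIter_mono (t := t) hl o1 k
  have m2 := affIter_mono (t := t) hl o2 k
  have r1 := abs_le.1 R1
  have r2 := abs_le.1 R2
  have : (2 * E + A) / k = 2 * (E / k) + A / k := by ring
  rw [abs_le, this]
  constructor <;> linarith [u0.1, u0.2, u1.1, u1.2, u2.1, u2.2, r1.1, r1.2, r2.1, r2.2]

end PlanarModel

end PWL


namespace PWL

set_option linter.unusedSectionVars false
attribute [local instance] Matrix.linftyOpNormedAddCommGroup Matrix.linftyOpNormedSpace Matrix.linftyOpNormedRing Matrix.linftyOpNormedAlgebra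
variable {N : ℕ} [NeZero N] {F : Family N} {D : RotData} {ξ₀ : ℝ × ℝ} {ρ : ℝ}

/-! ### Localisation of the sectors -/

/-- The sign of `κ⁺_χ` decides between multiplier `1` (shrinking point) and `-1`, but both kinds of
endpoint provide the same data: an admissible cycle and a real multiplier of modulus one. -/
theorem IsEndpoint.exists_root {k : ℕ} {χ : ℤ} {p : ℝ × ℝ} (h : IsEndpoint F D ξ₀ k χ p)
    (hk : 0 < k) (hκ : kappa F D ξ₀ χ ≠ 0) :
    (∃ x, IsCycle F p (D.Gseq k χ) (D.nk k) x ∧ IsAdmissible (D.Gseq k χ) x) ∧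
      ∃ ε : ℝ, |ε| = 1 ∧ (F.MWord p (D.G k χ)).charpoly.IsRoot ε := by
  rcases lt_or_gt_of_ne hκ with h' | h'
  · exact ⟨(h.2 h').1, -1, by simp, (h.2 h').2⟩
  · obtain ⟨h1, h2⟩ := (h.1 h').exists_cycle hk
    exact ⟨h1, 1, by simp, h2⟩

theorem PlanarModel.continuousAt_affIter {l g η ν : ℝ × ℝ → ℝ} {L₁ L₂ : ℝ × ℝ →L[ℝ] ℝ}
    {t α β C r : ℝ} (P : PlanarModel ξ₀ l g η ν L₁ L₂ t α β C r) {ξ : ℝ × ℝ} (h : ‖ξ - ξ₀‖ < r)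
    (k : ℕ) : ContinuousAt (fun ξ => affIter (l ξ) (g ξ) t k) ξ := by
  have h1 := P.cont_l ξ h
  have h2 := P.cont_g ξ h
  unfold affIter
  exact ((h1.pow k).mul continuousAt_const).add
    (h2.mul (tendsto_finsetSum _ fun i _ => h1.pow i))

variable {L₁ L₂ : ℝ × ℝ →L[ℝ] ℝ} {α β C r : ℝ}

/-- A closed condition that holds in the mode-locking region holds on its inner boundary. -/
theorem innerBoundary_interior_le
    (P : PlanarModel ξ₀ (lam F D) (drift F D) (eta F D) (nu F D) L₁ L₂
      (cyclePt F ξ₀ D.S0 D.n (-(D.d : ℤ)) 0) α β C r) {U : Set (ℝ × ℝ)} {k : ℕ} {χ : ℤ} {B s θ : ℝ}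
    {ξ : ℝ × ℝ} (hU : ∀ ξ ∈ U, ‖ξ - ξ₀‖ < r) (hξ : ξ ∈ U) (hp : HasPolar F D ξ₀ ξ s θ)
    (hglb : IsGLB {s | ∃ ξ ∈ U, HasPolar F D ξ₀ ξ s θ ∧ ξ ∈ modeLocked F D k χ} s)
    (hB : ∀ ξ ∈ U, ξ ∈ modeLocked F D k χ →
      |affIter (lam F D ξ) (drift F D ξ) (cyclePt F ξ₀ D.S0 D.n (-(D.d : ℤ)) 0) k| ≤
          B * ‖ξ - ξ₀‖ * (1 + lam F D ξ ^ k)) :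
    |affIter (lam F D ξ) (drift F D ξ) (cyclePt F ξ₀ D.S0 D.n (-(D.d : ℤ)) 0) k| ≤
          B * ‖ξ - ξ₀‖ * (1 + lam F D ξ ^ k) := by
  -- Radii tending to the infimum give points of the region on the same ray. Their values of `η`,
  -- `ν` converge, so by `dist_le` the points converge to `ξ`, and the estimate survives the limit.
  obtain ⟨u, -, -, hu, hmem⟩ := hglb.exists_seq_antitone_tendsto hglb.nonempty
  choose z hzU hzp hzm using hmem
  obtain ⟨-, -, -, e1, e2⟩ := hp
  have hz : Tendsto z atTop (𝓝 ξ) := by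
    rw [tendsto_iff_norm_sub_tendsto_zero]
    have hlim : Tendsto (fun n => C * (|eta F D (z n) - eta F D ξ| + |nu F D (z n) - nu F D ξ|))
        atTop (𝓝 0) := by
      have h1 : Tendsto (fun n => eta F D (z n)) atTop (𝓝 (eta F D ξ)) := by
        rw [e1]
        simp only [(hzp _).2.2.2.1]
        exact (hu.const_mul _).mul_const _
      have h2 : Tendsto (fun n => nu F D (z n)) atTop (𝓝 (nu F D ξ)) := by
        rw [e2]
        simp only [(hzp _).2.2.2.2]
        exact (hu.const_mul _).mul_const _
      have h3 := ((h1.sub_const (eta F D ξ)).abs.add (h2.sub_const (nu F D ξ)).abs).const_mul C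
      simpa using h3
    exact squeeze_zero (fun _ => norm_nonneg _)
      (fun n => P.dist_le _ _ (hU _ (hzU n)) (hU _ hξ)) hlim
  have c1 := ((P.continuousAt_affIter (hU _ hξ) k).tendsto.comp hz).abs
  have c2 : Tendsto (fun n => B * ‖z n - ξ₀‖ * (1 + lam F D (z n) ^ k)) atTop
      (𝓝 (B * ‖ξ - ξ₀‖ * (1 + lam F D ξ ^ k))) :=
    ((hz.sub_const ξ₀).norm.const_mul B).mul
      ((((P.cont_l _ (hU _ hξ)).tendsto.comp hz).pow k).const_add 1)
  exact le_of_tendsto_of_tendsto' c1 c2 fun n => hB _ (hzU n) (hzm n)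

/-- The endpoints are localised by their cycle and multiplier (`exists_endpoint_bounds`), which
makes both drifts negative there. At the other points only the estimate of `R_k` is available, as a
limit from the mode-locking region; their angle places them in the cone spanned by the endpoints,
and `exists_cone_bounds` replaces the missing multiplier. The limits `y`, `y'` of `λ^k` at the two
kinds of endpoint do not depend on `k`; this is used for the line segments. -/
theorem exists_innerBoundary_bounds (hS : IsShrinkingPoint F ξ₀ D.l D.m D.n)
    (nf : NormalForm F D ξ₀ ρ) (hρ0 : 0 ≤ ρ) (hρ1 : ρ < 1) (hr : rhoMax F D ξ₀ < 1)
    (P : PlanarModel ξ₀ (lam F D) (drift F D) (eta F D) (nu F D) L₁ L₂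
      (cyclePt F ξ₀ D.S0 D.n (-(D.d : ℤ)) 0) α β C r) {χ : ℤ} (hχ : 0 ≤ χ)
    (hκ : kappa F D ξ₀ χ ≠ 0) (hκ' : kappa F D ξ₀ (χ - 1) ≠ 0) :
    ∃ (A y y' s : ℝ) (k₀ : ℕ), 1 ≤ A ∧ 0 < y ∧ 0 < y' ∧ 0 < s ∧ ∀ k, k₀ ≤ k → ∀ U,
      (∀ ξ ∈ U, ‖ξ - ξ₀‖ < s) → ∀ p q γ, IsInnerBoundary F D ξ₀ U k χ p q γ →
      p ∈ γ ∧ q ∈ γ ∧ γ ⊆ U ∧ |lam F D p ^ k - y| ≤ A / k ∧ |lam F D q ^ k - y'| ≤ A / k ∧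
      ∀ ξ ∈ γ, ‖ξ - ξ₀‖ ≤ A / k ∧
        |affIter (lam F D ξ) (drift F D ξ) (cyclePt F ξ₀ D.S0 D.n (-(D.d : ℤ)) 0) k| ≤ A / k := by
  obtain ⟨y, C1, k1, hy, hC1, ev1⟩ := exists_cycle_bounds hS nf hρ0 hρ1 hr (by omega) hκ
  obtain ⟨y', C2, k2, hy', hC2, ev2⟩ := exists_cycle_bounds hS nf hρ0 hρ1 hr (by omega) hκ'
  have hC := P.one_le
  have hrr := P.r_pos
  have ht := P.t_pos
  set t := cyclePt F ξ₀ D.S0 D.n (-(D.d : ℤ)) 0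
  obtain ⟨B, hB⟩ : ∃ B, B = max C1 C2 := ⟨_, rfl⟩
  have hB1 : C1 ≤ B := hB ▸ le_max_left _ _
  have hB2 : C2 ≤ B := hB ▸ le_max_right _ _
  have hσ₀ : 0 ≤ (1 + ρ) / 2 := by linarith
  have hσ₁ : (1 + ρ) / 2 < 1 := by linarith
  obtain ⟨A1, s1, K1, hA1, hs1, b1⟩ := P.exists_endpoint_bounds (hC1.trans hB1) hy hσ₀ hσ₁
  obtain ⟨A2, s2, K2, hA2, hs2, b2⟩ := P.exists_endpoint_bounds (hC1.trans hB1) hy' hσ₀ hσ₁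
  obtain ⟨A3, hA3⟩ : ∃ A3, A3 = 2 * C * (A1 + A2) := ⟨_, rfl⟩
  have hA3' : A1 + A2 ≤ A3 := by rw [hA3]; nlinarith
  obtain ⟨c, K3, hc, b3⟩ := exists_drift_le (A := A3) (t := t) (by linarith) ht
  obtain ⟨c', s4, hc', hs4, b4⟩ := P.exists_cone_le (c := c / A3) (by
    have : 0 < A3 := by linarith
    positivity)
  obtain ⟨A5, s5, hA5, hs5, b5⟩ := P.exists_cone_bounds (hC1.trans hB1) hc'
  obtain ⟨s6, hs6, ev⟩ := Metric.eventually_nhds_iff_ball.1 (ev1.and ev2)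
  refine ⟨A1 + A2 + A5, y, y', min (min (min r s1) (min s2 s4)) (min s5 s6),
    max (max k1 k2) (max K1 K2) + K3 + 1, by linarith, hy, hy', by positivity, ?_⟩
  rintro k hk U hU p q γ ⟨ep, eq, θp, θq, rk, curve, -, hcp, hcq, hγ, hpol, hglb⟩
  have hk' : (0 : ℝ) < k := by exact_mod_cast (by omega : 0 < k)
  have n1 : ∀ ξ ∈ U, ‖ξ - ξ₀‖ < r := fun ξ h =>
    (hU ξ h).trans_le ((min_le_left _ _).trans ((min_le_left _ _).trans (min_le_left _ _)))
  have n2 : ∀ ξ ∈ U, ‖ξ - ξ₀‖ < s1 := fun ξ h =>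
    (hU ξ h).trans_le ((min_le_left _ _).trans ((min_le_left _ _).trans (min_le_right _ _)))
  have n3 : ∀ ξ ∈ U, ‖ξ - ξ₀‖ < s2 := fun ξ h =>
    (hU ξ h).trans_le ((min_le_left _ _).trans ((min_le_right _ _).trans (min_le_left _ _)))
  have n4 : ∀ ξ ∈ U, ‖ξ - ξ₀‖ < s4 := fun ξ h =>
    (hU ξ h).trans_le ((min_le_left _ _).trans ((min_le_right _ _).trans (min_le_right _ _)))
  have n5 : ∀ ξ ∈ U, ‖ξ - ξ₀‖ < s5 := fun ξ h =>
    (hU ξ h).trans_le ((min_le_right _ _).trans (min_le_left _ _))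
  have n6 : ∀ ξ ∈ U, ξ ∈ Metric.ball ξ₀ s6 := fun ξ h => by
    rw [mem_ball_iff_norm]
    exact (hU ξ h).trans_le ((min_le_right _ _).trans (min_le_right _ _))
  have hmul : ∀ ξ ∈ U, ∀ C', C' ≤ B → C' * ‖ξ - ξ₀‖ * (1 + lam F D ξ ^ k) ≤
      B * ‖ξ - ξ₀‖ * (1 + lam F D ξ ^ k) := by
    intro ξ h C' hC'
    have : 0 ≤ lam F D ξ ^ k := pow_nonneg (by linarith [(P.half_le (n1 ξ h)).1]) _
    gcongr
  have hml : ∀ ξ ∈ U, ξ ∈ modeLocked F D k χ → |affIter (lam F D ξ) (drift F D ξ) t k| ≤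
      B * ‖ξ - ξ₀‖ * (1 + lam F D ξ ^ k) := by
    rintro ξ hξ (⟨hx, -⟩ | ⟨hx, -⟩)
    · exact (((ev ξ (n6 ξ hξ)).1 k (by omega)).1 hx).trans (hmul ξ hξ _ hB1)
    · exact (((ev ξ (n6 ξ hξ)).2 k (by omega)).1 hx).trans (hmul ξ hξ _ hB2)
  have hpU : p ∈ U := hcp ▸ (hpol θp left_mem_uIcc).1
  have hqU : q ∈ U := hcq ▸ (hpol θq right_mem_uIcc).1
  have hmul' : ∀ ξ : ℝ × ℝ, ∀ C', C' ≤ B → C' * (‖ξ - ξ₀‖ + ((1 + ρ) / 2) ^ k) ≤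
      B * (‖ξ - ξ₀‖ + ((1 + ρ) / 2) ^ k) := by
    intro ξ C' hC'
    gcongr
  have bp : ‖p - ξ₀‖ ≤ A1 / k ∧ |affIter (lam F D p) (drift F D p) t k| ≤ A1 / k ∧
      |lam F D p ^ k - y| ≤ A1 / k := by
    obtain ⟨h1, ε, hε, h2⟩ := ep.exists_root (by omega) hκ
    obtain ⟨e1, e2⟩ := (ev p (n6 p hpU)).1 k (by omega)
    exact b1 p (n2 p hpU) k (by omega) ((e1 h1).trans (hmul p hpU _ hB1))
      ((e2 ε hε h2).trans (hmul' p _ hB1))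
  have bq : ‖q - ξ₀‖ ≤ A2 / k ∧ |affIter (lam F D q) (drift F D q) t k| ≤ A2 / k ∧
      |lam F D q ^ k - y'| ≤ A2 / k := by
    obtain ⟨h1, ε, hε, h2⟩ := eq.exists_root (by omega) hκ'
    obtain ⟨e1, e2⟩ := (ev q (n6 q hqU)).2 k (by omega)
    exact b2 q (n3 q hqU) k (by omega) ((e1 h1).trans (hmul q hqU _ hB2))
      ((e2 ε hε h2).trans (hmul' q _ hB2))
  have mono : ∀ a, a ≤ A1 + A2 + A5 → a / (k : ℝ) ≤ (A1 + A2 + A5) / k := fun a ha =>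
    div_le_div_of_nonneg_right ha hk'.le
  -- The drift bound `-c/k` is restated relative to the distance, which is at most `A3/k`; this is
  -- the scale-free form of the cone condition.
  have dr : ∀ ξ ∈ U, ∀ a, a ≤ A1 + A2 → ‖ξ - ξ₀‖ ≤ a / k →
      |affIter (lam F D ξ) (drift F D ξ) t k| ≤ a / k →
      0 < ‖ξ - ξ₀‖ ∧ drift F D ξ ≤ -(c / A3 * ‖ξ - ξ₀‖) ∧
        drift F D ξ + (lam F D ξ - 1) * t ≤ -(c / A3 * ‖ξ - ξ₀‖) := by
    intro ξ hξ a ha h1 h2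
    have h3 : ‖ξ - ξ₀‖ ≤ A3 / k := h1.trans (div_le_div_of_nonneg_right (by linarith) hk'.le)
    have h4 : |lam F D ξ - 1| ≤ A3 / k := by
      refine (P.bounds (n1 ξ hξ)).1.trans ?_
      calc 2 * C * ‖ξ - ξ₀‖ ≤ 2 * C * ((A1 + A2) / k) := by
            gcongr; exact h1.trans (div_le_div_of_nonneg_right ha hk'.le)
        _ = A3 / k := by rw [hA3]; ring
    obtain ⟨d1, d2⟩ := b3 (lam F D ξ) (drift F D ξ) k (by omega) (P.half_le (n1 ξ hξ)).1 h4
      (h2.trans (div_le_div_of_nonneg_right (by linarith) hk'.le))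
    have h5 : c / A3 * ‖ξ - ξ₀‖ ≤ c / k := by
      have hA30 : 0 < A3 := by linarith
      calc c / A3 * ‖ξ - ξ₀‖ ≤ c / A3 * (A3 / k) := by gcongr
        _ = c / k := by field_simp
    refine ⟨norm_pos_iff.2 fun h => ?_, by linarith, by linarith⟩
    have h6 := (abs_le.1 (P.bounds (n1 ξ hξ)).2).1
    rw [h, norm_zero, mul_zero, neg_zero] at h6
    have : 0 < c / k := by positivity
    linarith
  obtain ⟨dp0, dp1, dp2⟩ := dr p hpU A1 (by linarith) bp.1 bp.2.1
  obtain ⟨dq0, dq1, dq2⟩ := dr q hqU A2 (by linarith) bq.1 bq.2.1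
  have hpp := (hpol θp left_mem_uIcc).2
  have hqq := (hpol θq right_mem_uIcc).2
  rw [hcp] at hpp
  rw [hcq] at hqq
  refine ⟨hγ ▸ ⟨θp, left_mem_uIcc, hcp⟩, hγ ▸ ⟨θq, right_mem_uIcc, hcq⟩, ?_,
    bp.2.2.trans (mono _ (by linarith)), bq.2.2.trans (mono _ (by linarith)), ?_⟩
  · rw [hγ]
    rintro _ ⟨θ, hθ, rfl⟩
    exact (hpol θ hθ).1
  · rw [hγ]
    rintro _ ⟨θ, hθ, rfl⟩
    obtain ⟨hxU, hx⟩ := hpol θ hθ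
    by_cases h1 : θ = θp
    · rw [h1, hcp]
      exact ⟨bp.1.trans (mono _ (by linarith)), bp.2.1.trans (mono _ (by linarith))⟩
    by_cases h2 : θ = θq
    · rw [h2, hcq]
      exact ⟨bq.1.trans (mono _ (by linarith)), bq.2.1.trans (mono _ (by linarith))⟩
    have hoo : θ ∈ uIoo θp θq := by
      rw [uIcc, mem_Icc] at hθ
      rw [uIoo, mem_Ioo]
      refine ⟨lt_of_le_of_ne hθ.1 fun h => ?_, lt_of_le_of_ne hθ.2 fun h => ?_⟩
      · rcases min_choice θp θq with h3 | h3
        · exact h1 (h ▸ h3)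
        · exact h2 (h ▸ h3)
      · rcases max_choice θp θq with h3 | h3
        · exact h1 (h ▸ h3)
        · exact h2 (h ▸ h3)
    have hR := innerBoundary_interior_le P n1 hxU hx (hglb θ hoo) hml
    obtain ⟨g1, g2⟩ := b4 p q (curve θ) (n4 p hpU) (n4 q hqU) (n4 _ hxU) dp0 dq0 dp1 dp2 dq1 dq2
      _ _ _ _ _ θ θp θq (abs_nonneg _) hx.1 hpp.1 hqq.1 hpp.2.1 hpp.2.2.1 hqq.2.1 hqq.2.2.1 hoo
      hpp.2.2.2.1 hpp.2.2.2.2 hqq.2.2.2.1 hqq.2.2.2.2 hx.2.2.2.1 hx.2.2.2.2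
    obtain ⟨f1, f2⟩ := b5 (curve θ) (n5 _ hxU) k (by omega) hR g1 g2
    exact ⟨f1.trans (mono _ (by linarith)), f2.trans (mono _ (by linarith))⟩

end PWL


/-! ### Estimates on the line segments and in the region enclosed by the boundary of a sector. -/

namespace PWL

set_option linter.unusedSectionVars false
attribute [local instance] Matrix.linftyOpNormedAddCommGroup Matrix.linftyOpNormedSpace Matrix.linftyOpNormedRing Matrix.linftyOpNormedAlgebra
variable {N : ℕ} [NeZero N] {F : Family N} {D : RotData} {ξ₀ : ℝ × ℝ} {ρ : ℝ}

namespace PlanarModel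

variable {l g η ν : ℝ × ℝ → ℝ} {L₁ L₂ : ℝ × ℝ →L[ℝ] ℝ} {t α β C r : ℝ}

/-- `R_k = O(1/k)` on a segment between two points with `λ^k` within `O(1/k)` of each other. -/
theorem exists_segment_bound (P : PlanarModel ξ₀ l g η ν L₁ L₂ t α β C r) {A : ℝ} (hA : 0 ≤ A) :
    ∃ B : ℝ, 1 ≤ B ∧ ∀ k : ℕ, 0 < k → A / k < r → ∀ p p', ‖p - ξ₀‖ ≤ A / k → ‖p' - ξ₀‖ ≤ A / k →
      |l p ^ k - l p' ^ k| ≤ A / k →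
      |affIter (l p) (g p) t k| ≤ A / k → |affIter (l p') (g p') t k| ≤ A / k →
      ∀ ξ ∈ segment ℝ p p', ‖ξ - ξ₀‖ ≤ A / k ∧ |affIter (l ξ) (g ξ) t k| ≤ B / k := by
  have hC := P.one_le
  obtain ⟨E, hE, b1⟩ := exists_abs_sub_le_of_pow (A := 2 * C * A) (by positivity)
  obtain ⟨A', hA'⟩ : ∃ A', A' = A + E * A + 2 * C * A ^ 2 := ⟨_, rfl⟩
  have hA0 : A ≤ A' := by
    have : 0 ≤ E * A + 2 * C * A ^ 2 := by positivity
    linarith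
  obtain ⟨B, hB, b2⟩ := P.exists_between_bound (A := A') (hA.trans hA0)
  refine ⟨B, hB, ?_⟩
  intro k hk hkr p p' hp hp' hl hR hR' ξ hξ
  have hk' : (0 : ℝ) < k := by exact_mod_cast hk
  have lb : ∀ ζ : ℝ × ℝ, ‖ζ - ξ₀‖ ≤ A / k → |l ζ - 1| ≤ 2 * C * A / k := by
    intro ζ h
    refine (P.bounds (h.trans_lt hkr)).1.trans ?_
    calc 2 * C * ‖ζ - ξ₀‖ ≤ 2 * C * (A / k) := by gcongr
      _ = _ := by ring
  have hll := b1 (l p) (l p') A k hk (P.half_le (hp.trans_lt hkr)).1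
    (P.half_le (hp'.trans_lt hkr)).1 (lb p hp) (lb p' hp') hl
  -- `λ^k` differing by `O(1/k)` means `λ` differing by `O(1/k²)`, and by Taylor's formula the same
  -- holds for `L₁`. On the segment `L₁` and `L₂` are interpolated linearly, so every point is
  -- between `p` and `p'` in the sense of `exists_between_bound`.
  have hL : |L₁ (p - ξ₀) - L₁ (p' - ξ₀)| ≤ A' / k ^ 2 := by
    have t1 := abs_le.1 (P.taylor_l p (hp.trans_lt hkr))
    have t2 := abs_le.1 (P.taylor_l p' (hp'.trans_lt hkr))
    have sq : ∀ ζ : ℝ × ℝ, ‖ζ - ξ₀‖ ≤ A / k → C * ‖ζ - ξ₀‖ ^ 2 ≤ C * A ^ 2 / k ^ 2 := by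
      intro ζ hζ
      calc C * ‖ζ - ξ₀‖ ^ 2 ≤ C * (A / k) ^ 2 := by gcongr
        _ = _ := by ring
    have e := abs_le.1 hll
    have s1 := sq p hp
    have s2 := sq p' hp'
    have : E * A / (k : ℝ) ^ 2 + 2 * (C * A ^ 2 / k ^ 2) ≤ A' / k ^ 2 := by
      rw [← mul_div_assoc, ← add_div]
      refine div_le_div_of_nonneg_right ?_ (by positivity)
      rw [hA']; linarith
    rw [abs_le]
    constructor <;> linarith [t1.1, t1.2, t2.1, t2.2, e.1, e.2]
  have hd : ‖ξ - ξ₀‖ ≤ A / k := by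
    have h := (convex_closedBall ξ₀ (A / (k : ℝ))).segment_subset (mem_closedBall_iff_norm.2 hp)
      (mem_closedBall_iff_norm.2 hp') hξ
    exact mem_closedBall_iff_norm.1 h
  refine ⟨hd, ?_⟩
  obtain ⟨a, b, ha, hb, hab, rfl⟩ := hξ
  have lin : ∀ L : ℝ × ℝ →L[ℝ] ℝ, L (a • p + b • p' - ξ₀) = a * L (p - ξ₀) + b * L (p' - ξ₀) := by
    intro L
    simp only [map_sub, map_add, map_smul, smul_eq_mul]
    linear_combination (L ξ₀) * hab
  have ea : a = 1 - b := by linarith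
  have d1 : |L₁ (a • p + b • p' - ξ₀) - L₁ (p - ξ₀)| ≤ A' / k ^ 2 := by
    have : L₁ (a • p + b • p' - ξ₀) - L₁ (p - ξ₀) = -(b * (L₁ (p - ξ₀) - L₁ (p' - ξ₀))) := by
      rw [lin, ea]; ring
    rw [this, abs_neg, abs_mul, abs_of_nonneg hb]
    exact (mul_le_of_le_one_left (abs_nonneg _) (by linarith)).trans hL
  have d2 : |L₁ (a • p + b • p' - ξ₀) - L₁ (p' - ξ₀)| ≤ A' / k ^ 2 := by
    have : L₁ (a • p + b • p' - ξ₀) - L₁ (p' - ξ₀) = a * (L₁ (p - ξ₀) - L₁ (p' - ξ₀)) := by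
      rw [lin, ea]; ring
    rw [this, abs_mul, abs_of_nonneg ha]
    exact (mul_le_of_le_one_left (abs_nonneg _) (by linarith)).trans hL
  have up : ∀ x : ℝ, x ≤ A / k → x ≤ A' / k := fun x h =>
    h.trans (div_le_div_of_nonneg_right hA0 hk'.le)
  rcases le_total (L₂ (p - ξ₀)) (L₂ (p' - ξ₀)) with h | h
  · refine b2 k hk _ p p' (hd.trans_lt hkr) (hp.trans_lt hkr) (hp'.trans_lt hkr) (up _ hd) (up _ hp)
      (up _ hp') d1 d2 ?_ ?_ (up _ hR) (up _ hR')
    · rw [lin, ea]; nlinarith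
    · rw [lin, ea]; nlinarith
  · refine b2 k hk _ p' p (hd.trans_lt hkr) (hp'.trans_lt hkr) (hp.trans_lt hkr) (up _ hd) (up _ hp')
      (up _ hp) d2 d1 ?_ ?_ (up _ hR') (up _ hR)
    · rw [lin, ea]; nlinarith
    · rw [lin, ea]; nlinarith

/-- Bounds on a closed curve hold in the region that it bounds. -/
theorem exists_region_bound (P : PlanarModel ξ₀ l g η ν L₁ L₂ t α β C r) {A : ℝ} (hA : 1 ≤ A) :
    ∃ B : ℝ, 1 ≤ B ∧ ∀ k : ℕ, 0 < k → B / k < r → ∀ Γ : Set (ℝ × ℝ),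
      (∀ ξ ∈ Γ, ‖ξ - ξ₀‖ ≤ A / k ∧ |affIter (l ξ) (g ξ) t k| ≤ A / k) →
      ∀ ξ ∈ regionBoundedBy Γ, ‖ξ - ξ₀‖ ≤ B / k ∧ |affIter (l ξ) (g ξ) t k| ≤ B / k := by
  have hC := P.one_le
  obtain ⟨A', hA'⟩ : ∃ A', A' = C * (C * A + C * A) + A := ⟨_, rfl⟩
  have hCA : 0 ≤ C * (C * A + C * A) := by positivity
  obtain ⟨B, hB, b⟩ := P.exists_between_bound (A := A') (by linarith)
  refine ⟨A' + B, by linarith, ?_⟩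
  intro k hk hkr Γ hΓ ξ hξ
  have hk' : (0 : ℝ) < k := by exact_mod_cast hk
  -- In the direction `w` the linear part of `λ` is constant and that of `g` grows at unit speed.
  -- The rays in the directions `w` and `-w` both meet `Γ`, so `ξ` lies between two points of `Γ` at
  -- which `R_k` is controlled.
  obtain ⟨w, hw1, hw2⟩ := P.dir
  have hw : w ≠ 0 := by rintro rfl; simp at hw2
  obtain ⟨s, hs, hs'⟩ := exists_mem_of_regionBoundedBy hξ hw
  obtain ⟨u, hu, hu'⟩ := exists_mem_of_regionBoundedBy hξ (neg_ne_zero.2 hw)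
  obtain ⟨x1, y1⟩ := hΓ _ hs'
  obtain ⟨x2, y2⟩ := hΓ _ hu'
  have e1 : L₁ (ξ + s • w - ξ₀) = L₁ (ξ - ξ₀) := by
    rw [add_sub_right_comm, map_add, map_smul, hw1, smul_zero, add_zero]
  have e2 : L₁ (ξ + u • -w - ξ₀) = L₁ (ξ - ξ₀) := by
    rw [add_sub_right_comm, map_add, map_smul, map_neg, hw1, neg_zero, smul_zero, add_zero]
  have e3 : L₂ (ξ + s • w - ξ₀) = L₂ (ξ - ξ₀) + s := by
    rw [add_sub_right_comm, map_add, map_smul, hw2, smul_eq_mul, mul_one]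
  have e4 : L₂ (ξ + u • -w - ξ₀) = L₂ (ξ - ξ₀) - u := by
    rw [add_sub_right_comm, map_add, map_smul, map_neg, hw2, smul_eq_mul]; ring
  have q1 : |L₁ (ξ - ξ₀)| ≤ C * A / k := by
    rw [← e1]
    refine (P.upper₁ _).trans ?_
    calc C * ‖ξ + s • w - ξ₀‖ ≤ C * (A / k) := by gcongr
      _ = _ := by ring
  have q2 : |L₂ (ξ - ξ₀)| ≤ C * A / k := by
    have z1 := (abs_le.1 (P.upper₂ (ξ + s • w - ξ₀))).2
    have z2 := (abs_le.1 (P.upper₂ (ξ + u • -w - ξ₀))).1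
    have z3 : C * ‖ξ + s • w - ξ₀‖ ≤ C * (A / k) := by gcongr
    have z4 : C * ‖ξ + u • -w - ξ₀‖ ≤ C * (A / k) := by gcongr
    rw [mul_div_assoc, abs_le]
    constructor <;> linarith
  have up : ∀ x : ℝ, x ≤ A / k → x ≤ A' / k := fun x h =>
    h.trans (div_le_div_of_nonneg_right (by linarith) hk'.le)
  have hd : ‖ξ - ξ₀‖ ≤ A' / k := by
    refine (P.lower _).trans ?_
    calc C * (|L₁ (ξ - ξ₀)| + |L₂ (ξ - ξ₀)|) ≤ C * (C * A / k + C * A / k) := by gcongr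
      _ = C * (C * A + C * A) / k := by ring
      _ ≤ _ := div_le_div_of_nonneg_right (by linarith) hk'.le
  have hr : A' / k < r := (div_le_div_of_nonneg_right (by linarith) hk'.le).trans_lt hkr
  have hA0 : 0 ≤ A' / (k : ℝ) ^ 2 := div_nonneg (by linarith) (by positivity)
  refine ⟨hd.trans (div_le_div_of_nonneg_right (by linarith) hk'.le),
    (b k hk ξ (ξ + u • -w) (ξ + s • w) (hd.trans_lt hr) ((up _ x2).trans_lt hr)
      ((up _ x1).trans_lt hr) hd (up _ x2) (up _ x1) ?_ ?_ ?_ ?_ (up _ y2) (up _ y1)).trans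
      (div_le_div_of_nonneg_right (by linarith) hk'.le)⟩
  · rwa [e2, sub_self, abs_zero]
  · rwa [e1, sub_self, abs_zero]
  · rw [e4]; linarith
  · rw [e3]; linarith

end PlanarModel

variable {L₁ L₂ : ℝ × ℝ →L[ℝ] ℝ} {α β C r : ℝ}

/-- The four pieces of the boundary are estimated with respect to the same index `k`. On the inner
boundary of index `k + 1` this uses `R_{k+1} = λ R_k + g` and `λ^{k+1} = λ · λ^k`. Since `p_k` and
`p_{k+1}` have the same limit of `λ^k`, and likewise `q_k` and `q_{k+1}`, the segments are covered
by `exists_segment_bound`; the interior follows by `exists_region_bound`. -/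
theorem exists_sector_bounds (hS : IsShrinkingPoint F ξ₀ D.l D.m D.n)
    (nf : NormalForm F D ξ₀ ρ) (hρ0 : 0 ≤ ρ) (hρ1 : ρ < 1) (hr : rhoMax F D ξ₀ < 1)
    (P : PlanarModel ξ₀ (lam F D) (drift F D) (eta F D) (nu F D) L₁ L₂
      (cyclePt F ξ₀ D.S0 D.n (-(D.d : ℤ)) 0) α β C r) {χ : ℤ} (hχ : 0 ≤ χ)
    (hκ : kappa F D ξ₀ χ ≠ 0) (hκ' : kappa F D ξ₀ (χ - 1) ≠ 0) :
    ∃ (A s : ℝ) (k₀ : ℕ), 1 ≤ A ∧ 0 < s ∧ ∀ k, k₀ ≤ k → ∀ U, (∀ ξ ∈ U, ‖ξ - ξ₀‖ < s) →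
      ∀ Sg, IsSector F D ξ₀ U k χ Sg → ∀ ξ ∈ Sg, ‖ξ - ξ₀‖ ≤ A / k ∧
        |affIter (lam F D ξ) (drift F D ξ) (cyclePt F ξ₀ D.S0 D.n (-(D.d : ℤ)) 0) k| ≤ A / k := by
  obtain ⟨A, y, y', s, k₀, hA, hy, hy', hs, b⟩ :=
    exists_innerBoundary_bounds hS nf hρ0 hρ1 hr P hχ hκ hκ'
  have hC := P.one_le
  have hrr := P.r_pos
  have ht := P.t_pos
  set t := cyclePt F ξ₀ D.S0 D.n (-(D.d : ℤ)) 0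
  obtain ⟨A1, hA1⟩ : ∃ A1, A1 = 2 * (A + 2 * C * A) + (2 * A + 2 * (y + A) * (2 * C * A)) +
    (2 * A + 2 * (y' + A) * (2 * C * A)) + A := ⟨_, rfl⟩
  have j1 : 0 ≤ 2 * (A + 2 * C * A) := by positivity
  have j2 : 0 ≤ 2 * A + 2 * (y + A) * (2 * C * A) := by positivity
  have j3 : 0 ≤ 2 * A + 2 * (y' + A) * (2 * C * A) := by positivity
  have hA1' : A ≤ A1 := by linarith
  obtain ⟨B, hB, bseg⟩ := P.exists_segment_bound (A := A1) (by linarith)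
  obtain ⟨E, hE, breg⟩ := P.exists_region_bound (A := A1 + B) (by linarith)
  obtain ⟨k₁, hk₁⟩ := exists_nat_gt ((A1 + E) / r)
  refine ⟨E, s, k₀ + k₁ + 1, hE, hs, ?_⟩
  rintro k hk U hU Sg ⟨-, -, -, -, p, q, p', q', γ, γ', ib, ib', rfl⟩ ξ hξ
  have hk' : (0 : ℝ) < k := by exact_mod_cast (by omega : 0 < k)
  have hkr : (A1 + E) / k < r := by
    rw [div_lt_iff₀ hrr] at hk₁
    rw [div_lt_iff₀ hk']
    have : (k₁ : ℝ) ≤ k := by exact_mod_cast (by omega : k₁ ≤ k)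
    have := mul_le_mul_of_nonneg_right this hrr.le
    linarith
  have hr1 : A1 / k < r := (div_le_div_of_nonneg_right (by linarith) hk'.le).trans_lt hkr
  have up : ∀ x : ℝ, x ≤ A / k → x ≤ A1 / k := fun x h =>
    h.trans (div_le_div_of_nonneg_right hA1' hk'.le)
  obtain ⟨hp, hq, -, lp, lq, hγ⟩ := b k (by omega) U hU p q γ ib
  obtain ⟨hp', hq', -, lp', lq', hγ'⟩ := b (k + 1) (by omega) U hU p' q' γ' ib'
  have hk1 : A / ((k + 1 : ℕ) : ℝ) ≤ A / k := by
    apply div_le_div_of_nonneg_left (by linarith) hk'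
    push_cast; linarith
  have lam_bd : ∀ ζ : ℝ × ℝ, ‖ζ - ξ₀‖ ≤ A / k →
      |lam F D ζ - 1| ≤ 2 * C * A / k ∧ |drift F D ζ| ≤ 2 * C * A / k := by
    intro ζ h
    obtain ⟨b1, b2⟩ := P.bounds ((up _ h).trans_lt hr1)
    have : 2 * C * ‖ζ - ξ₀‖ ≤ 2 * C * A / k := by
      calc 2 * C * ‖ζ - ξ₀‖ ≤ 2 * C * (A / k) := by gcongr
        _ = _ := by ring
    exact ⟨b1.trans this, b2.trans this⟩
  have c1 : ∀ ζ ∈ γ', ‖ζ - ξ₀‖ ≤ A / k ∧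
      |affIter (lam F D ζ) (drift F D ζ) t k| ≤ 2 * (A + 2 * C * A) / k := by
    intro ζ hζ
    obtain ⟨h1, h2⟩ := hγ' ζ hζ
    have h3 := h1.trans hk1
    refine ⟨h3, ?_⟩
    have h4 := (P.half_le ((up _ h3).trans_lt hr1)).1
    have h5 := h2.trans hk1
    rw [affIter_succ] at h5
    have h6 := (lam_bd ζ h3).2
    have h7 : 1 / 2 * |affIter (lam F D ζ) (drift F D ζ) t k| ≤
        |lam F D ζ * affIter (lam F D ζ) (drift F D ζ) t k| := by
      rw [abs_mul, abs_of_nonneg (by linarith : 0 ≤ lam F D ζ)]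
      gcongr
    have h8 := abs_sub (lam F D ζ * affIter (lam F D ζ) (drift F D ζ) t k + drift F D ζ)
      (drift F D ζ)
    rw [add_sub_cancel_right] at h8
    have h9 : 2 * (A + 2 * C * A) / (k : ℝ) = 2 * (A / k + 2 * C * A / k) := by ring
    rw [h9]
    linarith
  have c2 : ∀ ζ ∈ γ', ∀ z : ℝ, 0 < z → |lam F D ζ ^ (k + 1) - z| ≤ A / ((k + 1 : ℕ) : ℝ) →
      |lam F D ζ ^ k - z| ≤ (A + 2 * (z + A) * (2 * C * A)) / k := by
    intro ζ hζ z hz h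
    have h3 := (hγ' ζ hζ).1.trans hk1
    obtain ⟨h4, -⟩ := P.half_le ((up _ h3).trans_lt hr1)
    have h5 := (lam_bd ζ h3).1
    have h1k : A / ((k + 1 : ℕ) : ℝ) ≤ A := div_le_self (by linarith) (by
      push_cast; linarith)
    have h6 := (abs_le.1 (h.trans h1k)).2
    have h7 : 0 < lam F D ζ ^ k := pow_pos (by linarith) _
    have h8 : lam F D ζ ^ k ≤ 2 * (z + A) := by
      rw [pow_succ] at h6
      have : lam F D ζ ^ k * (1 / 2) ≤ lam F D ζ ^ k * lam F D ζ := by gcongr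
      linarith
    have h9 : lam F D ζ ^ k - z = (lam F D ζ ^ (k + 1) - z) - lam F D ζ ^ k * (lam F D ζ - 1) := by
      rw [pow_succ]; ring
    rw [h9]
    refine (abs_sub _ _).trans ?_
    rw [abs_mul, abs_of_pos h7]
    calc |lam F D ζ ^ (k + 1) - z| + lam F D ζ ^ k * |lam F D ζ - 1|
        ≤ A / k + 2 * (z + A) * (2 * C * A / k) := by
          gcongr
          exact h.trans hk1
      _ = _ := by ring
  have c3 : ∀ ζ ∈ γ, ∀ ζ' ∈ γ', ∀ z : ℝ, 0 < z → 2 * A + 2 * (z + A) * (2 * C * A) ≤ A1 →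
      |lam F D ζ ^ k - z| ≤ A / k → |lam F D ζ' ^ (k + 1) - z| ≤ A / ((k + 1 : ℕ) : ℝ) →
      ∀ x ∈ segment ℝ ζ ζ', ‖x - ξ₀‖ ≤ A1 / k ∧
        |affIter (lam F D x) (drift F D x) t k| ≤ B / k := by
    intro ζ hζ ζ' hζ' z hz hzA h1 h2
    obtain ⟨v1, v2⟩ := hγ ζ hζ
    obtain ⟨v3, v4⟩ := c1 ζ' hζ'
    refine bseg k (by omega) hr1 ζ ζ' (up _ v1) (up _ v3) ?_ (up _ v2)
      (v4.trans (div_le_div_of_nonneg_right (by linarith) hk'.le))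
    have h3 := c2 ζ' hζ' z hz h2
    have h4 : |lam F D ζ ^ k - lam F D ζ' ^ k| ≤ A / k + (A + 2 * (z + A) * (2 * C * A)) / k := by
      have e : lam F D ζ ^ k - lam F D ζ' ^ k =
        (lam F D ζ ^ k - z) - (lam F D ζ' ^ k - z) := by ring
      rw [e]
      exact (abs_sub _ _).trans (add_le_add h1 h3)
    refine h4.trans ?_
    rw [← add_div]
    exact div_le_div_of_nonneg_right (by linarith) hk'.le
  refine breg k (by omega) ((div_le_div_of_nonneg_right (by linarith) hk'.le).trans_lt hkr) _ ?_ ξ hξ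
  have up1 : ∀ x a : ℝ, a ≤ A1 + B → x ≤ a / k → x ≤ (A1 + B) / k := fun x a ha h =>
    h.trans (div_le_div_of_nonneg_right ha hk'.le)
  rintro x (((hx | hx) | hx) | hx)
  · obtain ⟨h1, h2⟩ := hγ x hx
    exact ⟨up1 _ A (by linarith) h1, up1 _ A (by linarith) h2⟩
  · obtain ⟨h1, h2⟩ := c1 x hx
    exact ⟨up1 _ A (by linarith) h1, up1 _ _ (by linarith) h2⟩
  · obtain ⟨h1, h2⟩ := c3 p hp p' hp' y hy (by linarith) lp lp' x hx
    exact ⟨up1 _ A1 (by linarith) h1, up1 _ B (by linarith) h2⟩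
  · obtain ⟨h1, h2⟩ := c3 q hq q' hq' y' hy' (by linarith) lq lq' x hx
    exact ⟨up1 _ A1 (by linarith) h1, up1 _ B (by linarith) h2⟩

end PWL


/-! ### The planar model at a shrinking point and the estimates in the sectors. -/

namespace PWL

set_option linter.unusedSectionVars false
attribute [local instance] Matrix.linftyOpNormedAddCommGroup Matrix.linftyOpNormedSpace Matrix.linftyOpNormedRing Matrix.linftyOpNormedAlgebra
variable {N : ℕ} [NeZero N] {F : Family N} {D : RotData} {ξ₀ : ℝ × ℝ} {ρ : ℝ}

/-- A `C²` map of the plane with invertible derivative is expanding up to a constant. -/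
theorem exists_norm_sub_le_of_det_ne_zero {f : ℝ × ℝ → ℝ × ℝ} (hf : ContDiffAt ℝ 2 f ξ₀)
    (hdet : (fderiv ℝ f ξ₀).det ≠ 0) :
    ∃ K s : ℝ, 1 ≤ K ∧ 0 < s ∧ (∀ v, ‖v‖ ≤ K * ‖fderiv ℝ f ξ₀ v‖) ∧
      ∀ ξ ξ', ‖ξ - ξ₀‖ < s → ‖ξ' - ξ₀‖ < s → ‖ξ - ξ'‖ ≤ K * ‖f ξ - f ξ'‖ := by
  set e := (fderiv ℝ f ξ₀).toContinuousLinearEquivOfDetNeZero hdet with he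
  obtain ⟨K, hK⟩ : ∃ K, K = ‖(e.symm : ℝ × ℝ →L[ℝ] ℝ × ℝ)‖ + 1 := ⟨_, rfl⟩
  have hK1 : 1 ≤ K := by rw [hK]; linarith [norm_nonneg (e.symm : ℝ × ℝ →L[ℝ] ℝ × ℝ)]
  have hv : ∀ v, ‖v‖ ≤ K * ‖fderiv ℝ f ξ₀ v‖ := by
    intro v
    have h := (e.symm : ℝ × ℝ →L[ℝ] ℝ × ℝ).le_opNorm (fderiv ℝ f ξ₀ v)
    have h2 : (e.symm : ℝ × ℝ →L[ℝ] ℝ × ℝ) (fderiv ℝ f ξ₀ v) = v := e.symm_apply_apply v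
    rw [h2] at h
    refine h.trans ?_
    rw [hK]
    gcongr
    linarith
  have hstrict := (hf.hasStrictFDerivAt (by norm_num)).isLittleO
  have hK0 : 0 < 1 / (2 * K) := by positivity
  obtain ⟨s, hs, hb⟩ := Metric.eventually_nhds_iff_ball.1 (hstrict.bound hK0)
  refine ⟨2 * K, s, by linarith, hs, fun v => (hv v).trans ?_, ?_⟩
  · gcongr; linarith
  · intro ξ ξ' h h'
    have h1 := hb (ξ, ξ') (by
      rw [mem_ball_iff_norm]
      exact max_lt h h')
    have h2 := hv (ξ - ξ')
    have h3 : ‖fderiv ℝ f ξ₀ (ξ - ξ')‖ ≤ ‖f ξ - f ξ'‖ + 1 / (2 * K) * ‖ξ - ξ'‖ := by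
      have h4 := norm_sub_norm_le (fderiv ℝ f ξ₀ (ξ - ξ')) (f ξ - f ξ')
      rw [norm_sub_rev (fderiv ℝ f ξ₀ (ξ - ξ'))] at h4
      have h5 : ‖f ξ - f ξ' - fderiv ℝ f ξ₀ (ξ - ξ')‖ ≤ 1 / (2 * K) * ‖ξ - ξ'‖ := h1
      linarith
    have h6 := h2.trans (mul_le_mul_of_nonneg_left h3 (by linarith : 0 ≤ K))
    have h7 : K * (‖f ξ - f ξ'‖ + 1 / (2 * K) * ‖ξ - ξ'‖) = K * ‖f ξ - f ξ'‖ + ‖ξ - ξ'‖ / 2 := by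
      field_simp
    linarith

theorem fderiv_eq_zero_of_quadratic {f : ℝ × ℝ → ℝ} {C : ℝ}
    (h : ∀ᶠ ξ in 𝓝 ξ₀, |f ξ| ≤ C * ‖ξ - ξ₀‖ ^ 2) : HasFDerivAt f (0 : ℝ × ℝ →L[ℝ] ℝ) ξ₀ := by
  refine Asymptotics.IsBigO.hasFDerivAt (n := 2) ?_ (by norm_num)
  refine Asymptotics.IsBigO.of_bound C (h.mono fun ξ hξ => ?_)
  simpa using hξ

/-- Differentiating the two second-order relations gives `dg = α dν` and `dg + t dλ = β dη`. With
`α`, `β`, `t` nonzero, `det J ≠ 0` makes `(dλ, dg)` invertible. The direction with `dη = 1/β` and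
`dν = 1/α` has `dg = 1` and `dλ = 0`. -/
theorem exists_planarModel (hS : IsShrinkingPoint F ξ₀ D.l D.m D.n) (nf : NormalForm F D ξ₀ ρ)
    (hJ : (fderiv ℝ (fun ξ => (eta F D ξ, nu F D ξ)) ξ₀).det ≠ 0) :
    ∃ (L₁ L₂ : ℝ × ℝ →L[ℝ] ℝ) (α β C r : ℝ),
      PlanarModel ξ₀ (lam F D) (drift F D) (eta F D) (nu F D) L₁ L₂
        (cyclePt F ξ₀ D.S0 D.n (-(D.d : ℤ)) 0) α β C r := by
  have sη := eta_smooth hS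
  have sν := nu_smooth hS
  have sl := nf.lam_smooth
  have sg := drift_smooth nf
  have ht := hS.pt_neg_d
  set t := cyclePt F ξ₀ D.S0 D.n (-(D.d : ℤ)) 0
  obtain ⟨α, hα, C1, hC1, b1⟩ := drift_eq_nu hS nf
  obtain ⟨β, hβ, C2, hC2, b2⟩ := drift_eq_eta hS nf
  obtain ⟨C3, hC3, b3⟩ := exists_taylor_bound sl
  obtain ⟨C4, hC4, b4⟩ := exists_taylor_bound sg
  obtain ⟨K, s, hK, hs, hv, hd⟩ := exists_norm_sub_le_of_det_ne_zero (sη.prodMk sν) hJ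
  have dη := (sη.differentiableAt (by norm_num)).hasFDerivAt
  have dν := (sν.differentiableAt (by norm_num)).hasFDerivAt
  have dl := (sl.differentiableAt (by norm_num)).hasFDerivAt
  have dg := (sg.differentiableAt (by norm_num)).hasFDerivAt
  have hG : fderiv ℝ (fun ξ => (eta F D ξ, nu F D ξ)) ξ₀ =
      (fderiv ℝ (eta F D) ξ₀).prod (fderiv ℝ (nu F D) ξ₀) := (dη.prodMk dν).fderiv
  obtain ⟨M₁, hM₁⟩ : ∃ M, M = fderiv ℝ (eta F D) ξ₀ := ⟨_, rfl⟩
  obtain ⟨M₂, hM₂⟩ : ∃ M, M = fderiv ℝ (nu F D) ξ₀ := ⟨_, rfl⟩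
  obtain ⟨L₁, hL₁⟩ : ∃ M, M = fderiv ℝ (lam F D) ξ₀ := ⟨_, rfl⟩
  obtain ⟨L₂, hL₂⟩ : ∃ M, M = fderiv ℝ (drift F D) ξ₀ := ⟨_, rfl⟩
  rw [← hM₁] at dη hG
  rw [← hM₂] at dν hG
  rw [← hL₁] at dl b3
  rw [← hL₂] at dg b4
  have hsurj : ∀ y, ∃ w, (M₁.prod M₂) w = y := by
    intro y
    rw [hG] at hJ
    exact ⟨((M₁.prod M₂).toContinuousLinearEquivOfDetNeZero hJ).symm y,
      ((M₁.prod M₂).toContinuousLinearEquivOfDetNeZero hJ).apply_symm_apply y⟩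
  rw [hG] at hv
  have e2 : ∀ v, L₂ v = α * M₂ v := by
    intro v
    have h := (fderiv_eq_zero_of_quadratic b1).unique (dg.sub (dν.const_mul α))
    have := congrArg (fun L : ℝ × ℝ →L[ℝ] ℝ => L v) h
    simp at this
    linarith
  have e1 : ∀ v, L₂ v + L₁ v * t = β * M₁ v := by
    intro v
    have h := (fderiv_eq_zero_of_quadratic b2).unique
      ((dg.add ((dl.sub_const 1).mul_const t)).sub (dη.const_mul β))
    have := congrArg (fun L : ℝ × ℝ →L[ℝ] ℝ => L v) h
    simp at this
    linarith
  have hα' := abs_pos.2 hα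
  have hβ' := abs_pos.2 hβ
  obtain ⟨C, hC⟩ : ∃ C, C = 1 + C1 + C2 + C3 + C4 + K + K * (1 / |β| + 1 / |α| + t / |β|) +
      ‖L₁‖ + ‖L₂‖ := ⟨_, rfl⟩
  have hnn : 0 ≤ K * (1 / |β| + 1 / |α| + t / |β|) := by positivity
  have n1 := norm_nonneg L₁
  have n2 := norm_nonneg L₂
  have clg : ∀ᶠ ξ in 𝓝 ξ₀, ContinuousAt (lam F D) ξ ∧ ContinuousAt (drift F D) ξ :=
    ((sl.eventually (by simp)).and (sg.eventually (by simp))).mono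
      fun ξ h => ⟨h.1.continuousAt, h.2.continuousAt⟩
  have hhalf : ∀ᶠ ξ in 𝓝 ξ₀, |lam F D ξ - 1| < 1 / 2 :=
    (sl.continuousAt.sub continuousAt_const).abs.eventually_lt continuousAt_const
      (by simp [nf.lam_eq])
  obtain ⟨r, hr, ev⟩ := Metric.eventually_nhds_iff_ball.1
    (((b1.and b2).and (b3.and b4)).and (clg.and hhalf))
  have ev' : ∀ ξ, ‖ξ - ξ₀‖ < min (min r s) 1 → _ := fun ξ h => ev ξ (mem_ball_iff_norm.2
    (h.trans_le ((min_le_left _ _).trans (min_le_left _ _))))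
  have up : ∀ (x a b : ℝ), a ≤ C → 0 ≤ b → x ≤ a * b → x ≤ C * b := fun x a b h hb hx =>
    hx.trans (mul_le_mul_of_nonneg_right h hb)
  refine ⟨L₁, L₂, α, β, C, min (min r s) 1, ?_⟩
  exact
  { t_pos := ht
    alpha_ne := hα
    beta_ne := hβ
    one_le := by linarith
    r_pos := by positivity
    r_le := min_le_right _ _
    cont_l := fun ξ h => (ev' ξ h).2.1.1
    cont_g := fun ξ h => (ev' ξ h).2.1.2
    half := fun ξ h => (ev' ξ h).2.2.le
    taylor_l := fun ξ h => by
      have := (ev' ξ h).1.2.1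
      rw [nf.lam_eq] at this
      exact up _ C3 _ (by linarith) (by positivity) this
    taylor_g := fun ξ h => by
      have := (ev' ξ h).1.2.2
      rw [drift_zero hS nf, sub_zero] at this
      exact up _ C4 _ (by linarith) (by positivity) this
    drift_nu := fun ξ h => up _ C1 _ (by linarith) (by positivity) (ev' ξ h).1.1.1
    drift_eta := fun ξ h => up _ C2 _ (by linarith) (by positivity) (ev' ξ h).1.1.2
    dist_le := fun ξ ξ' h h' => by
      have hs' : min (min r s) 1 ≤ s := (min_le_left _ _).trans (min_le_right _ _)
      refine up _ K _ (by linarith) (by positivity) ((hd ξ ξ' (h.trans_le hs') (h'.trans_le hs')).trans ?_)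
      refine mul_le_mul_of_nonneg_left ?_ (by linarith)
      exact max_le_add_of_nonneg (abs_nonneg _) (abs_nonneg _)
    eta_zero := eta_zero hS
    nu_zero := nu_zero hS
    lower := fun v => by
      have h1 : ‖(M₁.prod M₂) v‖ ≤ |M₁ v| + |M₂ v| :=
        max_le_add_of_nonneg (abs_nonneg _) (abs_nonneg _)
      have h2 : |M₂ v| = |L₂ v| / |α| := by rw [e2, abs_mul]; field_simp
      have h3 : |M₁ v| ≤ (|L₂ v| + |L₁ v| * t) / |β| := by
        rw [le_div_iff₀ hβ', mul_comm, ← abs_mul, ← e1]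
        refine (abs_add_le _ _).trans ?_
        rw [abs_mul, abs_of_pos ht]
      refine up _ (K * (1 / |β| + 1 / |α| + t / |β|)) _ (by linarith) (by positivity)
        ((hv v).trans ?_)
      rw [mul_assoc]
      refine mul_le_mul_of_nonneg_left (h1.trans ?_) (by linarith)
      rw [h2]
      have h4 : 0 ≤ 1 / |β| * |L₁ v| + 1 / |α| * |L₁ v| + t / |β| * |L₂ v| := by positivity
      have h5 : (1 / |β| + 1 / |α| + t / |β|) * (|L₁ v| + |L₂ v|) =
        (|L₂ v| + |L₁ v| * t) / |β| + |L₂ v| / |α| +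
          (1 / |β| * |L₁ v| + 1 / |α| * |L₁ v| + t / |β| * |L₂ v|) := by ring
      linarith
    upper₁ := fun v => up _ ‖L₁‖ _ (by linarith) (by positivity) (L₁.le_opNorm v)
    upper₂ := fun v => up _ ‖L₂‖ _ (by linarith) (by positivity) (L₂.le_opNorm v)
    dir := by
      obtain ⟨w, hw⟩ := hsurj (1 / β, 1 / α)
      have w1 : M₁ w = 1 / β := congrArg Prod.fst hw
      have w2 : M₂ w = 1 / α := congrArg Prod.snd hw
      have h2 : L₂ w = 1 := by rw [e2, w2]; field_simp
      refine ⟨w, ?_, h2⟩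
      have h1 := e1 w
      rw [h2, w1, mul_one_div_cancel hβ] at h1
      have : L₁ w * t = 0 := by linarith
      exact (mul_eq_zero.1 this).resolve_right ht.ne' }

/-- In the sectors, `ξ - ξ₀ = O(1/k)`, `λ - 1 = O(1/k)`, and both drifts are negative of
order `1/k`. -/
theorem exists_sector_estimates (hS : IsShrinkingPoint F ξ₀ D.l D.m D.n)
    (nf : NormalForm F D ξ₀ ρ) (hρ0 : 0 ≤ ρ) (hρ1 : ρ < 1) (hr : rhoMax F D ξ₀ < 1)
    (hJ : (fderiv ℝ (fun ξ => (eta F D ξ, nu F D ξ)) ξ₀).det ≠ 0) {χ : ℤ} (hχ : 0 ≤ χ) :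
    ∃ (A c s : ℝ) (k₀ : ℕ), 1 ≤ A ∧ 0 < c ∧ 0 < s ∧ ∀ k, k₀ ≤ k → ∀ U, (∀ ξ ∈ U, ‖ξ - ξ₀‖ < s) →
      ∀ Sg, IsSector F D ξ₀ U k χ Sg → ∀ ξ ∈ Sg, ‖ξ - ξ₀‖ ≤ A / k ∧ |lam F D ξ - 1| ≤ A / k ∧
        |drift F D ξ| ≤ A / k ∧
        |affIter (lam F D ξ) (drift F D ξ) (cyclePt F ξ₀ D.S0 D.n (-(D.d : ℤ)) 0) k| ≤ A / k ∧
        drift F D ξ ≤ -(c / k) ∧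
        drift F D ξ + (lam F D ξ - 1) * cyclePt F ξ₀ D.S0 D.n (-(D.d : ℤ)) 0 ≤ -(c / k) := by
  -- If one of the two coefficients vanishes there are no sectors and nothing has to be shown.
  by_cases hκ : kappa F D ξ₀ χ ≠ 0 ∧ kappa F D ξ₀ (χ - 1) ≠ 0
  swap
  · refine ⟨1, 1, 1, 0, le_rfl, one_pos, one_pos, fun k _ U _ Sg h => ?_⟩
    exact absurd ⟨h.2.2.1, h.2.2.2.1⟩ hκ
  obtain ⟨L₁, L₂, α, β, C, r, P⟩ := exists_planarModel hS nf hJ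
  obtain ⟨A, s, k₀, hA, hs, b⟩ := exists_sector_bounds hS nf hρ0 hρ1 hr P hχ hκ.1 hκ.2
  have hC := P.one_le
  have hrr := P.r_pos
  obtain ⟨A', hA'⟩ : ∃ A', A' = 2 * C * A := ⟨_, rfl⟩
  have hAA : A ≤ A' := by rw [hA']; nlinarith
  obtain ⟨c, k₁, hc, hdr⟩ := exists_drift_le (A := A') (by linarith) P.t_pos
  obtain ⟨k₂, hk₂⟩ := exists_nat_gt (A / r)
  refine ⟨A', c, s, k₀ + k₁ + k₂ + 1, by linarith, hc, hs, ?_⟩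
  intro k hk U hU Sg hSg ξ hξ
  have hk' : (0 : ℝ) < k := by exact_mod_cast (by omega : 0 < k)
  obtain ⟨h1, h2⟩ := b k (by omega) U hU Sg hSg ξ hξ
  have hlt : ‖ξ - ξ₀‖ < r := by
    refine h1.trans_lt ?_
    rw [div_lt_iff₀ hrr] at hk₂
    rw [div_lt_iff₀ hk', mul_comm]
    have : (k₂ : ℝ) ≤ k := by exact_mod_cast (by omega : k₂ ≤ k)
    nlinarith
  obtain ⟨h3, h4⟩ := P.bounds hlt
  have h5 : 2 * C * ‖ξ - ξ₀‖ ≤ A' / k := by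
    calc 2 * C * ‖ξ - ξ₀‖ ≤ 2 * C * (A / k) := by gcongr
      _ = _ := by rw [hA']; ring
  have up : A / (k : ℝ) ≤ A' / k := div_le_div_of_nonneg_right hAA hk'.le
  obtain ⟨h6, h7⟩ := hdr _ _ k (by omega) (P.half_le hlt).1 (h3.trans h5) (h2.trans up)
  exact ⟨h1.trans up, h3.trans h5, h4.trans h5, h2.trans up, h6, h7⟩

end PWL


namespace PWL

set_option linter.unusedSectionVars false
attribute [local instance] Matrix.linftyOpNormedAddCommGroup Matrix.linftyOpNormedSpace Matrix.linftyOpNormedRing Matrix.linftyOpNormedAlgebra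
variable {N : ℕ} [NeZero N] {F : Family N} {D : RotData} {ξ₀ : ℝ × ℝ} {ρ : ℝ}

/-! ### The range of `M` -/

/-- Equality of the ranks means that `A` maps its range onto a space of the same dimension, so it is
injective on its range. -/
theorem eq_zero_of_rank_sq {A : Matrix (Fin N) (Fin N) ℝ} (h : A.rank = (A ^ 2).rank)
    (x : Fin N → ℝ) (hx : A *ᵥ (A *ᵥ x) = 0) : A *ᵥ x = 0 := by
  have hmap : LinearMap.range (A ^ 2).mulVecLin = (LinearMap.range A.mulVecLin).map A.mulVecLin := by
    rw [pow_two, Matrix.mulVecLin_mul, LinearMap.range_comp]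
  set R := LinearMap.range A.mulVecLin with hR
  have h1 : Module.finrank ℝ (LinearMap.range (A.mulVecLin.domRestrict R)) = Module.finrank ℝ R := by
    rw [LinearMap.range_domRestrict, ← hmap]
    exact h.symm
  have h2 := (A.mulVecLin.domRestrict R).finrank_range_add_finrank_ker
  have h3 : LinearMap.ker (A.mulVecLin.domRestrict R) = ⊥ := by
    rw [← Submodule.finrank_eq_zero (R := ℝ)]; omega
  have h4 : (⟨A *ᵥ x, ⟨x, rfl⟩⟩ : R) ∈ LinearMap.ker (A.mulVecLin.domRestrict R) := by
    rw [LinearMap.mem_ker]; exact hx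
  rw [h3, Submodule.mem_bot] at h4
  exact congrArg Subtype.val h4

/-- If the rank is constant and equal to that of the square at one point, then the matrices are
bounded below on their ranges. -/
theorem exists_lower_bound_on_range {A : ℝ × ℝ → Matrix (Fin N) (Fin N) ℝ}
    (hA : ContinuousAt A ξ₀) (hrank : ∀ᶠ ξ in 𝓝 ξ₀, (A ξ).rank = (A ξ₀ ^ 2).rank) :
    ∃ K, 1 ≤ K ∧ ∀ᶠ ξ in 𝓝 ξ₀, ∀ x, ‖A ξ *ᵥ x‖ ≤ K * ‖A ξ *ᵥ (A ξ *ᵥ x)‖ := by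
  set R := LinearMap.range (A ξ₀).mulVecLin with hR
  have hinj := eq_zero_of_rank_sq hrank.self_of_nhds
  -- The range of `A ξ` moves with `ξ`, so the lower bound is proved on the fixed space `R`, the
  -- range of `A ξ₀`. On `R` even the square is injective, and a lower bound for it is stable under
  -- perturbation.
  have hker : LinearMap.ker ((A ξ₀ ^ 2).mulVecLin.domRestrict R) = ⊥ := by
    rw [LinearMap.ker_eq_bot']
    rintro ⟨_, y, rfl⟩ h
    have h1 : (A ξ₀ ^ 2) *ᵥ (A ξ₀ *ᵥ y) = 0 := h
    rw [pow_two, ← mulVec_mulVec] at h1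
    exact Subtype.ext (hinj y (hinj _ h1))
  obtain ⟨K, hK, hanti⟩ := LinearMap.exists_antilipschitzWith _ hker
  have hK' : (0 : ℝ) < K := hK
  have hlow : ∀ x ∈ R, ‖x‖ ≤ K * ‖(A ξ₀ ^ 2) *ᵥ x‖ := by
    intro x hx
    have := hanti.le_mul_dist ⟨x, hx⟩ 0
    simpa [dist_eq_norm] using this
  have hc : ∀ᶠ ξ in 𝓝 ξ₀, ‖A ξ ^ 2 - A ξ₀ ^ 2‖ < 1 / (2 * K) :=
    ((hA.pow 2).sub continuousAt_const).norm.eventually_lt continuousAt_const (by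
      have : 0 < 1 / (2 * (K : ℝ)) := by positivity
      simpa using this)
  have hn : ∀ᶠ ξ in 𝓝 ξ₀, ‖A ξ‖ < ‖A ξ₀‖ + 1 :=
    hA.norm.eventually_lt continuousAt_const (by linarith)
  refine ⟨(‖A ξ₀‖ + 1) * (2 * K) + 1, by
    have : 0 ≤ (‖A ξ₀‖ + 1) * (2 * K) := by positivity
    linarith, ?_⟩
  filter_upwards [hc, hn, hrank] with ξ hc hn hrk z
  have hlow' : ∀ x ∈ R, ‖x‖ ≤ 2 * K * ‖A ξ *ᵥ (A ξ *ᵥ x)‖ := by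
    intro x hx
    have h1 := hlow x hx
    have h2 : ‖(A ξ ^ 2 - A ξ₀ ^ 2) *ᵥ x‖ ≤ 1 / (2 * K) * ‖x‖ :=
      (Matrix.linfty_opNorm_mulVec _ _).trans (mul_le_mul_of_nonneg_right hc.le (norm_nonneg _))
    rw [sub_mulVec] at h2
    have h3 := norm_sub_norm_le ((A ξ₀ ^ 2) *ᵥ x) ((A ξ ^ 2) *ᵥ x)
    rw [norm_sub_rev] at h3
    have h4 : (K : ℝ) * ‖(A ξ₀ ^ 2) *ᵥ x‖ ≤ K * (‖(A ξ ^ 2) *ᵥ x‖ + 1 / (2 * K) * ‖x‖) := by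
      gcongr; linarith
    have h5 : (K : ℝ) * (‖(A ξ ^ 2) *ᵥ x‖ + 1 / (2 * K) * ‖x‖) =
        K * ‖(A ξ ^ 2) *ᵥ x‖ + ‖x‖ / 2 := by field_simp
    rw [mulVec_mulVec, ← pow_two]
    linarith
  have hker' : LinearMap.ker ((A ξ).mulVecLin.domRestrict R) = ⊥ := by
    rw [LinearMap.ker_eq_bot']
    rintro ⟨x, hx⟩ h
    have h1 : A ξ *ᵥ x = 0 := h
    have h2 := hlow' x hx
    rw [h1, mulVec_zero, norm_zero, mul_zero] at h2
    exact Subtype.ext (norm_le_zero_iff.1 h2)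
  -- `A ξ` is injective on `R` and has the same rank as `A ξ₀`, so it maps `R` onto its whole range.
  -- Vectors of the range can thus be represented by elements of `R`.
  have hrange : R.map (A ξ).mulVecLin = LinearMap.range (A ξ).mulVecLin := by
    apply Submodule.eq_of_le_of_finrank_eq LinearMap.map_le_range
    rw [← LinearMap.range_domRestrict, LinearMap.finrank_range_of_inj (LinearMap.ker_eq_bot.1 hker')]
    exact hrank.self_of_nhds.trans hrk.symm
  have hz : A ξ *ᵥ z ∈ R.map (A ξ).mulVecLin := by rw [hrange]; exact ⟨z, rfl⟩
  obtain ⟨x, hx, hxz⟩ := hz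
  have hxz' : A ξ *ᵥ x = A ξ *ᵥ z := hxz
  rw [← hxz']
  have hAx := norm_nonneg (A ξ *ᵥ (A ξ *ᵥ x))
  calc ‖A ξ *ᵥ x‖ ≤ ‖A ξ‖ * ‖x‖ := Matrix.linfty_opNorm_mulVec _ _
    _ ≤ (‖A ξ₀‖ + 1) * (2 * K * ‖A ξ *ᵥ (A ξ *ᵥ x)‖) := by
        gcongr
        exact hlow' x hx
    _ ≤ _ := by linarith

/-- The bound makes `A` injective on its range, hence bijective there by finite dimension. -/
theorem exists_preimage_of_lower_bound {A : Matrix (Fin N) (Fin N) ℝ} {K : ℝ}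
    (h : ∀ x, ‖A *ᵥ x‖ ≤ K * ‖A *ᵥ (A *ᵥ x)‖) (y : Fin N → ℝ) :
    ∃ z, A *ᵥ (A *ᵥ z) = A *ᵥ y := by
  set R := LinearMap.range A.mulVecLin with hR
  have hker : LinearMap.ker (A.mulVecLin.domRestrict R) = ⊥ := by
    rw [LinearMap.ker_eq_bot']
    rintro ⟨_, y, rfl⟩ h'
    have h1 : A *ᵥ (A *ᵥ y) = 0 := h'
    have h2 := h y
    rw [h1, norm_zero, mul_zero] at h2
    exact Subtype.ext (norm_le_zero_iff.1 h2)
  have hrange : R.map A.mulVecLin = R := by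
    apply Submodule.eq_of_le_of_finrank_eq LinearMap.map_le_range
    rw [← LinearMap.range_domRestrict, LinearMap.finrank_range_of_inj (LinearMap.ker_eq_bot.1 hker)]
  have hy : A *ᵥ y ∈ R.map A.mulVecLin := by rw [hrange]; exact ⟨y, rfl⟩
  obtain ⟨_, ⟨z, rfl⟩, hz⟩ := hy
  exact ⟨z, hz⟩

/-- A range of dimension at most one is spanned by `ζ`, so the transverse part maps into that line,
while `ωᵀ` annihilates its image and `ωᵀ ζ = 1`. -/
theorem transv_eq_zero {ξ : ℝ × ℝ} (h : IsNormal F D ξ) (hl : lam F D ξ ≠ 0)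
    (hr : (Mmd F D ξ).rank ≤ 1) : transv F D ξ = 0 := by
  obtain ⟨⟨v, hv⟩, hv'⟩ := finrank_le_one_iff.1 (show Module.finrank ℝ
    (LinearMap.range (Mmd F D ξ).mulVecLin) ≤ 1 from hr)
  have hsp : ∀ x, ∃ c : ℝ, c • v = Mmd F D ξ *ᵥ x := by
    intro x
    obtain ⟨c, hc⟩ := hv' ⟨Mmd F D ξ *ᵥ x, x, rfl⟩
    exact ⟨c, congrArg Subtype.val hc⟩
  obtain ⟨a, ha⟩ := hsp (zeta F D ξ)
  rw [h.right] at ha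
  have ha0 : a ≠ 0 := by
    rintro rfl
    have := congrFun ha 0
    simp [h.zeta_zero] at this
    exact hl this.symm
  have key : ∀ x, transv F D ξ *ᵥ x = 0 := by
    intro x
    obtain ⟨c, hc⟩ := hsp x
    have e : transv F D ξ *ᵥ x = (c * a⁻¹ * lam F D ξ - lam F D ξ * (omega F D ξ ⬝ᵥ x)) •
        zeta F D ξ := by
      have hv2 : v = (a⁻¹ * lam F D ξ) • zeta F D ξ := by
        rw [mul_smul, ← ha, smul_smul, inv_mul_cancel₀ ha0, one_smul]
      rw [transv, sub_mulVec, smul_mulVec, vecMulVec_mulVec, ← hc, hv2]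
      ext i
      simp
      ring
    have h0 : omega F D ξ ⬝ᵥ transv F D ξ *ᵥ x = 0 := by
      rw [transv, sub_mulVec, smul_mulVec, vecMulVec_mulVec, dotProduct_sub,
        dotProduct_mulVec, h.left, dotProduct_smul, smul_dotProduct]
      simp [h.omega_zeta]
    rw [e, dotProduct_smul, h.omega_zeta, smul_eq_mul, mul_one] at h0
    rw [e, h0, zero_smul]
  ext i j
  have := congrFun (key (Pi.single j 1)) i
  simpa using this

/-- On the time scale of order `k`, the transverse part decays like `ρ^k`. -/
theorem exists_transv_pow_le (hS : IsShrinkingPoint F ξ₀ D.l D.m D.n) (nf : NormalForm F D ξ₀ ρ)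
    (hρ0 : 0 ≤ ρ) (hρ1 : ρ < 1)
    (hrank : ∀ᶠ ξ in 𝓝 ξ₀, (Mmd F D ξ).rank = (Mmd F D ξ₀ ^ 2).rank) {A : ℝ} (hA : 0 ≤ A)
    (c : ℕ) : ∃ C, 1 ≤ C ∧ ∀ᶠ ξ in 𝓝 ξ₀, ∀ k : ℕ, 0 < k → ‖ξ - ξ₀‖ ≤ A / k →
      ∀ i : ℕ, 1 ≤ i → k ≤ i + c → i ≤ 2 * k →
      ∀ x, ‖transv F D ξ ^ i *ᵥ x‖ ≤ C * ρ ^ k * ‖x‖ := by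
  obtain ⟨C1, hC1, b1⟩ := nf.pow_le
  rcases hρ0.eq_or_lt with h0 | hpos
  -- For `ρ = 0` a perturbation of the transverse part would destroy the bound. The power bound
  -- makes it vanish at `ξ₀`, so `M(ξ₀)` has rank at most one; by the rank condition this persists
  -- nearby, and the transverse part stays zero.
  · refine ⟨1, le_rfl, ?_⟩
    have hN0 : transv F D ξ₀ = 0 := by
      have := b1.self_of_nhds 1
      rw [← h0] at this
      simpa using this
    have hM0 : (Mmd F D ξ₀).rank ≤ 1 := by
      have h1 : Mmd F D ξ₀ = vecMulVec (lam F D ξ₀ • zeta F D ξ₀) (omega F D ξ₀) := by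
        rw [transv, sub_eq_zero] at hN0
        rw [hN0, smul_vecMulVec]
      rw [h1]
      exact Matrix.rank_vecMulVec_le _ _
    obtain ⟨Cn, -, bn⟩ := exists_normalBounds hS nf hρ0 hρ1
    filter_upwards [hrank, bn] with ξ hrk bn k _ _ i hi _ _ x
    have h2 : (Mmd F D ξ).rank ≤ 1 := by
      rw [hrk, pow_two]
      exact (Matrix.rank_mul_le_left _ _).trans hM0
    have hl := (lam_pos bn).1
    rw [transv_eq_zero bn.normal (by linarith) h2, zero_pow (by omega), zero_mulVec, norm_zero]
    positivity
  · have hE : 1 ≤ Real.exp (2 * (C1 * A / ρ)) := Real.one_le_exp (by positivity)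
    have hρc : 0 < ρ ^ c := by positivity
    have hρc1 : 1 ≤ (ρ ^ c)⁻¹ := (one_le_inv₀ hρc).2 (pow_le_one₀ hρ0 hρ1.le)
    refine ⟨C1 * (Real.exp (2 * (C1 * A / ρ)) * (ρ ^ c)⁻¹), by
      have := one_le_mul_of_one_le_of_one_le hE hρc1
      exact one_le_mul_of_one_le_of_one_le hC1 this, ?_⟩
    filter_upwards [b1] with ξ b1 k hk hd i hi hik hi2 x
    have hk' : (0 : ℝ) < k := by exact_mod_cast hk
    refine (Matrix.linfty_opNorm_mulVec _ _).trans (mul_le_mul_of_nonneg_right ?_ (norm_nonneg _))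
    refine (b1 i).trans ?_
    rw [mul_assoc]
    refine mul_le_mul_of_nonneg_left ?_ (by linarith)
    -- The perturbed rate is at most `ρ exp (C1 A / (ρ k))`, so over `i ≤ 2k` steps the perturbation
    -- costs only a constant factor. Being up to `c` steps short of `k` costs a further `ρ^{-c}`.
    have h1 : ρ + C1 * ‖ξ - ξ₀‖ ≤ ρ * Real.exp (C1 * A / ρ / k) := by
      have h2 : C1 * ‖ξ - ξ₀‖ ≤ C1 * (A / k) := by gcongr
      have h3 := mul_le_mul_of_nonneg_left (Real.add_one_le_exp (C1 * A / ρ / k)) hρ0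
      have h4 : ρ * (C1 * A / ρ / k + 1) = ρ + C1 * (A / k) := by field_simp; ring
      linarith
    have h5 : (ρ + C1 * ‖ξ - ξ₀‖) ^ i ≤ (ρ * Real.exp (C1 * A / ρ / k)) ^ i :=
      pow_le_pow_left₀ (by positivity) h1 i
    refine h5.trans ?_
    rw [mul_pow, ← Real.exp_nat_mul]
    have h6 : Real.exp (i * (C1 * A / ρ / k)) ≤ Real.exp (2 * (C1 * A / ρ)) := by
      apply Real.exp_le_exp.2
      have h7 : (i : ℝ) ≤ 2 * k := by exact_mod_cast hi2
      calc (i : ℝ) * (C1 * A / ρ / k) ≤ 2 * k * (C1 * A / ρ / k) := by gcongr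
        _ = _ := by field_simp
    have h8 : ρ ^ i ≤ (ρ ^ c)⁻¹ * ρ ^ k := by
      rw [inv_mul_eq_div, le_div_iff₀ hρc, ← pow_add]
      exact pow_le_pow_of_le_one hρ0 hρ1.le hik
    calc ρ ^ i * Real.exp (i * (C1 * A / ρ / k)) ≤
        ((ρ ^ c)⁻¹ * ρ ^ k) * Real.exp (2 * (C1 * A / ρ)) := by gcongr
      _ = _ := by ring

end PWL


namespace PWL

set_option linter.unusedSectionVars false
attribute [local instance] Matrix.linftyOpNormedAddCommGroup Matrix.linftyOpNormedSpace Matrix.linftyOpNormedRing Matrix.linftyOpNormedAlgebra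
variable {N : ℕ} [NeZero N] {F : Family N} {D : RotData}

/-! ### The recurrent set -/

/-- The estimates that hold in the `k`-th sector. -/
structure StripBounds (F : Family N) (D : RotData) (ξ : ℝ × ℝ) (t C c μ r : ℝ) (k Δ : ℕ) :
    Prop where
  normal : IsNormal F D ξ
  one_le : 1 ≤ C
  c_pos : 0 < c
  mu_pos : 0 < μ
  k_pos : 0 < k
  lam_lo : 1 / 2 ≤ lam F D ξ
  lam_hi : lam F D ξ ≤ 3 / 2
  lam_le : |lam F D ξ - 1| ≤ C / k
  drift_abs : |drift F D ξ| ≤ C / k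
  drift_le : drift F D ξ ≤ -(c / k)
  drift_le' : drift F D ξ + (lam F D ξ - 1) * t ≤ -(c / k)
  aff_le : |affIter (lam F D ξ) (drift F D ξ) t k| ≤ C / k
  zeta_le : ‖zeta F D ξ‖ ≤ C
  pow_le : ∀ (j : ℕ) (x : Fin N → ℝ), ‖transv F D ξ ^ j *ᵥ x‖ ≤ C * r ^ j * ‖x‖
  mulVec_le : ∀ x, ‖Mmd F D ξ *ᵥ x‖ ≤ C * ‖x‖
  lower : ∀ x, ‖Mmd F D ξ *ᵥ x‖ ≤ C * ‖Mmd F D ξ *ᵥ (Mmd F D ξ *ᵥ x)‖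
  switch_zero : |switchFn F D ξ Δ (xInt F D ξ)| ≤ C / k
  slope_le : (F.MWord ξ (D.switchWord Δ) *ᵥ zeta F D ξ) 0 ≤ -μ
  slope_abs : |(F.MWord ξ (D.switchWord Δ) *ᵥ zeta F D ξ) 0| ≤ C
  switch_le : ∀ x, |(F.MWord ξ (D.switchWord Δ) *ᵥ x) 0| ≤ C * ‖x‖

theorem Family.fWord_combo (ξ : ℝ × ℝ) (W : List Side) (x y : Fin N → ℝ) (α : ℝ) :
    F.fWord ξ W (α • x + (1 - α) • y) = α • F.fWord ξ W x + (1 - α) • F.fWord ξ W y := by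
  rw [F.fWord_eq ξ W (α • x + (1 - α) • y), F.fWord_eq ξ W x, F.fWord_eq ξ W y, mulVec_add,
    mulVec_smul, mulVec_smul]
  ext i
  simp
  ring

theorem switchFn_combo (ξ : ℝ × ℝ) (Δ : ℕ) (x y : Fin N → ℝ) (α : ℝ) :
    switchFn F D ξ Δ (α • x + (1 - α) • y) =
      α * switchFn F D ξ Δ x + (1 - α) * switchFn F D ξ Δ y := by
  simp only [switchFn]
  rw [F.fWord_combo]
  simp

theorem phi_combo (ξ : ℝ × ℝ) (x y : Fin N → ℝ) (α : ℝ) :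
    phi F D ξ (α • x + (1 - α) • y) = α • phi F D ξ x + (1 - α) • phi F D ξ y :=
  F.fWord_combo ξ _ x y α

theorem combo_mem_range_phi {ξ : ℝ × ℝ} {x y : Fin N → ℝ} (hx : x ∈ range (phi F D ξ))
    (hy : y ∈ range (phi F D ξ)) (α : ℝ) : α • x + (1 - α) • y ∈ range (phi F D ξ) := by
  obtain ⟨a, rfl⟩ := hx
  obtain ⟨b, rfl⟩ := hy
  exact ⟨α • a + (1 - α) • b, phi_combo ξ a b α⟩

theorem norm_le_norm_toLp (v : Fin N → ℝ) : ‖v‖ ≤ ‖WithLp.toLp 2 v‖ :=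
  (pi_norm_le_iff_of_nonneg (norm_nonneg _)).2 fun i => PiLp.norm_apply_le (WithLp.toLp 2 v) i

theorem norm_toLp_le (v : Fin N → ℝ) : ‖WithLp.toLp 2 v‖ ≤ N * ‖v‖ := by
  have hN : (1 : ℝ) ≤ N := by exact_mod_cast NeZero.one_le
  rw [EuclideanSpace.norm_eq]
  apply Real.sqrt_le_iff.2
  refine ⟨by positivity, ?_⟩
  have : ∀ i ∈ Finset.univ, ‖(WithLp.toLp 2 v).ofLp i‖ ^ 2 ≤ ‖v‖ ^ 2 := fun i _ => by
    have := norm_le_pi_norm v i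
    exact pow_le_pow_left₀ (norm_nonneg _) this 2
  refine (Finset.sum_le_sum this).trans ?_
  simp only [Finset.sum_const, Finset.card_univ, Fintype.card_fin, nsmul_eq_mul]
  rw [mul_pow]
  refine mul_le_mul_of_nonneg_right ?_ (by positivity)
  nlinarith

namespace IsNormal

variable {ξ : ℝ × ℝ}

theorem hCoord_mk (h : IsNormal F D ξ) {v : Fin N → ℝ} (hv : omega F D ξ ⬝ᵥ v = 0) (a : ℝ) :
    hCoord F D ξ (xInt F D ξ + a • zeta F D ξ + v) = a := by
  have : xInt F D ξ + a • zeta F D ξ + v - xInt F D ξ = a • zeta F D ξ + v := by abel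
  rw [hCoord, this, dotProduct_add, dotProduct_smul, h.omega_zeta, hv]
  simp

theorem qPart_mk (h : IsNormal F D ξ) {v : Fin N → ℝ} (hv : omega F D ξ ⬝ᵥ v = 0) (a : ℝ) :
    qPart F D ξ (xInt F D ξ + a • zeta F D ξ + v) = v := by
  have h1 := decomp (F := F) (D := D) ξ (xInt F D ξ + a • zeta F D ξ + v)
  rw [h.hCoord_mk hv] at h1
  exact (add_left_cancel h1).symm

theorem ext_coords {x y : Fin N → ℝ} (h1 : hCoord F D ξ x = hCoord F D ξ y)
    (h2 : qPart F D ξ x = qPart F D ξ y) : x = y := by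
  rw [decomp (F := F) (D := D) ξ x, decomp (F := F) (D := D) ξ y, h1, h2]

/-- Because `λ ≠ 0`, the coordinate `h` can always be solved for, so membership in the range
restricts only `q`. In particular the range is invariant under translation along `ζ`. -/
theorem mem_range_phi (h : IsNormal F D ξ) (hl : lam F D ξ ≠ 0) (x : Fin N → ℝ) :
    x ∈ range (phi F D ξ) ↔ ∃ y, Mmd F D ξ *ᵥ y = qPart F D ξ x := by
  constructor
  · rintro ⟨y, rfl⟩
    exact ⟨qPart F D ξ y, (h.qPart_phi y).symm⟩
  · rintro ⟨y, hy⟩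
    have h0 : omega F D ξ ⬝ᵥ y = 0 := by
      have h1 := h.omega_qPart x
      rw [← hy, dotProduct_mulVec, h.left, smul_dotProduct, smul_eq_mul] at h1
      exact (mul_eq_zero.1 h1).resolve_left hl
    refine ⟨xInt F D ξ + ((hCoord F D ξ x - drift F D ξ) / lam F D ξ) • zeta F D ξ + y,
      ext_coords (F := F) (D := D) (ξ := ξ) ?_ ?_⟩
    · rw [h.hCoord_phi, h.hCoord_mk h0]; field_simp; ring
    · rw [h.qPart_phi, h.qPart_mk h0, hy]

end IsNormal

namespace StripBounds

variable {ξ : ℝ × ℝ} {t C c μ r : ℝ} {k Δ : ℕ}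

theorem lam_ne (h : StripBounds F D ξ t C c μ r k Δ) : lam F D ξ ≠ 0 := by
  linarith [h.lam_lo]

theorem phi_injOn (h : StripBounds F D ξ t C c μ r k Δ) :
    InjOn (phi F D ξ) (range (phi F D ξ)) := by
  rintro _ ⟨a, rfl⟩ _ ⟨b, rfl⟩ hab
  rw [← sub_eq_zero, phi_sub, phi_sub] at hab
  have h1 := h.lower (a - b)
  rw [hab, norm_zero, mul_zero] at h1
  rw [← sub_eq_zero, phi_sub]
  exact norm_le_zero_iff.1 h1

theorem exists_preimage (h : StripBounds F D ξ t C c μ r k Δ) {x : Fin N → ℝ}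
    (hx : x ∈ range (phi F D ξ)) : ∃ z ∈ range (phi F D ξ), phi F D ξ z = x := by
  obtain ⟨u, rfl⟩ := hx
  obtain ⟨z, hz⟩ := exists_preimage_of_lower_bound h.lower (qPart F D ξ u)
  have hn := h.normal
  have h0 : omega F D ξ ⬝ᵥ Mmd F D ξ *ᵥ z = 0 := by
    have h1 := hn.omega_qPart (phi F D ξ u)
    rw [hn.qPart_phi, ← hz, dotProduct_mulVec, hn.left, smul_dotProduct, smul_eq_mul] at h1
    exact (mul_eq_zero.1 h1).resolve_left h.lam_ne
  refine ⟨xInt F D ξ + hCoord F D ξ u • zeta F D ξ + Mmd F D ξ *ᵥ z, ?_,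
    IsNormal.ext_coords (F := F) (D := D) (ξ := ξ) ?_ ?_⟩
  · rw [hn.mem_range_phi h.lam_ne]
    exact ⟨z, (hn.qPart_mk h0 _).symm⟩
  · rw [hn.hCoord_phi, hn.hCoord_phi, hn.hCoord_mk h0]
  · rw [hn.qPart_phi, hn.qPart_phi, hn.qPart_mk h0, hz]

theorem qPart_le (h : StripBounds F D ξ t C c μ r k Δ) {x : Fin N → ℝ}
    (hx : x ∈ range (phi F D ξ)) : ‖qPart F D ξ x‖ ≤ C * ‖qPart F D ξ (phi F D ξ x)‖ := by
  obtain ⟨y, hy⟩ := (h.normal.mem_range_phi h.lam_ne x).1 hx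
  rw [h.normal.qPart_phi, ← hy]
  exact h.lower y

theorem switchFn_eq (ξ : ℝ × ℝ) (Δ : ℕ) (x : Fin N → ℝ) :
    switchFn F D ξ Δ x = switchFn F D ξ Δ (xInt F D ξ) +
      hCoord F D ξ x * (F.MWord ξ (D.switchWord Δ) *ᵥ zeta F D ξ) 0 +
      (F.MWord ξ (D.switchWord Δ) *ᵥ qPart F D ξ x) 0 :=
  IsNormal.fWord_zero_coord _ ξ x

theorem abs_switch_sub_le (h : StripBounds F D ξ t C c μ r k Δ) (v : Fin N → ℝ) :
    |(F.MWord ξ (D.switchWord Δ) *ᵥ (Mmd F D ξ *ᵥ v)) 0 -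
      (F.MWord ξ (D.switchWord Δ) *ᵥ v) 0| ≤ C * (C + 1) * ‖v‖ := by
  have hC := h.one_le
  have h1 := (h.switch_le (Mmd F D ξ *ᵥ v)).trans
    (mul_le_mul_of_nonneg_left (h.mulVec_le v) (by linarith))
  refine (abs_sub _ _).trans ((add_le_add h1 (h.switch_le v)).trans_eq ?_)
  ring

/-- Along an orbit of `f^{S^{(-d)}}` near `x^int`, the switching function increases. -/
theorem switchFn_lt_phi (h : StripBounds F D ξ t C c μ r k Δ) {B : ℝ} (hB : 4 * C * B ≤ c * k)
    {x : Fin N → ℝ} (hx : |hCoord F D ξ x| ≤ B / k)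
    (hq : 8 * (C * (C + 1)) * ‖qPart F D ξ x‖ * k ≤ μ * c) :
    switchFn F D ξ Δ x < switchFn F D ξ Δ (phi F D ξ x) := by
  have hk : (0 : ℝ) < k := by exact_mod_cast h.k_pos
  have hC := h.one_le
  have hc := h.c_pos
  have hμ := h.mu_pos
  have h1 := (abs_le.1 (h.abs_switch_sub_le (qPart F D ξ x))).1
  have hs := h.slope_le
  have hg := h.drift_le
  have h2 : |(lam F D ξ - 1) * hCoord F D ξ x| ≤ c / (4 * k) := by
    rw [abs_mul]
    have h3 : |lam F D ξ - 1| * |hCoord F D ξ x| ≤ C / k * (B / k) :=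
      mul_le_mul h.lam_le hx (abs_nonneg _) (by positivity)
    refine h3.trans ?_
    rw [div_mul_div_comm, div_le_div_iff₀ (by positivity) (by positivity)]
    nlinarith
  have h3 : (lam F D ξ - 1) * hCoord F D ξ x + drift F D ξ ≤ -(c / (2 * k)) := by
    have e1 : c / (4 * k) = c / k / 4 := by field_simp
    have e2 : c / (2 * k) = c / k / 2 := by field_simp
    have : 0 < c / k := by positivity
    linarith [(abs_le.1 h2).2]
  have hck : 0 < c / (2 * k) := by positivity
  have h4 : μ * (c / (2 * k)) ≤ ((lam F D ξ - 1) * hCoord F D ξ x + drift F D ξ) *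
      (F.MWord ξ (D.switchWord Δ) *ᵥ zeta F D ξ) 0 := by
    have := mul_le_mul (neg_le_neg h3) (neg_le_neg hs) (by linarith) (by linarith)
    linarith
  have h5 : C * (C + 1) * ‖qPart F D ξ x‖ ≤ μ * (c / (2 * k)) / 2 := by
    have : μ * (c / (2 * k)) / 2 = μ * c / (4 * k) := by field_simp; ring
    rw [this, le_div_iff₀ (by positivity)]
    nlinarith [mul_pos hμ hc]
  have h6 : 0 < μ * (c / (2 * k)) := by positivity
  rw [switchFn_eq ξ Δ x, switchFn_eq ξ Δ (phi F D ξ x), h.normal.hCoord_phi, h.normal.qPart_phi]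
  linarith

/-- On `σ = 0` the coordinate `h` is determined by `q` through a slope of modulus at least `μ`, and
both `σ(x^int)` and the contribution of `q` are `O(1/k)`. -/
theorem abs_hCoord_le (h : StripBounds F D ξ t C c μ r k Δ) {x : Fin N → ℝ}
    (hx : switchFn F D ξ Δ x = 0) (hq : ‖qPart F D ξ x‖ ≤ 1 / k) :
    |hCoord F D ξ x| ≤ 2 * C / μ / k := by
  have hk : (0 : ℝ) < k := by exact_mod_cast h.k_pos
  have hC := h.one_le
  have hμ := h.mu_pos
  rw [switchFn_eq] at hx
  set m := (F.MWord ξ (D.switchWord Δ) *ᵥ zeta F D ξ) 0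
  have h1 := h.switch_zero
  have h2 := (h.switch_le (qPart F D ξ x)).trans (mul_le_mul_of_nonneg_left hq (by linarith))
  have h3 : |hCoord F D ξ x * m| ≤ C / k + C * (1 / k) := by
    have e : hCoord F D ξ x * m = -(switchFn F D ξ Δ (xInt F D ξ) +
      (F.MWord ξ (D.switchWord Δ) *ᵥ qPart F D ξ x) 0) := by linarith
    rw [e, abs_neg]
    exact (abs_add_le _ _).trans (add_le_add h1 h2)
  have h4 : μ ≤ |m| := by
    have := neg_abs_le m
    have := h.slope_le
    linarith
  rw [abs_mul] at h3
  rw [div_div, le_div_iff₀ (by positivity)]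
  have h5 : |hCoord F D ξ x| * μ ≤ C / k + C * (1 / k) :=
    (mul_le_mul_of_nonneg_left h4 (abs_nonneg _)).trans h3
  have h6 : |hCoord F D ξ x| * (μ * k) ≤ (C / k + C * (1 / k)) * k := by
    rw [← mul_assoc]; exact mul_le_mul_of_nonneg_right h5 hk.le
  refine h6.trans_eq ?_
  field_simp
  ring

theorem norm_sub_xInt_le' (h : StripBounds F D ξ t C c μ r k Δ) (x : Fin N → ℝ) :
    ‖x - xInt F D ξ‖ ≤ C * |hCoord F D ξ x| + ‖qPart F D ξ x‖ := by
  have h2 : x - xInt F D ξ = hCoord F D ξ x • zeta F D ξ + qPart F D ξ x := by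
    rw [qPart, hCoord]; abel
  rw [h2]
  refine (norm_add_le _ _).trans (add_le_add ?_ le_rfl)
  rw [norm_smul, Real.norm_eq_abs, mul_comm]
  exact mul_le_mul_of_nonneg_right h.zeta_le (abs_nonneg _)

variable {ρ Q : ℝ}

/-- On the right face `σ` vanishes and on its image under `φ` it is positive; `σ` is affine and the
coefficient `1 - α` of the image point is positive. -/
theorem switchFn_pos_of_mem (h : StripBounds F D ξ t C c μ r k Δ)
    (hk : 4 * C * (2 * C / μ) ≤ c * k) (hQ1 : Q * ρ ^ k ≤ 1 / k)
    (hQ2 : 8 * (C * (C + 1)) * (C * (Q * ρ ^ k)) * k ≤ μ * c) {x : Fin N → ℝ}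
    (hx : x ∈ recSet F D ξ ρ k Δ Q) : 0 < switchFn F D ξ Δ x := by
  obtain ⟨x₁, ⟨-, hσ₁, -⟩, _, ⟨z, ⟨-, hσz, hqz⟩, rfl⟩, α, hα0, hα1, rfl⟩ := hx
  have hC := h.one_le
  have hq := (norm_le_norm_toLp _).trans hqz
  have h1 := h.switchFn_lt_phi hk (h.abs_hCoord_le hσz (hq.trans hQ1)) (le_trans (by
    gcongr
    exact hq.trans (le_mul_of_one_le_left ((norm_nonneg _).trans hqz) hC)) hQ2)
  rw [switchFn_combo, hσ₁, mul_zero, zero_add]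
  rw [hσz] at h1
  exact mul_pos (by linarith) h1

theorem norm_sub_xInt_of_mem (h : StripBounds F D ξ t C c μ r k Δ) (hQ1 : Q * ρ ^ k ≤ 1 / k)
    {x : Fin N → ℝ} (hx : x ∈ recSet F D ξ ρ k Δ Q) :
    ‖x - xInt F D ξ‖ ≤ (C * (2 * (2 * C / μ) + C) + C) / k := by
  obtain ⟨x₁, ⟨-, hσ₁, hq₁⟩, _, ⟨z, ⟨-, hσz, hqz⟩, rfl⟩, α, hα0, hα1, rfl⟩ := hx
  have hk : (0 : ℝ) < k := by exact_mod_cast h.k_pos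
  have hC := h.one_le
  have hμ := h.mu_pos
  have hq₁ := ((norm_le_norm_toLp _).trans hq₁).trans hQ1
  have hqz := ((norm_le_norm_toLp _).trans hqz).trans hQ1
  have hh₁ := h.abs_hCoord_le hσ₁ hq₁
  have hhz := h.abs_hCoord_le hσz hqz
  have b1 : ‖x₁ - xInt F D ξ‖ ≤ (C * (2 * (2 * C / μ) + C) + C) / k := by
    refine (h.norm_sub_xInt_le' x₁).trans ?_
    calc C * |hCoord F D ξ x₁| + ‖qPart F D ξ x₁‖ ≤ C * (2 * C / μ / k) + 1 / k := by gcongr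
      _ = (C * (2 * C / μ) + 1) / k := by ring
      _ ≤ _ := by
        refine div_le_div_of_nonneg_right (add_le_add (mul_le_mul_of_nonneg_left ?_ (by linarith)) hC)
          hk.le
        have : 0 ≤ 2 * C / μ := by positivity
        linarith
  have b2 : ‖phi F D ξ z - xInt F D ξ‖ ≤ (C * (2 * (2 * C / μ) + C) + C) / k := by
    refine (h.norm_sub_xInt_le' _).trans ?_
    have h1 : |hCoord F D ξ (phi F D ξ z)| ≤ (2 * (2 * C / μ) + C) / k := by
      rw [h.normal.hCoord_phi]
      refine (abs_add_le _ _).trans ?_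
      rw [abs_mul, abs_of_nonneg (by linarith [h.lam_lo] : 0 ≤ lam F D ξ)]
      calc lam F D ξ * |hCoord F D ξ z| + |drift F D ξ| ≤ 2 * (2 * C / μ / k) + C / k := by
            gcongr
            · linarith [h.lam_hi]
            · exact h.drift_abs
        _ = _ := by ring
    have h2 : ‖qPart F D ξ (phi F D ξ z)‖ ≤ C / k := by
      rw [h.normal.qPart_phi]
      refine (h.mulVec_le _).trans ?_
      calc C * ‖qPart F D ξ z‖ ≤ C * (1 / k) := by gcongr
        _ = C / k := by ring
    calc C * |hCoord F D ξ (phi F D ξ z)| + ‖qPart F D ξ (phi F D ξ z)‖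
        ≤ C * ((2 * (2 * C / μ) + C) / k) + C / k := by gcongr
      _ = _ := by ring
  have e : α • x₁ + (1 - α) • phi F D ξ z - xInt F D ξ =
      α • (x₁ - xInt F D ξ) + (1 - α) • (phi F D ξ z - xInt F D ξ) := by
    ext i; simp; ring
  rw [e]
  refine (norm_add_le _ _).trans ?_
  rw [norm_smul, norm_smul, Real.norm_of_nonneg hα0, Real.norm_of_nonneg (by linarith)]
  calc _ ≤ α * ((C * (2 * (2 * C / μ) + C) + C) / k) +
        (1 - α) * ((C * (2 * (2 * C / μ) + C) + C) / k) := by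
        have : 0 ≤ 1 - α := by linarith
        gcongr
    _ = _ := by ring

/-- Since `φ` is injective on its range, a convex combination representing `φ(x)` can be pulled
back: `x` is a combination of `z`, where `σ` vanishes, and of the preimage of a point of the face,
where `σ` is negative. Hence an orbit visits the set only directly after crossing `σ = 0`. -/
theorem switchFn_nonpos_of_phi_mem (h : StripBounds F D ξ t C c μ r k Δ)
    (hk : 4 * C * (2 * (2 * C / μ + C)) ≤ c * k) (hQ1 : Q * ρ ^ k ≤ 1 / k)
    (hQ2 : 8 * (C * (C + 1)) * (C * (Q * ρ ^ k)) * k ≤ μ * c) {x : Fin N → ℝ}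
    (hx : x ∈ range (phi F D ξ)) (hφ : phi F D ξ x ∈ recSet F D ξ ρ k Δ Q) :
    switchFn F D ξ Δ x ≤ 0 := by
  obtain ⟨x₁, ⟨hr₁, hσ₁, hq₁⟩, _, ⟨z, ⟨hrz, hσz, hqz⟩, rfl⟩, α, hα0, hα1, he⟩ := hφ
  have hk' : (0 : ℝ) < k := by exact_mod_cast h.k_pos
  have hC := h.one_le
  have hμ := h.mu_pos
  have hq := (norm_le_norm_toLp _).trans hq₁
  obtain ⟨y, hyr, rfl⟩ := h.exists_preimage hr₁
  have h1 : switchFn F D ξ Δ y < 0 := by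
    rw [← hσ₁]
    refine h.switchFn_lt_phi hk ?_ (le_trans ?_ hQ2)
    · have h2 := h.abs_hCoord_le hσ₁ (hq.trans hQ1)
      rw [h.normal.hCoord_phi] at h2
      have h3 := abs_sub (lam F D ξ * hCoord F D ξ y + drift F D ξ) (drift F D ξ)
      rw [add_sub_cancel_right, abs_mul, abs_of_nonneg (by linarith [h.lam_lo])] at h3
      have h4 : 1 / 2 * |hCoord F D ξ y| ≤ lam F D ξ * |hCoord F D ξ y| :=
        mul_le_mul_of_nonneg_right h.lam_lo (abs_nonneg _)
      have h5 : 2 * (2 * C / μ + C) / k = 2 * (2 * C / μ / k + C / k) := by ring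
      rw [h5]
      linarith [h.drift_abs]
    · gcongr
      exact (h.qPart_le hyr).trans (mul_le_mul_of_nonneg_left hq (by linarith))
  rw [← phi_combo] at he
  have h6 := h.phi_injOn hx (combo_mem_range_phi hyr hrz α) he
  rw [h6, switchFn_combo, hσz, mul_zero, add_zero]
  exact mul_nonpos_of_nonneg_of_nonpos hα0 h1.le

/-- A point just across the switching of `σ` belongs to the recurrent set. -/
theorem phi_mem_recSet (h : StripBounds F D ξ t C c μ r k Δ) {x : Fin N → ℝ}
    (hx : x ∈ range (phi F D ξ)) (h1 : switchFn F D ξ Δ x ≤ 0)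
    (h2 : 0 < switchFn F D ξ Δ (phi F D ξ x)) (hq : ‖WithLp.toLp 2 (qPart F D ξ x)‖ ≤ Q * ρ ^ k)
    (hq' : ‖WithLp.toLp 2 (qPart F D ξ (phi F D ξ x))‖ ≤ Q * ρ ^ k) :
    phi F D ξ x ∈ recSet F D ξ ρ k Δ Q := by
  have hn := h.normal
  have hμ := h.mu_pos
  have hsl := h.slope_le
  set m := (F.MWord ξ (D.switchWord Δ) *ᵥ zeta F D ξ) 0 with hm
  have hm0 : m < 0 := by linarith
  -- The face is a graph over the transverse directions: moving `y` along `ζ` reaches it without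
  -- changing `q` or leaving the range.
  have key : ∀ y ∈ range (phi F D ξ), ‖WithLp.toLp 2 (qPart F D ξ y)‖ ≤ Q * ρ ^ k →
      ∃ z ∈ face F D ξ ρ k Δ Q, qPart F D ξ z = qPart F D ξ y ∧
        switchFn F D ξ Δ y = (hCoord F D ξ y - hCoord F D ξ z) * m := by
    intro y hy hqy
    have ho := hn.omega_qPart y
    set a := -(switchFn F D ξ Δ (xInt F D ξ) +
      (F.MWord ξ (D.switchWord Δ) *ᵥ qPart F D ξ y) 0) / m with ha
    have ham : a * m = -(switchFn F D ξ Δ (xInt F D ξ) +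
      (F.MWord ξ (D.switchWord Δ) *ᵥ qPart F D ξ y) 0) := div_mul_cancel₀ _ hm0.ne
    have hσ0 : switchFn F D ξ Δ (xInt F D ξ + a • zeta F D ξ + qPart F D ξ y) = 0 := by
      rw [switchFn_eq, hn.hCoord_mk ho, hn.qPart_mk ho, ← hm, ham]; ring
    refine ⟨xInt F D ξ + a • zeta F D ξ + qPart F D ξ y, ⟨?_, hσ0, ?_⟩, hn.qPart_mk ho a, ?_⟩
    · rw [hn.mem_range_phi h.lam_ne, hn.qPart_mk ho]
      exact (hn.mem_range_phi h.lam_ne y).1 hy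
    · rwa [hn.qPart_mk ho]
    · rw [hn.hCoord_mk ho, sub_mul, ham, switchFn_eq ξ Δ y]; ring
  obtain ⟨z, hz, hzq, hzs⟩ := key x hx hq
  obtain ⟨y, hy, hyq, hys⟩ := key (phi F D ξ x) ⟨x, rfl⟩ hq'
  have e1 : hCoord F D ξ z ≤ hCoord F D ξ x := by
    rw [hzs] at h1
    have := nonneg_of_mul_nonpos_left h1 hm0
    linarith
  have e2 : hCoord F D ξ (phi F D ξ x) < hCoord F D ξ y := by
    rw [hys] at h2
    have := neg_of_mul_pos_left h2 hm0.le
    linarith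
  have e3 : hCoord F D ξ (phi F D ξ z) ≤ hCoord F D ξ (phi F D ξ x) := by
    rw [hn.hCoord_phi, hn.hCoord_phi]
    have := mul_le_mul_of_nonneg_left e1 (by linarith [h.lam_lo] : 0 ≤ lam F D ξ)
    linarith
  have e4 : qPart F D ξ (phi F D ξ z) = qPart F D ξ (phi F D ξ x) := by
    rw [hn.qPart_phi, hn.qPart_phi, hzq]
  have d0 : 0 < hCoord F D ξ y - hCoord F D ξ (phi F D ξ z) := by linarith
  -- The points `φ(z)`, `φ(x)` and `y` have the same transverse part and increasing coordinates `h`,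
  -- so `φ(x)` is a convex combination of the outer two. The strict inequality between `φ(x)` and
  -- `y` gives `α < 1`.
  set α := (hCoord F D ξ (phi F D ξ x) - hCoord F D ξ (phi F D ξ z)) /
    (hCoord F D ξ y - hCoord F D ξ (phi F D ξ z)) with hα
  have hα' : α * (hCoord F D ξ y - hCoord F D ξ (phi F D ξ z)) =
    hCoord F D ξ (phi F D ξ x) - hCoord F D ξ (phi F D ξ z) := div_mul_cancel₀ _ d0.ne'
  refine ⟨y, hy, phi F D ξ z, ⟨z, hz, rfl⟩, α, div_nonneg (by linarith) d0.le,
    (div_lt_one d0).2 (by linarith), ?_⟩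
  conv_rhs => rw [decomp (F := F) (D := D) ξ y, decomp (F := F) (D := D) ξ (phi F D ξ z), e4, hyq]
  conv_lhs => rw [decomp (F := F) (D := D) ξ (phi F D ξ x)]
  have e5 : hCoord F D ξ (phi F D ξ x) =
    α * hCoord F D ξ y + (1 - α) * hCoord F D ξ (phi F D ξ z) := by linarith
  rw [e5]
  ext i
  simp
  ring

end StripBounds

end PWL


/-! ### The crossing time of an orbit of `φ`. -/

namespace PWL

set_option linter.unusedSectionVars false
attribute [local instance] Matrix.linftyOpNormedAddCommGroup Matrix.linftyOpNormedSpace Matrix.linftyOpNormedRing Matrix.linftyOpNormedAlgebra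
variable {N : ℕ} [NeZero N] {F : Family N} {D : RotData}

/-- The increments of an affine iteration form a geometric sequence, so the sign of the drift at the
start persists along the orbit. -/
theorem affIter_drift (l g s : ℝ) (i : ℕ) :
    (l - 1) * affIter l g s i + g = l ^ i * ((l - 1) * s + g) := by
  induction i with
  | zero => rw [affIter_zero, pow_zero, one_mul]
  | succ i ih =>
    rw [affIter_succ, pow_succ]
    linear_combination l * ih

namespace StripBounds

variable {ξ : ℝ × ℝ} {t C c μ r : ℝ} {k Δ : ℕ}

/-- The increments of the switching function along an orbit, with a constant that does not depend
on `k`. -/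
theorem exists_increment_bound (hC : 1 ≤ C) (hc : 0 < c) (hμ : 0 < μ) (hr0 : 0 ≤ r)
    (hr1 : r < 1) {B : ℝ} (hB : 1 ≤ B) :
    ∃ i₁ k₁ : ℕ, ∀ {F : Family N} {D : RotData} {ξ : ℝ × ℝ} {t : ℝ} {k Δ : ℕ},
      StripBounds F D ξ t C c μ r k Δ → k₁ ≤ k →
      ∀ w, |hCoord F D ξ w - t| ≤ B / k → ‖qPart F D ξ w‖ ≤ B / k → ∀ i, i₁ ≤ i →
        switchFn F D ξ Δ ((phi F D ξ)^[i] w) + μ * c / (4 * k) * lam F D ξ ^ i ≤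
          switchFn F D ξ Δ ((phi F D ξ)^[i + 1] w) := by
  -- `r'` lies strictly between `r` and `1`, and `λ ≥ r'` for large `k`. The transverse
  -- contribution, of order `r^i / k`, is then dominated by the increment of order `λ^i / k` as soon
  -- as `(r/r')^i` is small, which fixes `i₁` independently of `k`.
  obtain ⟨r', hr'⟩ : ∃ r', r' = (1 + r) / 2 := ⟨_, rfl⟩
  have hr'0 : 0 < r' := by rw [hr']; linarith
  obtain ⟨i₁, hi₁⟩ : ∃ i₁ : ℕ, ∀ i, i₁ ≤ i → C * (C + 1) * C * B * (r / r') ^ i ≤ μ * c / 4 := by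
    have h1 : Tendsto (fun i : ℕ => C * (C + 1) * C * B * (r / r') ^ i) atTop (𝓝 0) := by
      have := tendsto_pow_atTop_nhds_zero_of_lt_one (r := r / r') (by positivity)
        ((div_lt_one hr'0).2 (by rw [hr']; linarith))
      simpa using this.const_mul (C * (C + 1) * C * B)
    exact eventually_atTop.1 (h1.eventually_le_const (by positivity))
  obtain ⟨k₁, hk₁⟩ := exists_nat_gt (2 * C * B / c + 2 * C / (1 - r))
  refine ⟨i₁, k₁, ?_⟩
  intro F D ξ t k Δ h hk w hw hq i hi
  have hk' : (0 : ℝ) < k := by exact_mod_cast h.k_pos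
  have hkk : (k₁ : ℝ) ≤ k := by exact_mod_cast hk
  have t1 : 0 ≤ 2 * C * B / c := by positivity
  have t2 : 0 ≤ 2 * C / (1 - r) := div_nonneg (by linarith) (by linarith)
  have hk1 : 2 * C * B ≤ c * k := by
    have : 2 * C * B / c ≤ k := by linarith
    rw [div_le_iff₀ hc] at this
    linarith
  have hk2 : 2 * C ≤ (1 - r) * k := by
    have : 2 * C / (1 - r) ≤ k := by linarith
    rw [div_le_iff₀ (by linarith)] at this
    linarith
  have hlam : r' ≤ lam F D ξ := by
    have h1 := (abs_le.1 h.lam_le).1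
    have h2 : C / k ≤ (1 - r) / 2 := by rw [div_le_iff₀ hk']; linarith
    rw [hr']; linarith
  have hg0 : (lam F D ξ - 1) * hCoord F D ξ w + drift F D ξ ≤ -(c / (2 * k)) := by
    have h1 : |(lam F D ξ - 1) * (hCoord F D ξ w - t)| ≤ c / (2 * k) := by
      rw [abs_mul]
      refine (mul_le_mul h.lam_le hw (abs_nonneg _) (by positivity)).trans ?_
      rw [div_mul_div_comm, div_le_div_iff₀ (by positivity) (by positivity)]
      nlinarith
    have h2 := h.drift_le'
    have e2 : c / (2 * k) = c / k / 2 := by field_simp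
    linarith [(abs_le.1 h1).2]
  set x := (phi F D ξ)^[i] w with hx
  have hqx : ‖qPart F D ξ x‖ ≤ C * r ^ i * (B / k) := by
    rw [hx, h.normal.qPart_iterate]
    exact (h.pow_le _ _).trans (mul_le_mul_of_nonneg_left hq (by positivity))
  have hgx : (lam F D ξ - 1) * hCoord F D ξ x + drift F D ξ ≤
      -(lam F D ξ ^ i * (c / (2 * k))) := by
    rw [hx, h.normal.hCoord_iterate, affIter_drift]
    have := mul_le_mul_of_nonneg_left hg0 (pow_nonneg (hr'0.le.trans hlam) i)
    linarith
  have hl0 : 0 < lam F D ξ ^ i := pow_pos (hr'0.trans_le hlam) i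
  have h4 : μ * (lam F D ξ ^ i * (c / (2 * k))) ≤
      ((lam F D ξ - 1) * hCoord F D ξ x + drift F D ξ) *
      (F.MWord ξ (D.switchWord Δ) *ᵥ zeta F D ξ) 0 := by
    have h0 : 0 ≤ lam F D ξ ^ i * (c / (2 * k)) := by positivity
    have := mul_le_mul (neg_le_neg hgx) (neg_le_neg h.slope_le) (by linarith) (by linarith)
    linarith
  have h5 : C * (C + 1) * ‖qPart F D ξ x‖ ≤ μ * c / (4 * k) * lam F D ξ ^ i := by
    have h6 : C * (C + 1) * C * B * r ^ i ≤ μ * c / 4 * lam F D ξ ^ i := by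
      have h7 := hi₁ i hi
      rw [div_pow, mul_div_assoc', div_le_iff₀ (by positivity)] at h7
      exact h7.trans (mul_le_mul_of_nonneg_left (pow_le_pow_left₀ hr'0.le hlam i) (by positivity))
    calc C * (C + 1) * ‖qPart F D ξ x‖ ≤ C * (C + 1) * (C * r ^ i * (B / k)) := by gcongr
      _ = C * (C + 1) * C * B * r ^ i / k := by ring
      _ ≤ μ * c / 4 * lam F D ξ ^ i / k := div_le_div_of_nonneg_right h6 hk'.le
      _ = _ := by field_simp
  have h6 := (abs_le.1 (h.abs_switch_sub_le (qPart F D ξ x))).1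
  rw [Function.iterate_succ_apply', ← hx, switchFn_eq ξ Δ x, switchFn_eq ξ Δ (phi F D ξ x),
    h.normal.hCoord_phi, h.normal.qPart_phi]
  have h8 : μ * (lam F D ξ ^ i * (c / (2 * k))) = 2 * (μ * c / (4 * k) * lam F D ξ ^ i) := by
    field_simp; ring
  linarith

/-- The orbit crosses the switching of `σ` within a bounded number of steps of `k - Δ`, and only
once. -/
theorem exists_crossing_bounds (hC : 1 ≤ C) (hc : 0 < c) (hμ : 0 < μ) (hr0 : 0 ≤ r)
    (hr1 : r < 1) {B t : ℝ} (hB : 1 ≤ B) (ht : 0 < t) (Δ : ℕ) :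
    ∃ C₀ k₁ : ℕ, ∀ {F : Family N} {D : RotData} {ξ : ℝ × ℝ} {k : ℕ},
      StripBounds F D ξ t C c μ r k Δ → k₁ ≤ k →
      ∀ w, |hCoord F D ξ w - t| ≤ B / k → ‖qPart F D ξ w‖ ≤ B / k →
        Δ + C₀ + 2 ≤ k ∧
        (∀ i, i + C₀ + Δ ≤ k → switchFn F D ξ Δ ((phi F D ξ)^[i] w) ≤ 0) ∧
        0 < switchFn F D ξ Δ ((phi F D ξ)^[k - Δ + C₀] w) ∧
        ∀ i j, k ≤ i + C₀ + Δ → i ≤ j → 0 < switchFn F D ξ Δ ((phi F D ξ)^[i] w) →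
          0 < switchFn F D ξ Δ ((phi F D ξ)^[j] w) := by
  obtain ⟨i₁, k₁, inc⟩ := exists_increment_bound (N := N) hC hc hμ hr0 hr1 hB
  obtain ⟨E, hE⟩ : ∃ E, E = Real.exp (2 * C * 2) := ⟨_, rfl⟩
  have hE1 : 1 ≤ E := hE ▸ Real.one_le_exp (by positivity)
  have hE0 : 0 < E := by linarith
  -- `c₃/k` is a lower bound of a single increment of `σ` for times between `i₁` and `2k`, where
  -- `λ^i ≥ E⁻¹`.
  obtain ⟨c₃, hc₃⟩ : ∃ c₃, c₃ = μ * c * E⁻¹ / 4 := ⟨_, rfl⟩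
  have hc₃0 : 0 < c₃ := by rw [hc₃]; positivity
  obtain ⟨C₁, hC₁⟩ : ∃ C₁, C₁ = E * (C + C * (Δ * E)) + E * B := ⟨_, rfl⟩
  have hC₁0 : 0 < C₁ := by rw [hC₁]; positivity
  obtain ⟨C₂, hC₂⟩ : ∃ C₂, C₂ = C + C₁ * C + C * (C * B) := ⟨_, rfl⟩
  have hC₂0 : 0 < C₂ := by rw [hC₂]; positivity
  -- At time `k - Δ` the modulus of `σ` is at most `C₂/k`, so `C₀` increments suffice to pass
  -- through zero in either direction of time.
  obtain ⟨C₀, hC₀⟩ := exists_nat_gt (C₂ / c₃)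
  rw [div_lt_iff₀ hc₃0] at hC₀
  obtain ⟨G, hG⟩ : ∃ G, G = B + (C + C * (t + B)) * (i₁ * E) := ⟨_, rfl⟩
  have hG0 : 0 < G := by rw [hG]; positivity
  obtain ⟨k₂, hk₂⟩ := exists_nat_gt ((G * μ + C + C * (C * B)) / (μ * t))
  refine ⟨C₀, k₁ + k₂ + Δ + C₀ + i₁ + 2, ?_⟩
  intro F D ξ k h hk w hw hq
  have hk' : (0 : ℝ) < k := by exact_mod_cast h.k_pos
  have hlp : ∀ i : ℕ, i ≤ 2 * k → E⁻¹ ≤ lam F D ξ ^ i ∧ lam F D ξ ^ i ≤ E := by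
    intro i hi
    have h1 := pow_mem_of_abs_sub_le (B := 2) h.k_pos h.lam_lo h.lam_le
      (show (i : ℝ) ≤ 2 * k by exact_mod_cast hi) (by linarith)
    rwa [Real.exp_neg, ← hE] at h1
  have hsum : ∀ i : ℕ, i ≤ 2 * k → 0 ≤ ∑ j ∈ Finset.range i, lam F D ξ ^ j ∧
      ∑ j ∈ Finset.range i, lam F D ξ ^ j ≤ i * E := by
    intro i hi
    obtain ⟨s1, s2⟩ := geomSum_bounds (k := i) fun j hj => hlp j (by omega)
    exact ⟨le_trans (by positivity) s1, s2⟩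
  have hqi : ∀ i : ℕ, ‖qPart F D ξ ((phi F D ξ)^[i] w)‖ ≤ C * B / k := by
    intro i
    rw [h.normal.qPart_iterate]
    refine (h.pow_le _ _).trans ?_
    calc C * r ^ i * ‖qPart F D ξ w‖ ≤ C * 1 * (B / k) := by
          gcongr
          exact pow_le_one₀ hr0 hr1.le
      _ = _ := by ring
  have hmono : ∀ i, i₁ ≤ i → switchFn F D ξ Δ ((phi F D ξ)^[i] w) ≤
      switchFn F D ξ Δ ((phi F D ξ)^[i + 1] w) := by
    intro i hi
    have h1 := inc h (by omega) w hw hq i hi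
    have h2 : 0 ≤ μ * c / (4 * k) * lam F D ξ ^ i := by
      have := pow_nonneg (by linarith [h.lam_lo] : 0 ≤ lam F D ξ) i
      positivity
    linarith
  have hinc : ∀ i j, i₁ ≤ i → i + j ≤ 2 * k → switchFn F D ξ Δ ((phi F D ξ)^[i] w) + j * (c₃ / k) ≤
      switchFn F D ξ Δ ((phi F D ξ)^[i + j] w) := by
    intro i j hi
    induction j with
    | zero => intro _; simp
    | succ j ih =>
      intro hj
      have h1 := inc h (by omega) w hw hq (i + j) (by omega)
      have h2 := ih (by omega)
      have h3 : c₃ / k ≤ μ * c / (4 * k) * lam F D ξ ^ (i + j) := by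
        have h4 := mul_le_mul_of_nonneg_left (hlp (i + j) (by omega)).1
          (by positivity : 0 ≤ μ * c / (4 * k))
        have : c₃ / k = μ * c / (4 * k) * E⁻¹ := by rw [hc₃]; ring
        linarith
      rw [← add_assoc]
      push_cast
      linarith
  obtain ⟨K, hK⟩ : ∃ K, k = K + Δ := ⟨k - Δ, by omega⟩
  have hKk : k - Δ = K := by omega
  -- The known bound is for `R_k`; undoing the last `Δ` steps, with `λ^Δ` bounded below and `g =
  -- O(1/k)`, gives the one for time `k - Δ`. Starting from `h(w)` instead of `t` changes it by
  -- `O(1/k)`.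
  have hhK : |hCoord F D ξ ((phi F D ξ)^[K] w)| ≤ C₁ / k := by
    rw [h.normal.hCoord_iterate]
    set R := affIter (lam F D ξ) (drift F D ξ) t K with hR
    have h1 := h.aff_le
    rw [hK, affIter_add, ← hK, ← hR, affIter] at h1
    obtain ⟨s0, s1⟩ := hsum Δ (by omega)
    obtain ⟨p0, p1⟩ := hlp Δ (by omega)
    obtain ⟨-, p2⟩ := hlp K (by omega)
    have h2 : |drift F D ξ * ∑ i ∈ Finset.range Δ, lam F D ξ ^ i| ≤ C / k * (Δ * E) := by
      rw [abs_mul, abs_of_nonneg s0]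
      exact mul_le_mul h.drift_abs s1 s0 (by positivity)
    have h3 := abs_sub (lam F D ξ ^ Δ * R + drift F D ξ * ∑ i ∈ Finset.range Δ, lam F D ξ ^ i)
      (drift F D ξ * ∑ i ∈ Finset.range Δ, lam F D ξ ^ i)
    rw [add_sub_cancel_right, abs_mul, abs_of_nonneg ((inv_pos.2 hE0).le.trans p0)] at h3
    have h4 : |R| ≤ E * (C / k + C / k * (Δ * E)) := by
      have h5 : E⁻¹ * |R| ≤ C / k + C / k * (Δ * E) :=
        (mul_le_mul_of_nonneg_right p0 (abs_nonneg R)).trans (by linarith)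
      rwa [inv_mul_le_iff₀ hE0] at h5
    have h6 := affIter_sub (lam F D ξ) (drift F D ξ) (hCoord F D ξ w) t K
    have h7 : |lam F D ξ ^ K * (hCoord F D ξ w - t)| ≤ E * (B / k) := by
      rw [abs_mul, abs_of_nonneg (pow_nonneg (by linarith [h.lam_lo]) _)]
      exact mul_le_mul p2 hw (abs_nonneg _) hE0.le
    have h8 : affIter (lam F D ξ) (drift F D ξ) (hCoord F D ξ w) K =
      R + lam F D ξ ^ K * (hCoord F D ξ w - t) := by rw [hR]; linarith
    rw [h8]
    refine (abs_add_le _ _).trans ((add_le_add h4 h7).trans_eq ?_)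
    rw [hC₁]; ring
  have hσK : |switchFn F D ξ Δ ((phi F D ξ)^[K] w)| ≤ C₂ / k := by
    rw [switchFn_eq]
    refine (abs_add_le _ _).trans ((add_le_add (abs_add_le _ _) (h.switch_le _)).trans ?_)
    rw [abs_mul]
    calc _ ≤ C / k + C₁ / k * C + C * (C * B / k) := by
          gcongr
          · exact h.switch_zero
          · exact h.slope_abs
          · exact hqi K
      _ = _ := by rw [hC₂]; ring
  have hck : C₂ / k < C₀ * (c₃ / k) := by
    rw [← mul_div_assoc]; exact div_lt_div_of_pos_right hC₀ hk'
  have hσK' := abs_le.1 hσK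
  refine ⟨by omega, ?_, ?_, ?_⟩
  · intro i hi
    rcases le_or_gt i₁ i with h1 | h1
    · obtain ⟨j, hj⟩ : ∃ j, K = i + j := ⟨K - i, by omega⟩
      have h2 := hinc i j h1 (by omega)
      rw [← hj] at h2
      have h3 : (C₀ : ℝ) * (c₃ / k) ≤ j * (c₃ / k) := by
        have : (C₀ : ℝ) ≤ j := by exact_mod_cast (by omega : C₀ ≤ j)
        gcongr
      linarith
    -- Before time `i₁` monotonicity is not available, but after so few steps `h` is still within
    -- `G/k` of `t > 0`. The negative slope then makes `σ` nonpositive directly.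
    · have hi2 : i ≤ 2 * k := by omega
      obtain ⟨s0, s1⟩ := hsum i hi2
      have s2 : ∑ j ∈ Finset.range i, lam F D ξ ^ j ≤ i₁ * E := by
        refine s1.trans (mul_le_mul_of_nonneg_right ?_ hE0.le)
        exact_mod_cast h1.le
      have hw' := abs_le.1 hw
      have hBk : B / k ≤ B := div_le_self (by linarith) (by exact_mod_cast h.k_pos)
      have hgw : |drift F D ξ + (lam F D ξ - 1) * hCoord F D ξ w| ≤ (C + C * (t + B)) / k := by
        refine (abs_add_le _ _).trans ?_
        rw [abs_mul]
        have h3 : |hCoord F D ξ w| ≤ t + B := by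
          rw [abs_le]; constructor <;> linarith
        calc _ ≤ C / k + C / k * (t + B) := by
              gcongr
              · exact h.drift_abs
              · exact h.lam_le
          _ = _ := by ring
      have hhi : t - G / k ≤ hCoord F D ξ ((phi F D ξ)^[i] w) := by
        rw [h.normal.hCoord_iterate, affIter_eq]
        have h4 : |(drift F D ξ + (lam F D ξ - 1) * hCoord F D ξ w) *
            ∑ j ∈ Finset.range i, lam F D ξ ^ j| ≤ (C + C * (t + B)) / k * (i₁ * E) := by
          rw [abs_mul, abs_of_nonneg s0]
          exact mul_le_mul hgw s2 s0 (by positivity)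
        have h5 : G / k = B / k + (C + C * (t + B)) / k * (i₁ * E) := by rw [hG]; ring
        linarith [(abs_le.1 h4).1]
      have hkt : (G * μ + C + C * (C * B)) / k ≤ μ * t := by
        rw [div_lt_iff₀ (by positivity)] at hk₂
        rw [div_le_iff₀ hk']
        have h5 : (k₂ : ℝ) ≤ k := by exact_mod_cast (by omega : k₂ ≤ k)
        have := mul_le_mul_of_nonneg_right h5 (by positivity : 0 ≤ μ * t)
        linarith
      have hGt : 0 ≤ t - G / k := by
        have h6 : G * μ / k ≤ (G * μ + C + C * (C * B)) / k :=
          div_le_div_of_nonneg_right (by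
            have : 0 ≤ C + C * (C * B) := by positivity
            linarith) hk'.le
        have h7 : μ * (G / k) ≤ μ * t := by
          have : μ * (G / k) = G * μ / k := by ring
          linarith
        linarith [le_of_mul_le_mul_left h7 hμ]
      rw [switchFn_eq]
      have h8 := (abs_le.1 h.switch_zero).2
      have h9 := (abs_le.1 (h.switch_le (qPart F D ξ ((phi F D ξ)^[i] w)))).2
      have h10 := mul_le_mul_of_nonneg_left (hqi i) (by linarith : 0 ≤ C)
      have h11 : hCoord F D ξ ((phi F D ξ)^[i] w) *
          (F.MWord ξ (D.switchWord Δ) *ᵥ zeta F D ξ) 0 ≤ -((t - G / k) * μ) := by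
        have := mul_le_mul hhi (neg_le_neg h.slope_le) (by linarith) (hGt.trans hhi)
        linarith
      have h12 : (G * μ + C + C * (C * B)) / k = G / k * μ + C / k + C * (C * B / k) := by ring
      linarith
  · rw [hKk]
    have h2 := hinc K C₀ (by omega) (by omega)
    linarith
  · intro i j hi hij hpos
    induction j, hij using Nat.le_induction with
    | base => exact hpos
    | succ j hj ih => exact ih.trans_le (hmono j (by omega))

end StripBounds

end PWL


namespace PWL

set_option linter.unusedSectionVars false
attribute [local instance] Matrix.linftyOpNormedAddCommGroup Matrix.linftyOpNormedSpace Matrix.linftyOpNormedRing Matrix.linftyOpNormedAlgebra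
variable {N : ℕ} [NeZero N] {F : Family N} {D : RotData} {ξ₀ : ℝ × ℝ} {ρ : ℝ}

/-! ### The return map -/

theorem iterate_mem_range {X : Type*} (f : X → X) (w : X) {i : ℕ} (hi : 1 ≤ i) :
    f^[i] w ∈ range f := by
  obtain ⟨j, rfl⟩ : ∃ j, i = j + 1 := ⟨i - 1, by omega⟩
  exact ⟨f^[j] w, (Function.iterate_succ_apply' f j w).symm⟩

theorem iterate_injOn_range {X : Type*} {f : X → X} (hf : InjOn f (range f)) (i : ℕ) :
    InjOn f^[i] (range f) := by
  induction i with
  | zero => exact injOn_id _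
  | succ i ih =>
    intro x hx y hy h
    rw [Function.iterate_succ_apply, Function.iterate_succ_apply] at h
    exact hf hx hy (ih ⟨x, rfl⟩ ⟨y, rfl⟩ h)

namespace StripBounds

variable {ξ : ℝ × ℝ} {t C c μ r Q : ℝ} {k Δ : ℕ}

theorem isRangePreimage_iff (h : StripBounds F D ξ t C c μ r k Δ) (w : Fin N → ℝ) {i K : ℕ}
    (hi : i < K) (z : Fin N → ℝ) :
    IsRangePreimage F D ξ i ((phi F D ξ)^[K] w) z ↔ z = (phi F D ξ)^[K - i] w := by
  have hmem : (phi F D ξ)^[K - i] w ∈ range (phi F D ξ) := iterate_mem_range _ w (by omega)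
  have he : (phi F D ξ)^[i] ((phi F D ξ)^[K - i] w) = (phi F D ξ)^[K] w := by
    rw [← Function.iterate_add_apply]; congr 2; omega
  constructor
  · rintro ⟨h1, h2⟩
    exact iterate_injOn_range h.phi_injOn i h1 hmem (h2.trans he.symm)
  · rintro rfl
    exact ⟨hmem, he⟩

/-- Injectivity on the range makes the chosen preimage the earlier iterate of `w`, provided that
this iterate has positive index and therefore lies in the range. -/
theorem phiPow_eq (h : StripBounds F D ξ t C c μ r k Δ) (w : Fin N → ℝ) {K : ℕ} {j : ℤ}
    (hj : 0 < K + j) :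
    phiPow F D ξ j ((phi F D ξ)^[K] w) = (phi F D ξ)^[(K + j).toNat] w := by
  rw [phiPow]
  split_ifs with h0
  · rw [← Function.iterate_add_apply]; congr 2; omega
  · have h1 := h.isRangePreimage_iff w (i := (-j).toNat) (K := K) (by omega)
    have h2 := Classical.epsilon_spec (p := IsRangePreimage F D ξ (-j).toNat ((phi F D ξ)^[K] w))
      ⟨_, (h1 _).2 rfl⟩
    rw [(h1 _).1 h2]; congr 2; omega

/-- The return index along one orbit, and the return to the recurrent set. -/
theorem return_spec (h : StripBounds F D ξ t C c μ r k Δ)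
    (hk : 4 * C * (2 * (2 * C / μ + C)) ≤ c * k) (hQ1 : Q * ρ ^ k ≤ 1 / k)
    (hQ2 : 8 * (C * (C + 1)) * (C * (Q * ρ ^ k)) * k ≤ μ * c) {C₀ : ℕ} (hk2 : Δ + C₀ + 2 ≤ k)
    {w : Fin N → ℝ}
    (hlow : ∀ i, i + C₀ + Δ ≤ k → switchFn F D ξ Δ ((phi F D ξ)^[i] w) ≤ 0)
    (hhigh : 0 < switchFn F D ξ Δ ((phi F D ξ)^[k - Δ + C₀] w))
    (hstay : ∀ i j, k ≤ i + C₀ + Δ → i ≤ j → 0 < switchFn F D ξ Δ ((phi F D ξ)^[i] w) →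
      0 < switchFn F D ξ Δ ((phi F D ξ)^[j] w))
    (hq : ∀ i, 1 ≤ i → k ≤ i + (C₀ + Δ + 1) → i ≤ 2 * k →
      ‖WithLp.toLp 2 (qPart F D ξ ((phi F D ξ)^[i] w))‖ ≤ Q * ρ ^ k) :
    BetaWellDefined F D C₀ ξ k Δ ((phi F D ξ)^[k - Δ] w) ∧
    (∀ k' : ℕ, Δ < k' → ((phi F D ξ)^[k' - Δ] w ∈ recSet F D ξ ρ k Δ Q ↔
      (k' : ℤ) - k = beta F D ξ k Δ ((phi F D ξ)^[k - Δ] w))) ∧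
    returnT F D ξ k Δ ((phi F D ξ)^[k - Δ] w) ∈ recSet F D ξ ρ k Δ Q := by
  classical
  have hC := h.one_le
  have hμ := h.mu_pos
  have hkB : 4 * C * (2 * C / μ) ≤ c * k := by
    refine le_trans ?_ hk
    have : 0 ≤ 2 * C / μ := by positivity
    gcongr
    linarith
  set y : ℕ → Fin N → ℝ := fun i => (phi F D ξ)^[i] w with hy
  obtain ⟨K, hK⟩ : ∃ K, k = K + Δ := ⟨k - Δ, by omega⟩
  have hKk : k - Δ = K := by omega
  -- Times start at `1`: the condition `k + Δk > Δ` says that at least one step of `φ` has been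
  -- made, and `w` itself need not lie in the range.
  have hex : ∃ i, 1 ≤ i ∧ 0 < switchFn F D ξ Δ (y i) := ⟨k - Δ + C₀, by omega, hhigh⟩
  obtain ⟨i, hi⟩ : ∃ i, i = Nat.find hex := ⟨_, rfl⟩
  have hi1 : 1 ≤ i ∧ 0 < switchFn F D ξ Δ (y i) := hi ▸ Nat.find_spec hex
  have himin : ∀ j, 1 ≤ j → 0 < switchFn F D ξ Δ (y j) → i ≤ j := fun j h1 h2 =>
    hi ▸ Nat.find_min' hex ⟨h1, h2⟩
  have hiu : i ≤ k - Δ + C₀ := himin _ (by omega) hhigh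
  have hil : k < i + C₀ + Δ := by
    by_contra hc
    exact absurd hi1.2 (not_lt.2 (hlow i (not_lt.1 hc)))
  have hpow : ∀ j : ℤ, (Δ : ℤ) < k + j → phiPow F D ξ j (y (k - Δ)) = y (K + j).toNat := by
    intro j hj
    rw [hKk]
    exact h.phiPow_eq w (by omega)
  have hleast : IsLeast (betaSet F D ξ k Δ (y (k - Δ))) ((i : ℤ) - K) := by
    constructor
    · have h1 : (Δ : ℤ) < k + ((i : ℤ) - K) := by omega
      refine ⟨h1, ?_⟩
      rw [hpow _ h1, add_sub_cancel, Int.toNat_natCast]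
      exact hi1.2
    · rintro j ⟨hj1, hj2⟩
      rw [hpow j hj1] at hj2
      have := himin _ (by omega) hj2
      omega
  have hbeta : beta F D ξ k Δ (y (k - Δ)) = (i : ℤ) - K :=
    (Classical.epsilon_spec (p := IsLeast (betaSet F D ξ k Δ (y (k - Δ)))) ⟨_, hleast⟩).unique hleast
  have hmem : y i ∈ recSet F D ξ ρ k Δ Q := by
    obtain ⟨j, rfl⟩ : ∃ j, i = j + 1 := ⟨i - 1, by omega⟩
    have e : y (j + 1) = phi F D ξ (y j) := Function.iterate_succ_apply' _ _ _
    have hj0 : switchFn F D ξ Δ (y j) ≤ 0 := by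
      by_contra hc
      have := himin j (by omega) (not_le.1 hc)
      omega
    have hq1 := hq j (by omega) (by omega) (by omega)
    have hq2 : ‖WithLp.toLp 2 (qPart F D ξ (y (j + 1)))‖ ≤ Q * ρ ^ k :=
      hq (j + 1) (by omega) (by omega) (by omega)
    have h2 := hi1.2
    rw [e] at h2 hq2 ⊢
    exact h.phi_mem_recSet (iterate_mem_range _ w (by omega)) hj0 h2 hq1 hq2
  refine ⟨⟨fun j hj0 hj => ?_, _, hleast, by omega⟩, fun k' hk' => ?_, ?_⟩
  · have h1 := h.isRangePreimage_iff w (i := j) (K := k - Δ) (by omega)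
    exact ⟨_, (h1 _).2 rfl, fun z hz => (h1 z).1 hz⟩
  · rw [hbeta]
    constructor
    · intro hm
      have hpos := h.switchFn_pos_of_mem hkB hQ1 hQ2 hm
      have h1 := himin (k' - Δ) (by omega) hpos
      rcases h1.eq_or_lt with h2 | h2
      · omega
      -- At a later time the preceding iterate already has `σ > 0`, whereas a preimage of a point of
      -- the recurrent set has `σ ≤ 0`.
      · exfalso
        obtain ⟨j, hj⟩ : ∃ j, k' - Δ = j + 1 := ⟨k' - Δ - 1, by omega⟩
        have h3 : 0 < switchFn F D ξ Δ (y j) := hstay i j (by omega) (by omega) hi1.2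
        rw [hj, Function.iterate_succ_apply'] at hm
        have h4 := h.switchFn_nonpos_of_phi_mem hk hQ1 hQ2
          (iterate_mem_range _ w (by omega : 1 ≤ j)) hm
        exact absurd h3 (not_lt.2 h4)
    · intro he
      have : k' - Δ = i := by omega
      rw [this]
      exact hmem
  · rw [returnT, hbeta, hpow _ (by omega), add_sub_cancel, Int.toNat_natCast]
    exact hmem

end StripBounds

/-- The prefix `Gpre Δ` is common to all `k`, so the maps of these words send `x` to iterates of one
and the same point. The flip acts on the prefix only. -/
theorem RotData.fWord_G (F : Family N) (D : RotData) (ξ : ℝ × ℝ) {k Δ : ℕ} (h : Δ < k)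
    (x : Fin N → ℝ) :
    F.fWord ξ (D.G k Δ) x = (phi F D ξ)^[k - Δ] (F.fWord ξ (D.Gpre Δ) x) ∧
    F.fWord ξ (flipHead (D.G k Δ)) x =
      (phi F D ξ)^[k - Δ] (F.fWord ξ (flipHead (D.Gpre Δ)) x) := by
  rw [D.G_of_nonneg k Δ h, flipHead_append (D.Gpre_ne_nil Δ), F.fWord_append, F.fWord_append,
    F.fWord_replicate, F.fWord_replicate]
  exact ⟨rfl, rfl⟩

theorem IsShrinkingPoint.fWord_switchWord (hS : IsShrinkingPoint F ξ₀ D.l D.m D.n) (Δ : ℕ) :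
    F.fWord ξ₀ (D.switchWord Δ) (cyclePt F ξ₀ D.S0 D.n 0) 0 = 0 := by
  have h1 : ∀ j : ℕ, F.fWord ξ₀ (List.replicate j (flipHead D.Y ++ D.X)).flatten
      (cyclePt F ξ₀ D.S0 D.n D.e) = cyclePt F ξ₀ D.S0 D.n D.e := by
    intro j
    induction j with
    | zero => simp [F.fWord_nil]
    | succ j ih =>
      rw [List.replicate_succ, List.flatten_cons, F.fWord_append, F.fWord_append, hS.fWord_Y',
        hS.fWord_X, ih]
  rw [RotData.switchWord, F.fWord_append, hS.fWord_X', h1, hS.pt_e]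

/-- In the sectors, all estimates of the recurrent set hold. -/
theorem exists_stripBounds (hS : IsShrinkingPoint F ξ₀ D.l D.m D.n) (nf : NormalForm F D ξ₀ ρ)
    (hρ0 : 0 ≤ ρ) (hρ1 : ρ < 1) (hr : rhoMax F D ξ₀ < 1)
    (hJ : (fderiv ℝ (fun ξ => (eta F D ξ, nu F D ξ)) ξ₀).det ≠ 0)
    (hrank : ∀ᶠ ξ in 𝓝 ξ₀, (Mmd F D ξ).rank = (Mmd F D ξ₀ ^ 2).rank) (Δ : ℕ)
    (hκ : 0 < (kappa F D ξ₀ Δ - kappa F D ξ₀ ((Δ : ℤ) - 1)) * aa F D ξ₀) :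
    ∃ (C c μ s : ℝ), 1 ≤ C ∧ 0 < c ∧ 0 < μ ∧ 0 < s ∧
      ∀ p : ℝ × ℝ → Prop, (∀ᶠ ξ in 𝓝 ξ₀, p ξ) → ∃ k₀ : ℕ, ∀ k, k₀ ≤ k →
      ∀ U, (∀ ξ ∈ U, ‖ξ - ξ₀‖ < s) → ∀ Sg, IsSector F D ξ₀ U k Δ Sg → ∀ ξ ∈ Sg,
        p ξ ∧ ‖ξ - ξ₀‖ ≤ C / k ∧
        StripBounds F D ξ (cyclePt F ξ₀ D.S0 D.n (-(D.d : ℤ)) 0) C c μ ((1 + ρ) / 2) k Δ := by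
  obtain ⟨Cn, hCn, bn⟩ := exists_normalBounds hS nf hρ0 (by linarith : ρ < (1 + ρ) / 2)
  obtain ⟨A, c, s, k₀, hA, hc, hs, bsec⟩ :=
    exists_sector_estimates hS nf hρ0 hρ1 hr hJ (χ := (Δ : ℤ)) (by omega)
  obtain ⟨Cs, hCs, bs⟩ := exists_coord_bounds nf (D.switchWord Δ) (hS.fWord_switchWord Δ)
  obtain ⟨K, hK, bK⟩ := exists_lower_bound_on_range
    ((F.contDiff_MWord D.Smd ξ₀).continuousAt : ContinuousAt (Mmd F D) ξ₀) hrank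
  have hm := hS.switch_slope_neg hr Δ hκ
  set m := (F.MWord ξ₀ (D.switchWord Δ) *ᵥ dirVec F D ξ₀) 0 with hm'
  clear_value m
  have hM := eventually_norm_le (F.contDiff_MWord D.Smd ξ₀)
  set Z := ‖F.MWord ξ₀ D.Smd‖ + 1 with hZ
  have hZ0 : 0 ≤ Z := by positivity
  clear_value Z
  obtain ⟨C, hC⟩ : ∃ C, C = Cn + A + Cs * A + Cs - 2 * m + K + Z := ⟨_, rfl⟩
  have hCsA : 0 ≤ Cs * A := by positivity
  refine ⟨C, c, -m / 2, s, by linarith, hc, by linarith, hs, ?_⟩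
  intro p hp
  obtain ⟨ε, hε, ev⟩ := Metric.eventually_nhds_iff_ball.1 ((bn.and bs).and ((bK.and hM).and hp))
  obtain ⟨k₁, hk₁⟩ := exists_nat_gt (A / ε + 2 * (Cs * A) / -m)
  refine ⟨k₀ + k₁ + 1, ?_⟩
  intro k hk U hU Sg hSg ξ hξ
  have hk' : (0 : ℝ) < k := by exact_mod_cast (by omega : 0 < k)
  have hkk : (k₁ : ℝ) ≤ k := by exact_mod_cast (by omega : k₁ ≤ k)
  obtain ⟨d1, d2, d3, d4, d5, d6⟩ := bsec k (by omega) U hU Sg hSg ξ hξ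
  have u1 : 0 ≤ A / ε := by positivity
  have u2 : 0 ≤ 2 * (Cs * A) / -m := div_nonneg (by positivity) (by linarith)
  have hδε : ‖ξ - ξ₀‖ < ε := by
    refine d1.trans_lt ?_
    rw [div_lt_iff₀ hk']
    have : A / ε < k := by linarith
    rw [div_lt_iff₀ hε] at this
    linarith
  have hδm : Cs * ‖ξ - ξ₀‖ ≤ -m / 2 := by
    have h1 : 2 * (Cs * A) / -m < k := by linarith
    rw [div_lt_iff₀ (by linarith)] at h1
    have h2 : Cs * ‖ξ - ξ₀‖ ≤ Cs * A / k := by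
      rw [mul_div_assoc]; gcongr
    refine h2.trans ?_
    rw [div_le_iff₀ hk']
    linarith
  obtain ⟨⟨e1, e2, e3, e4⟩, ⟨e5, e6⟩, e7⟩ := ev ξ (mem_ball_iff_norm.2 hδε)
  have up : ∀ x a : ℝ, a ≤ C → x ≤ a / k → x ≤ C / k := fun x a ha hx =>
    hx.trans (div_le_div_of_nonneg_right ha hk'.le)
  have upx : ∀ x a b : ℝ, a ≤ C → 0 ≤ b → x ≤ a * b → x ≤ C * b := fun x a b ha hb hx =>
    hx.trans (mul_le_mul_of_nonneg_right ha hb)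
  have hsl := abs_le.1 e3
  obtain ⟨l1, l2⟩ := lam_pos e1
  have hAC : A ≤ C := by linarith
  refine ⟨e7, up _ A hAC d1, ?_⟩
  exact
  { normal := e1.normal
    one_le := by linarith
    c_pos := hc
    mu_pos := by linarith
    k_pos := by omega
    lam_lo := l1
    lam_hi := l2
    lam_le := up _ A hAC d2
    drift_abs := up _ A hAC d3
    drift_le := d5
    drift_le' := d6
    aff_le := up _ A hAC d4
    zeta_le := e1.zeta_le.trans (by linarith)
    pow_le := fun j x => by
      refine (e1.pow_le j x).trans ?_
      have h0 : 0 ≤ (1 + ρ) / 2 := by linarith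
      gcongr
      linarith
    mulVec_le := fun x => (Matrix.linfty_opNorm_mulVec _ _).trans
      (mul_le_mul_of_nonneg_right (e6.trans (by linarith)) (norm_nonneg _))
    lower := fun x => upx _ K _ (by linarith) (norm_nonneg _) (e5 x)
    switch_zero := up _ (Cs * A) (by linarith) (e2.trans (by
      rw [mul_div_assoc]; gcongr))
    slope_le := by linarith [hsl.2]
    slope_abs := by rw [abs_le]; constructor <;> linarith [hsl.1, hsl.2]
    switch_le := fun x => upx _ Cs _ (by linarith) (norm_nonneg _) (e4 x) }

theorem exists_decay_bound (hρ0 : 0 ≤ ρ) (hρ1 : ρ < 1) (Q : ℝ) {b : ℝ} (hb : 0 < b) :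
    ∃ k₀ : ℕ, ∀ k, k₀ ≤ k → Q * ρ ^ k * k ≤ b := by
  have h : Tendsto (fun k : ℕ => Q * ((k : ℝ) * ρ ^ k)) atTop (𝓝 0) := by
    simpa using (tendsto_self_mul_const_pow_of_lt_one hρ0 hρ1).const_mul Q
  obtain ⟨k₀, hk₀⟩ := eventually_atTop.1 (h.eventually_le_const hb)
  exact ⟨k₀, fun k hk => by linarith [hk₀ k hk]⟩

/-- Returns to the recurrent set, for all parameters in the sectors. -/
theorem exists_return_bounds (hS : IsShrinkingPoint F ξ₀ D.l D.m D.n) (nf : NormalForm F D ξ₀ ρ)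
    (hρ0 : 0 ≤ ρ) (hρ1 : ρ < 1) (hr : rhoMax F D ξ₀ < 1)
    (hJ : (fderiv ℝ (fun ξ => (eta F D ξ, nu F D ξ)) ξ₀).det ≠ 0)
    (hrank : ∀ᶠ ξ in 𝓝 ξ₀, (Mmd F D ξ).rank = (Mmd F D ξ₀ ^ 2).rank) (Δ : ℕ)
    (hκ : 0 < (kappa F D ξ₀ Δ - kappa F D ξ₀ ((Δ : ℤ) - 1)) * aa F D ξ₀) :
    ∃ (s Q₀ : ℝ) (C₀ : ℕ), 0 < s ∧ ∀ Q : ℝ, Q₀ ≤ Q → ∃ k₀ : ℕ, ∀ k : ℕ, k₀ ≤ k →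
      Δ < k ∧ ∀ U, (∀ ξ ∈ U, ‖ξ - ξ₀‖ < s) → ∀ Sg, IsSector F D ξ₀ U k Δ Sg → ∀ ξ ∈ Sg,
      ∀ x ∈ recSet F D ξ ρ k Δ Q, ∀ V, V = D.Gpre Δ ∨ V = flipHead (D.Gpre Δ) →
        BetaWellDefined F D C₀ ξ k Δ ((phi F D ξ)^[k - Δ] (F.fWord ξ V x)) ∧
        (∀ k' : ℕ, Δ < k' → ((phi F D ξ)^[k' - Δ] (F.fWord ξ V x) ∈ recSet F D ξ ρ k Δ Q ↔
          (k' : ℤ) - k = beta F D ξ k Δ ((phi F D ξ)^[k - Δ] (F.fWord ξ V x)))) ∧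
        returnT F D ξ k Δ ((phi F D ξ)^[k - Δ] (F.fWord ξ V x)) ∈ recSet F D ξ ρ k Δ Q := by
  obtain ⟨C, c, μ, s, hC, hc, hμ, hs, strip⟩ := exists_stripBounds hS nf hρ0 hρ1 hr hJ hrank Δ hκ
  have hV1 := hS.fWord_Gpre Δ
  have hV2 : F.fWord ξ₀ (flipHead (D.Gpre Δ)) (cyclePt F ξ₀ D.S0 D.n 0) =
      cyclePt F ξ₀ D.S0 D.n (-(D.d : ℤ)) := by
    rw [F.fWord_flipHead _ _ _ hS.pt_zero, hV1]
  obtain ⟨C1, hC1, w1⟩ := exists_word_bounds hS nf hρ0 _ hV1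
  obtain ⟨C2, hC2, w2⟩ := exists_word_bounds hS nf hρ0 _ hV2
  obtain ⟨P, hP⟩ : ∃ P, P = C * (2 * (2 * C / μ) + C) + C := ⟨_, rfl⟩
  have hP0 : 0 ≤ P := by rw [hP]; positivity
  obtain ⟨B, hB⟩ : ∃ B, B = 1 + (C1 + C2) * (C + P) := ⟨_, rfl⟩
  have hB1 : 1 ≤ B := by
    have : 0 ≤ (C1 + C2) * (C + P) := by positivity
    linarith
  have hr0 : 0 ≤ (1 + ρ) / 2 := by linarith
  obtain ⟨C₀, k₁, cross⟩ := StripBounds.exists_crossing_bounds (N := N) hC hc hμ hr0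
    (by linarith : (1 + ρ) / 2 < 1) hB1 hS.pt_neg_d Δ
  obtain ⟨Ct, hCt, bt⟩ := exists_transv_pow_le hS nf hρ0 hρ1 hrank (by linarith : 0 ≤ C)
    (C₀ + Δ + 1)
  -- The local property is supplied only at this point because the transverse decay bound depends on
  -- the constants `C` and `C₀` already obtained.
  obtain ⟨k₂, strip⟩ := strip _ ((w1.and w2).and bt)
  -- `Ct B ρ^k` bounds the sup norm of the transverse part near time `k`; the factor `N` passes to
  -- the Euclidean norm used in the face.
  refine ⟨s, N * (Ct * B), C₀, hs, ?_⟩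
  intro Q hQ
  obtain ⟨k₃, hk₃⟩ := exists_decay_bound hρ0 hρ1 Q one_pos
  obtain ⟨k₄, hk₄⟩ := exists_decay_bound hρ0 hρ1 Q
    (by positivity : 0 < μ * c / (8 * (C * (C + 1)) * C))
  obtain ⟨k₅, hk₅⟩ := exists_nat_gt (4 * C * (2 * (2 * C / μ + C)) / c)
  refine ⟨k₁ + k₂ + k₃ + k₄ + k₅ + Δ + 1, ?_⟩
  intro k hk
  refine ⟨by omega, ?_⟩
  intro U hU Sg hSg ξ hξ x hx V hV
  have hk' : (0 : ℝ) < k := by exact_mod_cast (by omega : 0 < k)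
  have hk1 : (1 : ℝ) ≤ k := by exact_mod_cast (by omega : 1 ≤ k)
  obtain ⟨⟨⟨b1, b2⟩, bt⟩, hd, h⟩ := strip k (by omega) U hU Sg hSg ξ hξ
  have hQ1 : Q * ρ ^ k ≤ 1 / k := by
    rw [le_div_iff₀ hk']; exact hk₃ k (by omega)
  have hQ2 : 8 * (C * (C + 1)) * (C * (Q * ρ ^ k)) * k ≤ μ * c := by
    have := hk₄ k (by omega)
    rw [le_div_iff₀ (by positivity)] at this
    linarith
  have hkA : 4 * C * (2 * (2 * C / μ + C)) ≤ c * k := by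
    rw [div_lt_iff₀ hc] at hk₅
    have h5 : (k₅ : ℝ) ≤ k := by exact_mod_cast (by omega : k₅ ≤ k)
    have := mul_le_mul_of_nonneg_right h5 hc.le
    linarith
  have hxd := h.norm_sub_xInt_of_mem hQ1 hx
  rw [← hP] at hxd
  have hsum : ‖ξ - ξ₀‖ + ‖x - xInt F D ξ‖ ≤ (C + P) / k := by
    rw [add_div]; exact add_le_add hd hxd
  have hsum0 : 0 ≤ ‖ξ - ξ₀‖ + ‖x - xInt F D ξ‖ := by positivity
  have hCB : ∀ C', 0 ≤ C' → C' ≤ C1 + C2 → C' * (‖ξ - ξ₀‖ + ‖x - xInt F D ξ‖) ≤ B / k := by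
    intro C' h0 h1
    calc C' * (‖ξ - ξ₀‖ + ‖x - xInt F D ξ‖) ≤ (C1 + C2) * ((C + P) / k) := by gcongr
      _ = (C1 + C2) * (C + P) / k := by ring
      _ ≤ _ := div_le_div_of_nonneg_right (by linarith) hk'.le
  obtain ⟨hw1, hw2⟩ : |hCoord F D ξ (F.fWord ξ V x) - cyclePt F ξ₀ D.S0 D.n (-(D.d : ℤ)) 0| ≤ B / k ∧
      ‖qPart F D ξ (F.fWord ξ V x)‖ ≤ B / k := by
    rcases hV with rfl | rfl
    · obtain ⟨v1, v2⟩ := b1.1 x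
      have := hCB C1 (by linarith) (by linarith)
      exact ⟨v1.trans this, v2.trans this⟩
    · obtain ⟨v1, v2⟩ := b2.1 x
      have := hCB C2 (by linarith) (by linarith)
      exact ⟨v1.trans this, v2.trans this⟩
  obtain ⟨c1, c2, c3, c4⟩ := cross h (by omega) _ hw1 hw2
  refine h.return_spec hkA hQ1 hQ2 c1 c2 c3 c4 ?_
  intro i hi1 hi2 hi3
  refine (norm_toLp_le _).trans ?_
  rw [h.normal.qPart_iterate]
  have hρk : 0 ≤ ρ ^ k := pow_nonneg hρ0 k
  have hBk : B / k ≤ B := div_le_self (by linarith) hk1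
  have h1 := bt k (by omega) hd i hi1 hi2 hi3 (qPart F D ξ (F.fWord ξ V x))
  calc (N : ℝ) * ‖transv F D ξ ^ i *ᵥ qPart F D ξ (F.fWord ξ V x)‖
      ≤ N * (Ct * ρ ^ k * B) := by
        gcongr
        refine h1.trans ?_
        gcongr
        exact hw2.trans hBk
    _ = N * (Ct * B) * ρ ^ k := by ring
    _ ≤ Q * ρ ^ k := mul_le_mul_of_nonneg_right hQ hρk

end PWL


/-! ### The lemma: both words at once, and the return map. -/

theorem lemma4p2 {N : ℕ} [NeZero N] (hN : 2 ≤ N) (F : PWL.Family N) (D : PWL.RotData)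
    (ξ₀ : ℝ × ℝ) (hS : PWL.IsShrinkingPoint F ξ₀ D.l D.m D.n)
    (hJ : (fderiv ℝ (fun ξ => (PWL.eta F D ξ, PWL.nu F D ξ)) ξ₀).det ≠ 0)
    (hrank : ∀ᶠ ξ in 𝓝 ξ₀, (PWL.Mmd F D ξ).rank = (PWL.Mmd F D ξ₀ ^ 2).rank)
    (ρ : ℝ) (hρ1 : ρ < 1)
    (hρ : PWL.rhoMax F D ξ₀ < ρ ∨
      (ρ = PWL.rhoMax F D ξ₀ ∧ PWL.SemisimpleOnCircle (PWL.Mmd F D ξ₀) ρ))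
    (Δ : ℕ)
    (hκ : 0 < (PWL.kappa F D ξ₀ Δ - PWL.kappa F D ξ₀ ((Δ : ℤ) - 1)) * PWL.aa F D ξ₀) :
    ∃ V ∈ 𝓝 ξ₀, ∃ (Q₀ : ℝ) (C : ℕ), ∀ Q : ℝ, Q₀ ≤ Q → ∃ k₀ : ℕ, ∀ k : ℕ, k₀ ≤ k →
      ∀ U ∈ 𝓝 ξ₀, U ⊆ V → ∀ Sg : Set (ℝ × ℝ), PWL.IsSector F D ξ₀ U k Δ Sg →
      ∀ ξ ∈ Sg,
        (∀ x ∈ PWL.recSet F D ξ ρ k Δ Q,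
          (PWL.BetaWellDefined F D C ξ k Δ (F.fWord ξ (D.G k Δ) x) ∧
            ∀ k' : ℕ, Δ < k' →
              (F.fWord ξ (D.G k' Δ) x ∈ PWL.recSet F D ξ ρ k Δ Q ↔
                (k' : ℤ) - k = PWL.beta F D ξ k Δ (F.fWord ξ (D.G k Δ) x))) ∧
          (PWL.BetaWellDefined F D C ξ k Δ (F.fWord ξ (PWL.flipHead (D.G k Δ)) x) ∧
            ∀ k' : ℕ, Δ < k' →
              (F.fWord ξ (PWL.flipHead (D.G k' Δ)) x ∈ PWL.recSet F D ξ ρ k Δ Q ↔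
                (k' : ℤ) - k =
                  PWL.beta F D ξ k Δ (F.fWord ξ (PWL.flipHead (D.G k Δ)) x)))) ∧
        MapsTo (PWL.returnMap F D ξ k Δ)
          (PWL.recSet F D ξ ρ k Δ Q) (PWL.recSet F D ξ ρ k Δ Q) := by
  have hρmax : PWL.rhoMax F D ξ₀ ≤ ρ := by
    rcases hρ with h | h
    · exact h.le
    · exact h.1.ge
  have hρ0 : 0 ≤ ρ := le_trans (NNReal.coe_nonneg _) hρmax
  have nf := PWL.normalForm hS hρ1 hρ
  obtain ⟨s, Q₀, C₀, hs, hmain⟩ := PWL.exists_return_bounds hS nf hρ0 hρ1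
    (hρmax.trans_lt hρ1) hJ hrank Δ hκ
  refine ⟨Metric.ball ξ₀ s, Metric.ball_mem_nhds ξ₀ hs, Q₀, C₀, fun Q hQ => ?_⟩
  obtain ⟨k₀, hk₀⟩ := hmain Q hQ
  refine ⟨k₀, fun k hk U _ hUV Sg hSg ξ hξ => ?_⟩
  obtain ⟨hΔ, hret⟩ := hk₀ k hk
  have hret := hret U (fun z hz => mem_ball_iff_norm.1 (hUV hz)) Sg hSg ξ hξ
  have hG := fun (k' : ℕ) (h : Δ < k') x => PWL.RotData.fWord_G F D ξ h x
  refine ⟨fun x hx => ?_, fun x hx => ?_⟩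
  · obtain ⟨a1, a2, -⟩ := hret x hx _ (Or.inl rfl)
    obtain ⟨b1, b2, -⟩ := hret x hx _ (Or.inr rfl)
    rw [(hG k hΔ x).1, (hG k hΔ x).2]
    refine ⟨⟨a1, fun k' h => ?_⟩, b1, fun k' h => ?_⟩
    · rw [(hG k' h x).1]; exact a2 k' h
    · rw [(hG k' h x).2]; exact b2 k' h
  · rw [PWL.returnMap, (hG k hΔ x).1, (hG k hΔ x).2]
    split_ifs
    · exact (hret x hx _ (Or.inl rfl)).2.2
    · exact (hret x hx _ (Or.inr rfl)).2.2
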